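/- Let $n\ge 1$, $s>0$ and $0<p\le 1$. For $z,w\in\mathbb{C}^n$ put $z\bullet w=z_1w_1+\cdots+z_nw_n$, $\|z\|^2=z\bullet\bar z$, $N_*(z)=\sqrt{\|z\|^2+|z\bullet z|}$ (so that $N_*/\sqrt2$ is the Hahn–Pflug norm), and $$\phi(z)=\frac{s\,N_*(z)^2-\log|z\bullet z|}{2},\qquad\text{i.e. } e^{-\phi(z)}=|z\bullet z|^{1/2}e^{-sN_*(z)^2/2}$$ (with $e^{-\phi(z)}=0$ where $z\bullet z=0$). Let $dA$ be Lebesgue measure on $\mathbb{C}^n$, normalized so that the unit ball has measure one. Let $F_s^p$ be the space of entire functions $f$ on $\mathbb{C}^n$ with $$\|f\|_{p,s}=\Big(\int_{\mathbb{C}^n}|f(z)e^{-\phi(z)}|^p\,|z\bullet z|^{-1}\,dA(z)\Big)^{1/p}<\infty,$$ and let $F_s^\infty$ be the space of entire functions $g$ on $\mathbb{C}^n$ with $\|g\|_{\infty,s}=\sup_{z\in\mathbb{C}^n}|g(z)|e^{-\phi(z)}<\infty$. Then the dual space of $F_s^p$ can be identified with $F_s^\infty$. More precisely, there is a bounded complex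 bilinear form $L$ on $F_s^p\times F_s^\infty$ (that is, $|L(f,g)|\le M\|f\|_{p,s}\|g\|_{\infty,s}$ for some constant $M$) such that every bounded linear functional on $F_s^p$ has the form $f\mapsto L_g(f):=L(f,g)$ for a unique $g\in F_s^\infty$. Furthermore, there is a constant $C>0$ such that $$C^{-1}\|g\|_{\infty,s}\le\|L_g\|\le C\|g\|_{\infty,s}\qquad\text{for all } g\in F_s^\infty,$$ where $\|L_g\|=\sup\{|L(f,g)|:\|f\|_{p,s}\le1\}$. -/

import Mathlib

open MeasureTheory
open scoped ENNReal

noncomputable section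

namespace HPFock

/-- The complex bilinear product `z • w = z₁ w₁ + ⋯ + zₙ wₙ` (no conjugation). -/
def bdot {n : ℕ} (z w : Fin n → ℂ) : ℂ := ∑ j, z j * w j

/-- The square `‖z‖² = z • z̄` of the Euclidean norm on `ℂⁿ`. -/
def euclSq {n : ℕ} (z : Fin n → ℂ) : ℝ := ∑ j, ‖z j‖ ^ 2

/-- `N_*(z) = √(‖z‖² + |z • z|)`; `N_* / √2` is the Hahn–Pflug norm. -/
def Nstar {n : ℕ} (z : Fin n → ℂ) : ℝ := Real.sqrt (euclSq z + ‖bdot z z‖)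

/-- The weight exponent `φ(z) = (s N_*(z)² - log |z • z|) / 2`, meaningful where `z • z ≠ 0`. -/
def phi {n : ℕ} (s : ℝ) (z : Fin n → ℂ) : ℝ :=
  (s * Nstar z ^ 2 - Real.log ‖bdot z z‖) / 2

/-- The weight `e^{-φ(z)} = |z • z|^{1/2} e^{-s N_*(z)² / 2}`. Where `z • z = 0` one has
`φ(z) = +∞`, and the weight is `0`. -/
def weight {n : ℕ} (s : ℝ) (z : Fin n → ℂ) : ℝ :=
  Real.sqrt ‖bdot z z‖ * Real.exp (-(s * Nstar z ^ 2 / 2))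

theorem weight_eq_exp_neg_phi {n : ℕ} (s : ℝ) (z : Fin n → ℂ) (hz : bdot z z ≠ 0) :
    weight s z = Real.exp (-phi s z) := by
  have h : 0 < ‖bdot z z‖ := norm_pos_iff.mpr hz
  have e : -phi s z = Real.log ‖bdot z z‖ / 2 + -(s * Nstar z ^ 2 / 2) := by
    unfold phi; ring
  rw [e, Real.exp_add, ← Real.log_sqrt h.le, Real.exp_log (Real.sqrt_pos.mpr h), weight]

/-- Lebesgue measure on `ℂⁿ`, normalized so that the Euclidean unit ball has measure one. -/
def dA (n : ℕ) : Measure (Fin n → ℂ) :=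
  (volume {z : Fin n → ℂ | euclSq z < 1})⁻¹ • volume

/-- The measure `|z • z|⁻¹ dA(z)`. -/
def fockMeasure (n : ℕ) : Measure (Fin n → ℂ) :=
  (dA n).withDensity fun z => (ENNReal.ofReal ‖bdot z z‖)⁻¹

/-- The space `F_s^p`, `0 < p < ∞`, of entire functions `f` on `ℂⁿ` with
`∫ |f e^{-φ}|^p |z • z|⁻¹ dA < ∞`. -/
def FockP (n : ℕ) (s p : ℝ) : Submodule ℂ ((Fin n → ℂ) → ℂ) where
  carrier := {f | Differentiable ℂ f ∧
    MemLp (fun z => f z * (weight s z : ℂ)) (ENNReal.ofReal p) (fockMeasure n)}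
  zero_mem' := ⟨differentiable_const 0, by simp⟩
  add_mem' := by
    rintro f g ⟨hf, hf'⟩ ⟨hg, hg'⟩
    refine ⟨hf.add hg, ?_⟩
    convert hf'.add hg' using 1
    funext z
    simp [add_mul]
  smul_mem' := by
    rintro c f ⟨hf, hf'⟩
    refine ⟨hf.const_smul c, ?_⟩
    convert hf'.const_smul c using 1
    funext z
    simp [mul_assoc]

/-- The (quasi-)norm `‖f‖_{p,s} = (∫ |f e^{-φ}|^p |z • z|⁻¹ dA)^{1/p}` of `F_s^p`. -/
def pNorm {n : ℕ} {s p : ℝ} (f : FockP n s p) : ℝ :=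
  (eLpNorm (fun z => (f : (Fin n → ℂ) → ℂ) z * (weight s z : ℂ))
    (ENNReal.ofReal p) (fockMeasure n)).toReal

/-- The space `F_s^∞` of entire functions `g` on `ℂⁿ` with `sup |g e^{-φ}| < ∞`. -/
def FockInf (n : ℕ) (s : ℝ) : Submodule ℂ ((Fin n → ℂ) → ℂ) where
  carrier := {g | Differentiable ℂ g ∧
    BddAbove (Set.range fun z => ‖g z * (weight s z : ℂ)‖)}
  zero_mem' := ⟨differentiable_const 0, 0, by rintro _ ⟨z, rfl⟩; simp⟩
  add_mem' := by
    rintro f g ⟨hf, A, hA⟩ ⟨hg, B, hB⟩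
    refine ⟨hf.add hg, A + B, ?_⟩
    rintro _ ⟨z, rfl⟩
    have h1 := hA ⟨z, rfl⟩
    have h2 := hB ⟨z, rfl⟩
    simp only [Pi.add_apply, add_mul]
    exact (norm_add_le _ _).trans (add_le_add h1 h2)
  smul_mem' := by
    rintro c f ⟨hf, A, hA⟩
    refine ⟨hf.const_smul c, ‖c‖ * A, ?_⟩
    rintro _ ⟨z, rfl⟩
    have h1 := hA ⟨z, rfl⟩
    simp only [Pi.smul_apply, smul_eq_mul, mul_assoc]
    rw [norm_mul]
    exact mul_le_mul_of_nonneg_left h1 (norm_nonneg c)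

/-- The norm `‖g‖_{∞,s} = sup |g e^{-φ}|` of `F_s^∞`. -/
def infNorm {n : ℕ} {s : ℝ} (g : FockInf n s) : ℝ :=
  ⨆ z, ‖(g : (Fin n → ℂ) → ℂ) z * (weight s z : ℂ)‖

/-- Bounded linear functionals on `F_s^p`. -/
def IsBoundedFunctional {n : ℕ} {s p : ℝ} (G : FockP n s p →ₗ[ℂ] ℂ) : Prop :=
  ∃ M : ℝ, ∀ f, ‖G f‖ ≤ M * pNorm f

/-- The norm `‖G‖ = sup {|G f| : ‖f‖_{p,s} ≤ 1}` of a bounded linear functional on `F_s^p`. -/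
def functionalNorm {n : ℕ} {s p : ℝ} (G : FockP n s p →ₗ[ℂ] ℂ) : ℝ :=
  sSup {r : ℝ | ∃ f : FockP n s p, pNorm f ≤ 1 ∧ ‖G f‖ = r}

end HPFock

end

/-! The weight becomes natural on the cone {(z, ζ) : ζ² = z • z} in ℂⁿ × ℂ, a double cover of ℂⁿ.
There N_*(z)² = ‖z‖² + |ζ|² is the squared Euclidean norm, e^{-φ} = |ζ| e^{-sN_*²/2}, and N_*² |z •
z|⁻¹ dA is surface measure up to a constant. An entire f corresponds to ζ f(z), a function odd in ζ.
The natural kernel of degree m is therefore P_m(z, u) = ((z • u + ζω)^{m+1} - (z • u - ζω)^{m+1}) /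
(2ζω), which is a polynomial in z and u (`homKer`).

If f is entire and homogeneous of degree m, then ∫ P_m(z, w̄) f(w) e^{-sN_*(w)²} dw = X_m f(z) with
an explicit X_m (`integral_homKer`). This comes from the Fock reproducing formula in ℂ^{n+1}. With q
= W • W, two ∂̄-integrations by parts involving q̄ / (|q|² + ε) turn the Gaussian integral into one
against ε / (|q|² + ε)², which concentrates on the quadric q = 0 as ε → 0.

Put K = ∑ (m+n+1)^{1/p-1} X_m⁻¹ P_m, let T multiply the component of degree m by (m+n+1)^{-1/p}, and
let L(f, g) = ∫ f(w) (Tg)(w̄) (1 + sN_*²) e^{-sN_*²} dw. The factor 1 + sN_*² contributes m+n+1, the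
powers cancel, and L(K(·, u), g) = g(u) (`pairing_kerFun`).

Two estimates carry the duality. The first is ‖K(·, u)‖_{p,s} e^{-φ(u)} ≤ C
(`exists_pNorm_kerFun_le`): with the weights, the kernel is a polynomial factor times Gaussians in
the distance from (z, ζ) to (ū, ±ω̄), and such Gaussians have uniformly bounded integrals
(`chart_bound`). The second is |L(f, g)| ≤ C ‖f‖ ‖g‖ (`exists_norm_pairing_le`). Here F = |f| e^{-φ}
is at most C (1 + N_*²)^{1/p} ‖f‖ (`exists_sharp_growth`), while T gains (1 + N_*²)^{-1/p}
(`exists_norm_fracInt_le`). Writing F = F^{1-p} F^p, all powers of 1 + N_*² cancel and the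
integrable F^p remains.

Given a bounded G, the only candidate is g(u) = G(K(·, u)). It is entire and lies in F_s^∞ by the
first estimate. The functional G - L_g is bounded by the second estimate and kills every K(·, u), so
it vanishes because these functions are total in F_s^p (`functional_eq_zero`). The same two
estimates give the equivalence of norms. -/

namespace HPFock

/-! ### Algebra of the bilinear form and geometry of the cone ζ² = z • z -/

section Basics
variable {n : ℕ}

/-- The square of `Nstar`, without the square root. -/
noncomputable def nsq (z : Fin n → ℂ) : ℝ := euclSq z + ‖bdot z z‖

/-- A measurable square root of `z • z`. -/
noncomputable def rt (z : Fin n → ℂ) : ℂ := (bdot z z) ^ ((2 : ℕ)⁻¹ : ℂ)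

theorem rt_sq (z : Fin n → ℂ) : rt z ^ 2 = bdot z z :=
  Complex.cpow_nat_inv_pow _ two_ne_zero

theorem norm_rt_sq (z : Fin n → ℂ) : ‖rt z‖ ^ 2 = ‖bdot z z‖ := by
  rw [← norm_pow, rt_sq]

theorem euclSq_nonneg (z : Fin n → ℂ) : 0 ≤ euclSq z :=
  Finset.sum_nonneg fun _ _ => by positivity

theorem nsq_nonneg (z : Fin n → ℂ) : 0 ≤ nsq z := add_nonneg (euclSq_nonneg z) (norm_nonneg _)

theorem Nstar_sq (z : Fin n → ℂ) : Nstar z ^ 2 = nsq z := Real.sq_sqrt (nsq_nonneg z)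

theorem euclSq_le_nsq (z : Fin n → ℂ) : euclSq z ≤ nsq z := le_add_of_nonneg_right (norm_nonneg _)

theorem norm_bdot_self_le_nsq (z : Fin n → ℂ) : ‖bdot z z‖ ≤ nsq z :=
  le_add_of_nonneg_left (euclSq_nonneg z)

theorem sq_norm_le_euclSq (z : Fin n → ℂ) : ‖z‖ ^ 2 ≤ euclSq z := by
  have h : ‖z‖ ≤ Real.sqrt (euclSq z) := by
    refine (pi_norm_le_iff_of_nonneg (Real.sqrt_nonneg _)).2 fun j => Real.le_sqrt_of_sq_le ?_
    exact Finset.single_le_sum (f := fun j => ‖z j‖ ^ 2) (fun _ _ => by positivity)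
      (Finset.mem_univ j)
  calc ‖z‖ ^ 2 ≤ Real.sqrt (euclSq z) ^ 2 := by gcongr
    _ = euclSq z := Real.sq_sqrt (euclSq_nonneg z)

theorem euclSq_le_mul_sq_norm (z : Fin n → ℂ) : euclSq z ≤ n * ‖z‖ ^ 2 := by
  have : euclSq z ≤ ∑ _j : Fin n, ‖z‖ ^ 2 :=
    Finset.sum_le_sum fun j _ => by gcongr; exact norm_le_pi_norm z j
  simpa using this

theorem norm_bdot_self_le (z : Fin n → ℂ) : ‖bdot z z‖ ≤ euclSq z :=
  (norm_sum_le _ _).trans (le_of_eq (Finset.sum_congr rfl fun j _ => by rw [norm_mul, sq]))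

theorem nsq_le_two_mul_euclSq (z : Fin n → ℂ) : nsq z ≤ 2 * euclSq z := by
  have := norm_bdot_self_le z
  unfold nsq; linarith

theorem bdot_smul_left (c : ℂ) (z w : Fin n → ℂ) : bdot (c • z) w = c * bdot z w := by
  simp [bdot, Finset.mul_sum, mul_assoc]

theorem bdot_smul_right (c : ℂ) (z w : Fin n → ℂ) : bdot z (c • w) = c * bdot z w := by
  simp [bdot, Finset.mul_sum, mul_left_comm]

theorem bdot_comm (z w : Fin n → ℂ) : bdot z w = bdot w z :=
  Finset.sum_congr rfl fun _ _ => mul_comm _ _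

theorem bdot_smul_self (c : ℂ) (z : Fin n → ℂ) : bdot (c • z) (c • z) = c ^ 2 * bdot z z := by
  rw [bdot_smul_left, bdot_smul_right]; ring

theorem bdot_star (z w : Fin n → ℂ) : bdot (star z) (star w) = star (bdot z w) := by
  simp [bdot]

theorem bdot_add_left (x y w : Fin n → ℂ) : bdot (x + y) w = bdot x w + bdot y w := by
  simp [bdot, add_mul, Finset.sum_add_distrib]

theorem bdot_add_right (w x y : Fin n → ℂ) : bdot w (x + y) = bdot w x + bdot w y := by
  simp [bdot, mul_add, Finset.sum_add_distrib]

theorem bdot_star_self (z : Fin n → ℂ) : bdot z (star z) = euclSq z := by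
  simp [bdot, euclSq, Complex.mul_conj']

theorem euclSq_smul (c : ℂ) (z : Fin n → ℂ) : euclSq (c • z) = ‖c‖ ^ 2 * euclSq z := by
  simp [euclSq, Finset.mul_sum, mul_pow]

theorem euclSq_star (z : Fin n → ℂ) : euclSq (star z) = euclSq z := by
  simp [euclSq]

theorem nsq_smul (c : ℂ) (z : Fin n → ℂ) : nsq (c • z) = ‖c‖ ^ 2 * nsq z := by
  simp [nsq, euclSq_smul, bdot_smul_self]; ring

theorem nsq_star (z : Fin n → ℂ) : nsq (star z) = nsq z := by
  simp only [nsq, euclSq_star, bdot_star, norm_star]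

@[fun_prop]
theorem continuous_bdot_self : Continuous fun z : Fin n → ℂ => bdot z z := by
  unfold bdot; fun_prop

@[fun_prop]
theorem continuous_bdot_left (w : Fin n → ℂ) : Continuous fun z : Fin n → ℂ => bdot z w := by
  unfold bdot; fun_prop

@[fun_prop]
theorem continuous_bdot_right (w : Fin n → ℂ) : Continuous fun z : Fin n → ℂ => bdot w z := by
  unfold bdot; fun_prop

@[fun_prop]
theorem continuous_euclSq : Continuous fun z : Fin n → ℂ => euclSq z := by
  unfold euclSq; fun_prop

@[fun_prop]
theorem continuous_nsq : Continuous fun z : Fin n → ℂ => nsq z := by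
  unfold nsq; fun_prop

theorem differentiable_bdot_self : Differentiable ℂ fun z : Fin n → ℂ => bdot z z := by
  unfold bdot; fun_prop

theorem differentiable_bdot_left (w : Fin n → ℂ) :
    Differentiable ℂ fun z : Fin n → ℂ => bdot z w := by
  unfold bdot; fun_prop

@[fun_prop]
theorem measurable_rt : Measurable (rt : (Fin n → ℂ) → ℂ) := by
  unfold rt
  exact (continuous_bdot_self.measurable).pow_const _

theorem weight_eq (s : ℝ) (z : Fin n → ℂ) :
    weight s z = ‖rt z‖ * Real.exp (-(s * nsq z / 2)) := by
  rw [weight, Nstar_sq, ← norm_rt_sq, Real.sqrt_sq (norm_nonneg _)]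

theorem weight_nonneg (s : ℝ) (z : Fin n → ℂ) : 0 ≤ weight s z := by
  rw [weight_eq]; positivity

@[fun_prop]
theorem continuous_weight (s : ℝ) : Continuous (weight s : (Fin n → ℂ) → ℝ) := by
  have : (weight s : (Fin n → ℂ) → ℝ) =
      fun z => Real.sqrt ‖bdot z z‖ * Real.exp (-(s * nsq z / 2)) := by
    funext z; rw [weight, Nstar_sq]
  rw [this]; fun_prop

/-- Squared distance of two points of `ℂⁿ × ℂ`. -/
noncomputable def dsq (z : Fin n → ℂ) (ζ : ℂ) (w : Fin n → ℂ) (ω : ℂ) : ℝ :=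
  euclSq (z - w) + ‖ζ - ω‖ ^ 2

theorem dsq_nonneg (z : Fin n → ℂ) (ζ : ℂ) (w : Fin n → ℂ) (ω : ℂ) : 0 ≤ dsq z ζ w ω :=
  add_nonneg (euclSq_nonneg _) (by positivity)

theorem two_mul_re_mul_star (a b : ℂ) :
    2 * (a * star b).re = ‖a‖ ^ 2 + ‖b‖ ^ 2 - ‖a - b‖ ^ 2 := by
  rw [Complex.sq_norm, Complex.sq_norm, Complex.sq_norm]
  simp [Complex.normSq_apply]; ring

theorem two_mul_re_bdot_star (z w : Fin n → ℂ) :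
    2 * (bdot z (star w)).re = euclSq z + euclSq w - euclSq (z - w) := by
  simp only [bdot, euclSq, Complex.re_sum, Finset.mul_sum, ← Finset.sum_add_distrib,
    ← Finset.sum_sub_distrib, Pi.star_apply, Pi.sub_apply, two_mul_re_mul_star]

/-- Polarisation in ℂⁿ × ℂ. It converts the real part in an exponential kernel into a squared
distance, and is the source of the off-diagonal Gaussian decay. -/
theorem two_mul_re_pairing (z w : Fin n → ℂ) (ζ ω : ℂ) :
    2 * (bdot z (star w) + ζ * star ω).re =
      (euclSq z + ‖ζ‖ ^ 2) + (euclSq w + ‖ω‖ ^ 2) - dsq z ζ w ω := by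
  rw [Complex.add_re, mul_add, two_mul_re_bdot_star, two_mul_re_mul_star, dsq]; ring

/-- Cauchy–Schwarz in ℂⁿ × ℂ, done first on ℂⁿ and then on the last coordinate. -/
theorem sq_norm_pairing_le (z u : Fin n → ℂ) (ζ ω : ℂ) :
    ‖bdot z u + ζ * ω‖ ^ 2 ≤ (euclSq z + ‖ζ‖ ^ 2) * (euclSq u + ‖ω‖ ^ 2) := by
  have h1 : ‖bdot z u‖ ≤ ∑ j, ‖z j‖ * ‖u j‖ :=
    (norm_sum_le _ _).trans (le_of_eq (Finset.sum_congr rfl fun j _ => norm_mul _ _))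
  have h2 : (∑ j, ‖z j‖ * ‖u j‖) ^ 2 ≤ euclSq z * euclSq u :=
    Finset.sum_mul_sq_le_sq_mul_sq _ _ _
  set A := ∑ j, ‖z j‖ * ‖u j‖
  have hA : 0 ≤ A := (norm_nonneg _).trans h1
  have h3 : ‖bdot z u + ζ * ω‖ ≤ A + ‖ζ‖ * ‖ω‖ := by
    refine (norm_add_le _ _).trans ?_
    rw [norm_mul]; gcongr
  have ez := euclSq_nonneg z
  have eu := euclSq_nonneg u
  have h4 : A ≤ Real.sqrt (euclSq z) * Real.sqrt (euclSq u) := by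
    rw [← Real.sqrt_mul ez]; exact Real.le_sqrt_of_sq_le h2
  calc ‖bdot z u + ζ * ω‖ ^ 2
      ≤ (Real.sqrt (euclSq z) * Real.sqrt (euclSq u) + ‖ζ‖ * ‖ω‖) ^ 2 := by gcongr; linarith
    _ ≤ (Real.sqrt (euclSq z) ^ 2 + ‖ζ‖ ^ 2) * (Real.sqrt (euclSq u) ^ 2 + ‖ω‖ ^ 2) := by
        nlinarith [sq_nonneg (Real.sqrt (euclSq z) * ‖ω‖ - Real.sqrt (euclSq u) * ‖ζ‖)]
    _ = _ := by rw [Real.sq_sqrt ez, Real.sq_sqrt eu]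

/-- If `ζ² = z • z`, the point `(z, ζ)` of the cone has squared norm `nsq z`. -/
theorem nsq_eq_of_sq {z : Fin n → ℂ} {ζ : ℂ} (h : ζ ^ 2 = bdot z z) :
    nsq z = euclSq z + ‖ζ‖ ^ 2 := by
  rw [nsq, ← h, norm_pow]

theorem norm_pairing_le {z u : Fin n → ℂ} {ζ ω : ℂ} (hz : ζ ^ 2 = bdot z z)
    (hu : ω ^ 2 = bdot u u) : ‖bdot z u + ζ * ω‖ ≤ Nstar z * Nstar u := by
  have := sq_norm_pairing_le z u ζ ω
  rw [← nsq_eq_of_sq hz, ← nsq_eq_of_sq hu, ← Nstar_sq, ← Nstar_sq, ← mul_pow] at this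
  exact le_of_sq_le_sq this (by unfold Nstar; positivity)

theorem Nstar_nonneg (z : Fin n → ℂ) : 0 ≤ Nstar z := Real.sqrt_nonneg _

@[fun_prop]
theorem continuous_Nstar : Continuous fun z : Fin n → ℂ => Nstar z := by
  have : (fun z : Fin n → ℂ => Nstar z) = fun z => Real.sqrt (nsq z) := rfl
  rw [this]; fun_prop

theorem Nstar_smul (c : ℂ) (z : Fin n → ℂ) : Nstar (c • z) = ‖c‖ * Nstar z := by
  have : ∀ z : Fin n → ℂ, Nstar z = Real.sqrt (nsq z) := fun _ => rfl
  rw [this, this, nsq_smul, Real.sqrt_mul (by positivity), Real.sqrt_sq (norm_nonneg _)]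

theorem Nstar_star (z : Fin n → ℂ) : Nstar (star z) = Nstar z := by
  have : ∀ z : Fin n → ℂ, Nstar z = Real.sqrt (nsq z) := fun _ => rfl
  rw [this, this, nsq_star]

theorem norm_le_Nstar (z : Fin n → ℂ) : ‖z‖ ≤ Nstar z :=
  Real.le_sqrt_of_sq_le ((sq_norm_le_euclSq z).trans (euclSq_le_nsq z))

theorem measurePreserving_smul (c : ℂ) (hc : ‖c‖ = 1) :
    MeasurePreserving (fun z : Fin n → ℂ => c • z) := by
  have h1 : MeasurePreserving (fun x : ℂ => c * x) := by
    have := (rotation ⟨c, by simpa [Submonoid.unitSphere] using hc⟩).measurePreserving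
    exact this
  have := volume_preserving_pi (ι := Fin n) (fun _ => h1)
  exact this

theorem measurePreserving_star : MeasurePreserving (fun z : Fin n → ℂ => star z) := by
  have h1 : MeasurePreserving (fun x : ℂ => star x) := Complex.conjLIE.measurePreserving
  exact volume_preserving_pi (ι := Fin n) (fun _ => h1)

end Basics

/-! ### Change of variables under squaring in the plane -/

theorem measurableSet_re_pos : MeasurableSet {z : ℂ | 0 < z.re} :=
  measurableSet_lt measurable_const Complex.measurable_re

theorem abs_det_mulLeft_complex (a : ℂ) :
    |((ContinuousLinearMap.toSpanSingleton ℂ a).restrictScalars ℝ : ℂ →L[ℝ] ℂ).det| = ‖a‖ ^ 2 := by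
  rw [ContinuousLinearMap.det]
  have : (((ContinuousLinearMap.toSpanSingleton ℂ a).restrictScalars ℝ : ℂ →L[ℝ] ℂ) : ℂ →ₗ[ℝ] ℂ)
      = Algebra.lmul ℝ ℂ a := by
    ext; simp [mul_comm]
  rw [this, ← Algebra.norm_apply, Algebra.norm_complex_apply,
    abs_of_nonneg (Complex.normSq_nonneg _), Complex.sq_norm]

/-- Squaring maps the right half-plane bijectively onto the slit plane with real Jacobian |2z|². -/
theorem lintegral_halfplane_sq (h : ℂ → ℝ≥0∞) :
    ∫⁻ z in {z : ℂ | 0 < z.re}, ENNReal.ofReal (4 * ‖z‖ ^ 2) * h (z ^ 2) =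
      ∫⁻ z in Complex.slitPlane, h z := by
  have himg : (fun z : ℂ => z ^ 2) '' {z : ℂ | 0 < z.re} = Complex.slitPlane := by
    ext w
    constructor
    · rintro ⟨z, hz, rfl⟩
      simp only [Set.mem_ofPred_eq] at hz
      rw [Complex.mem_slitPlane_iff]
      by_cases h : z.im = 0
      · left; simp [sq, h]; positivity
      · right
        have e : (z ^ 2).im = 2 * (z.re * z.im) := by rw [sq, Complex.mul_im]; ring
        rw [e]
        exact mul_ne_zero two_ne_zero (mul_ne_zero hz.ne' h)
    · intro hw
      -- The principal root has argument in (-π/2, π/2), hence positive real part.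
      refine ⟨w ^ ((2 : ℕ)⁻¹ : ℂ), ?_, Complex.cpow_nat_inv_pow _ two_ne_zero⟩
      have hw0 : w ≠ 0 := Complex.slitPlane_ne_zero hw
      have harg := Complex.mem_slitPlane_iff_arg.1 hw
      have h1 : w ^ ((2 : ℕ)⁻¹ : ℂ) = Complex.exp (Complex.log w * ((2 : ℕ)⁻¹ : ℂ)) := by
        rw [Complex.cpow_def_of_ne_zero hw0]
      simp only [Set.mem_ofPred_eq]
      rw [h1, Complex.exp_re]
      refine mul_pos (Real.exp_pos _) (Real.cos_pos_of_mem_Ioo ?_)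
      have e : (Complex.log w * ((2 : ℕ)⁻¹ : ℂ)).im = w.arg / 2 := by
        have : ((2 : ℕ)⁻¹ : ℂ) = ((1 / 2 : ℝ) : ℂ) := by push_cast; norm_num
        rw [this, Complex.im_mul_ofReal, Complex.log_im]; ring
      rw [e]
      have := Complex.neg_pi_lt_arg w
      have h3 := lt_of_le_of_ne (Complex.arg_le_pi w) harg.1
      constructor <;> linarith
  have hinj : Set.InjOn (fun z : ℂ => z ^ 2) {z : ℂ | 0 < z.re} := by
    intro a ha b hb hab
    simp only [Set.mem_ofPred_eq] at ha hb
    rcases sq_eq_sq_iff_eq_or_eq_neg.1 hab with h | h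
    · exact h
    · rw [h] at ha; simp at ha; linarith
  rw [← himg, lintegral_image_eq_lintegral_abs_det_fderiv_mul volume measurableSet_re_pos
    (f' := fun z => (ContinuousLinearMap.toSpanSingleton ℂ (2 * z)).restrictScalars ℝ)
    (fun z _ => ?_) hinj]
  · refine lintegral_congr fun z => ?_
    rw [abs_det_mulLeft_complex, norm_mul, mul_pow]; norm_num
  · have := (hasDerivAt_pow 2 z).hasFDerivAt.restrictScalars ℝ
    simpa using this.hasFDerivWithinAt

theorem ae_re_ne_zero : ∀ᵐ z : ℂ, z.re ≠ 0 := by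
  have := Measure.addHaar_submodule (volume : Measure ℂ) (LinearMap.ker Complex.reLm) ?_
  · rw [ae_iff]; convert this using 2; ext z; simp
  · intro h
    have : (1 : ℂ) ∈ LinearMap.ker Complex.reLm := h ▸ Submodule.mem_top
    simp at this

theorem ae_mem_slitPlane : ∀ᵐ z : ℂ, z ∈ Complex.slitPlane := by
  have := Measure.addHaar_submodule (volume : Measure ℂ) (LinearMap.ker Complex.imLm) ?_
  · rw [ae_iff]
    refine measure_mono_null ?_ this
    intro z hz
    simp only [Set.mem_ofPred_eq, Complex.mem_slitPlane_iff, not_or, not_not] at hz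
    simpa using hz.2
  · intro h
    have : (Complex.I : ℂ) ∈ LinearMap.ker Complex.imLm := h ▸ Submodule.mem_top
    simp at this

/-- Each of the half-planes Re z > 0 and Re z < 0 covers the plane once up to null sets, with
Jacobian 4|z|². This gives the factor 2/4. -/
theorem lintegral_sq (h : ℂ → ℝ≥0∞) (hh : Measurable h) :
    ∫⁻ z : ℂ, ENNReal.ofReal (‖z‖ ^ 2) * h (z ^ 2) = 2⁻¹ * ∫⁻ z, h z := by
  set S : Set ℂ := {z : ℂ | 0 < z.re}
  have hS : MeasurableSet S := measurableSet_re_pos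
  set g : ℂ → ℝ≥0∞ := fun z => ENNReal.ofReal (4 * ‖z‖ ^ 2) * h (z ^ 2) with hg
  have hgm : Measurable g := by fun_prop
  have h1 : ∫⁻ z in S, g z = ∫⁻ z, h z := by
    rw [lintegral_halfplane_sq]
    rw [Measure.restrict_eq_self_of_ae_mem ae_mem_slitPlane]
  have h2 : ∫⁻ z in Sᶜ, g z = ∫⁻ z, h z := by
    rw [← h1]
    have e : ∫⁻ z in (fun z : ℂ => -z) ⁻¹' S, g z = ∫⁻ z in S, g z := by
      have := (Measure.measurePreserving_neg (volume : Measure ℂ)).setLIntegral_comp_preimage hS hgm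
      rw [← this]
      simp [hg]
    rw [← e]
    refine setLIntegral_congr ?_
    filter_upwards [ae_re_ne_zero] with z hz
    refine propext ?_
    change ¬ (0 < z.re) ↔ 0 < (-z).re
    simp only [Complex.neg_re, not_lt, Left.neg_pos_iff]
    exact ⟨fun h => lt_of_le_of_ne h hz, le_of_lt⟩
  have h3 : ∫⁻ z, g z = 2 * ∫⁻ z, h z := by
    rw [← lintegral_add_compl g hS, h1, h2, two_mul]
  have h4 : ∀ z, g z = 4 * (ENNReal.ofReal (‖z‖ ^ 2) * h (z ^ 2)) := by
    intro z
    simp only [hg]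
    rw [ENNReal.ofReal_mul (by norm_num), mul_assoc]; norm_num
  simp_rw [h4] at h3
  rw [lintegral_const_mul _ (by fun_prop)] at h3
  have h5 : (4 : ℝ≥0∞)⁻¹ * (4 * ∫⁻ z : ℂ, ENNReal.ofReal (‖z‖ ^ 2) * h (z ^ 2)) =
      4⁻¹ * (2 * ∫⁻ z, h z) := by rw [h3]
  rw [← mul_assoc, ← mul_assoc, ENNReal.inv_mul_cancel (by norm_num) (by norm_num), one_mul] at h5
  rw [h5]
  congr 1
  have : (4 : ℝ≥0∞) = 2 * 2 := by norm_num
  rw [this, ENNReal.mul_inv (by norm_num) (by norm_num), mul_assoc,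
    ENNReal.inv_mul_cancel (by norm_num) (by norm_num), mul_one]

/-! ### The coordinates (z', z • z), and Gaussian integrals -/

section Coord
variable {n : ℕ}

theorem bdot_insertNth (j : Fin (n + 1)) (x y : ℂ) (z w : Fin n → ℂ) :
    bdot (j.insertNth x z : Fin (n + 1) → ℂ) (j.insertNth y w : Fin (n + 1) → ℂ) =
      x * y + bdot z w := by
  simp [bdot, Fin.sum_univ_succAbove _ j]

theorem euclSq_insertNth (j : Fin (n + 1)) (x : ℂ) (z : Fin n → ℂ) :
    euclSq (j.insertNth x z : Fin (n + 1) → ℂ) = ‖x‖ ^ 2 + euclSq z := by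
  simp [euclSq, Fin.sum_univ_succAbove _ j]

theorem lintegral_insertNth (j : Fin (n + 1)) (F : (Fin (n + 1) → ℂ) → ℝ≥0∞) (hF : Measurable F) :
    ∫⁻ z, F z = ∫⁻ z' : Fin n → ℂ, ∫⁻ x : ℂ, F (j.insertNth x z') := by
  have h := (volume_preserving_piFinSuccAbove (fun _ : Fin (n + 1) => ℂ) j).symm
  rw [← h.lintegral_comp hF, Measure.volume_eq_prod,
    lintegral_prod_symm (fun a => F ((MeasurableEquiv.piFinSuccAbove (fun _ => ℂ) j).symm a))
      (hF.comp (MeasurableEquiv.measurable _)).aemeasurable]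
  rfl

/-- For fixed remaining coordinates z', the map z_j ↦ z • z = z_j² + z' • z' is squaring followed by
a translation. The factor |z_j|² therefore makes (z', z • z) a two-to-one chart with constant
Jacobian. -/
theorem lintegral_coord_sq (j : Fin (n + 1)) (H : (Fin n → ℂ) → ℂ → ℝ≥0∞)
    (hH : Measurable (Function.uncurry H)) :
    ∫⁻ z : Fin (n + 1) → ℂ, ENNReal.ofReal (‖z j‖ ^ 2) * H (j.removeNth z) (bdot z z) =
      2⁻¹ * ∫⁻ z', ∫⁻ τ, H z' τ := by
  have hrem : Measurable fun z : Fin (n + 1) → ℂ => (j.removeNth z : Fin n → ℂ) :=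
    measurable_pi_lambda _ fun i => measurable_pi_apply _
  have hm : Measurable fun z : Fin (n + 1) → ℂ =>
      ENNReal.ofReal (‖z j‖ ^ 2) * H (j.removeNth z) (bdot z z) := by
    refine Measurable.mul (by fun_prop) ?_
    exact hH.comp (hrem.prodMk continuous_bdot_self.measurable)
  rw [lintegral_insertNth j _ hm, ← lintegral_const_mul (f := fun z' => ∫⁻ τ, H z' τ) _
    hH.lintegral_prod_right']
  refine lintegral_congr fun z' => ?_
  simp only [Fin.insertNth_apply_same, Fin.removeNth_insertNth, bdot_insertNth, ← sq]
  have hz' : Measurable (H z') := hH.comp measurable_prodMk_left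
  rw [lintegral_sq (fun τ => H z' (τ + bdot z' z')) (by fun_prop),
    lintegral_add_right_eq_self (fun τ => H z' τ)]

/-- Testing the chart on the indicator of τ = 0 shows that each z_j vanishes almost everywhere on
the null cone, so the cone agrees with {0} up to a null set. -/
theorem ae_bdot_self_ne_zero_succ : ∀ᵐ z : Fin (n + 1) → ℂ, bdot z z ≠ 0 := by
  have key : ∀ j : Fin (n + 1), ∀ᵐ z : Fin (n + 1) → ℂ, bdot z z = 0 → z j = 0 := by
    intro j
    have h := lintegral_coord_sq j (fun _ τ => Set.indicator {(0 : ℂ)} 1 τ)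
      (by
        have : Measurable (Set.indicator {(0 : ℂ)} (1 : ℂ → ℝ≥0∞)) :=
          measurable_one.indicator (measurableSet_singleton _)
        exact this.comp measurable_snd)
    simp only [lintegral_indicator_one (measurableSet_singleton (0 : ℂ)), measure_singleton,
      lintegral_zero, mul_zero] at h
    have hm : Measurable (Set.indicator {(0 : ℂ)} (1 : ℂ → ℝ≥0∞)) :=
      measurable_one.indicator (measurableSet_singleton _)
    have hm' : Measurable fun z : Fin (n + 1) → ℂ =>
        ENNReal.ofReal (‖z j‖ ^ 2) * Set.indicator {(0 : ℂ)} (1 : ℂ → ℝ≥0∞) (bdot z z) :=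
      Measurable.mul (by fun_prop) (hm.comp continuous_bdot_self.measurable)
    rw [lintegral_eq_zero_iff hm'] at h
    filter_upwards [h] with z hz hq
    simp only [hq, Set.indicator_of_mem, Set.mem_singleton_iff, Pi.one_apply, mul_one,
      Pi.zero_apply, ENNReal.ofReal_eq_zero] at hz
    have : ‖z j‖ ^ 2 = 0 := le_antisymm hz (by positivity)
    simpa using this
  have h0 : ∀ᵐ z : Fin (n + 1) → ℂ, z ≠ 0 := by
    rw [ae_iff]; simp
  filter_upwards [ae_all_iff.2 key, h0] with z hz h0 hq
  exact h0 (funext fun j => hz j hq)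

theorem ae_bdot_self_ne_zero (hn : 1 ≤ n) : ∀ᵐ z : Fin n → ℂ, bdot z z ≠ 0 := by
  obtain ⟨m, rfl⟩ := Nat.exists_eq_add_of_le' hn
  exact ae_bdot_self_ne_zero_succ

theorem integrable_gauss_complex {c : ℝ} (hc : 0 < c) :
    Integrable fun x : ℂ => Real.exp (-c * ‖x‖ ^ 2) := by
  refine Integrable.of_integral_ne_zero ?_
  rw [GaussianFourier.integral_rexp_neg_mul_sq_norm hc]
  positivity

theorem integral_gauss_complex {c : ℝ} (hc : 0 < c) :
    ∫ x : ℂ, Real.exp (-c * ‖x‖ ^ 2) = Real.pi / c := by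
  rw [GaussianFourier.integral_rexp_neg_mul_sq_norm hc]; simp

theorem exp_neg_mul_euclSq (c : ℝ) (z : Fin n → ℂ) :
    Real.exp (-c * euclSq z) = ∏ j, Real.exp (-c * ‖z j‖ ^ 2) := by
  rw [← Real.exp_sum, euclSq, Finset.mul_sum]

theorem integral_gauss {c : ℝ} (hc : 0 < c) :
    ∫ z : Fin n → ℂ, Real.exp (-c * euclSq z) = (Real.pi / c) ^ n := by
  simp_rw [exp_neg_mul_euclSq]
  rw [integral_fintype_prod_volume_eq_prod (fun _ (x : ℂ) => Real.exp (-c * ‖x‖ ^ 2))]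
  rw [integral_gauss_complex hc]; simp [div_pow]

theorem integrable_gauss {c : ℝ} (hc : 0 < c) :
    Integrable fun z : Fin n → ℂ => Real.exp (-c * euclSq z) := by
  refine Integrable.of_integral_ne_zero ?_
  rw [integral_gauss hc]
  positivity

theorem integrable_rpow_mul_gauss_complex {p : ℝ} (hp : 0 < p) :
    Integrable fun x : ℂ => ‖x‖ ^ (p - 2) * Real.exp (-‖x‖ ^ (2 : ℝ)) := by
  refine Integrable.of_integral_ne_zero ?_
  rw [Complex.integral_rpow_mul_exp_neg_rpow (by norm_num) (by linarith)]
  have := Real.Gamma_pos_of_pos (show 0 < (p - 2 + 2) / 2 by linarith)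
  positivity

end Coord

/-! ### Uniform Gaussian integrals against |z • z|⁻¹ dA -/

section Chart
variable {n : ℕ}

theorem lintegral_gauss_lt_top {c : ℝ} (hc : 0 < c) :
    ∫⁻ z : Fin n → ℂ, ENNReal.ofReal (Real.exp (-c * euclSq z)) < ⊤ :=
  (integrable_gauss hc).lintegral_lt_top

/-- The singularity |x|^{p-2} matters only for |x| ≤ 1, where e · e^{-|x|²} ≥ 1; for |x| ≥ 1 it is
at most 1. The points x and y are unrelated, so the first term can later be translated. -/
theorem rpow_mul_gauss_le {p c : ℝ} (hp2 : p ≤ 2) (hc : 0 < c) {x : ℂ} (hx : x ≠ 0) (y : ℂ) :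
    (1 + ‖x‖ ^ (p - 2)) * Real.exp (-c * ‖y‖ ^ 2) ≤
      2 * Real.exp (-c * ‖y‖ ^ 2) +
        Real.exp 1 * (‖x‖ ^ (p - 2) * Real.exp (-‖x‖ ^ (2 : ℝ))) := by
  have hx0 : 0 < ‖x‖ := norm_pos_iff.2 hx
  have h1 : Real.exp (-c * ‖y‖ ^ 2) ≤ 1 := Real.exp_le_one_iff.2 (by
    have : 0 ≤ c * ‖y‖ ^ 2 := by positivity
    linarith)
  have hr : 0 ≤ ‖x‖ ^ (p - 2) := by positivity
  rcases le_total ‖x‖ 1 with h | h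
  · have h2 : 1 ≤ Real.exp 1 * Real.exp (-‖x‖ ^ (2 : ℝ)) := by
      rw [← Real.exp_add]
      refine Real.one_le_exp ?_
      have : ‖x‖ ^ (2 : ℝ) ≤ 1 := Real.rpow_le_one hx0.le h (by norm_num)
      linarith
    have h3 := mul_le_mul_of_nonneg_left h1 hr
    have h4 := mul_le_mul_of_nonneg_left h2 hr
    nlinarith [Real.exp_pos (-c * ‖y‖ ^ 2)]
  · have h2 : ‖x‖ ^ (p - 2) ≤ 1 := Real.rpow_le_one_of_one_le_of_nonpos h (by linarith)
    have h3 := mul_le_mul_of_nonneg_right h2 (Real.exp_pos (-c * ‖y‖ ^ 2)).le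
    have h4 : 0 ≤ Real.exp 1 * (‖x‖ ^ (p - 2) * Real.exp (-‖x‖ ^ (2 : ℝ))) := by positivity
    nlinarith

/-- The fibre density in the chart lemma. -/
noncomputable def fibreDensity (p c : ℝ) (η τ : ℂ) : ℝ≥0∞ :=
  ENNReal.ofReal ((1 + ‖τ‖ ^ (p / 2 - 1)) * Real.exp (-c * ‖τ ^ ((2 : ℕ)⁻¹ : ℂ) - η‖ ^ 2)) *
    (ENNReal.ofReal ‖τ‖)⁻¹

theorem measurable_fibreDensity (p c : ℝ) (η : ℂ) : Measurable (fibreDensity p c η) := by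
  unfold fibreDensity
  have : Measurable fun τ : ℂ => τ ^ ((2 : ℕ)⁻¹ : ℂ) := measurable_id.pow_const _
  fun_prop

/-- After τ = z² the Jacobian |z|² cancels 1/|τ|, and the principal root of z² is z or -z. The
integrand is thus dominated by the sum of the bounds with Gaussians centred at η and -η, whose
integrals do not depend on η. -/
theorem lintegral_fibreDensity_le {p c : ℝ} (hp : 0 < p) (hp2 : p ≤ 2) (hc : 0 < c) :
    ∃ K : ℝ≥0∞, K ≠ ⊤ ∧ ∀ η, ∫⁻ τ, fibreDensity p c η τ ≤ K := by
  set G : ℝ≥0∞ := ∫⁻ x : ℂ, ENNReal.ofReal (Real.exp (-c * ‖x‖ ^ 2)) with hG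
  set R : ℝ≥0∞ := ∫⁻ x : ℂ, ENNReal.ofReal
    (Real.exp 1 * (‖x‖ ^ (p - 2) * Real.exp (-‖x‖ ^ (2 : ℝ)))) with hR
  have hGt : G ≠ ⊤ := (integrable_gauss_complex hc).lintegral_lt_top.ne
  have hRt : R ≠ ⊤ := ((integrable_rpow_mul_gauss_complex hp).const_mul _).lintegral_lt_top.ne
  -- One bracket for each of the roots ±z; the outer 2 undoes the 1/2 of `lintegral_sq`.
  refine ⟨2 * ((2 * G + R) + (2 * G + R)), by finiteness, fun η => ?_⟩
  have h1 := lintegral_sq (fibreDensity p c η) (measurable_fibreDensity p c η)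
  have h2 : ∫⁻ τ, fibreDensity p c η τ =
      2 * ∫⁻ z : ℂ, ENNReal.ofReal (‖z‖ ^ 2) * fibreDensity p c η (z ^ 2) := by
    rw [h1, ← mul_assoc, ENNReal.mul_inv_cancel (by norm_num) (by norm_num), one_mul]
  rw [h2]
  gcongr
  have hae : ∀ᵐ z : ℂ, z ≠ 0 := by rw [ae_iff]; simp
  set B : ℂ → ℂ → ℝ := fun y x => 2 * Real.exp (-c * ‖y‖ ^ 2) +
        Real.exp 1 * (‖x‖ ^ (p - 2) * Real.exp (-‖x‖ ^ (2 : ℝ))) with hB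
  have hB0 : ∀ x y, 0 ≤ B x y := fun x y => by simp only [hB]; positivity
  have hBint : ∀ η', ∫⁻ x : ℂ, ENNReal.ofReal (B (x - η') x) = 2 * G + R := by
    intro η'
    simp only [hB]
    have : ∀ x : ℂ, ENNReal.ofReal (2 * Real.exp (-c * ‖x - η'‖ ^ 2) +
        Real.exp 1 * (‖x‖ ^ (p - 2) * Real.exp (-‖x‖ ^ (2 : ℝ)))) =
        2 * ENNReal.ofReal (Real.exp (-c * ‖x - η'‖ ^ 2)) + ENNReal.ofReal
        (Real.exp 1 * (‖x‖ ^ (p - 2) * Real.exp (-‖x‖ ^ (2 : ℝ)))) := by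
      intro x
      rw [ENNReal.ofReal_add (by positivity) (by positivity), ENNReal.ofReal_mul (by norm_num)]
      norm_num
    simp_rw [this]
    rw [lintegral_add_left (by fun_prop), lintegral_const_mul _ (by fun_prop),
      lintegral_sub_right_eq_self (fun x : ℂ => ENNReal.ofReal (Real.exp (-c * ‖x‖ ^ 2))) η']
  calc ∫⁻ z : ℂ, ENNReal.ofReal (‖z‖ ^ 2) * fibreDensity p c η (z ^ 2)
      ≤ ∫⁻ z : ℂ, ENNReal.ofReal (B (z - η) z) + ENNReal.ofReal (B (z - (-η)) z) := by
        refine lintegral_mono_ae ?_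
        filter_upwards [hae] with z hz
        have hz0 : 0 < ‖z‖ := norm_pos_iff.2 hz
        have e1 : ENNReal.ofReal (‖z‖ ^ 2) * fibreDensity p c η (z ^ 2) =
            ENNReal.ofReal ((1 + ‖z‖ ^ (p - 2)) *
              Real.exp (-c * ‖(z ^ 2) ^ ((2 : ℕ)⁻¹ : ℂ) - η‖ ^ 2)) := by
          rw [fibreDensity, norm_pow, mul_left_comm,
            ENNReal.mul_inv_cancel (by simpa using hz) ENNReal.ofReal_ne_top, mul_one]
          have : (‖z‖ ^ 2) ^ (p / 2 - 1) = ‖z‖ ^ (p - 2) := by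
            rw [← Real.rpow_natCast, ← Real.rpow_mul hz0.le]
            congr 1; push_cast; ring
          rw [this]
        rw [e1]
        have hs : ((z ^ 2) ^ ((2 : ℕ)⁻¹ : ℂ)) ^ 2 = z ^ 2 :=
          Complex.cpow_nat_inv_pow _ two_ne_zero
        rcases sq_eq_sq_iff_eq_or_eq_neg.1 hs with h | h
        · rw [h]
          exact (ENNReal.ofReal_le_ofReal (rpow_mul_gauss_le hp2 hc hz _)).trans le_self_add
        · rw [h]
          have : ‖-z - η‖ = ‖z - -η‖ := by rw [← norm_neg]; congr 1; ring
          rw [this]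
          exact (ENNReal.ofReal_le_ofReal (rpow_mul_gauss_le hp2 hc hz _)).trans le_add_self
    _ = (2 * G + R) + (2 * G + R) := by
        rw [lintegral_add_left (by simp only [hB]; fun_prop), hBint, hBint]

theorem euclSq_removeNth_le (j : Fin (n + 1)) (z : Fin (n + 1) → ℂ) :
    euclSq (j.removeNth z : Fin n → ℂ) ≤ euclSq z := by
  rw [euclSq, euclSq, Fin.sum_univ_succAbove _ j]
  exact le_add_of_nonneg_left (by positivity)

/-- Since nsq is at most 2 ∑ |z_j|², the density splits into terms with a factor |z_j|², each suited
to its own chart. The exponent p/2 - 1 is not positive, so nsq^{p/2-1} ≤ |z • z|^{p/2-1}. -/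
theorem chart_pointwise_real {p c : ℝ} (hp2 : p ≤ 2) (hc : 0 < c) (v : Fin (n + 1) → ℂ) (η : ℂ)
    {z : Fin (n + 1) → ℂ} (hz : bdot z z ≠ 0) :
    (nsq z ^ (p / 2) + nsq z) * Real.exp (-c * dsq z (rt z) v η) ≤
      ∑ j : Fin (n + 1), 2 * (‖z j‖ ^ 2 *
            (Real.exp (-c * euclSq (j.removeNth z - j.removeNth v : Fin n → ℂ)) *
            ((1 + ‖bdot z z‖ ^ (p / 2 - 1)) *
              Real.exp (-c * ‖bdot z z ^ ((2 : ℕ)⁻¹ : ℂ) - η‖ ^ 2)))) := by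
  have hq : 0 < ‖bdot z z‖ := norm_pos_iff.2 hz
  have hN : 0 < nsq z := hq.trans_le (norm_bdot_self_le_nsq z)
  have h1 : nsq z ^ (p / 2) + nsq z ≤ 2 * euclSq z * (1 + ‖bdot z z‖ ^ (p / 2 - 1)) := by
    have h3 : nsq z ^ (p / 2) = nsq z * nsq z ^ (p / 2 - 1) := by
      rw [mul_comm, ← Real.rpow_add_one hN.ne']; congr 1; ring
    have h4 : nsq z ^ (p / 2 - 1) ≤ ‖bdot z z‖ ^ (p / 2 - 1) :=
      Real.rpow_le_rpow_of_nonpos hq (norm_bdot_self_le_nsq z) (by linarith)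
    calc nsq z ^ (p / 2) + nsq z = nsq z * (1 + nsq z ^ (p / 2 - 1)) := by rw [h3]; ring
      _ ≤ 2 * euclSq z * (1 + ‖bdot z z‖ ^ (p / 2 - 1)) :=
        mul_le_mul (nsq_le_two_mul_euclSq z) (by linarith) (by positivity)
          (mul_nonneg (by norm_num) (euclSq_nonneg z))
  calc (nsq z ^ (p / 2) + nsq z) * Real.exp (-c * dsq z (rt z) v η)
      ≤ 2 * euclSq z * (1 + ‖bdot z z‖ ^ (p / 2 - 1)) *
          Real.exp (-c * dsq z (rt z) v η) := by gcongr
    _ = ∑ j, 2 * ‖z j‖ ^ 2 * (1 + ‖bdot z z‖ ^ (p / 2 - 1)) *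
          Real.exp (-c * dsq z (rt z) v η) := by
        rw [← Finset.sum_mul, ← Finset.sum_mul, ← Finset.mul_sum]; rfl
    _ ≤ _ := by
        refine Finset.sum_le_sum fun j _ => ?_
        -- Dropping the j-th coordinate from the Gaussian frees z_j, which the chart trades for z •
        -- z.
        have h5 : Real.exp (-c * dsq z (rt z) v η) ≤
            Real.exp (-c * euclSq (j.removeNth z - j.removeNth v : Fin n → ℂ)) *
              Real.exp (-c * ‖bdot z z ^ ((2 : ℕ)⁻¹ : ℂ) - η‖ ^ 2) := by
          rw [← Real.exp_add, Real.exp_le_exp, dsq, rt]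
          have := euclSq_removeNth_le j (z - v)
          have h6 : (j.removeNth (z - v) : Fin n → ℂ) =
            (j.removeNth z - j.removeNth v : Fin n → ℂ) := rfl
          rw [h6] at this
          nlinarith
        calc _ ≤ 2 * ‖z j‖ ^ 2 * (1 + ‖bdot z z‖ ^ (p / 2 - 1)) *
            (Real.exp (-c * euclSq (j.removeNth z - j.removeNth v : Fin n → ℂ)) *
              Real.exp (-c * ‖bdot z z ^ ((2 : ℕ)⁻¹ : ℂ) - η‖ ^ 2)) := by gcongr
          _ = _ := by ring

theorem chart_pointwise {p c : ℝ} (hp2 : p ≤ 2) (hc : 0 < c) (v : Fin (n + 1) → ℂ) (η : ℂ)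
    {z : Fin (n + 1) → ℂ} (hz : bdot z z ≠ 0) :
    ENNReal.ofReal ((nsq z ^ (p / 2) + nsq z) * Real.exp (-c * dsq z (rt z) v η)) *
          (ENNReal.ofReal ‖bdot z z‖)⁻¹ ≤ ∑ j : Fin (n + 1), 2 * (ENNReal.ofReal (‖z j‖ ^ 2) *
            (ENNReal.ofReal (Real.exp (-c * euclSq (j.removeNth z - j.removeNth v : Fin n → ℂ))) *
              fibreDensity p c η (bdot z z))) := by
  simp only [fibreDensity]
  have e : ∀ j : Fin (n + 1), 2 * (ENNReal.ofReal (‖z j‖ ^ 2) *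
      (ENNReal.ofReal (Real.exp (-c * euclSq (j.removeNth z - j.removeNth v : Fin n → ℂ))) *
      (ENNReal.ofReal ((1 + ‖bdot z z‖ ^ (p / 2 - 1)) *
        Real.exp (-c * ‖bdot z z ^ ((2 : ℕ)⁻¹ : ℂ) - η‖ ^ 2)) *
        (ENNReal.ofReal ‖bdot z z‖)⁻¹))) =
      ENNReal.ofReal (2 * (‖z j‖ ^ 2 *
      (Real.exp (-c * euclSq (j.removeNth z - j.removeNth v : Fin n → ℂ)) *
      ((1 + ‖bdot z z‖ ^ (p / 2 - 1)) *
        Real.exp (-c * ‖bdot z z ^ ((2 : ℕ)⁻¹ : ℂ) - η‖ ^ 2))))) *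
        (ENNReal.ofReal ‖bdot z z‖)⁻¹ := by
    intro j
    rw [ENNReal.ofReal_mul (p := 2) (by norm_num), ENNReal.ofReal_mul (p := ‖z j‖ ^ 2)
      (by positivity), ENNReal.ofReal_mul (p := Real.exp _) (by positivity)]
    rw [ENNReal.ofReal_ofNat]
    ring
  simp_rw [e]
  rw [← Finset.sum_mul, ← ENNReal.ofReal_sum_of_nonneg (fun j _ => by positivity)]
  exact mul_le_mul_left (ENNReal.ofReal_le_ofReal (chart_pointwise_real hp2 hc v η hz)) _

theorem measurable_removeNth (j : Fin (n + 1)) :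
    Measurable fun z : Fin (n + 1) → ℂ => (j.removeNth z : Fin n → ℂ) :=
  measurable_pi_lambda _ fun _ => measurable_pi_apply _

theorem measurable_chart_density (p c : ℝ) (j : Fin (n + 1)) (v : Fin (n + 1) → ℂ) (η : ℂ) :
    Measurable (Function.uncurry fun (z' : Fin n → ℂ) τ =>
      ENNReal.ofReal (Real.exp (-c * euclSq (z' - j.removeNth v : Fin n → ℂ))) *
        fibreDensity p c η τ) := by
  have h1 := (measurable_fibreDensity p c η).comp (measurable_snd : Measurable (Prod.snd : (Fin n → ℂ) × ℂ → ℂ))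
  have h2 : Measurable fun x : (Fin n → ℂ) × ℂ =>
      ENNReal.ofReal (Real.exp (-c * euclSq (x.1 - j.removeNth v : Fin n → ℂ))) := by
    have h3 : Measurable fun z' : Fin n → ℂ =>
        ENNReal.ofReal (Real.exp (-c * euclSq (z' - j.removeNth v : Fin n → ℂ))) := by
      have : Continuous fun z' : Fin n → ℂ =>
          Real.exp (-c * euclSq (z' - j.removeNth v : Fin n → ℂ)) := by fun_prop
      exact this.measurable.ennreal_ofReal
    exact h3.comp measurable_fst
  exact h2.mul h1


theorem measurable_chart_term {p c : ℝ} (j : Fin (n + 1)) (v : Fin (n + 1) → ℂ) (η : ℂ) : Measurable fun z : Fin (n + 1) → ℂ => ENNReal.ofReal (‖z j‖ ^ 2) *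
      (ENNReal.ofReal (Real.exp (-c * euclSq (j.removeNth z - j.removeNth v : Fin n → ℂ))) *
        fibreDensity p c η (bdot z z)) := by
  have h1 : Measurable fun z : Fin (n + 1) → ℂ => ENNReal.ofReal (‖z j‖ ^ 2) := by fun_prop
  have h2 := (measurable_removeNth j).prodMk (continuous_bdot_self (n := n + 1)).measurable
  have h3 := (measurable_chart_density p c j v η).comp h2
  exact h1.mul h3
theorem lintegral_chart_density_le {p c : ℝ} {K : ℝ≥0∞}
    (hK : ∀ η, ∫⁻ τ, fibreDensity p c η τ ≤ K) (j : Fin (n + 1)) (v : Fin (n + 1) → ℂ) (η : ℂ) :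
   ∫⁻ z' : Fin n → ℂ, ∫⁻ τ,  ENNReal.ofReal (Real.exp (-c * euclSq (z' - j.removeNth v : Fin n → ℂ))) *
      fibreDensity p c η τ ≤ ∫⁻ z' : Fin n → ℂ,
        ENNReal.ofReal (Real.exp (-c * euclSq (z' - j.removeNth v : Fin n → ℂ))) * K := by
        refine lintegral_mono fun z' => ?_
        rw [lintegral_const_mul _ (measurable_fibreDensity p c η)]
        gcongr; exact hK η
theorem lintegral_gauss_sub_mul {c : ℝ} {K : ℝ≥0∞} (a : Fin n → ℂ) : ∫⁻ z' : Fin n → ℂ,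
        ENNReal.ofReal (Real.exp (-c * euclSq (z' - a : Fin n → ℂ))) * K
    = (∫⁻ x : Fin n → ℂ, ENNReal.ofReal (Real.exp (-c * euclSq x))) * K := by
        have hc : Continuous fun x : Fin n → ℂ => Real.exp (-c * euclSq x) := by fun_prop
        have h3 : Measurable fun z' : Fin n → ℂ =>
            ENNReal.ofReal (Real.exp (-c * euclSq (z' - a : Fin n → ℂ))) :=
          (hc.comp (continuous_id.sub continuous_const)).measurable.ennreal_ofReal
        rw [lintegral_mul_const _ h3]
        rw [lintegral_sub_right_eq_self
          (fun x : Fin n → ℂ => ENNReal.ofReal (Real.exp (-c * euclSq x)))]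

theorem lintegral_chart_term {p c : ℝ} {K : ℝ≥0∞}
    (hK : ∀ η, ∫⁻ τ, fibreDensity p c η τ ≤ K) (j : Fin (n + 1)) (v : Fin (n + 1) → ℂ) (η : ℂ) :
    ∫⁻ z : Fin (n + 1) → ℂ, 2 * (ENNReal.ofReal (‖z j‖ ^ 2) *
      (ENNReal.ofReal (Real.exp (-c * euclSq (j.removeNth z - j.removeNth v : Fin n → ℂ))) *
        fibreDensity p c η (bdot z z))) ≤
      (∫⁻ x : Fin n → ℂ, ENNReal.ofReal (Real.exp (-c * euclSq x))) * K := by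
  rw [lintegral_const_mul _ (measurable_chart_term j v η), lintegral_coord_sq j (fun z' τ =>
    ENNReal.ofReal (Real.exp (-c * euclSq (z' - j.removeNth v : Fin n → ℂ))) *
      fibreDensity p c η τ) (measurable_chart_density p c j v η), ← mul_assoc,
    ENNReal.mul_inv_cancel (by norm_num) (by norm_num), one_mul]
  exact (lintegral_chart_density_le hK j v η).trans (lintegral_gauss_sub_mul _).le

theorem chart_bound_succ {p c : ℝ} (hp : 0 < p) (hp2 : p ≤ 2) (hc : 0 < c) :
    ∃ K : ℝ≥0∞, K ≠ ⊤ ∧ ∀ (v : Fin (n + 1) → ℂ) (η : ℂ),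
      ∫⁻ z : Fin (n + 1) → ℂ,
        ENNReal.ofReal ((nsq z ^ (p / 2) + nsq z) * Real.exp (-c * dsq z (rt z) v η)) *
          (ENNReal.ofReal ‖bdot z z‖)⁻¹ ≤ K := by
  obtain ⟨K₁, hK₁, hK₁b⟩ := lintegral_fibreDensity_le hp hp2 hc
  have hGt : ∫⁻ x : Fin n → ℂ, ENNReal.ofReal (Real.exp (-c * euclSq x)) ≠ ⊤ :=
    (lintegral_gauss_lt_top hc).ne
  refine ⟨∑ _j : Fin (n + 1), (∫⁻ x : Fin n → ℂ, ENNReal.ofReal (Real.exp (-c * euclSq x))) * K₁,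
    (ENNReal.sum_lt_top.2 fun _ _ => ENNReal.mul_lt_top hGt.lt_top hK₁.lt_top).ne, fun v η => ?_⟩
  have hFm : ∀ j : Fin (n + 1), Measurable fun z : Fin (n + 1) → ℂ =>
      2 * (ENNReal.ofReal (‖z j‖ ^ 2) *
      (ENNReal.ofReal (Real.exp (-c * euclSq (j.removeNth z - j.removeNth v : Fin n → ℂ))) *
        fibreDensity p c η (bdot z z))) := fun j =>
    (measurable_chart_term j v η).const_mul 2
  have h1 := lintegral_mono_ae (ae_bdot_self_ne_zero_succ.mono fun z hz =>
    chart_pointwise hp2 hc v η hz)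
  refine h1.trans ?_
  rw [lintegral_finsetSum _ fun j _ => hFm j]
  exact Finset.sum_le_sum fun j _ => lintegral_chart_term hK₁b j v η

/-- The main integral estimate. A Gaussian centred anywhere in ℂⁿ × ℂ, on the cone or not, has
bounded mass on the cone. The term nsq^{p/2} accommodates the singularity at the vertex for the p-th
power of the weight. -/
theorem chart_bound (hn : 1 ≤ n) {p c : ℝ} (hp : 0 < p) (hp2 : p ≤ 2) (hc : 0 < c) :
    ∃ K : ℝ≥0∞, K ≠ ⊤ ∧ ∀ (v : Fin n → ℂ) (η : ℂ),
      ∫⁻ z : Fin n → ℂ,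
        ENNReal.ofReal ((nsq z ^ (p / 2) + nsq z) * Real.exp (-c * dsq z (rt z) v η)) *
          (ENNReal.ofReal ‖bdot z z‖)⁻¹ ≤ K := by
  obtain ⟨m, rfl⟩ := Nat.exists_eq_add_of_le' hn
  exact chart_bound_succ hp hp2 hc

end Chart

/-! ### Entire functions: Cauchy estimates, parameter integrals, homogeneous expansion -/

section Holo
variable {n : ℕ}

theorem fderiv_apply_eq_deriv {f : (Fin n → ℂ) → ℂ} (hf : Differentiable ℂ f) (z v : Fin n → ℂ) :
    fderiv ℂ f z v = deriv (fun t : ℂ => f (z + t • v)) 0 := by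
  have h1 : HasDerivAt (fun t : ℂ => z + t • v) v 0 := by
    simpa using ((hasDerivAt_id (0 : ℂ)).smul_const v).const_add z
  have h2 : HasFDerivAt f (fderiv ℂ f z) (z + (0 : ℂ) • v) := by
    simpa using (hf z).hasFDerivAt
  exact (h2.comp_hasDerivAt 0 h1).deriv.symm

theorem norm_fderiv_apply_le {f : (Fin n → ℂ) → ℂ} (hf : Differentiable ℂ f) {z v : Fin n → ℂ}
    {R C : ℝ} (hR : 0 < R) (hC : ∀ t : ℂ, ‖t‖ = R → ‖f (z + t • v)‖ ≤ C) :
    ‖fderiv ℂ f z v‖ ≤ C / R := by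
  rw [fderiv_apply_eq_deriv hf]
  refine Complex.norm_deriv_le_of_forall_mem_sphere_norm_le hR ?_ fun t ht => hC t (by simpa using ht)
  have : Differentiable ℂ fun t : ℂ => f (z + t • v) :=
    hf.comp ((differentiable_id.smul_const v).const_add z)
  exact this.diffContOnCl

theorem norm_fderiv_le_of_ball {f : (Fin n → ℂ) → ℂ} (hf : Differentiable ℂ f) {z : Fin n → ℂ}
    {C : ℝ} (hC : ∀ w, ‖w - z‖ ≤ 1 → ‖f w‖ ≤ C) : ‖fderiv ℂ f z‖ ≤ C := by
  have hC0 : 0 ≤ C := (norm_nonneg _).trans (hC z (by simp))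
  refine ContinuousLinearMap.opNorm_le_bound _ hC0 fun v => ?_
  rcases eq_or_ne v 0 with rfl | hv
  · simp
  have hv' : 0 < ‖v‖ := norm_pos_iff.2 hv
  have := norm_fderiv_apply_le hf (z := z) (v := v) (R := ‖v‖⁻¹) (C := C) (by positivity)
    fun t ht => hC _ (by rw [add_sub_cancel_left, norm_smul, ht, inv_mul_cancel₀ hv'.ne'])
  simpa using this

/-- Local domination of the functions is enough: Cauchy's estimate on unit balls turns it into
domination of the derivatives. Measurability of the derivative in the parameter follows because it
is a limit of difference quotients. -/
theorem differentiable_integral {α : Type*} [MeasurableSpace α] {μ : Measure α}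
    {F : (Fin n → ℂ) → α → ℂ} (hm : ∀ z, AEStronglyMeasurable (F z) μ)
    (hd : ∀ a, Differentiable ℂ fun z => F z a)
    (hb : ∀ R : ℝ, ∃ B : α → ℝ, Integrable B μ ∧ ∀ z, ‖z‖ ≤ R → ∀ a, ‖F z a‖ ≤ B a) :
    Differentiable ℂ fun z => ∫ a, F z a ∂μ := by
  intro z₀
  -- One unit for the neighbourhood of z₀, one more for the Cauchy estimate at its points.
  obtain ⟨B, hBi, hB⟩ := hb (‖z₀‖ + 2)
  have hfd : ∀ v : Fin n → ℂ,
      AEStronglyMeasurable (fun a => fderiv ℂ (fun z => F z a) z₀ v) μ := by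
    intro v
    refine aestronglyMeasurable_of_tendsto_ae (u := Filter.atTop)
      (f := fun (k : ℕ) a => ((k : ℂ) + 1) • (F (z₀ + ((k : ℂ) + 1)⁻¹ • v) a - F z₀ a)) ?_ ?_
    · exact fun k => ((hm (z₀ + ((k : ℂ) + 1)⁻¹ • v)).sub (hm z₀)).const_smul ((k : ℂ) + 1)
    · refine Filter.Eventually.of_forall fun a => ?_
      have h1 := (hd a z₀).hasFDerivAt
      have hc : Filter.Tendsto (fun k : ℕ => ‖(k : ℂ) + 1‖) Filter.atTop Filter.atTop := by
        have : (fun k : ℕ => ‖(k : ℂ) + 1‖) = fun k : ℕ => (k : ℝ) + 1 := by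
          funext k
          rw [← Nat.cast_one, ← Nat.cast_add, Complex.norm_natCast]; push_cast; ring
        rw [this]
        exact Filter.tendsto_atTop_add_const_right _ _ tendsto_natCast_atTop_atTop
      exact h1.lim v hc
  have hF' : AEStronglyMeasurable (fun a => fderiv ℂ (fun z => F z a) z₀) μ := by
    have e : (fun a => fderiv ℂ (fun z => F z a) z₀) = fun a =>
        ∑ j, (fderiv ℂ (fun z => F z a) z₀ (Pi.single j 1)) •
          (ContinuousLinearMap.proj j : (Fin n → ℂ) →L[ℂ] ℂ) := by
      funext a
      ext v
      conv_lhs => rw [← Finset.univ_sum_single v]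
      simp only [map_sum, FunLike.coe_sum, Finset.sum_apply,
        smul_apply, ContinuousLinearMap.proj_apply, smul_eq_mul]
      refine Finset.sum_congr rfl fun j _ => ?_
      have : (Pi.single j (v j) : Fin n → ℂ) = v j • Pi.single j 1 := by
        rw [← Pi.single_smul]; simp
      rw [this, map_smul, smul_eq_mul, mul_comm]
    rw [e]
    exact Finset.aestronglyMeasurable_fun_sum _ fun j _ => (hfd _).smul_const _
  refine (hasFDerivAt_integral_of_dominated_of_fderiv_le (𝕜 := ℂ)
    (F' := fun z a => fderiv ℂ (fun z => F z a) z) (bound := B)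
    (Metric.ball_mem_nhds z₀ one_pos) (Filter.Eventually.of_forall hm) ?_ hF' ?_ hBi ?_).differentiableAt
  · exact hBi.mono' (hm z₀) (Filter.Eventually.of_forall fun a => hB z₀ (by linarith) a)
  · refine Filter.Eventually.of_forall fun a z hz => norm_fderiv_le_of_ball (hd a) fun w hw => ?_
    refine hB w ?_ a
    rw [Metric.mem_ball, dist_eq_norm] at hz
    have h1 := norm_add_le (w - z) (z - z₀)
    have h2 := norm_add_le (w - z + (z - z₀)) z₀
    have h3 : w - z + (z - z₀) + z₀ = w := by abel
    rw [h3] at h2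
    linarith
  · exact Filter.Eventually.of_forall fun a z _ => (hd a z).hasFDerivAt

/-- A series is an integral against counting measure. -/
theorem differentiable_tsum_of_bound {F : ℕ → (Fin n → ℂ) → ℂ}
    (hd : ∀ m, Differentiable ℂ (F m))
    (hb : ∀ R : ℝ, ∃ B : ℕ → ℝ, Summable B ∧ ∀ z, ‖z‖ ≤ R → ∀ m, ‖F m z‖ ≤ B m) :
    Differentiable ℂ fun z => ∑' m, F m z := by
  have hi : ∀ z, Integrable (fun m => F m z) Measure.count := by
    intro z
    obtain ⟨B, hB, h⟩ := hb ‖z‖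
    rw [integrable_count_iff]
    exact Summable.of_nonneg_of_le (fun _ => norm_nonneg _) (fun m => h z le_rfl m) hB
  have e : (fun z => ∑' m, F m z) = fun z => ∫ m, F m z ∂Measure.count := by
    funext z
    rw [integral_countable (hi z)]
    simp
  rw [e]
  refine differentiable_integral (fun z => (hi z).aestronglyMeasurable) hd fun R => ?_
  obtain ⟨B, hB, h⟩ := hb R
  exact ⟨B, by rw [integrable_count_iff]; exact hB.norm, h⟩

/-- Entire functions homogeneous of degree `m`. -/
structure HomogEntire (m : ℕ) (f : (Fin n → ℂ) → ℂ) : Prop where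
  differentiable : Differentiable ℂ f
  smul : ∀ (c : ℂ) z, f (c • z) = c ^ m * f z

theorem HomogEntire.exists_bound {m : ℕ} {f : (Fin n → ℂ) → ℂ} (hf : HomogEntire m f) :
    ∃ C, 0 ≤ C ∧ ∀ z, ‖f z‖ ≤ C * ‖z‖ ^ m := by
  obtain ⟨C, hC⟩ := (isCompact_closedBall (0 : Fin n → ℂ) 1).exists_bound_of_continuousOn
    hf.differentiable.continuous.continuousOn
  have hC0 : 0 ≤ C := (norm_nonneg _).trans (hC 0 (by simp))
  refine ⟨C, hC0, fun z => ?_⟩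
  rcases eq_or_ne z 0 with rfl | hz
  · rcases Nat.eq_zero_or_pos m with rfl | hm
    · simpa using hC 0 (by simp)
    · have := hf.smul 0 0
      simp [zero_pow hm.ne'] at this
      simp [this, zero_pow hm.ne']
  · have hz' : ‖z‖ ≠ 0 := norm_ne_zero_iff.2 hz
    have h1 : z = (‖z‖ : ℂ) • ((‖z‖ : ℂ)⁻¹ • z) := by
      rw [smul_smul, mul_inv_cancel₀ (by exact_mod_cast hz'), one_smul]
    rw [h1, hf.smul, norm_mul, norm_pow, Complex.norm_real, norm_norm, mul_comm, ← h1]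
    refine mul_le_mul_of_nonneg_right (hC _ ?_) (by positivity)
    simp [norm_smul, inv_mul_cancel₀ hz']

/-- The component of degree `m` of `f` under the circle action. -/
noncomputable def hcomp (m : ℕ) (f : (Fin n → ℂ) → ℂ) (z : Fin n → ℂ) : ℂ :=
  (2 * Real.pi : ℂ)⁻¹ * ∫ θ : ℝ in Set.Ioc 0 (2 * Real.pi),
    Complex.exp (θ * Complex.I) ^ (-(m : ℤ)) * f (Complex.exp (θ * Complex.I) • z)

theorem norm_exp_I (θ : ℝ) : ‖Complex.exp (θ * Complex.I)‖ = 1 := Complex.norm_exp_ofReal_mul_I θ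

/-- Cauchy's integral formula on the unit circle for the one-variable function t ↦ f (tz). -/
theorem hcomp_eq_iteratedDeriv (m : ℕ) {f : (Fin n → ℂ) → ℂ} (hf : Differentiable ℂ f)
    (z : Fin n → ℂ) :
    hcomp m f z = (m.factorial : ℂ)⁻¹ * iteratedDeriv m (fun t : ℂ => f (t • z)) 0 := by
  have hg : Differentiable ℂ fun t : ℂ => f (t • z) := hf.comp (differentiable_id.smul_const z)
  have h := (hg.diffContOnCl (s := Metric.ball 0 1)).circleIntegral_one_div_sub_center_pow_smul
    one_pos m
  have h2 : ∮ w in C(0, 1), (1 / (w - 0) ^ (m + 1)) • f (w • z) =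
      Complex.I * ∫ θ : ℝ in Set.Ioc 0 (2 * Real.pi),
        Complex.exp (θ * Complex.I) ^ (-(m : ℤ)) * f (Complex.exp (θ * Complex.I) • z) := by
    rw [circleIntegral, intervalIntegral.integral_of_le (by positivity), ← integral_const_mul]
    refine integral_congr_ae (Filter.Eventually.of_forall fun θ => ?_)
    simp only [deriv_circleMap, circleMap_zero, Complex.ofReal_one, one_mul, sub_zero, smul_eq_mul]
    rw [zpow_neg, zpow_natCast]
    have := Complex.exp_ne_zero (θ * Complex.I)
    field_simp
    ring
  rw [h2, smul_eq_mul] at h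
  rw [hcomp]
  have hpi : (2 * Real.pi : ℂ) ≠ 0 := by simp [Real.pi_ne_zero]
  have hI := Complex.I_ne_zero
  have hfac : (m.factorial : ℂ) ≠ 0 := by exact_mod_cast m.factorial_ne_zero
  apply mul_left_cancel₀ (mul_ne_zero hpi hI)
  calc _ = Complex.I * ∫ θ : ℝ in Set.Ioc 0 (2 * Real.pi),
        Complex.exp (θ * Complex.I) ^ (-(m : ℤ)) * f (Complex.exp (θ * Complex.I) • z) := by
        field_simp
    _ = _ := by rw [h]; field_simp

theorem hcomp_smul (m : ℕ) {f : (Fin n → ℂ) → ℂ} (hf : Differentiable ℂ f) (c : ℂ)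
    (z : Fin n → ℂ) : hcomp m f (c • z) = c ^ m * hcomp m f z := by
  have hg : Differentiable ℂ fun t : ℂ => f (t • z) := hf.comp (differentiable_id.smul_const z)
  rw [hcomp_eq_iteratedDeriv m hf, hcomp_eq_iteratedDeriv m hf]
  have := congrFun (iteratedDeriv_comp_const_mul (n := m) hg.contDiff c) 0
  simp only [mul_zero] at this
  have e : (fun t : ℂ => f (t • c • z)) = fun t : ℂ => f ((c * t) • z) := by
    funext t; rw [smul_smul, mul_comm]
  rw [e, this]; ring

theorem hasSum_hcomp {f : (Fin n → ℂ) → ℂ} (hf : Differentiable ℂ f) (z : Fin n → ℂ) :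
    HasSum (fun m => hcomp m f z) (f z) := by
  have hg : Differentiable ℂ fun t : ℂ => f (t • z) := hf.comp (differentiable_id.smul_const z)
  have := Complex.hasSum_taylorSeries_of_entire hg 0 1
  simpa [hcomp_eq_iteratedDeriv _ hf] using this

theorem norm_hcomp_le (m : ℕ) {f : (Fin n → ℂ) → ℂ} {z : Fin n → ℂ} {M : ℝ}
    (hM : ∀ c : ℂ, ‖c‖ = 1 → ‖f (c • z)‖ ≤ M) : ‖hcomp m f z‖ ≤ M := by
  have h1 : ‖∫ θ : ℝ in Set.Ioc 0 (2 * Real.pi),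
      Complex.exp (θ * Complex.I) ^ (-(m : ℤ)) * f (Complex.exp (θ * Complex.I) • z)‖ ≤
      M * (volume : Measure ℝ).real (Set.Ioc 0 (2 * Real.pi)) := by
    refine norm_setIntegral_le_of_norm_le_const measure_Ioc_lt_top fun θ _ => ?_
    rw [norm_mul, norm_zpow, norm_exp_I, one_zpow, one_mul]
    exact hM _ (norm_exp_I θ)
  have h2 : (volume : Measure ℝ).real (Set.Ioc 0 (2 * Real.pi)) = 2 * Real.pi := by
    rw [Real.volume_real_Ioc_of_le (by positivity)]; ring
  rw [h2] at h1
  have hp := Real.pi_pos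
  rw [hcomp, norm_mul, norm_inv]
  have h3 : ‖(2 * Real.pi : ℂ)‖ = 2 * Real.pi := by
    rw [norm_mul, Complex.norm_real, Real.norm_of_nonneg hp.le]; simp
  rw [h3, inv_mul_le_iff₀ (by positivity)]
  linarith

theorem differentiable_hcomp (m : ℕ) {f : (Fin n → ℂ) → ℂ} (hf : Differentiable ℂ f) :
    Differentiable ℂ (hcomp m f) := by
  unfold hcomp
  refine Differentiable.const_mul ?_ _
  refine differentiable_integral (fun z => ?_) (fun θ => ?_) fun R => ?_
  · refine Continuous.aestronglyMeasurable ?_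
    have := hf.continuous
    have h0 : ∀ θ : ℝ, Complex.exp (θ * Complex.I) ≠ 0 := fun θ => Complex.exp_ne_zero _
    have h1 : Continuous fun θ : ℝ => Complex.exp (θ * Complex.I) := by fun_prop
    exact (h1.zpow₀ _ fun θ => Or.inl (h0 θ)).mul (by fun_prop)
  · exact (hf.comp (differentiable_id.const_smul (Complex.exp (θ * Complex.I)))).const_mul _
  · obtain ⟨C, hC⟩ := (isCompact_closedBall (0 : Fin n → ℂ) R).exists_bound_of_continuousOn
      hf.continuous.continuousOn
    refine ⟨fun _ => C, integrable_const _, fun z hz θ => ?_⟩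
    rw [norm_mul, norm_zpow, norm_exp_I, one_zpow, one_mul]
    exact hC _ (by simpa [norm_smul, norm_exp_I] using hz)

theorem homogEntire_hcomp (m : ℕ) {f : (Fin n → ℂ) → ℂ} (hf : Differentiable ℂ f) :
    HomogEntire m (hcomp m f) := ⟨differentiable_hcomp m hf, hcomp_smul m hf⟩

end Holo

/-! ### Functions of exponential growth are integrable against Gaussians -/

section ExpBdd
variable {n : ℕ}

/-- At most exponential growth. -/
def ExpBdd (f : (Fin n → ℂ) → ℂ) : Prop :=
  ∃ C A : ℝ, 0 ≤ C ∧ 0 ≤ A ∧ ∀ z, ‖f z‖ ≤ C * Real.exp (A * ‖z‖)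

theorem ExpBdd.mono {f g : (Fin n → ℂ) → ℂ} (hg : ExpBdd g) (h : ∀ z, ‖f z‖ ≤ ‖g z‖) :
    ExpBdd f := by
  obtain ⟨C, A, hC, hA, hb⟩ := hg
  exact ⟨C, A, hC, hA, fun z => (h z).trans (hb z)⟩

theorem ExpBdd.const (c : ℂ) : ExpBdd fun _ : Fin n → ℂ => c :=
  ⟨‖c‖, 0, norm_nonneg _, le_rfl, fun z => by simp⟩

theorem ExpBdd.mul {f g : (Fin n → ℂ) → ℂ} (hf : ExpBdd f) (hg : ExpBdd g) :
    ExpBdd fun z => f z * g z := by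
  obtain ⟨C, A, hC, hA, hb⟩ := hf
  obtain ⟨C', A', hC', hA', hb'⟩ := hg
  refine ⟨C * C', A + A', by positivity, by positivity, fun z => ?_⟩
  rw [norm_mul]
  calc ‖f z‖ * ‖g z‖ ≤ (C * Real.exp (A * ‖z‖)) * (C' * Real.exp (A' * ‖z‖)) :=
        mul_le_mul (hb z) (hb' z) (norm_nonneg _) (by positivity)
    _ = _ := by rw [add_mul, Real.exp_add]; ring

theorem ExpBdd.add {f g : (Fin n → ℂ) → ℂ} (hf : ExpBdd f) (hg : ExpBdd g) :
    ExpBdd fun z => f z + g z := by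
  obtain ⟨C, A, hC, hA, hb⟩ := hf
  obtain ⟨C', A', hC', hA', hb'⟩ := hg
  refine ⟨C + C', A + A', by positivity, by positivity, fun z => ?_⟩
  have h1 : Real.exp (A * ‖z‖) ≤ Real.exp ((A + A') * ‖z‖) := by gcongr; linarith
  have h2 : Real.exp (A' * ‖z‖) ≤ Real.exp ((A + A') * ‖z‖) := by gcongr; linarith
  calc ‖f z + g z‖ ≤ C * Real.exp (A * ‖z‖) + C' * Real.exp (A' * ‖z‖) :=
        (norm_add_le _ _).trans (add_le_add (hb z) (hb' z))
    _ ≤ C * Real.exp ((A + A') * ‖z‖) + C' * Real.exp ((A + A') * ‖z‖) := by gcongr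
    _ = _ := by ring

theorem ExpBdd.neg {f : (Fin n → ℂ) → ℂ} (hf : ExpBdd f) : ExpBdd fun z => -f z :=
  hf.mono fun z => by rw [norm_neg]

theorem ExpBdd.pow {f : (Fin n → ℂ) → ℂ} (hf : ExpBdd f) (k : ℕ) : ExpBdd fun z => f z ^ k := by
  induction k with
  | zero => simpa using ExpBdd.const 1
  | succ k ih => simpa [pow_succ] using ih.mul hf

theorem ExpBdd.star {f : (Fin n → ℂ) → ℂ} (hf : ExpBdd f) : ExpBdd fun z => star (f z) :=
  hf.mono fun z => by rw [norm_star]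

theorem ExpBdd.sum {ι : Type*} (t : Finset ι) {f : ι → (Fin n → ℂ) → ℂ}
    (hf : ∀ i ∈ t, ExpBdd (f i)) : ExpBdd fun z => ∑ i ∈ t, f i z := by
  classical
  induction t using Finset.induction_on with
  | empty => simpa using ExpBdd.const 0
  | insert i t hi ih =>
    simp only [Finset.sum_insert hi]
    exact (hf i (Finset.mem_insert_self _ _)).add
      (ih fun j hj => hf j (Finset.mem_insert_of_mem hj))

theorem ExpBdd.of_norm_pow {f : (Fin n → ℂ) → ℂ} {C : ℝ} {k : ℕ} (hC : 0 ≤ C)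
    (h : ∀ z, ‖f z‖ ≤ C * ‖z‖ ^ k) : ExpBdd f := by
  refine ⟨C * k.factorial, 1, by positivity, zero_le_one, fun z => (h z).trans ?_⟩
  have := Real.pow_div_factorial_le_exp ‖z‖ (norm_nonneg _) k
  rw [div_le_iff₀ (by positivity)] at this
  rw [one_mul, mul_assoc, mul_comm (k.factorial : ℝ)]
  gcongr

theorem ExpBdd.coord (j : Fin n) : ExpBdd fun z : Fin n → ℂ => z j :=
  ExpBdd.of_norm_pow (C := 1) (k := 1) zero_le_one fun z => by simpa using norm_le_pi_norm z j

theorem ExpBdd.bdot_left (a : Fin n → ℂ) : ExpBdd fun z => bdot z a :=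
  ExpBdd.sum _ fun j _ => (ExpBdd.coord j).mul (ExpBdd.const _)

theorem ExpBdd.bdot_self : ExpBdd fun z : Fin n → ℂ => bdot z z :=
  ExpBdd.sum _ fun j _ => (ExpBdd.coord j).mul (ExpBdd.coord j)

theorem ExpBdd.euclSq : ExpBdd fun z : Fin n → ℂ => (euclSq z : ℂ) := by
  refine ExpBdd.of_norm_pow (C := n) (k := 2) (by positivity) fun z => ?_
  rw [Complex.norm_real, Real.norm_of_nonneg (euclSq_nonneg z)]
  exact euclSq_le_mul_sq_norm z

/-- Cauchy's estimate at radius 1 costs only the constant e^{A‖v‖}. -/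
theorem ExpBdd.fderiv_apply {f : (Fin n → ℂ) → ℂ} (hd : Differentiable ℂ f) (hf : ExpBdd f)
    (v : Fin n → ℂ) : ExpBdd fun z => fderiv ℂ f z v := by
  obtain ⟨C, A, hC, hA, hb⟩ := hf
  refine ⟨C * Real.exp (A * ‖v‖), A, by positivity, hA, fun z => ?_⟩
  have := norm_fderiv_apply_le hd (z := z) (v := v) (R := 1)
    (C := C * Real.exp (A * ‖v‖) * Real.exp (A * ‖z‖)) one_pos fun t ht => ?_
  · simpa using this
  · refine (hb _).trans ?_
    rw [mul_assoc, ← Real.exp_add, ← mul_add]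
    gcongr
    calc ‖z + t • v‖ ≤ ‖z‖ + ‖t • v‖ := norm_add_le _ _
      _ = ‖v‖ + ‖z‖ := by rw [norm_smul, ht]; ring

theorem HomogEntire.expBdd {m : ℕ} {f : (Fin n → ℂ) → ℂ} (hf : HomogEntire m f) : ExpBdd f := by
  obtain ⟨C, hC, h⟩ := hf.exists_bound
  exact ExpBdd.of_norm_pow hC h

theorem exp_mul_norm_le {c : ℝ} (hc : 0 < c) (A : ℝ) (z : Fin n → ℂ) :
    Real.exp (A * ‖z‖) ≤ Real.exp (A ^ 2 / (4 * c)) * Real.exp (c * euclSq z) := by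
  rw [← Real.exp_add, Real.exp_le_exp]
  have h := sq_norm_le_euclSq z
  have h1 : A * ‖z‖ ≤ A ^ 2 / (4 * c) + c * ‖z‖ ^ 2 := by
    have h2 : 0 ≤ (A / (2 * c) - ‖z‖) ^ 2 * c := by positivity
    have h3 : (A / (2 * c) - ‖z‖) ^ 2 * c = A ^ 2 / (4 * c) + c * ‖z‖ ^ 2 - A * ‖z‖ := by
      field_simp; ring
    linarith
  nlinarith

theorem ExpBdd.integrable_mul_gauss {f : (Fin n → ℂ) → ℂ} (hf : ExpBdd f)
    (hm : AEStronglyMeasurable f) {c : ℝ} (hc : 0 < c) :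
    Integrable fun z => f z * (Real.exp (-c * HPFock.euclSq z) : ℂ) := by
  obtain ⟨C, A, hC, hA, hb⟩ := hf
  have h1 := ((integrable_gauss (n := n) (half_pos hc)).const_mul
    (C * Real.exp (A ^ 2 / (4 * (c / 2)))))
  refine h1.mono' (hm.mul ?_) (Filter.Eventually.of_forall fun z => ?_)
  · exact Continuous.aestronglyMeasurable (by fun_prop)
  · rw [norm_mul, Complex.norm_real, Real.norm_of_nonneg (Real.exp_pos _).le]
    calc ‖f z‖ * Real.exp (-c * HPFock.euclSq z)
        ≤ (C * (Real.exp (A ^ 2 / (4 * (c / 2))) * Real.exp (c / 2 * HPFock.euclSq z))) *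
          Real.exp (-c * HPFock.euclSq z) := by
          gcongr
          exact (hb z).trans (by gcongr; exact exp_mul_norm_le (half_pos hc) A z)
      _ = C * Real.exp (A ^ 2 / (4 * (c / 2))) *
          (Real.exp (c / 2 * HPFock.euclSq z) * Real.exp (-c * HPFock.euclSq z)) := by ring
      _ = _ := by rw [← Real.exp_add]; congr 2; ring

theorem expBdd_cexp_bdot (c : ℂ) (a : Fin n → ℂ) : ExpBdd fun z => Complex.exp (c * bdot z a) := by
  refine ⟨1, ‖c‖ * ∑ j, ‖a j‖, zero_le_one, by positivity, fun z => ?_⟩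
  rw [one_mul, Complex.norm_exp, Real.exp_le_exp]
  refine (Complex.re_le_norm _).trans ?_
  rw [norm_mul, mul_assoc]
  gcongr
  refine (norm_sum_le _ _).trans ?_
  rw [Finset.sum_mul]
  refine Finset.sum_le_sum fun j _ => ?_
  rw [norm_mul, mul_comm]
  gcongr
  exact norm_le_pi_norm z j

end ExpBdd

/-! ### Circle averaging and the Bargmann–Fock reproducing formulas -/

section Circle
variable {n : ℕ}

/-- Averaging over the circle action replaces `h` by its component of degree `m`. -/
theorem integral_mul_eq_integral_mul_hcomp (m : ℕ) {Φ h : (Fin n → ℂ) → ℂ}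
    (hΦ : ∀ c : ℂ, ‖c‖ = 1 → ∀ w, Φ (c • w) = c ^ (-(m : ℤ)) * Φ w)
    (hm : Measurable fun w => Φ w * h w) (hi : Integrable fun w => Φ w * h w) :
    ∫ w, Φ w * h w = ∫ w, Φ w * hcomp m h w := by
  set Ψ : (Fin n → ℂ) → ℂ := fun w => Φ w * h w with hΨ
  have hmp : ∀ θ : ℝ, MeasurePreserving fun w : Fin n → ℂ => Complex.exp (θ * Complex.I) • w :=
    fun θ => measurePreserving_smul _ (norm_exp_I θ)
  have hinv : ∀ θ : ℝ, Integrable fun w => Ψ (Complex.exp (θ * Complex.I) • w) := fun θ =>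
    (hmp θ).integrable_comp_of_integrable hi
  have hint : ∀ θ : ℝ, ∫ w, Ψ (Complex.exp (θ * Complex.I) • w) = ∫ w, Ψ w := by
    intro θ
    rw [← integral_map (hmp θ).measurable.aemeasurable
      (by rw [(hmp θ).map_eq]; exact hi.aestronglyMeasurable), (hmp θ).map_eq]
  have hintn : ∀ θ : ℝ, ∫ w, ‖Ψ (Complex.exp (θ * Complex.I) • w)‖ = ∫ w, ‖Ψ w‖ := by
    intro θ
    rw [← integral_map (f := fun w => ‖Ψ w‖) (hmp θ).measurable.aemeasurable
      (by rw [(hmp θ).map_eq]; exact hi.norm.aestronglyMeasurable), (hmp θ).map_eq]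
  set ν : Measure ℝ := volume.restrict (Set.Ioc 0 (2 * Real.pi)) with hν
  -- Rotations preserve volume, so the norm integral is the same for every θ and Fubini applies over
  -- the bounded interval.
  have hprod : Integrable (Function.uncurry fun (θ : ℝ) (w : Fin n → ℂ) =>
      Ψ (Complex.exp (θ * Complex.I) • w)) (ν.prod volume) := by
    have hmeas : Measurable (Function.uncurry fun (θ : ℝ) (w : Fin n → ℂ) =>
        Ψ (Complex.exp (θ * Complex.I) • w)) := by
      have : Continuous fun x : ℝ × (Fin n → ℂ) => Complex.exp (x.1 * Complex.I) • x.2 := by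
        fun_prop
      exact hm.comp this.measurable
    rw [integrable_prod_iff hmeas.aestronglyMeasurable]
    refine ⟨Filter.Eventually.of_forall hinv, ?_⟩
    simp only [Function.uncurry_apply_pair, hintn]
    exact integrable_const _
  have hswap := integral_integral_swap hprod
  have e1 : ∫ θ, ∫ w, Ψ (Complex.exp (θ * Complex.I) • w) ∂volume ∂ν =
      (2 * Real.pi : ℂ) * ∫ w, Ψ w := by
    simp only [hint]
    rw [integral_const, hν, Complex.real_smul]
    congr 1
    rw [measureReal_restrict_apply MeasurableSet.univ, Set.univ_inter,
      Real.volume_real_Ioc_of_le (by positivity)]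
    push_cast; ring
  have e2 : ∫ w, ∫ θ, Ψ (Complex.exp (θ * Complex.I) • w) ∂ν =
      (2 * Real.pi : ℂ) * ∫ w, Φ w * hcomp m h w := by
    rw [← integral_const_mul]
    refine integral_congr_ae (Filter.Eventually.of_forall fun w => ?_)
    simp only [hΨ, hcomp]
    have hpi : (2 * Real.pi : ℂ) ≠ 0 := by simp [Real.pi_ne_zero]
    rw [mul_left_comm (Φ w), mul_inv_cancel_left₀ hpi, ← integral_const_mul]
    refine integral_congr_ae (Filter.Eventually.of_forall fun θ => ?_)
    simp only [hΦ _ (norm_exp_I θ) w]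
    ring
  have hpi : (2 * Real.pi : ℂ) ≠ 0 := by simp [Real.pi_ne_zero]
  exact mul_left_cancel₀ hpi (by rw [← e1, hswap, e2])

theorem hcomp_zero {f : (Fin n → ℂ) → ℂ} (hf : Differentiable ℂ f) (z : Fin n → ℂ) :
    hcomp 0 f z = f 0 := by
  rw [hcomp_eq_iteratedDeriv 0 hf]; simp

theorem hcomp_exp (m : ℕ) (a : Fin n → ℂ) (c : ℂ) (z : Fin n → ℂ) :
    hcomp m (fun w => Complex.exp (c * bdot w a)) z = (c * bdot z a) ^ m / m.factorial := by
  have hd : Differentiable ℂ fun w : Fin n → ℂ => Complex.exp (c * bdot w a) :=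
    ((differentiable_bdot_left a).const_mul c).cexp
  rw [hcomp_eq_iteratedDeriv m hd]
  have e : (fun t : ℂ => Complex.exp (c * bdot (t • z) a)) =
      fun t : ℂ => Complex.exp ((c * bdot z a) * t) := by
    funext t; rw [bdot_smul_left]; ring_nf
  rw [e]
  have := congrFun (iteratedDeriv_comp_const_mul (n := m)
    (Complex.differentiable_exp.contDiff) (c * bdot z a)) 0
  rw [this]
  simp [iteratedDeriv_eq_iterate, Complex.iter_deriv_exp]
  ring

/-- Reproducing formula of the Bargmann–Fock space. -/
theorem integral_fock_exp {s : ℝ} (hs : 0 < s) {F : (Fin n → ℂ) → ℂ} (hF : Differentiable ℂ F)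
    (hb : ExpBdd F) (a : Fin n → ℂ) :
    ∫ W, F W * Complex.exp (s * bdot a (star W)) * (Real.exp (-s * euclSq W) : ℂ) =
      (Real.pi / s) ^ n * F a := by
  -- Translating by a cancels the antiholomorphic exponent. What remains is a centred Gaussian times
  -- an entire function whose value at 0 is F(a), and the circle mean of an entire function is its
  -- value at 0.
  have hE : ∀ W, F (W + a) * Complex.exp (s * bdot a (star (W + a))) *
      (Real.exp (-s * euclSq (W + a)) : ℂ) =
      (Real.exp (-s * euclSq W) : ℂ) * (F (W + a) * Complex.exp (-s * bdot W (star a))) := by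
    intro W
    have h1 : (euclSq (W + a) : ℂ) = euclSq W + bdot W (star a) + bdot a (star W) + euclSq a := by
      rw [← bdot_star_self, ← bdot_star_self, ← bdot_star_self, star_add, bdot_add_left,
        bdot_add_right, bdot_add_right]
      ring
    have h2 : bdot a (star (W + a)) = bdot a (star W) + euclSq a := by
      rw [star_add, bdot_add_right, bdot_star_self]
    push_cast
    rw [mul_assoc, ← Complex.exp_add, mul_left_comm, ← Complex.exp_add]
    congr 2
    rw [h1, h2]; ring
  rw [← integral_add_right_eq_self _ a]
  simp_rw [hE]
  have hFa : Differentiable ℂ fun W => F (W + a) := hF.comp (differentiable_id.add_const a)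
  have hG : Differentiable ℂ fun W => F (W + a) * Complex.exp (-s * bdot W (star a)) :=
    hFa.mul ((differentiable_bdot_left _).const_mul _).cexp
  have hGb : ExpBdd fun W => F (W + a) * Complex.exp (-s * bdot W (star a)) := by
    refine ExpBdd.mul ?_ ?_
    · obtain ⟨C, A, hC, hA, hb⟩ := hb
      refine ⟨C * Real.exp (A * ‖a‖), A, by positivity, hA, fun z => (hb _).trans ?_⟩
      rw [mul_assoc, ← Real.exp_add, ← mul_add]
      gcongr
      rw [add_comm]; exact norm_add_le _ _
    · exact expBdd_cexp_bdot _ _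
  have hc : Continuous fun W : Fin n → ℂ => (Real.exp (-s * euclSq W) : ℂ) *
      (F (W + a) * Complex.exp (-s * bdot W (star a))) := by
    have := hG.continuous
    fun_prop
  rw [integral_mul_eq_integral_mul_hcomp 0 (Φ := fun W : Fin n → ℂ => (Real.exp (-s * euclSq W) : ℂ))
    (fun c hc w => by simp [euclSq_smul, hc]) hc.measurable
    (by simpa only [mul_comm] using hGb.integrable_mul_gauss hG.continuous.aestronglyMeasurable hs)]
  simp_rw [hcomp_zero hG]
  rw [integral_mul_const, integral_complex_ofReal, integral_gauss hs]
  simp [bdot]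

theorem continuous_star_pi : Continuous fun z : Fin n → ℂ => (star z : Fin n → ℂ) := continuous_star

/-- Reproducing formula on homogeneous functions. -/
theorem integral_fock_pow {s : ℝ} (hs : 0 < s) {k : ℕ} {F : (Fin n → ℂ) → ℂ}
    (hF : HomogEntire k F) (a : Fin n → ℂ) :
    ∫ W, F W * bdot a (star W) ^ k * (Real.exp (-s * euclSq W) : ℂ) =
      k.factorial * (Real.pi / s) ^ n / s ^ k * F a := by
  have h1 := integral_fock_exp hs hF.differentiable hF.expBdd a
  have hcF := hF.differentiable.continuous
  -- After conjugation the exponential is holomorphic in W and `Φ` has weight c^{-k} under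
  -- rotations, so averaging retains only the k-th term of the exponential series.
  set Φ : (Fin n → ℂ) → ℂ := fun W => star (F W) * (Real.exp (-s * euclSq W) : ℂ) with hΦ
  set h : (Fin n → ℂ) → ℂ := fun W => Complex.exp (s * bdot W (star a)) with hh
  have hconj : ∀ x : ℂ, star x = (starRingEnd ℂ) x := fun _ => rfl
  have hs1 : ∀ W, star (bdot a (star W)) = bdot W (star a) := by
    intro W; rw [← bdot_star, star_star, bdot_comm]
  have e1 : ∀ W, star (F W * Complex.exp (s * bdot a (star W)) * (Real.exp (-s * euclSq W) : ℂ)) =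
      Φ W * h W := by
    intro W
    simp only [hΦ, hh, star_mul', ← hs1 W]
    rw [hconj (Complex.exp _), ← Complex.exp_conj, hconj ((Real.exp _ : ℝ) : ℂ), Complex.conj_ofReal]
    simp only [map_mul, Complex.conj_ofReal, hconj]
    ring
  have hΦc : Continuous Φ := by simp only [hΦ]; fun_prop
  have hhc : Continuous h := by simp only [hh]; fun_prop
  have hhb : ExpBdd h := expBdd_cexp_bdot _ _
  have hint : Integrable fun W => Φ W * h W := by
    have := (hF.expBdd.star.mul hhb).integrable_mul_gauss (by
      exact Continuous.aestronglyMeasurable (by fun_prop)) hs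
    refine this.congr (Filter.Eventually.of_forall fun W => ?_)
    simp only [hΦ]; ring
  have h2 := integral_mul_eq_integral_mul_hcomp k (Φ := Φ) (h := h) (fun c hc w => ?_)
    (hΦc.mul hhc).measurable hint
  · have h3 : star (∫ W, F W * Complex.exp (s * bdot a (star W)) * (Real.exp (-s * euclSq W) : ℂ)) =
        ∫ W, Φ W * h W := by
      rw [hconj, ← integral_conj]
      exact integral_congr_ae (Filter.Eventually.of_forall e1)
    have e2 : ∀ W, Φ W * hcomp k h W =
        star ((s ^ k / k.factorial : ℂ) *
          (F W * bdot a (star W) ^ k * (Real.exp (-s * euclSq W) : ℂ))) := by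
      intro W
      simp only [hΦ, hh, hcomp_exp, star_mul', star_pow, hs1, star_div₀]
      simp only [hconj, Complex.conj_ofReal, map_natCast]
      rw [mul_pow]; ring
    simp_rw [e2] at h2
    have h4 : ∫ W, star ((s ^ k / k.factorial : ℂ) *
          (F W * bdot a (star W) ^ k * (Real.exp (-s * euclSq W) : ℂ))) =
        star ((s ^ k / k.factorial : ℂ) *
          ∫ W, F W * bdot a (star W) ^ k * (Real.exp (-s * euclSq W) : ℂ)) := by
      rw [← integral_const_mul, hconj, ← integral_conj]; rfl
    rw [h4, ← h3, h1] at h2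
    have h5 := star_injective h2
    have hk : (k.factorial : ℂ) ≠ 0 := by exact_mod_cast k.factorial_ne_zero
    have hs0 : (s : ℂ) ≠ 0 := by exact_mod_cast hs.ne'
    have h6 : (s : ℂ) ^ k ≠ 0 := pow_ne_zero _ hs0
    field_simp at h5 ⊢
    linear_combination -h5
  · simp only [hΦ, hF.smul, euclSq_smul, hc, star_mul', star_pow]
    have : star c = c⁻¹ := by
      rw [hconj, Complex.inv_def, Complex.normSq_eq_norm_sq, hc]; simp
    rw [this]; simp [mul_assoc]

end Circle

/-! ### Antiholomorphic derivatives and integration by parts -/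

section Dbar
variable {n : ℕ}

/-- `b` is the antiholomorphic derivative of `f` in the direction `v`, and `f` and its first
derivatives grow at most exponentially. -/
structure Dbar (f : (Fin n → ℂ) → ℂ) (v : Fin n → ℂ) (b : (Fin n → ℂ) → ℂ) : Prop where
  diff : Differentiable ℝ f
  bdd : ExpBdd f
  bdd₁ : ExpBdd fun W => fderiv ℝ f W v
  bdd₂ : ExpBdd fun W => fderiv ℝ f W (Complex.I • v)
  eq : ∀ W, fderiv ℝ f W v + Complex.I * fderiv ℝ f W (Complex.I • v) = 2 * b W

theorem Dbar.mul {f g bf bg : (Fin n → ℂ) → ℂ} {v : Fin n → ℂ} (hf : Dbar f v bf)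
    (hg : Dbar g v bg) : Dbar (fun W => f W * g W) v fun W => f W * bg W + g W * bf W := by
  have h : ∀ W u, fderiv ℝ (fun W => f W * g W) W u =
      f W * fderiv ℝ g W u + g W * fderiv ℝ f W u := by
    intro W u
    rw [fderiv_fun_mul (hf.diff W) (hg.diff W)]
    simp
  refine ⟨hf.diff.mul hg.diff, hf.bdd.mul hg.bdd, ?_, ?_, fun W => ?_⟩
  · simp only [h]; exact (hf.bdd.mul hg.bdd₁).add (hg.bdd.mul hf.bdd₁)
  · simp only [h]; exact (hf.bdd.mul hg.bdd₂).add (hg.bdd.mul hf.bdd₂)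
  · rw [h, h]; linear_combination f W * hg.eq W + g W * hf.eq W

theorem Dbar.of_holo {f : (Fin n → ℂ) → ℂ} (hf : Differentiable ℂ f) (hb : ExpBdd f)
    (v : Fin n → ℂ) : Dbar f v fun _ => 0 := by
  have h : ∀ W u, fderiv ℝ f W u = fderiv ℂ f W u := fun W u => by
    rw [((hf W).hasFDerivAt.restrictScalars ℝ).fderiv]; rfl
  refine ⟨hf.restrictScalars ℝ, hb, ?_, ?_, fun W => ?_⟩
  · simp only [h]; exact hb.fderiv_apply hf _
  · simp only [h]; exact hb.fderiv_apply hf _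
  · rw [h, h, map_smul, smul_eq_mul, ← mul_assoc, Complex.I_mul_I]; ring

theorem Dbar.of_star_holo {f : (Fin n → ℂ) → ℂ} (hf : Differentiable ℂ f) (hb : ExpBdd f)
    (v : Fin n → ℂ) : Dbar (fun W => star (f W)) v fun W => star (fderiv ℂ f W v) := by
  have h : ∀ W u, fderiv ℝ (fun W => star (f W)) W u = star (fderiv ℂ f W u) := fun W u => by
    rw [((hf W).hasFDerivAt.restrictScalars ℝ).star.fderiv]; simp
  refine ⟨(hf.restrictScalars ℝ).star, hb.star, ?_, ?_, fun W => ?_⟩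
  · simp only [h]; exact (hb.fderiv_apply hf _).star
  · simp only [h]; exact (hb.fderiv_apply hf _).star
  · rw [h, h, map_smul, smul_eq_mul, star_mul']
    have : star Complex.I = -Complex.I := Complex.conj_I
    rw [this]
    linear_combination (-star (fderiv ℂ f W v)) * Complex.I_mul_I

theorem Dbar.inv {g bg : (Fin n → ℂ) → ℂ} {v : Fin n → ℂ} (hg : Dbar g v bg)
    (h0 : ∀ W, g W ≠ 0) (hi : ExpBdd fun W => (g W)⁻¹) :
    Dbar (fun W => (g W)⁻¹) v fun W => -(bg W * (g W)⁻¹ ^ 2) := by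
  have h : ∀ W u, fderiv ℝ (fun W => (g W)⁻¹) W u = -((g W)⁻¹ ^ 2 * fderiv ℝ g W u) := by
    intro W u
    have h1 := (((hasDerivAt_inv (h0 W)).hasFDerivAt.restrictScalars ℝ).comp W
      (hg.diff W).hasFDerivAt).fderiv
    have h2 : ((fun y : ℂ => y⁻¹) ∘ g) = fun W => (g W)⁻¹ := rfl
    rw [h2] at h1
    rw [h1]
    simp [mul_comm]
  refine ⟨fun W => ?_, hi, ?_, ?_, fun W => ?_⟩
  · exact (((hasDerivAt_inv (h0 W)).hasFDerivAt.restrictScalars ℝ).comp W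
      (hg.diff W).hasFDerivAt).differentiableAt
  · simp only [h]; exact ((hi.pow 2).mul hg.bdd₁).neg
  · simp only [h]; exact ((hi.pow 2).mul hg.bdd₂).neg
  · rw [h, h]; linear_combination (-(g W)⁻¹ ^ 2) * hg.eq W

theorem Dbar.add {f g bf bg : (Fin n → ℂ) → ℂ} {v : Fin n → ℂ} (hf : Dbar f v bf)
    (hg : Dbar g v bg) : Dbar (fun W => f W + g W) v fun W => bf W + bg W := by
  have h : ∀ W u, fderiv ℝ (fun W => f W + g W) W u = fderiv ℝ f W u + fderiv ℝ g W u := by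
    intro W u
    rw [fderiv_fun_add (hf.diff W) (hg.diff W)]; rfl
  refine ⟨hf.diff.add hg.diff, hf.bdd.add hg.bdd, ?_, ?_, fun W => ?_⟩
  · simp only [h]; exact hf.bdd₁.add hg.bdd₁
  · simp only [h]; exact hf.bdd₂.add hg.bdd₂
  · rw [h, h]; linear_combination hf.eq W + hg.eq W

theorem Dbar.congr {f bf bg : (Fin n → ℂ) → ℂ} {v : Fin n → ℂ} (hf : Dbar f v bf)
    (h : ∀ W, bf W = bg W) : Dbar f v bg := by
  have : bf = bg := funext h
  rwa [← this]

theorem Dbar.expBdd_deriv {f b : (Fin n → ℂ) → ℂ} {v : Fin n → ℂ} (hf : Dbar f v b) :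
    ExpBdd b := by
  have : b = fun W => 2⁻¹ * (fderiv ℝ f W v + Complex.I * fderiv ℝ f W (Complex.I • v)) := by
    funext W; rw [hf.eq]; ring
  rw [this]
  exact (ExpBdd.const _).mul (hf.bdd₁.add ((ExpBdd.const _).mul hf.bdd₂))

theorem Dbar.measurable_deriv {f b : (Fin n → ℂ) → ℂ} {v : Fin n → ℂ} (hf : Dbar f v b) :
    Measurable b := by
  have : b = fun W => 2⁻¹ * (fderiv ℝ f W v + Complex.I * fderiv ℝ f W (Complex.I • v)) := by
    funext W; rw [hf.eq]; ring
  rw [this]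
  have h1 := measurable_fderiv_apply_const ℝ f v
  have h2 := measurable_fderiv_apply_const ℝ f (Complex.I • v)
  fun_prop

theorem Dbar.integrable_deriv {f b : (Fin n → ℂ) → ℂ} {v : Fin n → ℂ} (hf : Dbar f v b) {s : ℝ}
    (hs : 0 < s) : Integrable fun W => b W * (Real.exp (-s * euclSq W) : ℂ) :=
  hf.expBdd_deriv.integrable_mul_gauss hf.measurable_deriv.aestronglyMeasurable hs

theorem differentiable_euclSq : Differentiable ℝ fun W : Fin n → ℂ => euclSq W := by
  unfold euclSq
  refine Differentiable.fun_sum fun j _ => ?_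
  have h : Differentiable ℝ fun W : Fin n → ℂ => W j := by fun_prop
  exact h.norm_sq ℝ

theorem euclSq_add_smul (W v : Fin n → ℂ) (t : ℝ) :
    euclSq (W + t • v) = euclSq W + t * (2 * (bdot v (star W)).re) + t ^ 2 * euclSq v := by
  have h1 : ∀ j, ‖W j + t * v j‖ ^ 2 =
      ‖W j‖ ^ 2 + t * (2 * (v j * star (W j)).re) + t ^ 2 * ‖v j‖ ^ 2 := by
    intro j
    rw [Complex.sq_norm, Complex.sq_norm, Complex.sq_norm]
    simp [Complex.normSq_apply]; ring
  simp only [euclSq, bdot, Complex.re_sum, Pi.add_apply, Pi.smul_apply, Complex.real_smul, h1,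
    Finset.sum_add_distrib, Finset.mul_sum, Pi.star_apply]

/-- The Gaussian weight as a complex-valued function. -/
noncomputable def gauss (s : ℝ) (W : Fin n → ℂ) : ℂ := (Real.exp (-s * euclSq W) : ℂ)

theorem differentiable_gauss (s : ℝ) : Differentiable ℝ (gauss s : (Fin n → ℂ) → ℂ) := by
  have h : Differentiable ℝ fun W : Fin n → ℂ => Real.exp (-s * euclSq W) :=
    (differentiable_euclSq.const_mul _).exp
  exact Complex.ofRealCLM.differentiable.comp h

theorem fderiv_gauss (s : ℝ) (W v : Fin n → ℂ) :
    fderiv ℝ (gauss s) W v = -s * (2 * (bdot v (star W)).re : ℝ) * gauss s W := by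
  have h1 : HasDerivAt (fun t : ℝ => W + t • v) v 0 := by
    simpa using ((hasDerivAt_id (0 : ℝ)).smul_const v).const_add W
  have h2 : HasFDerivAt (gauss s) (fderiv ℝ (gauss s) W) (W + (0 : ℝ) • v) := by
    simpa using (differentiable_gauss s W).hasFDerivAt
  have h3 := h2.comp_hasDerivAt 0 h1
  have h4 : HasDerivAt (fun t : ℝ => (Real.exp (-s * (euclSq W + t * (2 * (bdot v (star W)).re) +
      t ^ 2 * euclSq v)) : ℂ)) ((Real.exp (-s * euclSq W) *
        (-s * (2 * (bdot v (star W)).re)) : ℝ) : ℂ) 0 := by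
    have h5 : HasDerivAt (fun t : ℝ => -s * (euclSq W + t * (2 * (bdot v (star W)).re) +
        t ^ 2 * euclSq v)) (-s * (2 * (bdot v (star W)).re)) 0 := by
      have := ((((hasDerivAt_id (0 : ℝ)).mul_const (2 * (bdot v (star W)).re)).const_add
        (euclSq W)).add ((hasDerivAt_pow 2 (0 : ℝ)).mul_const (euclSq v))).const_mul (-s)
      simpa using this
    have h6 := h5.exp.ofReal_comp
    simpa using h6
  have h7 : (gauss s ∘ fun t : ℝ => W + t • v) = fun t : ℝ =>
      (Real.exp (-s * (euclSq W + t * (2 * (bdot v (star W)).re) + t ^ 2 * euclSq v)) : ℂ) := by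
    funext t; simp only [Function.comp_apply, gauss, euclSq_add_smul]
  rw [h7] at h3
  rw [h3.unique h4, gauss]
  push_cast; ring

/-- Integration by parts against the Gaussian weight. -/
theorem Dbar.integral_eq {f b : (Fin n → ℂ) → ℂ} {j : Fin n} (hf : Dbar f (Pi.single j 1) b)
    {s : ℝ} (hs : 0 < s) :
    ∫ W, b W * gauss s W = s * ∫ W, W j * f W * gauss s W := by
  have hg := hf.diff.continuous
  have hgc : Continuous (gauss s : (Fin n → ℂ) → ℂ) := (differentiable_gauss s).continuous
  have hfi : Integrable fun W => f W * gauss s W :=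
    hf.bdd.integrable_mul_gauss hg.aestronglyMeasurable hs
  have hD : ∀ v : Fin n → ℂ, ExpBdd fun W : Fin n → ℂ => ((2 * (bdot v (star W)).re : ℝ) : ℂ) := by
    intro v
    refine ((ExpBdd.const 2).mul (ExpBdd.bdot_left (star v))).mono fun W => ?_
    rw [Complex.norm_real, norm_mul, norm_mul]
    have : ‖(bdot v (star W)).re‖ ≤ ‖bdot v (star W)‖ := Complex.abs_re_le_norm _
    have h2 : bdot v (star W) = star (bdot W (star v)) := by
      rw [← bdot_star, star_star, bdot_comm]
    rw [h2, norm_star] at this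
    rw [h2]
    simpa using this
  have hgi : ∀ v, Integrable fun W => f W * fderiv ℝ (gauss s) W v := by
    intro v
    have h1 := (((ExpBdd.const (-s : ℂ)).mul (hD v)).mul hf.bdd).integrable_mul_gauss (c := s) (by
      refine Continuous.aestronglyMeasurable ?_
      fun_prop) hs
    refine h1.congr (Filter.Eventually.of_forall fun W => ?_)
    simp only [fderiv_gauss, gauss]; ring
  have hfi1 : Integrable fun W => fderiv ℝ f W (Pi.single j 1) * gauss s W :=
    hf.bdd₁.integrable_mul_gauss (measurable_fderiv_apply_const ℝ f _).aestronglyMeasurable hs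
  have hfi2 : Integrable fun W => fderiv ℝ f W (Complex.I • Pi.single j 1) * gauss s W :=
    hf.bdd₂.integrable_mul_gauss (measurable_fderiv_apply_const ℝ f _).aestronglyMeasurable hs
  have e1 := integral_mul_fderiv_eq_neg_fderiv_mul_of_integrable hfi1 (hgi _) hfi
    (fun W _ => hf.diff W) (fun W _ => differentiable_gauss s W)
  have e2 := integral_mul_fderiv_eq_neg_fderiv_mul_of_integrable hfi2 (hgi _) hfi
    (fun W _ => hf.diff W) (fun W _ => differentiable_gauss s W)
  have e3 : ∫ W, 2 * (b W * gauss s W) = (∫ W, fderiv ℝ f W (Pi.single j 1) * gauss s W) +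
      Complex.I * ∫ W, fderiv ℝ f W (Complex.I • Pi.single j 1) * gauss s W := by
    rw [← integral_const_mul, ← integral_add hfi1 (hfi2.const_mul _)]
    refine integral_congr_ae (Filter.Eventually.of_forall fun W => ?_)
    simp only
    rw [← mul_assoc 2, ← hf.eq]; ring
  -- The operator D_v + i D_{iv} is twice ∂̄_j, and ∂̄_j of the Gaussian is -s W_j times it.
  have e4 : ∫ W, -2 * s * (W j * f W * gauss s W) =
      (∫ W, f W * fderiv ℝ (gauss s) W (Pi.single j 1)) +
      Complex.I * ∫ W, f W * fderiv ℝ (gauss s) W (Complex.I • Pi.single j 1) := by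
    rw [← integral_const_mul, ← integral_add (hgi _) ((hgi _).const_mul _)]
    refine integral_congr_ae (Filter.Eventually.of_forall fun W => ?_)
    simp only [fderiv_gauss]
    have h1 : bdot (Pi.single j 1) (star W) = star (W j) := by
      simp [bdot, Pi.single_apply]
    have h2 : bdot (Complex.I • Pi.single j 1) (star W) = Complex.I * star (W j) := by
      rw [bdot_smul_left, h1]
    rw [h1, h2]
    have h3 : (W j) = ((W j).re : ℂ) + (W j).im * Complex.I := (Complex.re_add_im _).symm
    have h4 : (star (W j)).re = (W j).re := rfl
    have h5 : (Complex.I * star (W j)).re = (W j).im := by simp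
    rw [h4, h5]
    push_cast
    linear_combination (-2 * s * f W * gauss s W) * h3
  rw [integral_const_mul] at e3 e4
  linear_combination (1 / 2 : ℂ) * e3 + (1 / 2 : ℂ) * e4 + (1 / 2 : ℂ) * e1 +
    (Complex.I / 2) * e2

end Dbar

/-! ### The regularised delta function on the quadric W • W = 0 -/

section Parts
variable {n : ℕ}

theorem fderiv_bdot_self (W v : Fin n → ℂ) :
    fderiv ℂ (fun W : Fin n → ℂ => bdot W W) W v = 2 * bdot W v := by
  rw [fderiv_apply_eq_deriv differentiable_bdot_self]
  have h : ∀ t : ℂ, bdot (W + t • v) (W + t • v) =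
      bdot W W + t * (2 * bdot W v) + t ^ 2 * bdot v v := by
    intro t
    rw [bdot_add_left, bdot_add_right, bdot_add_right, bdot_smul_left, bdot_smul_right,
      bdot_smul_right, bdot_smul_left, bdot_comm v W]
    ring
  simp only [h]
  have := ((((hasDerivAt_id (0 : ℂ)).mul_const (2 * bdot W v)).const_add
    (bdot W W)).fun_add ((hasDerivAt_pow 2 (0 : ℂ)).mul_const (bdot v v))).deriv
  simpa using this

theorem fderiv_bdot_left (W v a : Fin n → ℂ) :
    fderiv ℂ (fun W : Fin n → ℂ => bdot W a) W v = bdot v a := by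
  rw [fderiv_apply_eq_deriv (differentiable_bdot_left a)]
  have h : ∀ t : ℂ, bdot (W + t • v) a = bdot W a + t * bdot v a := by
    intro t
    rw [bdot_add_left, bdot_smul_left]
  simp only [h]
  simp

theorem bdot_single (j : Fin n) (a : Fin n → ℂ) : bdot (Pi.single j 1) a = a j := by
  simp [bdot, Pi.single_apply]

theorem star_bdot_star (a W : Fin n → ℂ) : star (bdot W (star a)) = bdot a (star W) := by
  rw [← bdot_star, star_star, bdot_comm]

/-- The regularised square modulus `|W • W|² + ε`. -/
noncomputable def regSq (ε : ℝ) (W : Fin n → ℂ) : ℝ := ‖bdot W W‖ ^ 2 + ε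

theorem regSq_pos {ε : ℝ} (hε : 0 < ε) (W : Fin n → ℂ) : 0 < regSq ε W := by
  unfold regSq; positivity

theorem regSq_eq (ε : ℝ) (W : Fin n → ℂ) :
    (regSq ε W : ℂ) = bdot W W * star (bdot W W) + ε := by
  have : bdot W W * star (bdot W W) = ((‖bdot W W‖ ^ 2 : ℝ) : ℂ) := by
    rw [← Complex.normSq_eq_norm_sq]; exact Complex.mul_conj _
  rw [this, regSq]; push_cast; ring

theorem expBdd_regSq_inv {ε : ℝ} (hε : 0 < ε) : ExpBdd fun W : Fin n → ℂ => (regSq ε W : ℂ)⁻¹ := by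
  refine (ExpBdd.const (ε⁻¹ : ℂ)).mono fun W => ?_
  rw [norm_inv, norm_inv, Complex.norm_real, Complex.norm_real, Real.norm_of_nonneg hε.le,
    Real.norm_of_nonneg (regSq_pos hε W).le]
  gcongr
  unfold regSq
  nlinarith [sq_nonneg ‖bdot W W‖]

/-- With q = W • W, the ∂̄-derivative of q̄ / (|q|² + ε) is ε ∂̄q̄ / (|q|² + ε)², a smooth
approximation of a delta function on q = 0. The remaining term differentiates (a • W̄)^k. -/
theorem dbar_regularised {ε : ℝ} (hε : 0 < ε) (a : Fin n → ℂ) (k : ℕ) {F : (Fin n → ℂ) → ℂ}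
    (hF : Differentiable ℂ F) (hb : ExpBdd F) (j : Fin n) :
    Dbar (fun W => star (bdot W W) * (regSq ε W : ℂ)⁻¹ * bdot a (star W) ^ k * F W) (Pi.single j 1)
      fun W => F W * (bdot a (star W) ^ k * (2 * star (W j)) * (ε * ((regSq ε W : ℂ)⁻¹) ^ 2) +
        star (bdot W W) * (regSq ε W : ℂ)⁻¹ * (k * bdot a (star W) ^ (k - 1) * a j)) := by
  have h1 := Dbar.of_star_holo (differentiable_bdot_self (n := n)) ExpBdd.bdot_self (Pi.single j 1)
  have h2 := Dbar.of_holo (differentiable_bdot_self (n := n)) ExpBdd.bdot_self (Pi.single j 1)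
  have h3 := ((h2.mul h1).add (Dbar.of_holo (differentiable_const (ε : ℂ)) (ExpBdd.const _)
    (Pi.single j 1)))
  simp only [← regSq_eq] at h3
  have h4 := h3.inv (fun W => by exact_mod_cast (regSq_pos hε W).ne') (expBdd_regSq_inv hε)
  have h5 := Dbar.of_star_holo (f := fun W => bdot W (star a) ^ k)
    ((differentiable_bdot_left (star a)).pow k) ((ExpBdd.bdot_left _).pow k) (Pi.single j 1)
  have h6 : ∀ W, fderiv ℂ (fun W : Fin n → ℂ => bdot W (star a) ^ k) W (Pi.single j 1) =
      k * bdot W (star a) ^ (k - 1) * star (a j) := by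
    intro W
    rw [fderiv_fun_pow _ (differentiable_bdot_left (star a) W)]
    simp [fderiv_bdot_left, bdot_single]
  simp only [h6, star_pow, star_mul', star_star, star_bdot_star, star_natCast] at h5
  have h7 := ((h1.mul h4).mul h5).mul (Dbar.of_holo hF hb (Pi.single j 1))
  refine h7.congr fun W => ?_
  rw [fderiv_bdot_self, bdot_comm W (Pi.single j 1), bdot_single, star_mul', star_ofNat]
  have hr : (regSq ε W : ℂ) * (regSq ε W : ℂ)⁻¹ = 1 :=
    mul_inv_cancel₀ (by exact_mod_cast (regSq_pos hε W).ne')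
  have h8 := regSq_eq ε W
  set r := (regSq ε W : ℂ)
  set i := r⁻¹
  have h9 : i = i ^ 2 * (bdot W W * star (bdot W W) + ε) := by
    rw [← h8, sq, mul_assoc, mul_comm i r, hr, mul_one]
  linear_combination (F W * bdot a (star W) ^ k * 2 * star (W j)) * h9

/-- The coefficients `c j` are holomorphic, so ∂̄ passes through them and `Dbar.integral_eq` applies
to each summand. -/
theorem Dbar.sum_integral_eq {g : (Fin n → ℂ) → ℂ} {b c : Fin n → (Fin n → ℂ) → ℂ}
    (hg : ∀ j, Dbar g (Pi.single j 1) (b j)) (hc : ∀ j, Differentiable ℂ (c j))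
    (hcb : ∀ j, ExpBdd (c j)) {s : ℝ} (hs : 0 < s) :
    ∫ W, (∑ j, c j W * b j W) * gauss s W = s * ∫ W, (∑ j, c j W * W j) * g W * gauss s W := by
  have h : ∀ j, Dbar (fun W => c j W * g W) (Pi.single j 1) fun W => c j W * b j W := fun j =>
    ((Dbar.of_holo (hc j) (hcb j) (Pi.single j 1)).mul (hg j)).congr fun W => by ring
  have hi : ∀ j, Integrable fun W => c j W * b j W * gauss s W := fun j =>
    (h j).integrable_deriv hs
  simp only [Finset.sum_mul]
  rw [integral_finsetSum _ fun j _ => hi j, integral_finsetSum, Finset.mul_sum]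
  · refine Finset.sum_congr rfl fun j _ => ?_
    rw [(h j).integral_eq hs]
    simp only [mul_assoc, mul_left_comm]
  · intro j _
    have := (((ExpBdd.coord j).mul (h j).bdd).integrable_mul_gauss (c := s) ?_ hs)
    · refine this.congr (Filter.Eventually.of_forall fun W => ?_)
      simp only [gauss]; ring
    · have := (h j).diff.continuous
      exact Continuous.aestronglyMeasurable (by fun_prop)

theorem bdot_self_star (W : Fin n → ℂ) : bdot W (star W) = euclSq W := bdot_star_self W

/-- Two integrations by parts. The Euler coefficients W_j produce q and hence the factor |q|² /
(|q|² + ε), but leave a term containing a • W. The constant coefficients a_j at exponent m evaluate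
that term, and a • a = 0 removes what would otherwise be left. -/
theorem integral_regularised {s ε : ℝ} (hs : 0 < s) (hε : 0 < ε) {a : Fin n → ℂ}
    (ha : bdot a a = 0) (m : ℕ) {F : (Fin n → ℂ) → ℂ}
    (hF : Differentiable ℂ F) (hb : ExpBdd F) :
    s ^ 2 * ∫ W, F W * bdot a (star W) ^ (m + 1) * (‖bdot W W‖ ^ 2 * (regSq ε W)⁻¹ : ℝ) *
        gauss s W =
      ∫ W, F W * bdot a (star W) ^ (m + 1) *
        ((2 * (m + 1) + 2 * s * euclSq W) * (ε * (regSq ε W)⁻¹ ^ 2) : ℝ) * gauss s W := by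
  have d1 := dbar_regularised hε a (m + 1) hF hb
  have d2 := dbar_regularised hε a m hF hb
  have hsum : ∀ W y : Fin n → ℂ, ∀ α β : ℂ, ∑ j, y j * (F W * (α * (2 * star (W j)) *
      (ε * ((regSq ε W : ℂ)⁻¹) ^ 2) + star (bdot W W) * (regSq ε W : ℂ)⁻¹ * (β * a j))) =
      F W * α * 2 * (ε * ((regSq ε W : ℂ)⁻¹) ^ 2) * bdot y (star W) +
      F W * star (bdot W W) * (regSq ε W : ℂ)⁻¹ * β * bdot y a := by
    intro W y α β
    simp only [bdot, Finset.mul_sum]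
    rw [← Finset.sum_add_distrib]
    refine Finset.sum_congr rfl fun j _ => ?_
    simp only [Pi.star_apply]; ring
  have e1 := Dbar.sum_integral_eq d1 (c := fun j W => W j) (fun j => by fun_prop)
    ExpBdd.coord hs
  have e2 := Dbar.sum_integral_eq d2 (c := fun j _ => a j) (fun j => by fun_prop)
    (fun j => ExpBdd.const _) hs
  have hreg : Continuous fun W : Fin n → ℂ => (regSq ε W : ℂ)⁻¹ := by
    refine Continuous.inv₀ ?_ fun W => by exact_mod_cast (regSq_pos hε W).ne'
    unfold regSq; fun_prop
  have hcs := continuous_star_pi (n := n)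
  have hFc := hF.continuous
  have hbs : ExpBdd fun W : Fin n → ℂ => bdot a (star W) :=
    ((ExpBdd.bdot_left (star a)).star).mono fun W => by rw [star_bdot_star]
  have hbc : Continuous fun W : Fin n → ℂ => bdot a (star W) := by unfold bdot; fun_prop
  have hqb : ExpBdd fun W : Fin n → ℂ => star (bdot W W) := ExpBdd.bdot_self.star
  have hqc : Continuous fun W : Fin n → ℂ => star (bdot W W) := continuous_bdot_self.star
  have i1 : Integrable fun W => F W * bdot a (star W) ^ (m + 1) * 2 *
      (ε * ((regSq ε W : ℂ)⁻¹) ^ 2) * bdot W (star W) * gauss s W := by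
    simp only [bdot_self_star]
    refine ExpBdd.integrable_mul_gauss (((((hb.mul (hbs.pow _)).mul (ExpBdd.const 2)).mul
      ((ExpBdd.const _).mul ((expBdd_regSq_inv hε).pow 2)))).mul ExpBdd.euclSq) ?_ hs
    exact Continuous.aestronglyMeasurable (by fun_prop)
  have i2 : Integrable fun W => F W * star (bdot W W) * (regSq ε W : ℂ)⁻¹ *
      ((m + 1 : ℕ) * bdot a (star W) ^ m) * bdot W a * gauss s W := by
    refine ExpBdd.integrable_mul_gauss ((((hb.mul hqb).mul (expBdd_regSq_inv hε)).mul
      ((ExpBdd.const _).mul (hbs.pow _))).mul (ExpBdd.bdot_left a)) ?_ hs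
    refine Continuous.aestronglyMeasurable ?_
    have := differentiable_bdot_left a |>.continuous
    fun_prop
  have i3 : Integrable fun W => F W * bdot a (star W) ^ (m + 1) *
      (ε * ((regSq ε W : ℂ)⁻¹) ^ 2) * gauss s W := by
    refine ExpBdd.integrable_mul_gauss (((hb.mul (hbs.pow _))).mul
      ((ExpBdd.const _).mul ((expBdd_regSq_inv hε).pow 2))) ?_ hs
    exact Continuous.aestronglyMeasurable (by fun_prop)
  simp only [hsum, ha, mul_zero, add_zero, add_tsub_cancel_right] at e1 e2
  simp only [add_mul] at e1
  rw [integral_add i1 i2] at e1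
  -- The remainder of `e1` is m + 1 times the right-hand integral of `e2`, which is what makes the
  -- two identities combine.
  have e3 : ∫ W, F W * star (bdot W W) * (regSq ε W : ℂ)⁻¹ *
      ((m + 1 : ℕ) * bdot a (star W) ^ m) * bdot W a * gauss s W =
      (m + 1) * ∫ W, (∑ j, a j * W j) * (star (bdot W W) * (regSq ε W : ℂ)⁻¹ *
        bdot a (star W) ^ m * F W) * gauss s W := by
    rw [← integral_const_mul]
    congr 1; funext W
    rw [show (∑ j, a j * W j) = bdot W a from bdot_comm a W]
    push_cast; ring
  have e4 : ∫ W, F W * bdot a (star W) ^ m * 2 *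
      (ε * ((regSq ε W : ℂ)⁻¹) ^ 2) * bdot a (star W) * gauss s W =
      2 * ∫ W, F W * bdot a (star W) ^ (m + 1) * (ε * ((regSq ε W : ℂ)⁻¹) ^ 2) * gauss s W := by
    rw [← integral_const_mul]
    congr 1; funext W; ring
  have e5 : ∫ W, (∑ j, W j * W j) * (star (bdot W W) * (regSq ε W : ℂ)⁻¹ *
      bdot a (star W) ^ (m + 1) * F W) * gauss s W = ∫ W, F W * bdot a (star W) ^ (m + 1) *
        (‖bdot W W‖ ^ 2 * (regSq ε W)⁻¹ : ℝ) * gauss s W := by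
    congr 1; funext W
    have : bdot W W * star (bdot W W) = ((‖bdot W W‖ ^ 2 : ℝ) : ℂ) := by
      rw [← Complex.normSq_eq_norm_sq]; exact Complex.mul_conj _
    rw [show (∑ j, W j * W j) = bdot W W from rfl]
    push_cast at this ⊢
    linear_combination ((regSq ε W : ℂ)⁻¹ *
      bdot a (star W) ^ (m + 1) * F W * gauss s W) * this
  have e6 : ∫ W, F W * bdot a (star W) ^ (m + 1) *
        ((2 * (m + 1) + 2 * s * euclSq W) * (ε * (regSq ε W)⁻¹ ^ 2) : ℝ) * gauss s W =
      2 * (m + 1) * (∫ W, F W * bdot a (star W) ^ (m + 1) *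
        (ε * ((regSq ε W : ℂ)⁻¹) ^ 2) * gauss s W) +
      s * ∫ W, F W * bdot a (star W) ^ (m + 1) * 2 *
        (ε * ((regSq ε W : ℂ)⁻¹) ^ 2) * bdot W (star W) * gauss s W := by
    rw [← integral_const_mul, ← integral_const_mul, ← integral_add (i3.const_mul _)
      (i1.const_mul _)]
    congr 1; funext W
    rw [bdot_self_star]
    push_cast; ring
  rw [e6, ← e5]
  rw [e3] at e1
  rw [e4] at e2
  linear_combination (-s : ℂ) * e1 - (m + 1) * e2

end Parts

/-! ### The homogeneous kernels P_m and their finite rank -/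

section OddP
variable {n : ℕ}

/-- The polynomials with `2 c p_m(a, c²) = (a + c)^(m+1) - (a - c)^(m+1)`. -/
noncomputable def oddP : ℕ → ℂ → ℂ → ℂ
  | 0, _, _ => 1
  | 1, a, _ => 2 * a
  | m + 2, a, b => 2 * a * oddP (m + 1) a b - (a ^ 2 - b) * oddP m a b

@[elab_as_elim]
theorem twoStep {P : ℕ → Prop} (h0 : P 0) (h1 : P 1) (h : ∀ m, P m → P (m + 1) → P (m + 2))
    (m : ℕ) : P m := by
  have : P m ∧ P (m + 1) := by
    induction m with
    | zero => exact ⟨h0, h1⟩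
    | succ m ih => exact ⟨ih.2, h m ih.1 ih.2⟩
  exact this.1

theorem oddP_sq (m : ℕ) (a c : ℂ) :
    2 * c * oddP m a (c ^ 2) = (a + c) ^ (m + 1) - (a - c) ^ (m + 1) := by
  induction m using twoStep with
  | h0 => simp [oddP]; ring
  | h1 => simp [oddP]; ring
  | h m h0 h1 => rw [oddP]; linear_combination (2 * a) * h1 - (a ^ 2 - c ^ 2) * h0

/-- This is the recursion of ∑ (a + c)^i (a - c)^{m-i}. It keeps information at c = 0, where the
closed formula is vacuous, and it yields the bound by m + 1 monomials. -/
theorem oddP_succ (m : ℕ) (a c : ℂ) :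
    oddP (m + 1) a (c ^ 2) = (a + c) * oddP m a (c ^ 2) + (a - c) ^ (m + 1) := by
  induction m with
  | zero => simp [oddP]; ring
  | succ m ih => rw [oddP]; linear_combination (a - c) * ih

theorem norm_oddP_le (m : ℕ) {a c : ℂ} {R : ℝ} (h1 : ‖a + c‖ ≤ R) (h2 : ‖a - c‖ ≤ R) :
    ‖oddP m a (c ^ 2)‖ ≤ (m + 1) * R ^ m := by
  have hR : 0 ≤ R := (norm_nonneg _).trans h1
  induction m with
  | zero => simp [oddP]
  | succ m ih =>
    rw [oddP_succ]
    refine (norm_add_le _ _).trans ?_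
    rw [norm_mul, norm_pow]
    calc ‖a + c‖ * ‖oddP m a (c ^ 2)‖ + ‖a - c‖ ^ (m + 1)
        ≤ R * ((m + 1) * R ^ m) + R ^ (m + 1) := by gcongr
      _ = _ := by push_cast; ring

theorem oddP_mul (m : ℕ) (t a b : ℂ) : oddP m (t * a) (t ^ 2 * b) = t ^ m * oddP m a b := by
  induction m using twoStep with
  | h0 => simp [oddP]
  | h1 => simp [oddP]; ring
  | h m h0 h1 => rw [oddP, oddP, h0, h1]; ring

theorem star_oddP (m : ℕ) (a b : ℂ) : star (oddP m a b) = oddP m (star a) (star b) := by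
  induction m using twoStep with
  | h0 => simp [oddP]
  | h1 => simp [oddP]
  | h m h0 h1 => rw [oddP, oddP, ← h0, ← h1]; simp

@[fun_prop]
theorem continuous_oddP {X : Type*} [TopologicalSpace X] (m : ℕ) {a b : X → ℂ}
    (ha : Continuous a) (hb : Continuous b) : Continuous fun x => oddP m (a x) (b x) := by
  induction m using twoStep with
  | h0 => simp only [oddP]; fun_prop
  | h1 => simp only [oddP]; fun_prop
  | h m h0 h1 => simp only [oddP]; fun_prop

/-- Kernels `∑ aᵢ(z) cᵢ(u)` with homogeneous entire functions of degree `m`. -/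
def FinRank (n m : ℕ) (K : (Fin n → ℂ) → (Fin n → ℂ) → ℂ) : Prop :=
  ∃ (ι : Type) (_ : Fintype ι) (a c : ι → (Fin n → ℂ) → ℂ),
    (∀ i, HomogEntire m (a i)) ∧ (∀ i, HomogEntire m (c i)) ∧ ∀ z u, K z u = ∑ i, a i z * c i u

theorem HomogEntire.mul {m k : ℕ} {f g : (Fin n → ℂ) → ℂ} (hf : HomogEntire m f)
    (hg : HomogEntire k g) : HomogEntire (m + k) fun z => f z * g z :=
  ⟨hf.differentiable.mul hg.differentiable, fun c z => by rw [hf.smul, hg.smul]; ring⟩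

theorem homogEntire_coord (j : Fin n) : HomogEntire 1 fun z : Fin n → ℂ => z j :=
  ⟨by fun_prop, fun c z => by simp⟩

theorem homogEntire_bdot_self : HomogEntire 2 fun z : Fin n → ℂ => bdot z z :=
  ⟨differentiable_bdot_self, fun c z => by rw [bdot_smul_left, bdot_smul_right]; ring⟩

theorem HomogEntire.const_mul {m : ℕ} {f : (Fin n → ℂ) → ℂ} (hf : HomogEntire m f) (b : ℂ) :
    HomogEntire m fun z => b * f z :=
  ⟨hf.differentiable.const_mul b, fun c z => by rw [hf.smul]; ring⟩

theorem FinRank.mul {m k : ℕ} {K J : (Fin n → ℂ) → (Fin n → ℂ) → ℂ} (hK : FinRank n m K)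
    (hJ : FinRank n k J) : FinRank n (m + k) fun z u => K z u * J z u := by
  obtain ⟨ι, _, a, c, ha, hc, h⟩ := hK
  obtain ⟨ι', _, a', c', ha', hc', h'⟩ := hJ
  refine ⟨ι × ι', inferInstance, fun i z => a i.1 z * a' i.2 z, fun i z => c i.1 z * c' i.2 z,
    fun i => (ha _).mul (ha' _), fun i => (hc _).mul (hc' _), fun z u => ?_⟩
  simp only [h, h']
  rw [Finset.sum_mul_sum, ← Finset.univ_product_univ, Finset.sum_product]
  exact Finset.sum_congr rfl fun i _ => Finset.sum_congr rfl fun j _ => by ring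

theorem FinRank.add {m : ℕ} {K J : (Fin n → ℂ) → (Fin n → ℂ) → ℂ} (hK : FinRank n m K)
    (hJ : FinRank n m J) : FinRank n m fun z u => K z u + J z u := by
  obtain ⟨ι, _, a, c, ha, hc, h⟩ := hK
  obtain ⟨ι', _, a', c', ha', hc', h'⟩ := hJ
  refine ⟨ι ⊕ ι', inferInstance, Sum.elim a a', Sum.elim c c', ?_, ?_, fun z u => ?_⟩
  · rintro (i | i) <;> simp [ha, ha']
  · rintro (i | i) <;> simp [hc, hc']
  · simp [h, h', Fintype.sum_sum_type]

theorem FinRank.const_mul {m : ℕ} {K : (Fin n → ℂ) → (Fin n → ℂ) → ℂ} (hK : FinRank n m K)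
    (b : ℂ) : FinRank n m fun z u => b * K z u := by
  obtain ⟨ι, _, a, c, ha, hc, h⟩ := hK
  refine ⟨ι, inferInstance, fun i z => b * a i z, c, fun i => (ha i).const_mul b, hc,
    fun z u => ?_⟩
  simp only [h]
  rw [Finset.mul_sum]
  exact Finset.sum_congr rfl fun j _ => by ring

theorem finRank_bdot : FinRank n 1 bdot :=
  ⟨Fin n, inferInstance, fun j z => z j, fun j z => z j, homogEntire_coord, homogEntire_coord,
    fun _ _ => rfl⟩

theorem finRank_bdot_self : FinRank n 2 fun z u => bdot z z * bdot u u :=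
  ⟨Unit, inferInstance, fun _ z => bdot z z, fun _ z => bdot z z, fun _ => homogEntire_bdot_self,
    fun _ => homogEntire_bdot_self, fun _ _ => by simp⟩

/-- The homogeneous kernels of degree `m`. -/
noncomputable def homKer (m : ℕ) (z u : Fin n → ℂ) : ℂ :=
  oddP m (bdot z u) (bdot z z * bdot u u)

/-- The three-term recursion preserves finite rank. This lets linear functionals pass through
integrals of the kernel with no topology on the space, and gives holomorphy in each variable. -/
theorem finRank_homKer (m : ℕ) : FinRank n m (homKer m) := by
  induction m using twoStep with
  | h0 =>
    refine ⟨Unit, inferInstance, fun _ _ => 1, fun _ _ => 1, fun _ => ⟨by fun_prop, by simp⟩,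
      fun _ => ⟨by fun_prop, by simp⟩, fun _ _ => by simp [homKer, oddP]⟩
  | h1 => exact finRank_bdot.const_mul 2
  | h m h0 h1 =>
    have e1 := (finRank_bdot.mul h1).const_mul 2
    have e2 := ((((finRank_bdot (n := n)).mul finRank_bdot).add
      (finRank_bdot_self.const_mul (-1))).mul h0).const_mul (-1)
    rw [show 1 + (m + 1) = m + 2 by ring] at e1
    rw [show 1 + 1 + m = m + 2 by ring] at e2
    have h3 : homKer (n := n) (m + 2) = fun z u => 2 * (bdot z u * homKer (m + 1) z u) +
        -1 * ((bdot z u * bdot z u + -1 * (bdot z z * bdot u u)) * homKer m z u) := by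
      funext z u
      rw [homKer, oddP, homKer, homKer]; ring
    rw [h3]
    exact e1.add e2

theorem homogEntire_homKer (m : ℕ) (u : Fin n → ℂ) : HomogEntire m fun z => homKer m z u := by
  refine ⟨?_, fun c z => ?_⟩
  · obtain ⟨ι, _, a, c, ha, hc, h⟩ := finRank_homKer (n := n) m
    simp only [h]
    exact Differentiable.fun_sum fun i _ => (ha i).differentiable.mul_const _
  · rw [homKer, homKer, bdot_smul_left, bdot_smul_left, bdot_smul_right, ← oddP_mul]
    congr 1; ring

theorem homKer_comm (m : ℕ) (z u : Fin n → ℂ) : homKer m z u = homKer m u z := by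
  rw [homKer, homKer, bdot_comm, mul_comm]

theorem star_homKer (m : ℕ) (z u : Fin n → ℂ) :
    star (homKer m z u) = homKer m (star z) (star u) := by
  rw [homKer, homKer, star_oddP, star_mul', bdot_star, bdot_star, bdot_star]

theorem homKer_eq (m : ℕ) {z u : Fin n → ℂ} {ζ ω : ℂ} (hζ : ζ ^ 2 = bdot z z)
    (hω : ω ^ 2 = bdot u u) : 2 * (ζ * ω) * homKer m z u =
      (bdot z u + ζ * ω) ^ (m + 1) - (bdot z u - ζ * ω) ^ (m + 1) := by
  rw [homKer, ← hζ, ← hω, ← mul_pow, oddP_sq]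

/-- Cauchy–Schwarz for the pairing on both sheets ±ζ of the cone, fed into `norm_oddP_le`. -/
theorem norm_homKer_le (m : ℕ) (z u : Fin n → ℂ) :
    ‖homKer m z u‖ ≤ (m + 1) * (Nstar z * Nstar u) ^ m := by
  have h1 := norm_pairing_le (z := z) (u := u) (rt_sq z) (rt_sq u)
  have h2 := norm_pairing_le (z := z) (u := u) (ζ := -rt z) (by rw [neg_sq, rt_sq]) (rt_sq u)
  rw [neg_mul, ← sub_eq_add_neg] at h2
  have := norm_oddP_le m h1 h2
  rwa [mul_pow, rt_sq, rt_sq] at this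

theorem continuous_homKer (m : ℕ) : Continuous fun x : (Fin n → ℂ) × (Fin n → ℂ) =>
    homKer m x.1 x.2 := by
  unfold homKer bdot
  fun_prop

end OddP

/-! ### Passage to the limit ε → 0 -/

section Limit
variable {n : ℕ}

theorem ExpBdd.integrable_mul_exp_nsq {f : (Fin n → ℂ) → ℂ} (hf : ExpBdd f)
    (hm : AEStronglyMeasurable f) {c : ℝ} (hc : 0 < c) :
    Integrable fun z => f z * (Real.exp (-c * nsq z) : ℂ) := by
  refine (hf.integrable_mul_gauss hm hc).mono
    (hm.mul (Continuous.aestronglyMeasurable (by fun_prop)))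
    (Filter.Eventually.of_forall fun z => ?_)
  rw [norm_mul, norm_mul, Complex.norm_real, Complex.norm_real,
    Real.norm_of_nonneg (Real.exp_pos _).le, Real.norm_of_nonneg (Real.exp_pos _).le]
  have := euclSq_le_nsq z
  gcongr ‖f z‖ * Real.exp ?_
  nlinarith

theorem expBdd_homKer_star (m : ℕ) (z : Fin n → ℂ) : ExpBdd fun w => homKer m z (star w) := by
  have h := (homogEntire_homKer m (star z)).expBdd.star
  refine h.mono fun w => ?_
  rw [star_homKer, star_star, homKer_comm]

theorem continuous_homKer_star (m : ℕ) (z : Fin n → ℂ) :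
    Continuous fun w => homKer m z (star w) :=
  (continuous_homKer m).comp (continuous_const.prodMk continuous_star_pi)

/-- The set-level content is that z ↦ z² pushes |z|² dz forward to half of Lebesgue measure;
equality of measures carries `lintegral_sq` over to complex integrands. -/
theorem integral_sq (h : ℂ → ℂ) (hh : AEStronglyMeasurable h) :
    ∫ z : ℂ, (‖z‖ ^ 2 : ℝ) * h (z ^ 2) = 2⁻¹ * ∫ z, h z := by
  have hμ : Measure.map (fun z : ℂ => z ^ 2)
      (volume.withDensity fun z : ℂ => ENNReal.ofReal (‖z‖ ^ 2)) = (2⁻¹ : ℝ≥0∞) • volume := by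
    refine Measure.ext_of_lintegral _ fun g hg => ?_
    rw [lintegral_map hg (by fun_prop), lintegral_withDensity_eq_lintegral_mul volume
      (f := fun z : ℂ => ENNReal.ofReal (‖z‖ ^ 2)) (by fun_prop) (g := fun z => g (z ^ 2))
      (hg.comp (by fun_prop)), lintegral_smul_measure]
    exact lintegral_sq g hg
  have h1 : ∫ z, h z ∂((2⁻¹ : ℝ≥0∞) • volume) = 2⁻¹ * ∫ z, h z := by
    rw [integral_smul_measure]; simp
  have h2 : AEStronglyMeasurable h ((2⁻¹ : ℝ≥0∞) • volume) := hh.smul_measure _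
  rw [← h1, ← hμ, integral_map (by fun_prop) (by rw [hμ]; exact h2)]
  rw [integral_withDensity_eq_integral_toReal_smul
    (show Measurable fun z : ℂ => ENNReal.ofReal (‖z‖ ^ 2) by fun_prop) (by simp)]
  refine integral_congr_ae (Filter.Eventually.of_forall fun z => ?_)
  simp only
  rw [ENNReal.toReal_ofReal (by positivity), Complex.real_smul]

theorem integral_insertNth (j : Fin (n + 1)) {F : (Fin (n + 1) → ℂ) → ℂ} (hF : Integrable F) :
    ∫ W, F W = ∫ w : Fin n → ℂ, ∫ x : ℂ, F (j.insertNth x w) := by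
  have h := (volume_preserving_piFinSuccAbove (fun _ : Fin (n + 1) => ℂ) j).symm
  have hi := (h.integrable_comp_emb (MeasurableEquiv.measurableEmbedding _)).mpr hF
  rw [← h.integral_comp (MeasurableEquiv.measurableEmbedding _)]
  exact integral_prod_symm _ hi

/-- The factor |q|² / (|q|² + ε) is at most 1 and tends to 1 off the null quadric, so the limit is
the Fock integral of `integral_fock_pow`. -/
theorem tendsto_integral_regularised (hn : 1 ≤ n) {s : ℝ} (hs : 0 < s) (a : Fin n → ℂ) {m : ℕ}
    {F : (Fin n → ℂ) → ℂ} (hF : HomogEntire m F) {ε : ℕ → ℝ} (hε : ∀ k, 0 < ε k)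
    (hε0 : Filter.Tendsto ε Filter.atTop (nhds 0)) :
    Filter.Tendsto (fun k => ∫ W, F W * bdot a (star W) ^ m *
      (‖bdot W W‖ ^ 2 * (regSq (ε k) W)⁻¹ : ℝ) * gauss s W) Filter.atTop
      (nhds (m.factorial * (Real.pi / s) ^ n / s ^ m * F a)) := by
  rw [← integral_fock_pow hs hF a]
  have hbs : ExpBdd fun W : Fin n → ℂ => bdot a (star W) :=
    ((ExpBdd.bdot_left (star a)).star).mono fun W => by rw [star_bdot_star]
  have hcs := continuous_star_pi (n := n)
  have hFc := hF.differentiable.continuous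
  have hi := (hF.expBdd.mul (hbs.pow m)).integrable_mul_gauss (c := s)
    (Continuous.aestronglyMeasurable (by unfold bdot; fun_prop)) hs
  refine tendsto_integral_of_dominated_convergence _ (fun k => ?_) hi.norm (fun k => ?_) ?_
  · refine AEStronglyMeasurable.mul (AEStronglyMeasurable.mul
      (Continuous.aestronglyMeasurable (by unfold bdot; fun_prop)) ?_)
      (differentiable_gauss s).continuous.aestronglyMeasurable
    refine Continuous.aestronglyMeasurable (Complex.continuous_ofReal.comp ?_)
    refine Continuous.mul (by fun_prop) (Continuous.inv₀ ?_ fun W => (regSq_pos (hε k) W).ne')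
    unfold regSq; fun_prop
  · refine Filter.Eventually.of_forall fun W => ?_
    rw [gauss, mul_right_comm, norm_mul]
    refine mul_le_of_le_one_right (norm_nonneg _) ?_
    have := regSq_pos (hε k) W
    rw [Complex.norm_real, Real.norm_of_nonneg (by positivity), ← div_eq_mul_inv,
      div_le_one this, regSq]
    linarith [hε k]
  · filter_upwards [ae_bdot_self_ne_zero hn] with W hW
    have h1 : Filter.Tendsto (fun k => ‖bdot W W‖ ^ 2 * (regSq (ε k) W)⁻¹) Filter.atTop
        (nhds (‖bdot W W‖ ^ 2 * (‖bdot W W‖ ^ 2 + 0)⁻¹)) := by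
      refine Filter.Tendsto.mul tendsto_const_nhds (Filter.Tendsto.inv₀ ?_ (by positivity))
      exact Filter.Tendsto.add tendsto_const_nhds hε0
    rw [add_zero, mul_inv_cancel₀ (by positivity)] at h1
    have h2 := (Complex.continuous_ofReal.tendsto _).comp h1
    have h3 := (h2.const_mul (F W * bdot a (star W) ^ m)).mul_const (gauss s W)
    simpa [gauss] using h3

/-- The total mass of `(1 + |σ|²)⁻²` on the plane. -/
noncomputable def kap : ℝ := ∫ σ : ℂ, ((1 + ‖σ‖ ^ 2) ^ 2)⁻¹

theorem integrable_kap : Integrable fun σ : ℂ => ((1 + ‖σ‖ ^ 2) ^ 2)⁻¹ := by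
  have := integrable_rpow_neg_one_add_norm_sq (E := ℂ) (μ := volume) (r := 4) (by simp; norm_num)
  refine this.congr (Filter.Eventually.of_forall fun σ => ?_)
  simp only
  rw [show (-4 / 2 : ℝ) = -(2 : ℕ) by norm_num, Real.rpow_neg (by positivity), Real.rpow_natCast]

theorem kap_pos : 0 < kap := by
  refine (integral_pos_iff_support_of_nonneg (fun σ => by positivity) integrable_kap).mpr ?_
  have : Function.support (fun σ : ℂ => ((1 + ‖σ‖ ^ 2) ^ 2)⁻¹) = Set.univ := by
    ext σ; simp only [Function.mem_support, Set.mem_univ, iff_true]; positivity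
  rw [this]; simp

/-- The substitution τ = -q + δσ exhibits δ² / (|τ + q|² + δ²)² as a rescaled fixed profile, of
total mass `kap`. -/
theorem integral_rescale (g : ℂ → ℂ) (q : ℂ) {δ : ℝ} (hδ : 0 < δ) :
    ∫ τ, g τ * (δ ^ 2 * ((‖τ + q‖ ^ 2 + δ ^ 2)⁻¹) ^ 2 : ℝ) =
      ∫ σ, g (-q + δ * σ) * (((1 + ‖σ‖ ^ 2) ^ 2)⁻¹ : ℝ) := by
  rw [← integral_add_left_eq_self _ (-q)]
  have h := Measure.integral_comp_smul (volume : Measure ℂ)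
    (fun τ => g (-q + τ) * (δ ^ 2 * ((‖-q + τ + q‖ ^ 2 + δ ^ 2)⁻¹) ^ 2 : ℝ)) δ
  rw [Complex.finrank_real_complex, abs_of_pos (by positivity), eq_inv_smul_iff₀ (by positivity),
    ← integral_smul] at h
  rw [← h]
  refine integral_congr_ae (Filter.Eventually.of_forall fun σ => ?_)
  simp only
  rw [Complex.real_smul, Complex.real_smul, mul_left_comm]
  congr 1
  rw [← Complex.ofReal_mul]
  congr 1
  rw [neg_add_eq_sub, sub_add_cancel, norm_mul, Complex.norm_real, Real.norm_of_nonneg hδ.le]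
  have h1 : (δ * ‖σ‖) ^ 2 + δ ^ 2 = δ ^ 2 * (1 + ‖σ‖ ^ 2) := by ring
  rw [h1]
  field_simp

theorem exists_one_add_pow_mul_exp_le (k : ℕ) {c : ℝ} (hc : 0 < c) :
    ∃ C, 0 < C ∧ ∀ R, 0 ≤ R → (1 + R) ^ k * Real.exp (-(c * R)) ≤ C := by
  refine ⟨k.factorial * Real.exp c / c ^ k, by positivity, fun R hR => ?_⟩
  have h := Real.pow_div_factorial_le_exp (c * (1 + R)) (by positivity) k
  rw [div_le_iff₀ (by positivity), mul_pow] at h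
  rw [Real.exp_neg, ← div_eq_mul_inv, div_le_div_iff₀ (by positivity) (by positivity)]
  calc (1 + R) ^ k * c ^ k = c ^ k * (1 + R) ^ k := mul_comm _ _
    _ ≤ Real.exp (c * (1 + R)) * k.factorial := h
    _ = _ := by rw [mul_add, mul_one, Real.exp_add]; ring

/-- The integrand on the fibre over `w`. -/
noncomputable def fibre (s : ℝ) (m : ℕ) (f : (Fin n → ℂ) → ℂ) (z w : Fin n → ℂ) (τ : ℂ) : ℂ :=
  f w * oddP m (bdot z (star w)) (-bdot z z * star τ) *
    ((m + 1 + s * (‖τ‖ + euclSq w) : ℝ) * Real.exp (-s * (‖τ‖ + euclSq w)) : ℝ)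

/-- The bound is uniform in τ, as dominated convergence over the moving point -w • w + δσ requires.
Half of the Gaussian absorbs the polynomial growth, the other half stays as decay in w. -/
theorem exists_norm_fibre_le {s : ℝ} (hs : 0 < s) (m : ℕ) (z : Fin n → ℂ) :
    ∃ C, 0 < C ∧ ∀ (f : (Fin n → ℂ) → ℂ) w τ,
      ‖fibre s m f z w τ‖ ≤ C * ‖f w * (Real.exp (-(s / 2) * euclSq w) : ℂ)‖ := by
  obtain ⟨C, hC, h⟩ := exists_one_add_pow_mul_exp_le (m + 1) (half_pos hs)
  have hz := nsq_nonneg z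
  refine ⟨(m + 1) * (1 + nsq z) ^ m * (m + 1 + s) * C, by positivity, fun f w τ => ?_⟩
  -- Square roots place both arguments of `oddP` in the form to which Cauchy–Schwarz and
  -- `norm_oddP_le` apply.
  obtain ⟨ω, hω⟩ := IsAlgClosed.exists_pow_nat_eq (star τ) (n := 2) two_pos
  obtain ⟨ζ, hζ⟩ := IsAlgClosed.exists_pow_nat_eq (-bdot z z) (n := 2) two_pos
  have hw := euclSq_nonneg w
  have hω' : ‖ω‖ ^ 2 = ‖τ‖ := by rw [← norm_pow, hω, norm_star]
  have hζ' : euclSq z + ‖ζ‖ ^ 2 = nsq z := by rw [← norm_pow, hζ, norm_neg]; rfl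
  have h1 := sq_norm_pairing_le z (star w) ζ ω
  have h2 := sq_norm_pairing_le z (star w) (-ζ) ω
  rw [norm_neg, neg_mul, ← sub_eq_add_neg] at h2
  rw [hζ', euclSq_star, hω'] at h1 h2
  set R := ‖τ‖ + euclSq w with hR
  have hR0 : 0 ≤ R := by positivity
  have h3 : nsq z * (euclSq w + ‖τ‖) ≤ ((1 + nsq z) * (1 + R)) ^ 2 := by
    rw [add_comm]
    calc nsq z * R ≤ (1 + nsq z) * (1 + R) := by gcongr <;> linarith
      _ ≤ _ := by
        refine le_self_pow₀ ?_ two_ne_zero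
        nlinarith [mul_nonneg hz hR0]
  have h4 := abs_le_of_sq_le_sq (h1.trans h3) (by positivity)
  have h5 := abs_le_of_sq_le_sq (h2.trans h3) (by positivity)
  rw [abs_norm] at h4 h5
  have h6 := norm_oddP_le m h4 h5
  rw [mul_pow, hζ, hω] at h6
  rw [fibre, norm_mul, norm_mul, norm_mul, Complex.norm_real, Complex.norm_real,
    Real.norm_of_nonneg (by positivity), Real.norm_of_nonneg (Real.exp_pos _).le]
  have h7 : Real.exp (-s * R) ≤ Real.exp (-(s / 2 * R)) * Real.exp (-(s / 2) * euclSq w) := by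
    rw [← Real.exp_add, Real.exp_le_exp]
    nlinarith [norm_nonneg τ]
  calc ‖f w‖ * ‖oddP m (bdot z (star w)) (-bdot z z * star τ)‖ * ((m + 1 + s * R) *
        Real.exp (-s * R)) ≤ ‖f w‖ * ((m + 1) * ((1 + nsq z) * (1 + R)) ^ m) *
        (((m + 1 + s) * (1 + R)) * (Real.exp (-(s / 2 * R)) *
          Real.exp (-(s / 2) * euclSq w))) := by
        gcongr
        have : (0 : ℝ) ≤ m := by positivity
        nlinarith
    _ = ‖f w‖ * ((m + 1) * (1 + nsq z) ^ m) * (m + 1 + s) *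
        ((1 + R) ^ (m + 1) * Real.exp (-(s / 2 * R))) * Real.exp (-(s / 2) * euclSq w) := by
        rw [mul_pow]; ring
    _ ≤ ‖f w‖ * ((m + 1) * (1 + nsq z) ^ m) * (m + 1 + s) * C *
          Real.exp (-(s / 2) * euclSq w) := by
        gcongr
        exact h R hR0
    _ = _ := by ring

theorem continuous_fibre {s : ℝ} (m : ℕ) {f : (Fin n → ℂ) → ℂ} (hf : Continuous f)
    (z : Fin n → ℂ) : Continuous fun x : (Fin n → ℂ) × ℂ => fibre s m f z x.1 x.2 := by
  unfold fibre bdot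
  have h1 : Continuous fun x : (Fin n → ℂ) × ℂ => euclSq x.1 := continuous_euclSq.comp continuous_fst
  have h2 : Continuous fun x : (Fin n → ℂ) × ℂ => f x.1 := hf.comp continuous_fst
  fun_prop

theorem tendsto_integral_fibre {s : ℝ} (hs : 0 < s) (m : ℕ) {f : (Fin n → ℂ) → ℂ}
    (hf : Continuous f) (hb : ExpBdd f) (z : Fin n → ℂ) {δ : ℕ → ℝ}
    (hδ0 : Filter.Tendsto δ Filter.atTop (nhds 0)) :
    Filter.Tendsto (fun k => ∫ w, ∫ σ : ℂ, fibre s m f z w (-bdot w w + δ k * σ) *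
      (((1 + ‖σ‖ ^ 2) ^ 2)⁻¹ : ℝ)) Filter.atTop
      (nhds (kap * ∫ w, fibre s m f z w (-bdot w w))) := by
  obtain ⟨C, hC, hfib⟩ := exists_norm_fibre_le (n := n) hs m z
  have hcf := continuous_fibre (s := s) m hf z
  have hk : Continuous fun σ : ℂ => ((((1 + ‖σ‖ ^ 2) ^ 2)⁻¹ : ℝ) : ℂ) := by
    refine Complex.continuous_ofReal.comp (Continuous.inv₀ (by fun_prop) fun σ => ?_)
    positivity
  have hcont : ∀ k, Continuous fun x : (Fin n → ℂ) × ℂ =>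
      fibre s m f z x.1 (-bdot x.1 x.1 + δ k * x.2) * (((1 + ‖x.2‖ ^ 2) ^ 2)⁻¹ : ℝ) := by
    intro k
    refine Continuous.mul (hcf.comp (f := fun x : (Fin n → ℂ) × ℂ =>
      (x.1, -bdot x.1 x.1 + δ k * x.2)) ?_) (hk.comp continuous_snd)
    refine continuous_fst.prodMk ?_
    unfold bdot
    fun_prop
  have hpt : ∀ w k σ, ‖fibre s m f z w (-bdot w w + δ k * σ) * (((1 + ‖σ‖ ^ 2) ^ 2)⁻¹ : ℝ)‖ ≤
      (C * ‖f w * (Real.exp (-(s / 2) * euclSq w) : ℂ)‖) * ((1 + ‖σ‖ ^ 2) ^ 2)⁻¹ := by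
    intro w k σ
    rw [norm_mul, Complex.norm_real, Real.norm_of_nonneg (by positivity)]
    gcongr
    exact hfib f w _
  rw [← integral_const_mul]
  refine tendsto_integral_of_dominated_convergence
    (fun w => C * ‖f w * (Real.exp (-(s / 2) * euclSq w) : ℂ)‖ * kap) (fun k => ?_) ?_
    (fun k => Filter.Eventually.of_forall fun w => ?_)
    (Filter.Eventually.of_forall fun w => ?_)
  · exact ((hcont k).stronglyMeasurable.integral_prod_right').aestronglyMeasurable
  · exact ((hb.integrable_mul_gauss hf.aestronglyMeasurable (half_pos hs)).norm.const_mul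
      C).mul_const _
  · refine (norm_integral_le_of_norm_le (integrable_kap.const_mul _)
      (Filter.Eventually.of_forall (hpt w k))).trans ?_
    rw [integral_const_mul, kap]
  · have h1 : (kap : ℂ) * fibre s m f z w (-bdot w w) =
        ∫ σ : ℂ, fibre s m f z w (-bdot w w) * (((1 + ‖σ‖ ^ 2) ^ 2)⁻¹ : ℝ) := by
      rw [integral_const_mul, mul_comm]
      congr 1
      exact integral_ofReal.symm
    rw [h1]
    refine tendsto_integral_of_dominated_convergence
      (fun σ => (C * ‖f w * (Real.exp (-(s / 2) * euclSq w) : ℂ)‖) * ((1 + ‖σ‖ ^ 2) ^ 2)⁻¹)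
      (fun k => ?_) (integrable_kap.const_mul _)
      (fun k => Filter.Eventually.of_forall (hpt w k)) (Filter.Eventually.of_forall fun σ => ?_)
    · exact ((hcont k).comp (f := fun σ : ℂ => (w, σ)) (by fun_prop)).aestronglyMeasurable
    · refine Filter.Tendsto.mul_const _ ?_
      have h2 : Filter.Tendsto (fun k => ((w, -bdot w w + δ k * σ) : (Fin n → ℂ) × ℂ))
          Filter.atTop (nhds (w, -bdot w w)) := by
        refine Filter.Tendsto.prodMk_nhds tendsto_const_nhds ?_
        have h3 := ((Complex.continuous_ofReal.tendsto _).comp hδ0).mul_const σ |>.const_add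
          (-bdot w w)
        simpa using h3
      exact (hcf.tendsto _).comp h2

end Limit

/-! ### Reproducing formula on the quadric -/

section Reproduce
variable {n : ℕ}

theorem homogEntire_lift {m : ℕ} {f : (Fin n → ℂ) → ℂ} (hf : HomogEntire m f) :
    HomogEntire (m + 1) fun W : Fin (n + 1) → ℂ =>
      W 0 * f (fun j => W ((0 : Fin (n + 1)).succAbove j)) := by
  refine ⟨?_, fun c W => ?_⟩
  · have h1 : Differentiable ℂ fun W : Fin (n + 1) → ℂ =>
        (fun j => W ((0 : Fin (n + 1)).succAbove j) : Fin n → ℂ) := by fun_prop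
    exact Differentiable.mul (by fun_prop) (hf.differentiable.comp h1)
  · have h := hf.smul c (fun j => W ((0 : Fin (n + 1)).succAbove j))
    have h2 : (fun j => (c • W) ((0 : Fin (n + 1)).succAbove j)) =
        c • (fun j => W ((0 : Fin (n + 1)).succAbove j)) := rfl
    simp only [h2, h]
    rw [Pi.smul_apply, smul_eq_mul]
    ring

/-- Subtracting the integrals at the vectors (±ζ, z) leaves the part odd in ζω̄, namely 2ζω̄ times
`oddP`. With the coordinate W₀ = ω this produces |ω|², which permits the substitution τ = ω²; then τ
is rescaled around -w • w, with ε = δ². -/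
theorem integral_lift {s δ : ℝ} (hs : 0 < s) (hδ : 0 < δ) {m : ℕ} {f : (Fin n → ℂ) → ℂ}
    (hf : HomogEntire m f) {z : Fin n → ℂ} {ζ : ℂ} (hζ : ζ ^ 2 = -bdot z z) :
    (∫ W : Fin (n + 1) → ℂ, (W 0 * f (fun j => W ((0 : Fin (n + 1)).succAbove j))) *
        bdot ((0 : Fin (n + 1)).insertNth ζ z : Fin (n + 1) → ℂ) (star W) ^ (m + 1) *
        ((2 * (m + 1) + 2 * s * euclSq W) * (δ ^ 2 * (regSq (δ ^ 2) W)⁻¹ ^ 2) : ℝ) * gauss s W) -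
      (∫ W : Fin (n + 1) → ℂ, (W 0 * f (fun j => W ((0 : Fin (n + 1)).succAbove j))) *
        bdot ((0 : Fin (n + 1)).insertNth (-ζ) z : Fin (n + 1) → ℂ) (star W) ^ (m + 1) *
        ((2 * (m + 1) + 2 * s * euclSq W) * (δ ^ 2 * (regSq (δ ^ 2) W)⁻¹ ^ 2) : ℝ) * gauss s W) =
      2 * ζ * ∫ w, ∫ σ : ℂ, fibre s m f z w (-bdot w w + δ * σ) *
        (((1 + ‖σ‖ ^ 2) ^ 2)⁻¹ : ℝ) := by
  have hε : 0 < δ ^ 2 := by positivity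
  have hF := homogEntire_lift hf
  have hi : ∀ a : Fin (n + 1) → ℂ, Integrable fun W : Fin (n + 1) → ℂ =>
      (W 0 * f (fun j => W ((0 : Fin (n + 1)).succAbove j))) * bdot a (star W) ^ (m + 1) *
        ((2 * (m + 1) + 2 * s * euclSq W) * (δ ^ 2 * (regSq (δ ^ 2) W)⁻¹ ^ 2) : ℝ) *
        gauss s W := by
    intro a
    have hbs : ExpBdd fun W : Fin (n + 1) → ℂ => bdot a (star W) :=
      ((ExpBdd.bdot_left (star a)).star).mono fun W => by rw [star_bdot_star]
    have hreg : Continuous fun W : Fin (n + 1) → ℂ => (regSq (δ ^ 2) W)⁻¹ := by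
      refine Continuous.inv₀ ?_ fun W => (regSq_pos hε W).ne'
      unfold regSq; fun_prop
    have h1 : ExpBdd fun W : Fin (n + 1) → ℂ => (((2 * (m + 1) + 2 * s * euclSq W) *
        (δ ^ 2 * (regSq (δ ^ 2) W)⁻¹ ^ 2) : ℝ) : ℂ) := by
      have := ((ExpBdd.const (2 * (m + 1) : ℂ)).add ((ExpBdd.const (2 * s : ℂ)).mul
        (ExpBdd.euclSq (n := n + 1)))).mul ((ExpBdd.const (δ ^ 2 : ℂ)).mul
          ((expBdd_regSq_inv hε).pow 2))
      convert this using 2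
      push_cast; ring
    refine ((hF.expBdd.mul (hbs.pow _)).mul h1).integrable_mul_gauss ?_ hs
    have := hF.differentiable.continuous
    have hcs := continuous_star_pi (n := n + 1)
    refine Continuous.aestronglyMeasurable (Continuous.mul (Continuous.mul this ?_) ?_)
    · unfold bdot; fun_prop
    · fun_prop
  have h0 := integral_insertNth 0 ((hi ((0 : Fin (n + 1)).insertNth ζ z)).sub
    (hi ((0 : Fin (n + 1)).insertNth (-ζ) z)))
  simp only [Pi.sub_apply] at h0
  rw [← integral_sub (hi _) (hi _), h0, ← integral_const_mul]
  refine integral_congr_ae (Filter.Eventually.of_forall fun w => ?_)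
  simp only
  have hcf := continuous_fibre (s := s) m hf.differentiable.continuous z
  have hcfw : Continuous fun τ => fibre s m f z w τ :=
    hcf.comp (f := fun τ : ℂ => (w, τ)) (by fun_prop)
  have e1 : (∫ τ : ℂ, (‖τ‖ ^ 2 : ℝ) * (fibre s m f z w (τ ^ 2) *
      (δ ^ 2 * ((‖τ ^ 2 + bdot w w‖ ^ 2 + δ ^ 2)⁻¹) ^ 2 : ℝ))) = 2⁻¹ *
      ∫ τ, fibre s m f z w τ * (δ ^ 2 * ((‖τ + bdot w w‖ ^ 2 + δ ^ 2)⁻¹) ^ 2 : ℝ) := by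
    refine integral_sq (fun τ => fibre s m f z w τ *
      (δ ^ 2 * ((‖τ + bdot w w‖ ^ 2 + δ ^ 2)⁻¹) ^ 2 : ℝ)) ?_
    refine Continuous.aestronglyMeasurable (Continuous.mul hcfw
      (Complex.continuous_ofReal.comp (continuous_const.mul (Continuous.pow
        (Continuous.inv₀ (by fun_prop) fun τ => ?_) 2))))
    positivity
  rw [integral_rescale _ _ hδ] at e1
  have e2 : ∀ I J : ℂ, J = 2⁻¹ * I → 2 * ζ * I = 4 * ζ * J := by
    rintro I J rfl; ring
  rw [e2 _ _ e1, ← integral_const_mul]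
  refine integral_congr_ae (Filter.Eventually.of_forall fun ω => ?_)
  have hst : star ((0 : Fin (n + 1)).insertNth ω w : Fin (n + 1) → ℂ) =
      ((0 : Fin (n + 1)).insertNth (star ω) (star w) : Fin (n + 1) → ℂ) := by
    ext j
    refine Fin.succAboveCases 0 ?_ (fun i => ?_) j
    · simp
    · simp
  simp only [Fin.insertNth_apply_same, Fin.insertNth_apply_succAbove, hst,
    bdot_insertNth, euclSq_insertNth, regSq, gauss, fibre]
  have h3 := oddP_sq m (bdot z (star w)) (ζ * star ω)
  rw [mul_pow, hζ] at h3
  have h4 : ((‖ω‖ ^ 2 : ℝ) : ℂ) = ω * star ω := by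
    rw [← Complex.normSq_eq_norm_sq]; exact (Complex.mul_conj _).symm
  rw [h4, norm_pow, star_pow, ← sq ω]
  have h5 : (bdot z (star w) + ζ * star ω) = ζ * star ω + bdot z (star w) := add_comm _ _
  rw [h5, show bdot z (star w) - ζ * star ω = -ζ * star ω + bdot z (star w) by ring] at h3
  push_cast
  linear_combination (-ω * f w * ((2 * (m + 1) + 2 * s * (‖ω‖ ^ 2 + euclSq w)) *
    (δ ^ 2 * ((‖ω ^ 2 + bdot w w‖ ^ 2 + δ ^ 2 : ℂ)⁻¹) ^ 2)) *
      Complex.exp (-s * (‖ω‖ ^ 2 + euclSq w))) * h3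

theorem fibre_neg_bdot_self (s : ℝ) (m : ℕ) (f : (Fin n → ℂ) → ℂ) (z w : Fin n → ℂ) :
    fibre s m f z w (-bdot w w) = f w * homKer m z (star w) *
      ((m + 1 + s * nsq w : ℝ) * Real.exp (-s * nsq w) : ℝ) := by
  rw [fibre, homKer, norm_neg, star_neg, neg_mul_neg, bdot_star, nsq, add_comm ‖bdot w w‖]

/-- The identity `integral_regularised` for F(W) = W₀ f(W'), subtracted at the null vectors (±ζ, z)
with ζ² = -z • z. As ε → 0 one side becomes the Fock value of F(ζ, z) - F(-ζ, z) = 2ζ f(z), the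
other 2ζ times an integral over the quadric. Dividing by 2ζ needs z • z ≠ 0. -/
theorem reproduce_aux_of_ne (hn : 1 ≤ n) {s : ℝ} (hs : 0 < s) {m : ℕ} {f : (Fin n → ℂ) → ℂ}
    (hf : HomogEntire m f) {z : Fin n → ℂ} (hz : bdot z z ≠ 0) :
    s ^ 2 * ((m + 1).factorial * (Real.pi / s) ^ (n + 1) / s ^ (m + 1)) * f z =
      kap * ∫ w, f w * homKer m z (star w) *
        ((m + 1 + s * nsq w : ℝ) * Real.exp (-s * nsq w) : ℝ) := by
  obtain ⟨ζ, hζ⟩ := IsAlgClosed.exists_pow_nat_eq (-bdot z z) (n := 2) two_pos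
  have hζ0 : ζ ≠ 0 := by
    rintro rfl
    apply hz
    rw [zero_pow two_ne_zero] at hζ
    rw [← neg_eq_zero, ← hζ]
  have hF := homogEntire_lift hf
  set δ : ℕ → ℝ := fun k => 1 / ((k : ℝ) + 1) with hδ
  have hδp : ∀ k, 0 < δ k := fun k => by positivity
  have hδ0 : Filter.Tendsto δ Filter.atTop (nhds 0) := tendsto_one_div_add_atTop_nhds_zero_nat
  have hε0 : Filter.Tendsto (fun k => δ k ^ 2) Filter.atTop (nhds 0) := by
    simpa using hδ0.pow 2
  have t1 := tendsto_integral_regularised (n := n + 1) (by omega) hs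
    ((0 : Fin (n + 1)).insertNth ζ z : Fin (n + 1) → ℂ) hF (fun k => pow_pos (hδp k) 2) hε0
  have t2 := tendsto_integral_regularised (n := n + 1) (by omega) hs
    ((0 : Fin (n + 1)).insertNth (-ζ) z : Fin (n + 1) → ℂ) hF (fun k => pow_pos (hδp k) 2) hε0
  have t3 := (t1.sub t2).const_mul ((s : ℂ) ^ 2)
  have t4 := (tendsto_integral_fibre hs m hf.differentiable.continuous hf.expBdd z hδ0).const_mul
    (2 * ζ)
  have ha : ∀ ξ : ℂ, ξ ^ 2 = -bdot z z → bdot ((0 : Fin (n + 1)).insertNth ξ z : Fin (n + 1) → ℂ)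
      ((0 : Fin (n + 1)).insertNth ξ z : Fin (n + 1) → ℂ) = 0 := by
    intro ξ hξ
    rw [bdot_insertNth, ← sq, hξ]; ring
  have e := tendsto_nhds_unique (t3.congr fun k => ?_) t4
  · simp only [fibre_neg_bdot_self, Fin.insertNth_apply_same,
      Fin.insertNth_apply_succAbove] at e
    have : (2 * ζ) ≠ 0 := by simpa using hζ0
    refine mul_left_cancel₀ this ?_
    linear_combination e
  · rw [mul_sub, integral_regularised hs (pow_pos (hδp k) 2) (ha ζ hζ) m hF.differentiable
      hF.expBdd, integral_regularised hs (pow_pos (hδp k) 2) (ha (-ζ) (by rw [neg_sq, hζ])) m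
      hF.differentiable hF.expBdd, integral_lift hs (hδp k) hf hζ]

theorem ExpBdd.nsq : ExpBdd fun z : Fin n → ℂ => (nsq z : ℂ) := by
  refine (ExpBdd.const (2 : ℂ) |>.mul ExpBdd.euclSq).mono fun z => ?_
  rw [norm_mul, Complex.norm_real, Complex.norm_real, Real.norm_of_nonneg (nsq_nonneg z),
    Real.norm_of_nonneg (euclSq_nonneg z)]
  simpa using nsq_le_two_mul_euclSq z

theorem dense_bdot_self_ne_zero (hn : 1 ≤ n) : Dense {z : Fin n → ℂ | bdot z z ≠ 0} :=
  Measure.dense_of_ae (ae_bdot_self_ne_zero hn)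

/-- Both sides are continuous in z, by finite rank of the kernel for the integral, and the set z • z
≠ 0 is dense. -/
theorem reproduce_aux (hn : 1 ≤ n) {s : ℝ} (hs : 0 < s) {m : ℕ} {f : (Fin n → ℂ) → ℂ}
    (hf : HomogEntire m f) (z : Fin n → ℂ) :
    s ^ 2 * ((m + 1).factorial * (Real.pi / s) ^ (n + 1) / s ^ (m + 1)) * f z =
      kap * ∫ w, f w * homKer m z (star w) *
        ((m + 1 + s * nsq w : ℝ) * Real.exp (-s * nsq w) : ℝ) := by
  have hfc := hf.differentiable.continuous
  have hcont : Continuous fun z => ∫ w, f w * homKer m z (star w) *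
      ((m + 1 + s * nsq w : ℝ) * Real.exp (-s * nsq w) : ℝ) := by
    obtain ⟨ι, _, a, c, ha, hc, h⟩ := finRank_homKer (n := n) m
    have : ∀ z, ∫ w, f w * homKer m z (star w) *
        ((m + 1 + s * nsq w : ℝ) * Real.exp (-s * nsq w) : ℝ) =
        ∑ i, a i z * ∫ w, f w * c i (star w) *
          ((m + 1 + s * nsq w : ℝ) * Real.exp (-s * nsq w) : ℝ) := by
      intro z
      simp only [← integral_const_mul]
      rw [← integral_finsetSum]
      · congr 1; funext w
        rw [h, Finset.mul_sum, Finset.sum_mul]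
        exact Finset.sum_congr rfl fun i _ => by ring
      · intro i _
        refine Integrable.const_mul ?_ _
        have hci : ExpBdd fun w => c i (star w) := by
          obtain ⟨C, A, hC, hA, hb⟩ := (hc i).expBdd
          exact ⟨C, A, hC, hA, fun w => (hb _).trans_eq (by rw [norm_star])⟩
        have := ((hf.expBdd.mul hci).mul ((ExpBdd.const (m + 1 : ℂ)).add
          ((ExpBdd.const (s : ℂ)).mul ExpBdd.nsq))).integrable_mul_exp_nsq
          (Continuous.aestronglyMeasurable ?_) hs
        · refine this.congr (Filter.Eventually.of_forall fun w => ?_)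
          simp only
          push_cast; ring
        · have h1 := (hc i).differentiable.continuous.comp (continuous_star_pi (n := n))
          have h2 : Continuous fun w => c i (star w) := h1
          have h3 : Continuous fun w : Fin n → ℂ => (nsq w : ℂ) :=
            Complex.continuous_ofReal.comp continuous_nsq
          exact (hfc.mul h2).mul (continuous_const.add (continuous_const.mul h3))
    simp only [this]
    exact continuous_finsetSum _ fun i _ =>
      (ha i).differentiable.continuous.mul continuous_const
  exact congrFun (Continuous.ext_on (dense_bdot_self_ne_zero hn) (continuous_const.mul hfc)
    (continuous_const.mul hcont) fun z hz => reproduce_aux_of_ne hn hs hf hz) z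

end Reproduce

/-! ### Euler's identity and the normalising constants -/

section Scaling
variable {n : ℕ}

/-- By dilation, r^{2(k+n)} ∫ Ψ e^{-r² nsq} is constant in r > 0. Differentiating at r = √s gives
the identity. -/
theorem integral_nsq_mul {s : ℝ} (hs : 0 < s) {k : ℕ} {Ψ : (Fin n → ℂ) → ℂ} (hc : Continuous Ψ)
    (hb : ExpBdd Ψ) (hΨ : ∀ (t : ℝ) w, Ψ ((t : ℂ) • w) = t ^ (2 * k) * Ψ w) :
    ∫ w, Ψ w * (s * nsq w * Real.exp (-s * nsq w) : ℝ) =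
      (k + n) * ∫ w, Ψ w * (Real.exp (-s * nsq w) : ℝ) := by
  set r₀ := Real.sqrt s with hr₀
  have hr0 : 0 < r₀ := Real.sqrt_pos.mpr hs
  have hr2 : r₀ ^ 2 = s := Real.sq_sqrt hs.le
  set J : ℝ → ℂ := fun r => ∫ w, Ψ w * (Real.exp (-r ^ 2 * nsq w) : ℝ) with hJ
  have hscale : ∀ r : ℝ, 0 < r → (r : ℂ) ^ (2 * (k + n)) * J r = J 1 := by
    intro r hr
    have h := Measure.integral_comp_smul (volume : Measure (Fin n → ℂ))
      (fun w => Ψ w * (Real.exp (-1 ^ 2 * nsq w) : ℝ)) r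
    have hfin : Module.finrank ℝ (Fin n → ℂ) = 2 * n := by
      rw [Module.finrank_pi_fintype]; simp [mul_comm]
    rw [hfin, abs_of_pos (by positivity), eq_inv_smul_iff₀ (by positivity)] at h
    simp only [hJ]
    rw [← h, Complex.real_smul, mul_add, pow_add, mul_comm ((r : ℂ) ^ _), mul_assoc,
      ← integral_const_mul]
    push_cast
    congr 1
    refine integral_congr_ae (Filter.Eventually.of_forall fun w => ?_)
    have e : r • w = (r : ℂ) • w := by ext j; simp
    simp only [e, hΨ, nsq_smul, Complex.norm_real, Real.norm_of_nonneg hr.le]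
    push_cast
    rw [one_pow, neg_one_mul, neg_mul]
    ring
  have hint : ∀ r, 0 < r → Integrable fun w => Ψ w * (Real.exp (-r ^ 2 * nsq w) : ℝ) := by
    intro r hr
    have := hb.integrable_mul_exp_nsq hc.aestronglyMeasurable (c := r ^ 2) (by positivity)
    simpa using this
  have hnc : Continuous fun w : Fin n → ℂ => nsq w := continuous_nsq
  have hd := hasDerivAt_integral_of_dominated_loc_of_deriv_le (μ := volume)
    (F := fun (r : ℝ) w => Ψ w * (Real.exp (-r ^ 2 * nsq w) : ℝ))
    (F' := fun (r : ℝ) w => Ψ w * (Real.exp (-r ^ 2 * nsq w) * (-(2 * r) * nsq w) : ℝ))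
    (x₀ := r₀) (s := Metric.ball r₀ (r₀ / 2))
    (bound := fun w => 3 * r₀ * ‖Ψ w * nsq w * (Real.exp (-(r₀ / 2) ^ 2 * nsq w) : ℝ)‖)
    (Metric.ball_mem_nhds _ (by positivity))
    (Filter.Eventually.of_forall fun r => Continuous.aestronglyMeasurable (by fun_prop))
    (hint r₀ hr0) (Continuous.aestronglyMeasurable (by fun_prop)) ?_ ?_ ?_
  · have hd2 := hd.2
    have h1 : HasDerivAt (fun r : ℝ => (r : ℂ) ^ (2 * (k + n)))
        ((2 * (k + n) : ℕ) * (r₀ : ℂ) ^ (2 * (k + n) - 1)) r₀ := by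
      have := (hasDerivAt_pow (2 * (k + n)) (r₀ : ℂ)).comp_ofReal
      simpa using this
    have h2 := h1.mul hd2
    have h3 : HasDerivAt (fun _ : ℝ => J 1) 0 r₀ := hasDerivAt_const _ _
    have h4 : HasDerivAt (fun r : ℝ => (r : ℂ) ^ (2 * (k + n)) * J r) 0 r₀ := by
      refine h3.congr_of_eventuallyEq ?_
      filter_upwards [lt_mem_nhds hr0] with r hr
      exact hscale r hr
    have h5 := h2.unique h4
    have h6 : ∫ w, Ψ w * (Real.exp (-r₀ ^ 2 * nsq w) * (-(2 * r₀) * nsq w) : ℝ) =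
        -(2 * r₀) * (∫ w, Ψ w * (nsq w * Real.exp (-s * nsq w) : ℝ)) := by
      rw [← integral_const_mul]
      congr 1; funext w
      rw [hr2]; push_cast; ring
    have h7 : ∫ w, Ψ w * (s * nsq w * Real.exp (-s * nsq w) : ℝ) =
        s * ∫ w, Ψ w * (nsq w * Real.exp (-s * nsq w) : ℝ) := by
      rw [← integral_const_mul]
      congr 1; funext w
      push_cast; ring
    rw [h6] at h5
    rw [h7]
    have hr2' : (r₀ : ℂ) ^ 2 = s := by exact_mod_cast hr2
    rw [hr2] at h5
    have hr0' : (r₀ : ℂ) ≠ 0 := by exact_mod_cast hr0.ne'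
    -- For k + n = 0 the exponent `2 * (k + n) - 1` is truncated, so this case is separate.
    rcases Nat.eq_zero_or_pos (k + n) with h0 | h0
    · have hk : k = 0 := by omega
      have hn : n = 0 := by omega
      subst hk hn
      simp only [add_zero, mul_zero, Nat.cast_zero, zero_mul, pow_zero, one_mul, zero_add] at h5 ⊢
      rw [mul_eq_zero] at h5
      rcases h5 with h5 | h5
      · simp [hr0'] at h5
      · rw [h5, mul_zero]
    · obtain ⟨N, hN⟩ := Nat.exists_eq_add_of_le' h0
      rw [hN] at h5
      have hkn : (k : ℂ) + n = N + 1 := by exact_mod_cast hN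
      rw [hkn, ← hr2']
      have h8 : (r₀ : ℂ) ^ (2 * (N + 1) - 1) ≠ 0 := pow_ne_zero _ hr0'
      have h9 : (r₀ : ℂ) ^ (2 * (N + 1)) = (r₀ : ℂ) ^ (2 * (N + 1) - 1) * r₀ := by
        rw [← pow_succ]; congr 1
      rw [h9] at h5
      have h10 : (2 * (N + 1) : ℂ) * (∫ w, Ψ w * (Real.exp (-s * nsq w) : ℝ)) +
          r₀ * (-(2 * r₀) * (∫ w, Ψ w * (nsq w * Real.exp (-s * nsq w) : ℝ))) = 0 := by
        refine (mul_eq_zero.mp ?_).resolve_left h8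
        push_cast at h5 ⊢
        linear_combination h5
      linear_combination (-1 / 2 : ℂ) * h10
  · refine Filter.Eventually.of_forall fun w r hr => ?_
    rw [Metric.mem_ball, Real.dist_eq, abs_lt] at hr
    have hq := nsq_nonneg w
    have hrp : 0 < r := by linarith
    rw [norm_mul, norm_mul, norm_mul, Complex.norm_real, Complex.norm_real, Complex.norm_real,
      Real.norm_of_nonneg hq, Real.norm_of_nonneg (Real.exp_pos _).le, norm_mul,
      Real.norm_of_nonneg (Real.exp_pos _).le, norm_mul, norm_neg, Real.norm_of_nonneg hq,
      Real.norm_of_nonneg (by linarith : 0 ≤ 2 * r)]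
    have h1 : Real.exp (-r ^ 2 * nsq w) ≤ Real.exp (-(r₀ / 2) ^ 2 * nsq w) := by
      rw [Real.exp_le_exp]
      have : (r₀ / 2) ^ 2 ≤ r ^ 2 := by gcongr; linarith
      nlinarith
    calc ‖Ψ w‖ * (Real.exp (-r ^ 2 * nsq w) * (2 * r * nsq w))
        ≤ ‖Ψ w‖ * (Real.exp (-(r₀ / 2) ^ 2 * nsq w) * (3 * r₀ * nsq w)) := by
          gcongr ‖Ψ w‖ * (?_ * (?_ * nsq w))
          linarith
      _ = _ := by ring
  · have := (hb.mul ExpBdd.nsq).integrable_mul_exp_nsq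
      (Continuous.aestronglyMeasurable (by fun_prop)) (c := (r₀ / 2) ^ 2) (by positivity)
    have h2 := this.norm.const_mul (3 * r₀)
    simpa using h2
  · refine Filter.Eventually.of_forall fun w r _ => ?_
    have h1 : HasDerivAt (fun r : ℝ => -r ^ 2 * nsq w) (-(2 * r) * nsq w) r := by
      simpa using ((hasDerivAt_pow 2 r).neg.mul_const (nsq w))
    exact (h1.exp.ofReal_comp).const_mul (Ψ w)

/-- The normalising constants of the homogeneous kernels. -/
noncomputable def normConst (n : ℕ) (s : ℝ) (m : ℕ) : ℝ :=
  (m + 1).factorial * Real.pi ^ (n + 1) / (kap * s ^ (m + n) * (2 * m + n + 1))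

theorem normConst_pos {s : ℝ} (hs : 0 < s) (m : ℕ) : 0 < normConst n s m := by
  have := kap_pos
  have := Real.pi_pos
  unfold normConst
  positivity

/-- Let I be the integral with plain Gaussian weight. Euler's identity turns the weight m + 1 + s
nsq of `reproduce_aux` into the factor (m + 1) + (m + n), whence 2m + n + 1 in `normConst`. The
weight α + β s nsq then contributes α + β (m + n). -/
theorem integral_homKer (hn : 1 ≤ n) {s : ℝ} (hs : 0 < s) {m : ℕ} {f : (Fin n → ℂ) → ℂ}
    (hf : HomogEntire m f) (z : Fin n → ℂ) (α β : ℝ) :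
    ∫ w, homKer m z (star w) * ((α + β * (s * nsq w)) * Real.exp (-s * nsq w) : ℝ) * f w =
      normConst n s m * (α + β * (m + n)) * f z := by
  have hfc := hf.differentiable.continuous
  have hkc := continuous_homKer_star m z
  have hnc : Continuous fun w : Fin n → ℂ => nsq w := continuous_nsq
  set Ψ : (Fin n → ℂ) → ℂ := fun w => f w * homKer m z (star w) with hΨ
  have hb : ExpBdd Ψ := hf.expBdd.mul (expBdd_homKer_star m z)
  have hc : Continuous Ψ := hfc.mul hkc
  have h1 := integral_nsq_mul hs hc hb (k := m) (fun t w => by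
    have e : star ((t : ℂ) • w) = (t : ℂ) • star w := by
      rw [star_smul]; congr 1; exact Complex.conj_ofReal t
    have e2 := (homogEntire_homKer m z).smul t (star w)
    rw [homKer_comm, homKer_comm m _ z] at e2
    simp only [hΨ]
    rw [e, e2, hf.smul]; ring)
  have i1 : Integrable fun w => Ψ w * (Real.exp (-s * nsq w) : ℝ) :=
    hb.integrable_mul_exp_nsq hc.aestronglyMeasurable hs
  have i2 : Integrable fun w => Ψ w * (s * nsq w * Real.exp (-s * nsq w) : ℝ) := by
    have := ((hb.mul ((ExpBdd.const (s : ℂ)).mul ExpBdd.nsq))).integrable_mul_exp_nsq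
      (Continuous.aestronglyMeasurable (by fun_prop)) hs
    refine this.congr (Filter.Eventually.of_forall fun w => ?_)
    simp only; push_cast; ring
  have hlin : ∀ α β : ℝ, ∫ w, Ψ w * ((α + β * (s * nsq w)) * Real.exp (-s * nsq w) : ℝ) =
      α * (∫ w, Ψ w * (Real.exp (-s * nsq w) : ℝ)) +
      β * ∫ w, Ψ w * (s * nsq w * Real.exp (-s * nsq w) : ℝ) := by
    intro α β
    rw [← integral_const_mul, ← integral_const_mul, ← integral_add (i1.const_mul _)
      (i2.const_mul _)]
    congr 1; funext w
    push_cast; ring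
  have h2 := reproduce_aux hn hs hf z
  have h3 : ∫ w, f w * homKer m z (star w) *
      ((m + 1 + s * nsq w : ℝ) * Real.exp (-s * nsq w) : ℝ) =
      (m + 1) * (∫ w, Ψ w * (Real.exp (-s * nsq w) : ℝ)) +
      ∫ w, Ψ w * (s * nsq w * Real.exp (-s * nsq w) : ℝ) := by
    have := hlin (m + 1) 1
    simp only [one_mul, Complex.ofReal_one, hΨ] at this ⊢
    rw [this]; push_cast; ring
  rw [h3, h1] at h2
  have h4 : ∫ w, homKer m z (star w) * ((α + β * (s * nsq w)) * Real.exp (-s * nsq w) : ℝ) * f w =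
      ∫ w, Ψ w * ((α + β * (s * nsq w)) * Real.exp (-s * nsq w) : ℝ) := by
    congr 1; funext w; simp only [hΨ]; ring
  rw [h4, hlin, h1]
  have hk : (kap : ℂ) ≠ 0 := by exact_mod_cast kap_pos.ne'
  have hmn : (2 * m + n + 1 : ℂ) ≠ 0 := by exact_mod_cast (by positivity : (2 * m + n + 1 : ℕ) ≠ 0)
  have hs' : (s : ℂ) ≠ 0 := by exact_mod_cast hs.ne'
  have h5 : (∫ w, Ψ w * (Real.exp (-s * nsq w) : ℝ)) = normConst n s m * f z := by
    have e : (s : ℂ) ^ 2 * ((m + 1).factorial * (Real.pi / s) ^ (n + 1) / s ^ (m + 1)) =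
        (m + 1).factorial * Real.pi ^ (n + 1) / s ^ (m + n) := by
      rw [div_pow, pow_add (s : ℂ) m n, pow_succ (s : ℂ) m, pow_succ (s : ℂ) n]
      field_simp
    rw [e] at h2
    have e2 : (normConst n s m : ℂ) = (m + 1).factorial * Real.pi ^ (n + 1) / s ^ (m + n) /
        (kap * (2 * m + n + 1)) := by
      rw [normConst]; push_cast
      field_simp
    rw [e2, div_mul_eq_mul_div, h2, eq_div_iff (mul_ne_zero hk hmn)]
    ring
  rw [h5]; ring

end Scaling

/-! ### The kernels K_b and their action on homogeneous expansions -/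

section Kernel
variable {n : ℕ}

/-- The coefficients of the reproducing kernels. -/
noncomputable def kerCoef (n : ℕ) (s b : ℝ) (m : ℕ) : ℝ := (m + n + 1 : ℝ) ^ b / normConst n s m

theorem kerCoef_pos {s : ℝ} (hs : 0 < s) (b : ℝ) (m : ℕ) : 0 < kerCoef n s b m :=
  div_pos (by positivity) (normConst_pos hs m)

theorem exists_rpow_le_exp (b : ℝ) : ∃ C, 0 < C ∧ ∀ R : ℝ, 0 ≤ R → (1 + R) ^ b ≤ C * Real.exp R := by
  obtain ⟨C, hC, h⟩ := exists_one_add_pow_mul_exp_le ⌈b⌉₊ one_pos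
  refine ⟨C, hC, fun R hR => ?_⟩
  have h1 := h R hR
  rw [one_mul, Real.exp_neg, ← div_eq_mul_inv, div_le_iff₀ (Real.exp_pos _)] at h1
  refine le_trans ?_ h1
  rw [← Real.rpow_natCast]
  exact Real.rpow_le_rpow_of_exponent_le (by linarith) (Nat.le_ceil b)

/-- The factorial sits in `normConst`; the polynomial factors are dominated by e^{m+n}. -/
theorem exists_kerCoef_le (n : ℕ) {s : ℝ} (hs : 0 < s) (b : ℝ) :
    ∃ C A, 0 < C ∧ 0 < A ∧ ∀ m, kerCoef n s b m * (m + 1) ≤ C * (A ^ m / m.factorial) := by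
  obtain ⟨C, hC, h⟩ := exists_rpow_le_exp (b + 1)
  have hk := kap_pos
  have hπ := Real.pi_pos
  refine ⟨2 * C * Real.exp n * kap * s ^ n / Real.pi ^ (n + 1), Real.exp 1 * s, by positivity,
    by positivity, fun m => ?_⟩
  have h1 := h (m + n) (by positivity)
  rw [Real.rpow_add_one (by positivity)] at h1
  have e : kerCoef n s b m * (m + 1) = ((1 + (m + n : ℝ)) ^ b * (2 * m + n + 1)) *
      (kap * s ^ (m + n) / (m.factorial * Real.pi ^ (n + 1))) := by
    rw [kerCoef, normConst, Nat.factorial_succ, add_comm 1 (m + n : ℝ)]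
    push_cast
    field_simp
  have h2 : (1 + (m + n : ℝ)) ^ b * (2 * m + n + 1) ≤ 2 * (C * Real.exp (m + n)) := by
    refine le_trans ?_ (mul_le_mul_of_nonneg_left h1 two_pos.le)
    rw [mul_left_comm]
    gcongr
    have : (0 : ℝ) ≤ n := by positivity
    linarith
  rw [e]
  refine (mul_le_mul_of_nonneg_right h2 (by positivity)).trans_eq ?_
  rw [Real.exp_add, mul_pow, ← Real.exp_nat_mul, mul_one, pow_add]
  field_simp

/-- The kernel `∑ (m+n+1)^b X_m⁻¹ P_m`. -/
noncomputable def ker (n : ℕ) (s b : ℝ) (z u : Fin n → ℂ) : ℂ :=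
  ∑' m, kerCoef n s b m * homKer m z u

theorem exists_norm_kerCoef_mul_le (n : ℕ) {s : ℝ} (hs : 0 < s) (b : ℝ) :
    ∃ C A, 0 < C ∧ 0 < A ∧ ∀ m (z u : Fin n → ℂ),
      ‖kerCoef n s b m * homKer m z u‖ ≤ C * ((A * Nstar z * Nstar u) ^ m / m.factorial) := by
  obtain ⟨C, A, hC, hA, h⟩ := exists_kerCoef_le n hs b
  refine ⟨C, A, hC, hA, fun m z u => ?_⟩
  have hp := kerCoef_pos (n := n) hs b m
  have hz := Nstar_nonneg z
  have hu := Nstar_nonneg u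
  rw [norm_mul, Complex.norm_real, Real.norm_of_nonneg hp.le]
  calc kerCoef n s b m * ‖homKer m z u‖
      ≤ kerCoef n s b m * ((m + 1) * (Nstar z * Nstar u) ^ m) := by
        gcongr; exact norm_homKer_le m z u
    _ = (kerCoef n s b m * (m + 1)) * (Nstar z * Nstar u) ^ m := by ring
    _ ≤ (C * (A ^ m / m.factorial)) * (Nstar z * Nstar u) ^ m :=
        mul_le_mul_of_nonneg_right (h m) (by positivity)
    _ = _ := by rw [mul_assoc A, mul_pow]; ring

theorem hasSum_ker {s : ℝ} (hs : 0 < s) (b : ℝ) (z u : Fin n → ℂ) :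
    HasSum (fun m => kerCoef n s b m * homKer m z u) (ker n s b z u) := by
  obtain ⟨C, A, hC, hA, h⟩ := exists_norm_kerCoef_mul_le n hs b
  exact (Summable.of_norm_bounded ((Real.summable_pow_div_factorial _).mul_left C)
    fun m => h m z u).hasSum

/-- Integrability against all Gaussian-type kernels. -/
def GaussInt (s : ℝ) (h : (Fin n → ℂ) → ℂ) : Prop :=
  ∀ A : ℝ, Integrable fun w => ‖h w‖ * Real.exp (A * Nstar w - s * nsq w)

/-- The kernel acts diagonally on the homogeneous expansion. Term by term, rotation averaging
replaces h by its component of degree m, `integral_homKer` evaluates the result, and `normConst`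
cancels against the coefficient of the kernel. The freedom in `A` in `GaussInt` pays for the factor
e^{A N_*(z) N_*(w)} that dominates the series. -/
theorem GaussInt.hasSum_integral (hn : 1 ≤ n) {s : ℝ} (hs : 0 < s) (b : ℝ)
    {h : (Fin n → ℂ) → ℂ} (hd : Differentiable ℂ h) (hi : GaussInt s h) (z : Fin n → ℂ)
    (α β : ℝ) : HasSum (fun m : ℕ => ((m + n + 1 : ℝ) ^ b * (α + β * (m + n)) : ℝ) * hcomp m h z)
      (∫ w, ker n s b z (star w) * ((α + β * (s * nsq w)) * Real.exp (-s * nsq w) : ℝ) * h w) := by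
  obtain ⟨C, A, hC, hA, hCA⟩ := exists_norm_kerCoef_mul_le n hs b
  have hhc := hd.continuous
  have hnc : Continuous fun w : Fin n → ℂ => nsq w := continuous_nsq
  set H : (Fin n → ℂ) → ℝ := fun w => ‖h w‖ * ((|α| + |β| * (s * nsq w)) *
    Real.exp (-s * nsq w)) with hH
  have hnz := Nstar_nonneg z
  have hHb : ∀ B : ℝ, 0 ≤ B → ∀ w, H w * Real.exp (B * Nstar w) ≤ (|α| + 2 * |β| * s) *
      (‖h w‖ * Real.exp ((B + 1) * Nstar w - s * nsq w)) := by
    intro B hB w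
    have hw := Nstar_nonneg w
    have h1 : nsq w ≤ 2 * Real.exp (Nstar w) := by
      rw [← Nstar_sq]
      have := Real.pow_div_factorial_le_exp (Nstar w) hw 2
      rw [div_le_iff₀ (by positivity)] at this
      simpa [mul_comm] using this
    have h2 : |α| ≤ |α| * Real.exp (Nstar w) :=
      le_mul_of_one_le_right (abs_nonneg _) (Real.one_le_exp hw)
    have h3 : |α| + |β| * (s * nsq w) ≤ (|α| + 2 * |β| * s) * Real.exp (Nstar w) := by
      have : |β| * (s * nsq w) ≤ |β| * (s * (2 * Real.exp (Nstar w))) := by gcongr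
      nlinarith
    have h4 : Real.exp ((B + 1) * Nstar w - s * nsq w) =
        Real.exp (Nstar w) * Real.exp (-s * nsq w) * Real.exp (B * Nstar w) := by
      rw [← Real.exp_add, ← Real.exp_add]; congr 1; ring
    rw [h4]
    calc H w * Real.exp (B * Nstar w) ≤ ‖h w‖ * (((|α| + 2 * |β| * s) * Real.exp (Nstar w)) *
          Real.exp (-s * nsq w)) * Real.exp (B * Nstar w) := by
          simp only [hH]; gcongr
      _ = _ := by ring
  have hint : ∀ B : ℝ, 0 ≤ B → Integrable fun w => H w * Real.exp (B * Nstar w) := by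
    intro B hB
    refine ((hi (B + 1)).const_mul (|α| + 2 * |β| * s)).mono'
      (Continuous.aestronglyMeasurable ?_) (Filter.Eventually.of_forall fun w => ?_)
    · have := continuous_Nstar (n := n)
      simp only [hH]; fun_prop
    · rw [Real.norm_of_nonneg]
      · exact hHb B hB w
      · have := nsq_nonneg w
        positivity
  have hle : ∀ w, |(α + β * (s * nsq w)) * Real.exp (-s * nsq w)| * ‖h w‖ ≤ H w := by
    intro w
    have := nsq_nonneg w
    rw [abs_mul, Real.abs_exp, mul_comm]
    simp only [hH]
    gcongr
    refine (abs_add_le _ _).trans_eq ?_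
    rw [abs_mul, abs_of_nonneg (by positivity : 0 ≤ s * nsq w)]
  have hterm : ∀ m w, ‖(kerCoef n s b m * homKer m z (star w)) *
      ((α + β * (s * nsq w)) * Real.exp (-s * nsq w) : ℝ) * h w‖ ≤
      C * ((A * Nstar z * Nstar w) ^ m / m.factorial) * H w := by
    intro m w
    rw [norm_mul, norm_mul, Complex.norm_real, Real.norm_eq_abs, mul_assoc]
    have := hCA m z (star w)
    rw [Nstar_star] at this
    exact mul_le_mul this (hle w) (by positivity)
      (by have := Nstar_nonneg w; positivity)
  have hmeas : ∀ m, Continuous fun w => (kerCoef n s b m * homKer m z (star w)) *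
      ((α + β * (s * nsq w)) * Real.exp (-s * nsq w) : ℝ) * h w := by
    intro m
    have := continuous_homKer_star m z
    fun_prop
  have htsum : ∀ w, HasSum (fun m : ℕ => C * ((A * Nstar z * Nstar w) ^ m / m.factorial) * H w)
      (C * Real.exp (A * Nstar z * Nstar w) * H w) := by
    intro w
    refine (HasSum.mul_left C ?_).mul_right _
    rw [Real.exp_eq_exp_ℝ]
    exact NormedSpace.expSeries_div_hasSum_exp (𝔸 := ℝ) _
  have hmain := hasSum_integral_of_dominated_convergence
    (F := fun m w => (kerCoef n s b m * homKer m z (star w)) *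
      ((α + β * (s * nsq w)) * Real.exp (-s * nsq w) : ℝ) * h w)
    (f := fun w => ker n s b z (star w) * ((α + β * (s * nsq w)) * Real.exp (-s * nsq w) : ℝ) * h w)
    (μ := volume) (fun m w => C * ((A * Nstar z * Nstar w) ^ m / m.factorial) * H w)
    (fun m => (hmeas m).aestronglyMeasurable)
    (fun m => Filter.Eventually.of_forall (hterm m))
    (Filter.Eventually.of_forall fun w => (htsum w).summable) ?_
    (Filter.Eventually.of_forall fun w => ((hasSum_ker hs b z (star w)).mul_right _).mul_right _)
  · refine cast (congrArg (fun F => HasSum F _) (funext fun m => ?_)) hmain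
    refine Eq.symm ?_
    set Φ : (Fin n → ℂ) → ℂ := fun w => homKer m z (star w) *
      ((α + β * (s * nsq w)) * Real.exp (-s * nsq w) : ℝ) with hΦ
    have hcoef : (kerCoef n s b m : ℂ) ≠ 0 := by exact_mod_cast (kerCoef_pos hs b m).ne'
    have hΦc : Continuous fun w => Φ w * h w := by
      have := continuous_homKer_star m z
      simp only [hΦ]; fun_prop
    have hΦi : Integrable fun w => Φ w * h w := by
      have h1 : Integrable fun w => (kerCoef n s b m : ℂ) * (Φ w * h w) := by
        refine ((hint (A * Nstar z) (by positivity)).const_mul C).mono'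
          (continuous_const.mul hΦc).aestronglyMeasurable (Filter.Eventually.of_forall fun w => ?_)
        have h2 := hterm m w
        have hw := Nstar_nonneg w
        have hq := nsq_nonneg w
        have h3 := Real.pow_div_factorial_le_exp (A * Nstar z * Nstar w) (by positivity) m
        calc ‖(kerCoef n s b m : ℂ) * (Φ w * h w)‖ = ‖(kerCoef n s b m * homKer m z (star w)) *
              ((α + β * (s * nsq w)) * Real.exp (-s * nsq w) : ℝ) * h w‖ := by
              simp only [hΦ]; congr 1; ring
          _ ≤ C * ((A * Nstar z * Nstar w) ^ m / m.factorial) * H w := h2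
          _ ≤ C * Real.exp (A * Nstar z * Nstar w) * H w := by
              have : 0 ≤ H w := by simp only [hH]; positivity
              gcongr
          _ = _ := by ring
      have h2 := h1.const_mul (kerCoef n s b m : ℂ)⁻¹
      simpa only [inv_mul_cancel_left₀ hcoef] using h2
    have e1 := integral_mul_eq_integral_mul_hcomp m (Φ := Φ) (h := h) (fun c hc w => by
      have e : star (c • w) = c⁻¹ • star w := by
        rw [star_smul]; congr 1
        exact (Complex.inv_eq_conj hc).symm
      have e2 := (homogEntire_homKer m z).smul c⁻¹ (star w)
      rw [homKer_comm, homKer_comm m _ z] at e2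
      simp only [hΦ]
      rw [e, e2, nsq_smul, hc, zpow_neg, zpow_natCast, inv_pow]
      simp only [one_pow, one_mul]
      ring) hΦc.measurable hΦi
    rw [integral_homKer hn hs (homogEntire_hcomp m hd) z α β] at e1
    have e2 : ∫ w, kerCoef n s b m * homKer m z (star w) *
        ((α + β * (s * nsq w)) * Real.exp (-s * nsq w) : ℝ) * h w =
        kerCoef n s b m * ∫ w, Φ w * h w := by
      rw [← integral_const_mul]
      congr 1; funext w; simp only [hΦ]; ring
    have hX : (normConst n s m : ℂ) ≠ 0 := by exact_mod_cast (normConst_pos hs m).ne'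
    rw [e2, e1, kerCoef]
    push_cast
    field_simp
  · have := (hint (A * Nstar z) (by positivity)).const_mul C
    refine this.congr (Filter.Eventually.of_forall fun w => ?_)
    simp only
    rw [(htsum w).tsum_eq]; ring

end Kernel

/-! ### Exponential sums with integral powers -/

section ExpSums

/-- The sums `∑ (k + c)^j x^k / k!`. -/
noncomputable def expSum : ℕ → ℕ → ℂ → ℂ
  | _, 0, x => Complex.exp x
  | c, j + 1, x => c * expSum c j x + x * expSum (c + 1) j x

theorem hasSum_expSum (c j : ℕ) (x : ℂ) :
    HasSum (fun k : ℕ => (k + c : ℂ) ^ j * (x ^ k / k.factorial)) (expSum c j x) := by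
  induction j generalizing c with
  | zero =>
    simp only [pow_zero, one_mul, expSum, Complex.exp_eq_exp_ℂ]
    exact NormedSpace.expSeries_div_hasSum_exp (𝔸 := ℂ) x
  | succ j ih =>
    have h1 := (ih c).mul_left (c : ℂ)
    have h2 : HasSum (fun k : ℕ => (k : ℂ) * (k + c) ^ j * (x ^ k / k.factorial))
        (x * expSum (c + 1) j x) := by
      rw [← hasSum_nat_add_iff' 1]
      simp only [Finset.range_one, Finset.sum_singleton, Nat.cast_zero, zero_mul, sub_zero]
      refine cast (congrArg (fun F => HasSum F _) (funext fun k => ?_)) ((ih (c + 1)).mul_left x)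
      rw [Nat.factorial_succ]
      have : (k.factorial : ℂ) ≠ 0 := by exact_mod_cast k.factorial_ne_zero
      have h3 : (k + 1 : ℂ) ≠ 0 := by exact_mod_cast k.succ_ne_zero
      push_cast
      field_simp
      ring
    refine cast (congrArg (fun F => HasSum F _) (funext fun k => ?_)) (h1.add h2)
    ring

theorem norm_exp_le_exp_max (x : ℂ) : ‖Complex.exp x‖ ≤ Real.exp (max x.re 0) := by
  rw [Complex.norm_exp]; gcongr; exact le_max_left _ _

/-- Mean value inequality along t ↦ e^{tx}. Keeping Re x instead of |x| in the exponent is essential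
for the off-diagonal decay. -/
theorem norm_exp_sub_one_le_max (x : ℂ) :
    ‖Complex.exp x - 1‖ ≤ ‖x‖ * Real.exp (max x.re 0) := by
  have h : ∀ t ∈ Set.Icc (0 : ℝ) 1, HasDerivWithinAt (fun t : ℝ => Complex.exp (t * x))
      (Complex.exp (t * x) * x) (Set.Icc 0 1) t := by
    intro t _
    have h1 : HasDerivAt (fun t : ℝ => (t : ℂ) * x) x t := by
      simpa using (Complex.ofRealCLM.hasDerivAt (x := t)).mul_const x
    exact h1.cexp.hasDerivWithinAt
  have := norm_image_sub_le_of_norm_deriv_le_segment' h (C := ‖x‖ * Real.exp (max x.re 0))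
    (fun t ht => ?_) 1 (by simp)
  · simpa using this
  · rw [norm_mul, mul_comm]
    gcongr
    rw [Complex.norm_exp]
    gcongr
    simp only [Complex.mul_re, Complex.ofReal_re, Complex.ofReal_im, zero_mul, sub_zero]
    rcases le_total 0 x.re with h0 | h0
    · exact le_max_of_le_left (mul_le_of_le_one_left h0 ht.2.le)
    · exact le_max_of_le_right (mul_nonpos_of_nonneg_of_nonpos ht.1 h0)

theorem exists_norm_expSum_sub_le (c j : ℕ) : ∃ C : ℝ, 0 ≤ C ∧ ∀ x,
    ‖expSum c j x - c ^ j‖ ≤ C * (‖x‖ * (1 + ‖x‖) ^ (j - 1) * Real.exp (max x.re 0)) := by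
  induction j generalizing c with
  | zero => exact ⟨1, zero_le_one, fun x => by simpa [expSum] using norm_exp_sub_one_le_max x⟩
  | succ j ih =>
    obtain ⟨C, hC, h⟩ := ih c
    obtain ⟨C', hC', h'⟩ := ih (c + 1)
    refine ⟨c * C + (C' + (c + 1) ^ j), by positivity, fun x => ?_⟩
    set M := Real.exp (max x.re 0) with hM
    have hM1 : 1 ≤ M := Real.one_le_exp (le_max_right _ _)
    have hx := norm_nonneg x
    have hp : (1 + ‖x‖) ^ (j - 1) ≤ (1 + ‖x‖) ^ j := by
      gcongr
      · linarith
      · omega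
    have hp1 : 1 ≤ (1 + ‖x‖) ^ j := one_le_pow₀ (by linarith)
    have h1 : ‖expSum (c + 1) j x‖ ≤ (C' + (c + 1) ^ j) * ((1 + ‖x‖) ^ j * M) := by
      rcases Nat.eq_zero_or_pos j with rfl | hj
      · simp only [expSum, pow_zero, one_mul]
        refine (norm_exp_le_exp_max x).trans (le_mul_of_one_le_left (by positivity) ?_)
        linarith
      · obtain ⟨i, rfl⟩ := Nat.exists_eq_add_of_le' hj
        have e : expSum (c + 1) (i + 1) x = (expSum (c + 1) (i + 1) x -
            ((c + 1 : ℕ) : ℂ) ^ (i + 1)) + ((c + 1 : ℕ) : ℂ) ^ (i + 1) := by ring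
        rw [e, add_mul]
        refine (norm_add_le _ _).trans (add_le_add ((h' x).trans ?_) ?_)
        · gcongr
          rw [add_tsub_cancel_right, pow_succ, mul_comm]
          gcongr
          linarith
        · rw [norm_pow, Complex.norm_natCast]
          push_cast
          exact le_mul_of_one_le_right (by positivity) (one_le_mul_of_one_le_of_one_le hp1 hM1)
    have e : expSum c (j + 1) x - (c : ℂ) ^ (j + 1) =
        c * (expSum c j x - (c : ℂ) ^ j) + x * expSum (c + 1) j x := by
      rw [expSum]; ring
    rw [e]
    refine (norm_add_le _ _).trans ?_
    rw [norm_mul, norm_mul, Complex.norm_natCast, add_tsub_cancel_right]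
    calc (c : ℝ) * ‖expSum c j x - (c : ℂ) ^ j‖ + ‖x‖ * ‖expSum (c + 1) j x‖
        ≤ c * (C * (‖x‖ * (1 + ‖x‖) ^ j * M)) +
          ‖x‖ * ((C' + (c + 1) ^ j) * ((1 + ‖x‖) ^ j * M)) := by
          gcongr
          exact (h x).trans (by gcongr)
      _ = _ := by ring

end ExpSums

/-! ### A Laplace-type integral -/

section LaplaceBound

theorem integrableOn_rpow_mul_exp {δ c : ℝ} (hδ : 0 < δ) (hc : 0 < c) :
    IntegrableOn (fun y : ℝ => y ^ (δ - 1) * Real.exp (-(c * y))) (Set.Ioi 0) := by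
  refine Integrable.of_integral_ne_zero ?_
  rw [Real.integral_rpow_mul_exp_neg_mul_Ioi hδ hc]
  have := Real.Gamma_pos_of_pos hδ
  positivity

theorem rpow_mul_exp_mul_exp_le {δ c X y : ℝ} (hX : 0 ≤ X) (hy : 0 < y) :
    y ^ (δ - 1) * Real.exp (-(c * y)) * Real.exp (X * Real.exp (-y)) ≤
      Real.exp X * (y ^ (δ - 1) * Real.exp (-((c + X / 2) * y)) +
        Real.exp (-(X / 2)) * (y ^ (δ - 1) * Real.exp (-(c * y)))) := by
  have h0 : 0 < y ^ (δ - 1) := by positivity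
  have key : Real.exp (X * Real.exp (-y)) ≤
      Real.exp X * (Real.exp (-(X / 2 * y)) + Real.exp (-(X / 2))) := by
    -- For y ≤ 1, e^{-y} ≤ 1 - y/2; for y ≥ 1, e^{-y} ≤ 1/2. The first gives decay at rate X/2 in y,
    -- the second a gain e^{-X/2}.
    rcases le_total y 1 with h | h
    · have h1 : Real.exp (-y) ≤ 1 - y / 2 := by
        have h2 := Real.add_one_le_exp y
        rw [Real.exp_neg, inv_le_iff_one_le_mul₀ (Real.exp_pos _)]
        nlinarith
      have h2 : X * Real.exp (-y) ≤ X + -(X / 2 * y) := by nlinarith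
      calc Real.exp (X * Real.exp (-y)) ≤ Real.exp (X + -(X / 2 * y)) := Real.exp_le_exp.mpr h2
        _ = Real.exp X * Real.exp (-(X / 2 * y)) := Real.exp_add _ _
        _ ≤ _ := by gcongr; linarith [Real.exp_pos (-(X / 2))]
    · have h1 : Real.exp (-y) ≤ 1 / 2 := by
        have h2 : Real.exp (-y) ≤ Real.exp (-1) := by gcongr
        have := Real.exp_neg_one_lt_half
        linarith
      have h2 : X * Real.exp (-y) ≤ X + -(X / 2) := by nlinarith
      calc Real.exp (X * Real.exp (-y)) ≤ Real.exp (X + -(X / 2)) := Real.exp_le_exp.mpr h2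
        _ = Real.exp X * Real.exp (-(X / 2)) := Real.exp_add _ _
        _ ≤ _ := by gcongr; linarith [Real.exp_pos (-(X / 2 * y))]
  calc _ ≤ y ^ (δ - 1) * Real.exp (-(c * y)) *
        (Real.exp X * (Real.exp (-(X / 2 * y)) + Real.exp (-(X / 2)))) := by gcongr
    _ = _ := by rw [show -((c + X / 2) * y) = -(c * y) + -(X / 2 * y) by ring, Real.exp_add]; ring

theorem integrableOn_laplace {δ c X : ℝ} (hδ : 0 < δ) (hc : 0 < c) (hX : 0 ≤ X) :
    IntegrableOn (fun y : ℝ => y ^ (δ - 1) * Real.exp (-(c * y)) * Real.exp (X * Real.exp (-y)))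
      (Set.Ioi 0) := by
  have i1 := integrableOn_rpow_mul_exp hδ (by positivity : 0 < c + X / 2)
  have i2 := integrableOn_rpow_mul_exp hδ hc
  refine Integrable.mono' ((i1.add (i2.const_mul (Real.exp (-(X / 2))))).const_mul (Real.exp X))
    (Measurable.aestronglyMeasurable (by fun_prop)) ?_
  filter_upwards [ae_restrict_mem measurableSet_Ioi] with y hy
  have hy' : (0 : ℝ) < y := hy
  rw [Real.norm_of_nonneg (by positivity)]
  exact rpow_mul_exp_mul_exp_le hX hy

theorem exists_rpow_le_exp_mul (b : ℝ) {c : ℝ} (hc : 0 < c) :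
    ∃ C, 0 < C ∧ ∀ R : ℝ, 0 ≤ R → (1 + R) ^ b ≤ C * Real.exp (c * R) := by
  obtain ⟨C, hC, h⟩ := exists_one_add_pow_mul_exp_le ⌈b⌉₊ hc
  refine ⟨C, hC, fun R hR => ?_⟩
  have h1 := h R hR
  rw [Real.exp_neg, ← div_eq_mul_inv, div_le_iff₀ (Real.exp_pos _)] at h1
  refine le_trans ?_ h1
  rw [← Real.rpow_natCast]
  exact Real.rpow_le_rpow_of_exponent_le (by linarith) (Nat.le_ceil b)

/-- As X grows, the integrand concentrates at y of order 1/X, where y^{δ-1} dy has mass of order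
X^{-δ}. -/
theorem exists_laplace_le {δ c : ℝ} (hδ : 0 < δ) (hc : 0 < c) : ∃ C, 0 < C ∧ ∀ X, 0 ≤ X →
    ∫ y in Set.Ioi (0 : ℝ), y ^ (δ - 1) * Real.exp (-(c * y)) * Real.exp (X * Real.exp (-y)) ≤
      C * ((1 + X) ^ (-δ) * Real.exp X) := by
  obtain ⟨K, hK, hexp⟩ := exists_rpow_le_exp_mul δ (c := 1 / 2) (by norm_num)
  have hΓ := Real.Gamma_pos_of_pos hδ
  set μ := min c (1 / 2) with hμ
  have hμ0 : 0 < μ := lt_min hc (by norm_num)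
  refine ⟨(μ ^ (-δ) + K * (1 / c) ^ δ) * Real.Gamma δ, by positivity, fun X hX => ?_⟩
  have i1 := integrableOn_rpow_mul_exp hδ (by positivity : 0 < c + X / 2)
  have i2 := integrableOn_rpow_mul_exp hδ hc
  have h1 := setIntegral_mono_on (integrableOn_laplace hδ hc hX)
    ((i1.add (i2.const_mul (Real.exp (-(X / 2))))).const_mul (Real.exp X)) measurableSet_Ioi
    fun y hy => rpow_mul_exp_mul_exp_le hX hy
  refine h1.trans ?_
  rw [integral_const_mul]
  simp only [Pi.add_apply]
  rw [integral_add i1 (i2.const_mul _), integral_const_mul,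
    Real.integral_rpow_mul_exp_neg_mul_Ioi hδ hc,
    Real.integral_rpow_mul_exp_neg_mul_Ioi hδ (by positivity)]
  have h2 : (1 / (c + X / 2)) ^ δ ≤ μ ^ (-δ) * (1 + X) ^ (-δ) := by
    rw [← Real.mul_rpow hμ0.le (by linarith), one_div, Real.inv_rpow (by positivity),
      ← Real.rpow_neg (by positivity)]
    refine Real.rpow_le_rpow_of_nonpos (by positivity) ?_ (by linarith)
    have := min_le_left c (1 / 2)
    have := min_le_right c (1 / 2)
    nlinarith
  have h3 : Real.exp (-(X / 2)) ≤ K * (1 + X) ^ (-δ) := by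
    have := hexp X hX
    rw [Real.rpow_neg (by linarith), Real.exp_neg, ← div_eq_mul_inv, le_div_iff₀ (by positivity),
      inv_mul_le_iff₀ (Real.exp_pos _)]
    rwa [mul_comm (Real.exp _), show X / 2 = 1 / 2 * X by ring]
  calc Real.exp X * ((1 / (c + X / 2)) ^ δ * Real.Gamma δ +
        Real.exp (-(X / 2)) * ((1 / c) ^ δ * Real.Gamma δ))
      ≤ Real.exp X * (μ ^ (-δ) * (1 + X) ^ (-δ) * Real.Gamma δ +
        K * (1 + X) ^ (-δ) * ((1 / c) ^ δ * Real.Gamma δ)) := by gcongr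
    _ = _ := by ring

end LaplaceBound

/-! ### Exponential sums with fractional powers -/

section FracExp

/-- The sums `∑ (2m+n+1) (m+n+1)^b x^(m+1) / (m+1)!`. -/
noncomputable def fracExp (n : ℕ) (b : ℝ) (x : ℂ) : ℂ :=
  ∑' m : ℕ, ((2 * m + n + 1) * (m + n + 1 : ℝ) ^ b : ℝ) * (x ^ (m + 1) / (m + 1).factorial)

/-- The version of `fracExp` with an integral exponent. -/
noncomputable def natExp (n j : ℕ) (x : ℂ) : ℂ :=
  2 * (expSum n (j + 1) x - n ^ (j + 1)) - (n + 1) * (expSum n j x - n ^ j)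

/-- Split 2m + n + 1 = 2(m + n + 1) - (n + 1); the subtracted powers of n are the omitted zeroth
terms. -/
theorem hasSum_natExp (n j : ℕ) (x : ℂ) :
    HasSum (fun m : ℕ => ((2 * m + n + 1) * (m + n + 1 : ℝ) ^ j : ℝ) *
      (x ^ (m + 1) / (m + 1).factorial)) (natExp n j x) := by
  have h : ∀ i : ℕ, HasSum (fun m : ℕ => (m + n + 1 : ℂ) ^ i * (x ^ (m + 1) / (m + 1).factorial))
      (expSum n i x - n ^ i) := by
    intro i
    have := (hasSum_nat_add_iff' 1).mpr (hasSum_expSum n i x)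
    simp only [Finset.range_one, Finset.sum_singleton, Nat.cast_zero, zero_add, pow_zero,
      Nat.factorial_zero, Nat.cast_one, div_one, mul_one] at this
    refine cast (congrArg (fun F => HasSum F _) (funext fun k => ?_)) this
    push_cast; ring
  refine cast (congrArg (fun F => HasSum F _) (funext fun k => ?_))
    (((h (j + 1)).mul_left 2).sub ((h j).mul_left (n + 1 : ℂ)))
  push_cast; ring

theorem exists_norm_natExp_le (n j : ℕ) : ∃ C : ℝ, 0 ≤ C ∧ ∀ x,
    ‖natExp n j x‖ ≤ C * (‖x‖ * (1 + ‖x‖) ^ j * Real.exp (max x.re 0)) := by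
  obtain ⟨C, hC, h⟩ := exists_norm_expSum_sub_le n (j + 1)
  obtain ⟨C', hC', h'⟩ := exists_norm_expSum_sub_le n j
  refine ⟨2 * C + (n + 1) * C', by positivity, fun x => ?_⟩
  have hx := norm_nonneg x
  have hp : (1 + ‖x‖) ^ (j - 1) ≤ (1 + ‖x‖) ^ j := by
    gcongr
    · linarith
    · omega
  have e : ‖(n + 1 : ℂ)‖ = n + 1 := by exact_mod_cast Complex.norm_natCast (n + 1)
  rw [natExp]
  refine (norm_sub_le _ _).trans ?_
  rw [norm_mul, norm_mul, Complex.norm_ofNat, e]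
  calc 2 * ‖expSum n (j + 1) x - (n : ℂ) ^ (j + 1)‖ + (n + 1) * ‖expSum n j x - (n : ℂ) ^ j‖
      ≤ 2 * (C * (‖x‖ * (1 + ‖x‖) ^ j * Real.exp (max x.re 0))) +
        (n + 1) * (C' * (‖x‖ * (1 + ‖x‖) ^ j * Real.exp (max x.re 0))) := by
        gcongr
        · exact h x
        · exact (h' x).trans (by gcongr)
    _ = _ := by ring

theorem summable_fracExp (n : ℕ) (b : ℝ) (x : ℂ) : Summable fun m : ℕ =>
    ‖(((2 * m + n + 1) * (m + n + 1 : ℝ) ^ b : ℝ) : ℂ) * (x ^ (m + 1) / (m + 1).factorial)‖ := by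
  have h := (hasSum_natExp n ⌈b⌉₊ (‖x‖ : ℂ)).summable.norm
  refine Summable.of_nonneg_of_le (fun m => norm_nonneg _) (fun m => ?_) h
  rw [norm_mul, norm_mul]
  have e : ‖((‖x‖ : ℂ) ^ (m + 1) / ((m + 1).factorial : ℂ))‖ =
      ‖x ^ (m + 1) / ((m + 1).factorial : ℂ)‖ := by
    rw [norm_div, norm_div, norm_pow, norm_pow, Complex.norm_real, norm_norm]
  rw [e, Complex.norm_real, Complex.norm_real, Real.norm_of_nonneg (by positivity),
    Real.norm_of_nonneg (by positivity), ← Real.rpow_natCast _ ⌈b⌉₊]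
  gcongr
  · have : (0 : ℝ) ≤ m + n := by positivity
    linarith
  · exact Nat.le_ceil b

/-- Write (m+n+1)^b = (m+n+1)^j (m+n+1)^{-δ} and represent the negative power by a Gamma integral.
The factor e^{-(m+1)y} then rescales the argument of the integer-power sum by e^{-y}. -/
theorem fracExp_eq_integral (n : ℕ) {b δ : ℝ} {j : ℕ} (hδ : 0 < δ) (hb : b + δ = j) (x : ℂ) :
    Real.Gamma δ * fracExp n b x = ∫ y in Set.Ioi (0 : ℝ),
      (y ^ (δ - 1) * Real.exp (-(n * y)) : ℝ) * natExp n j (Real.exp (-y) * x) := by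
  have hΓ := Real.Gamma_pos_of_pos hδ
  set F : ℕ → ℝ → ℂ := fun m y => (y ^ (δ - 1) * Real.exp (-((m + n + 1) * y)) : ℝ) *
    ((((2 * m + n + 1) * (m + n + 1 : ℝ) ^ j : ℝ) : ℂ) * (x ^ (m + 1) / (m + 1).factorial)) with hF
  have hi : ∀ m : ℕ, IntegrableOn (fun y : ℝ => y ^ (δ - 1) * Real.exp (-((m + n + 1) * y)))
      (Set.Ioi 0) := fun m => integrableOn_rpow_mul_exp hδ (by positivity)
  have hFi : ∀ m, Integrable (F m) (volume.restrict (Set.Ioi 0)) := fun m =>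
    (hi m).ofReal.mul_const _
  have hpow : ∀ m : ℕ, (1 / (m + n + 1) : ℝ) ^ δ * (m + n + 1 : ℝ) ^ j = (m + n + 1 : ℝ) ^ b := by
    intro m
    have h0 : (0 : ℝ) < m + n + 1 := by positivity
    rw [one_div, Real.inv_rpow h0.le, ← Real.rpow_neg h0.le, ← Real.rpow_natCast, ← Real.rpow_add h0,
      ← hb]
    congr 1; ring
  have hFint : ∀ m : ℕ, ∫ y in Set.Ioi (0 : ℝ), F m y = Real.Gamma δ *
      ((((2 * m + n + 1) * (m + n + 1 : ℝ) ^ b : ℝ) : ℂ) * (x ^ (m + 1) / (m + 1).factorial)) := by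
    intro m
    simp only [hF]
    rw [integral_mul_const, integral_complex_ofReal, Real.integral_rpow_mul_exp_neg_mul_Ioi hδ
      (by positivity), ← hpow]
    push_cast; ring
  have hFnorm : ∀ m : ℕ, ∫ y in Set.Ioi (0 : ℝ), ‖F m y‖ = Real.Gamma δ *
      ‖(((2 * m + n + 1) * (m + n + 1 : ℝ) ^ b : ℝ) : ℂ) * (x ^ (m + 1) / (m + 1).factorial)‖ := by
    intro m
    have : ∀ y ∈ Set.Ioi (0 : ℝ), ‖F m y‖ = (y ^ (δ - 1) * Real.exp (-((m + n + 1) * y))) *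
        ‖(((2 * m + n + 1) * (m + n + 1 : ℝ) ^ j : ℝ) : ℂ) * (x ^ (m + 1) / (m + 1).factorial)‖ := by
      intro y hy
      have hy' : (0 : ℝ) < y := hy
      simp only [hF]
      rw [norm_mul, Complex.norm_real, Real.norm_of_nonneg (by positivity)]
    rw [setIntegral_congr_fun measurableSet_Ioi this, integral_mul_const,
      Real.integral_rpow_mul_exp_neg_mul_Ioi hδ (by positivity), norm_mul, norm_mul,
      Complex.norm_real, Complex.norm_real, Real.norm_of_nonneg (by positivity),
      Real.norm_of_nonneg (by positivity), ← hpow]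
    ring
  have h1 := hasSum_integral_of_summable_integral_norm (F := F)
    (μ := volume.restrict (Set.Ioi (0 : ℝ))) hFi (by
      simp only [hFnorm]; exact (summable_fracExp n b x).mul_left _)
  simp only [hFint] at h1
  have h2 := (summable_fracExp n b x).of_norm.hasSum.mul_left (Real.Gamma δ : ℂ)
  rw [fracExp, h2.unique h1]
  refine setIntegral_congr_fun measurableSet_Ioi fun y hy => ?_
  have h3 := (hasSum_natExp n j (Real.exp (-y) * x)).mul_left
    ((y ^ (δ - 1) * Real.exp (-(n * y)) : ℝ) : ℂ)
  rw [← h3.tsum_eq]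
  congr 1; funext m
  simp only [hF]
  have e : Real.exp (-((m + n + 1) * y)) = Real.exp (-(n * y)) * Real.exp (-y) ^ (m + 1) := by
    rw [← Real.exp_nat_mul, ← Real.exp_add]; congr 1; push_cast; ring
  rw [e, mul_pow]
  push_cast
  ring

/-- Near the positive axis the Laplace integral gains (1 + Re x)^{-δ}, which reduces the integer
power j to b. Away from it the growth is at most e^{|x|/2} times a power, hence O(e^{3|x|/4}); any
exponent below 1 suffices later. -/
theorem exists_norm_fracExp_le (n : ℕ) (b : ℝ) : ∃ C : ℝ, 0 ≤ C ∧ ∀ x,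
    ‖fracExp n b x‖ ≤ C * (‖x‖ * ((1 + ‖x‖) ^ b * Real.exp x.re + Real.exp (3 / 4 * ‖x‖))) := by
  set j := ⌈b⌉₊ + 1 with hj
  set δ : ℝ := j - b with hδ'
  have hδ : 0 < δ := by
    have := Nat.le_ceil b
    rw [hδ', hj]; push_cast; linarith
  have hΓ := Real.Gamma_pos_of_pos hδ
  obtain ⟨C, hC, hQ⟩ := exists_norm_natExp_le n j
  obtain ⟨C', hC', hL⟩ := exists_laplace_le hδ (by positivity : (0 : ℝ) < n + 1)
  obtain ⟨K, hK, hexp⟩ := exists_rpow_le_exp_mul j (c := 1 / 4) (by norm_num)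
  refine ⟨C * C' / Real.Gamma δ * (2 ^ δ + K), by positivity, fun x => ?_⟩
  set X := max x.re 0 with hX
  have hX0 : 0 ≤ X := le_max_right _ _
  have hx := norm_nonneg x
  have h1 : ‖fracExp n b x‖ ≤ C * C' / Real.Gamma δ *
      (‖x‖ * ((1 + ‖x‖) ^ (j : ℝ) * ((1 + X) ^ (-δ) * Real.exp X))) := by
    rw [div_mul_eq_mul_div, le_div_iff₀ hΓ, mul_comm _ (Real.Gamma δ)]
    have h2 : Real.Gamma δ * ‖fracExp n b x‖ = ‖(Real.Gamma δ : ℂ) * fracExp n b x‖ := by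
      rw [norm_mul, Complex.norm_real, Real.norm_of_nonneg hΓ.le]
    rw [h2, fracExp_eq_integral n hδ (by rw [hδ']; ring : b + δ = j)]
    refine (norm_integral_le_of_norm_le ((integrableOn_laplace hδ
      (by positivity : (0 : ℝ) < n + 1) hX0).const_mul (C * (‖x‖ * (1 + ‖x‖) ^ j))) ?_).trans ?_
    · filter_upwards [ae_restrict_mem measurableSet_Ioi] with y hy
      have hy' : (0 : ℝ) < y := hy
      have he := Real.exp_pos (-y)
      have he1 : Real.exp (-y) ≤ 1 := Real.exp_le_one_iff.mpr (by linarith)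
      have h3 := hQ (Real.exp (-y) * x)
      have h4 : max ((Real.exp (-y) : ℂ) * x).re 0 = X * Real.exp (-y) := by
        rw [Complex.re_ofReal_mul, hX, mul_comm, max_mul_of_nonneg _ _ he.le, zero_mul]
      rw [h4, norm_mul, Complex.norm_real, Real.norm_of_nonneg he.le] at h3
      rw [norm_mul, Complex.norm_real, Real.norm_of_nonneg (by positivity)]
      have h5 : Real.exp (-(((n : ℝ) + 1) * y)) = Real.exp (-(n * y)) * Real.exp (-y) := by
        rw [← Real.exp_add]; congr 1; ring
      rw [h5]
      calc y ^ (δ - 1) * Real.exp (-(n * y)) * ‖natExp n j (Real.exp (-y) * x)‖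
          ≤ y ^ (δ - 1) * Real.exp (-(n * y)) * (C * (Real.exp (-y) * ‖x‖ *
            (1 + 1 * ‖x‖) ^ j * Real.exp (X * Real.exp (-y)))) := by
            gcongr
            exact h3.trans (by gcongr)
        _ = _ := by rw [one_mul]; ring
    · rw [integral_const_mul, Real.rpow_natCast]
      calc C * (‖x‖ * (1 + ‖x‖) ^ j) * ∫ y in Set.Ioi (0 : ℝ), y ^ (δ - 1) *
            Real.exp (-(((n : ℝ) + 1) * y)) * Real.exp (X * Real.exp (-y))
          ≤ C * (‖x‖ * (1 + ‖x‖) ^ j) * (C' * ((1 + X) ^ (-δ) * Real.exp X)) := by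
            gcongr; exact hL X hX0
        _ = _ := by ring
  refine h1.trans ?_
  rw [mul_assoc _ (2 ^ δ + K), mul_left_comm (2 ^ δ + K)]
  refine mul_le_mul_of_nonneg_left (mul_le_mul_of_nonneg_left ?_ hx) (by positivity)
  rcases le_total (‖x‖ / 2) x.re with h | h
  · have hXx : X = x.re := max_eq_left (by linarith)
    rw [hXx]
    have h2 : (1 + x.re) ^ (-δ) ≤ 2 ^ δ * (1 + ‖x‖) ^ (-δ) := by
      rw [← inv_inv (2 ^ δ : ℝ), ← Real.rpow_neg two_pos.le, ← Real.inv_rpow (by positivity),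
        ← Real.mul_rpow (by norm_num) (by positivity)]
      exact Real.rpow_le_rpow_of_nonpos (by positivity) (by linarith) (by linarith)
    have h3 : (1 + ‖x‖) ^ (j : ℝ) * (1 + ‖x‖) ^ (-δ) = (1 + ‖x‖) ^ b := by
      rw [← Real.rpow_add (by positivity), hδ']; congr 1; ring
    calc (1 + ‖x‖) ^ (j : ℝ) * ((1 + x.re) ^ (-δ) * Real.exp x.re)
        ≤ (1 + ‖x‖) ^ (j : ℝ) * (2 ^ δ * (1 + ‖x‖) ^ (-δ) * Real.exp x.re) := by gcongr
      _ = 2 ^ δ * ((1 + ‖x‖) ^ b * Real.exp x.re) := by rw [← h3]; ring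
      _ ≤ (2 ^ δ + K) * ((1 + ‖x‖) ^ b * Real.exp x.re + Real.exp (3 / 4 * ‖x‖)) := by
          gcongr
          · linarith
          · linarith [Real.exp_pos (3 / 4 * ‖x‖)]
  · have hXx : X ≤ ‖x‖ / 2 := max_le h (by positivity)
    have h2 : (1 + X) ^ (-δ) ≤ 1 :=
      Real.rpow_le_one_of_one_le_of_nonpos (by linarith) (by linarith)
    calc (1 + ‖x‖) ^ (j : ℝ) * ((1 + X) ^ (-δ) * Real.exp X)
        ≤ (K * Real.exp (1 / 4 * ‖x‖)) * (1 * Real.exp (‖x‖ / 2)) := by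
          gcongr
          exact hexp _ hx
      _ = K * Real.exp (3 / 4 * ‖x‖) := by
          rw [one_mul, mul_assoc, ← Real.exp_add]; congr 2; ring
      _ ≤ (2 ^ δ + K) * ((1 + ‖x‖) ^ b * Real.exp x.re + Real.exp (3 / 4 * ‖x‖)) := by
          gcongr
          · have : (0 : ℝ) < 2 ^ δ := by positivity
            linarith
          · have : 0 ≤ (1 + ‖x‖) ^ b * Real.exp x.re := by positivity
            linarith

end FracExp

/-! ### Off-diagonal decay and p-integrability of the kernel -/

section KernelBound
variable {n : ℕ}

/-- Sums the closed formulas for P_m: the kernel is the odd part in ζω of a function of z • u + ζω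
alone. -/
theorem ker_eq (hn : 1 ≤ n) {s : ℝ} (hs : 0 < s) (b : ℝ) {z u : Fin n → ℂ} {ζ ω : ℂ}
    (hζ : ζ ^ 2 = bdot z z) (hω : ω ^ 2 = bdot u u) :
    2 * (ζ * ω) * ker n s b z u = (kap * s ^ (n - 1) / Real.pi ^ (n + 1) : ℝ) *
      (fracExp n b (s * (bdot z u + ζ * ω)) - fracExp n b (s * (bdot z u - ζ * ω))) := by
  have h1 := (hasSum_ker hs b z u).mul_left (2 * (ζ * ω))
  have h2 := ((summable_fracExp n b (s * (bdot z u + ζ * ω))).of_norm.hasSum.sub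
    (summable_fracExp n b (s * (bdot z u - ζ * ω))).of_norm.hasSum).mul_left
      ((kap * s ^ (n - 1) / Real.pi ^ (n + 1) : ℝ) : ℂ)
  refine h1.unique (cast (congrArg (fun F => HasSum F _) (funext fun m => ?_)) h2)
  have h3 := homKer_eq m hζ hω
  have e : ((kerCoef n s b m : ℝ) : ℂ) = ((kap * s ^ (n - 1) / Real.pi ^ (n + 1) : ℝ) : ℂ) *
      ((((2 * m + n + 1) * (m + n + 1 : ℝ) ^ b : ℝ) : ℂ) * ((s : ℂ) ^ (m + 1) /
        (m + 1).factorial)) := by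
    obtain ⟨k, rfl⟩ := Nat.exists_eq_add_of_le' hn
    have hk := kap_pos.ne'
    have hπ := Real.pi_pos.ne'
    rw [kerCoef, normConst, ← Complex.ofReal_pow, ← Complex.ofReal_natCast, ← Complex.ofReal_div,
      ← Complex.ofReal_mul, ← Complex.ofReal_mul, add_tsub_cancel_right]
    congr 1
    rw [show m + (k + 1) = k + (m + 1) by ring, pow_add s k]
    have h0 : ((2 : ℝ) * m + (k + 1 : ℕ) + 1) ≠ 0 := by positivity
    have h00 : ((m + 1).factorial : ℝ) ≠ 0 := by positivity
    field_simp
  rw [mul_left_comm, h3, e, mul_pow, mul_pow]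
  ring

theorem le_rpow_add_sq {p x : ℝ} (hp1 : p ≤ 1) (hx : 0 ≤ x) : x ≤ x ^ p + x ^ 2 := by
  rcases le_total x 1 with h | h
  · rcases hx.eq_or_lt with rfl | h0
    · positivity
    · have := Real.rpow_le_rpow_of_exponent_ge h0 h hp1
      rw [Real.rpow_one] at this
      nlinarith [sq_nonneg x]
  · have : 0 ≤ x ^ p := by positivity
    nlinarith

theorem rpow_two_mul_le {p x : ℝ} (hp : 0 < p) (hp1 : p ≤ 1) (hx : 0 ≤ x) :
    x ^ p * x ^ p ≤ x ^ p + x ^ 2 := by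
  rcases le_total x 1 with h | h
  · have h1 : x ^ p ≤ 1 := Real.rpow_le_one hx h hp.le
    have h0 : 0 ≤ x ^ p := by positivity
    nlinarith [sq_nonneg x]
  · have h0 : 0 ≤ x ^ p := by positivity
    have h1 : x ^ p ≤ x := by
      have := Real.rpow_le_rpow_of_exponent_le h hp1
      rwa [Real.rpow_one] at this
    nlinarith

/-- Here x = N_*(z), y = N_*(u) and d is a squared distance on the cone. The polynomial growth of
the kernel to the power p is converted to the density of `chart_bound`, with loss 1 + d for the
Gaussian to absorb. -/
theorem growth_le {p x y d : ℝ} (hp : 0 < p) (hp1 : p ≤ 1) (hx : 0 ≤ x) (hy : 0 ≤ y) (hd : 0 ≤ d)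
    (h : y ^ 2 ≤ 2 * (x ^ 2 + d)) :
    (x * y) ^ p * (1 + x * y) ^ (1 - p) ≤ 12 * ((x ^ 2) ^ (p / 2) + x ^ 2) * (1 + d) := by
  have hxp : (x ^ 2) ^ (p / 2) = x ^ p := by
    rw [← Real.rpow_natCast, ← Real.rpow_mul hx]; congr 1; push_cast; ring
  rw [hxp]
  set D := Real.sqrt d with hD
  have hD0 : 0 ≤ D := Real.sqrt_nonneg _
  have hD2 : D ^ 2 = d := Real.sq_sqrt hd
  have hD1 : D ≤ 1 + d := by nlinarith [sq_nonneg (D - 1)]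
  have hy2 : y ≤ 2 * (x + D) := by
    refine le_of_sq_le_sq ?_ (by positivity)
    nlinarith [mul_nonneg hx hD0]
  have hxp0 : 0 ≤ x ^ p := by positivity
  have hM1 := le_rpow_add_sq hp1 hx
  have hM2 := rpow_two_mul_le hp hp1 hx
  set M := x ^ p + x ^ 2 with hM
  have hM0 : 0 ≤ M := by positivity
  have ht : x * y ≤ 2 * M * (1 + D) := by
    have : x * y ≤ x * (2 * (x + D)) := by gcongr
    nlinarith
  have htp : (x * y) ^ p ≤ 4 * M * (1 + D) := by
    rw [Real.mul_rpow hx hy]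
    have h1 : y ^ p ≤ 2 * (x ^ p + (1 + D)) := by
      calc y ^ p ≤ (2 * (x + D)) ^ p := by gcongr
        _ = 2 ^ p * (x + D) ^ p := Real.mul_rpow two_pos.le (by positivity)
        _ ≤ 2 * (x ^ p + D ^ p) := by
            gcongr
            · have := Real.rpow_le_rpow_of_exponent_le (one_le_two (α := ℝ)) hp1
              rwa [Real.rpow_one] at this
            · exact Real.rpow_add_le_add_rpow hx hD0 hp.le hp1
        _ ≤ _ := by
            gcongr
            rcases le_total D 1 with h | h
            · have := Real.rpow_le_one hD0 h hp.le
              linarith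
            · have := Real.rpow_le_rpow_of_exponent_le h hp1
              rw [Real.rpow_one] at this
              linarith
    calc x ^ p * y ^ p ≤ x ^ p * (2 * (x ^ p + (1 + D))) := by gcongr
      _ = 2 * (x ^ p * x ^ p) + 2 * (x ^ p * (1 + D)) := by ring
      _ ≤ 2 * M + 2 * (M * (1 + D)) := by
          gcongr
          linarith [sq_nonneg x]
      _ ≤ _ := by nlinarith [mul_nonneg hM0 hD0]
  have hxy : 0 ≤ x * y := by positivity
  have h1 : (1 + x * y) ^ (1 - p) ≤ 1 + (x * y) ^ (1 - p) := by
    have := Real.rpow_add_le_add_rpow zero_le_one hxy (by linarith : 0 ≤ 1 - p) (by linarith)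
    rwa [Real.one_rpow] at this
  have h2 : (x * y) ^ p * (x * y) ^ (1 - p) = x * y := by
    rw [← Real.rpow_add_of_nonneg hxy hp.le (by linarith)]
    simp
  calc (x * y) ^ p * (1 + x * y) ^ (1 - p) ≤ (x * y) ^ p * (1 + (x * y) ^ (1 - p)) := by gcongr
    _ = (x * y) ^ p + x * y := by rw [mul_add, h2, mul_one]
    _ ≤ 6 * M * (1 + D) := by linarith
    _ ≤ 6 * M * (2 * (1 + d)) := by gcongr; linarith
    _ = _ := by ring

theorem nsq_le_two_mul {z v : Fin n → ℂ} {ζ η : ℂ} (hζ : ζ ^ 2 = bdot z z) (hη : η ^ 2 = bdot v v) :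
    nsq v ≤ 2 * (nsq z + dsq z ζ v η) := by
  have h : ∀ x y : ℂ, ‖y‖ ^ 2 ≤ 2 * (‖x‖ ^ 2 + ‖x - y‖ ^ 2) := by
    intro x y
    have h1 : ‖y‖ ≤ ‖x‖ + ‖x - y‖ := by
      calc ‖y‖ = ‖x - (x - y)‖ := by rw [sub_sub_cancel]
        _ ≤ _ := norm_sub_le _ _
    nlinarith [sq_nonneg (‖x‖ - ‖x - y‖), norm_nonneg y, norm_nonneg x, norm_nonneg (x - y)]
  rw [nsq_eq_of_sq hζ, nsq_eq_of_sq hη, dsq]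
  have h1 : euclSq v ≤ 2 * (euclSq z + euclSq (z - v)) := by
    simp only [euclSq, ← Finset.sum_add_distrib, Finset.mul_sum]
    exact Finset.sum_le_sum fun j _ => h _ _
  linarith [h ζ η]

/-- Polarisation rewrites the main exponent s Re x minus the two weights as -s d/2. The secondary
term 3s|x|/4 stays strictly below the weights, because |x| is at most N_*(z) N_*(u). -/
theorem exists_norm_fracExp_pairing_le (n : ℕ) {s b : ℝ} (hs : 0 < s) (hb : 0 ≤ b) :
    ∃ C : ℝ, 0 ≤ C ∧ ∀ (z u : Fin n → ℂ) (ζ ω : ℂ), ζ ^ 2 = bdot z z → ω ^ 2 = bdot u u →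
      ‖fracExp n b (s * (bdot z u + ζ * ω))‖ * Real.exp (-(s * nsq z / 2)) *
        Real.exp (-(s * nsq u / 2)) ≤
      C * ((Nstar z * Nstar u) * (1 + Nstar z * Nstar u) ^ b *
        Real.exp (-(s / 16) * dsq z ζ (star u) (star ω))) := by
  obtain ⟨C, hC, h⟩ := exists_norm_fracExp_le n b
  refine ⟨C * (s * (1 + s) ^ b + s), by positivity, fun z u ζ ω hζ hω => ?_⟩
  set x := bdot z u + ζ * ω with hx
  set t := Nstar z * Nstar u with ht
  set d := dsq z ζ (star u) (star ω) with hd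
  have hd0 : 0 ≤ d := dsq_nonneg _ _ _ _
  have hz := Nstar_nonneg z
  have hu := Nstar_nonneg u
  have ht0 : 0 ≤ t := by positivity
  have hxt : ‖x‖ ≤ t := norm_pairing_le hζ hω
  have hre := two_mul_re_pairing z (star u) ζ (star ω)
  rw [star_star, star_star, euclSq_star, norm_star, ← nsq_eq_of_sq hζ, ← nsq_eq_of_sq hω, ← hx,
    ← hd] at hre
  have hxre := Complex.abs_re_le_norm x
  have hxre1 := (abs_le.mp hxre).1
  have hAB : 2 * t ≤ nsq z + nsq u := by
    rw [← Nstar_sq, ← Nstar_sq]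
    nlinarith [sq_nonneg (Nstar z - Nstar u)]
  have hsx : ‖(s : ℂ) * x‖ = s * ‖x‖ := by
    rw [norm_mul, Complex.norm_real, Real.norm_of_nonneg hs.le]
  have h1 := h (s * x)
  rw [hsx, Complex.re_ofReal_mul] at h1
  have e1 : Real.exp (s * x.re) * (Real.exp (-(s * nsq z / 2)) * Real.exp (-(s * nsq u / 2))) ≤
      Real.exp (-(s / 16) * d) := by
    rw [← Real.exp_add, ← Real.exp_add, Real.exp_le_exp]
    nlinarith
  have e2 : Real.exp (3 / 4 * (s * ‖x‖)) *
      (Real.exp (-(s * nsq z / 2)) * Real.exp (-(s * nsq u / 2))) ≤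
      Real.exp (-(s / 16) * d) := by
    rw [← Real.exp_add, ← Real.exp_add, Real.exp_le_exp]
    -- With A = nsq z + nsq u one has |x| ≤ A/2 and d ≤ 2A, so the left side is at most -A/8.
    have : 3 / 4 * ‖x‖ - nsq z / 2 - nsq u / 2 ≤ -(1 / 16) * d := by linarith
    nlinarith
  have h2 : (1 + s * ‖x‖) ^ b ≤ (1 + s) ^ b * (1 + t) ^ b := by
    rw [← Real.mul_rpow (by positivity) (by positivity)]
    gcongr
    nlinarith [mul_nonneg hs.le ht0]
  have h3 : 1 ≤ (1 + t) ^ b := Real.one_le_rpow (by linarith) hb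
  set G := Real.exp (-(s * nsq z / 2)) * Real.exp (-(s * nsq u / 2)) with hG
  have hG0 : 0 < G := by positivity
  rw [mul_assoc, ← hG]
  calc ‖fracExp n b (s * x)‖ * G
      ≤ C * (s * ‖x‖ * ((1 + s * ‖x‖) ^ b * Real.exp (s * x.re) +
        Real.exp (3 / 4 * (s * ‖x‖)))) * G := by gcongr
    _ = C * (s * ‖x‖ * ((1 + s * ‖x‖) ^ b * (Real.exp (s * x.re) * G) +
        Real.exp (3 / 4 * (s * ‖x‖)) * G)) := by ring
    _ ≤ C * (s * t * ((1 + s) ^ b * (1 + t) ^ b * Real.exp (-(s / 16) * d) +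
        (1 + t) ^ b * Real.exp (-(s / 16) * d))) := by
        have e3 := e2.trans (le_mul_of_one_le_left (Real.exp_pos _).le h3)
        have e4 : (1 + s * ‖x‖) ^ b * (Real.exp (s * x.re) * G) ≤
            (1 + s) ^ b * (1 + t) ^ b * Real.exp (-(s / 16) * d) := by gcongr
        exact mul_le_mul_of_nonneg_left (mul_le_mul (by gcongr) (add_le_add e4 e3)
          (by positivity) (by positivity)) hC
    _ = _ := by ring

/-- The factors |ζ| and |ω| in the two weights are exactly the denominator 2ζω of `ker_eq`, so no
singularity remains at the null cone. The two sheets give the two Gaussians. -/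
theorem exists_norm_ker_le (hn : 1 ≤ n) {s b : ℝ} (hs : 0 < s) (hb : 0 ≤ b) :
    ∃ C : ℝ, 0 ≤ C ∧ ∀ (z u : Fin n → ℂ), ‖ker n s b z u‖ * weight s z * weight s u ≤
      C * ((Nstar z * Nstar u) * (1 + Nstar z * Nstar u) ^ b *
        (Real.exp (-(s / 16) * dsq z (rt z) (star u) (star (rt u))) +
          Real.exp (-(s / 16) * dsq z (rt z) (star u) (-star (rt u))))) := by
  obtain ⟨C, hC, h⟩ := exists_norm_fracExp_pairing_le n hs hb
  have hk := kap_pos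
  have hπ := Real.pi_pos
  set κ := kap * s ^ (n - 1) / Real.pi ^ (n + 1) with hκ
  refine ⟨κ / 2 * C, by positivity, fun z u => ?_⟩
  have h1 := h z u (rt z) (rt u) (rt_sq z) (rt_sq u)
  have h2 := h z u (rt z) (-rt u) (rt_sq z) (by rw [neg_sq, rt_sq])
  rw [mul_neg, ← sub_eq_add_neg, star_neg] at h2
  have h3 := congrArg norm (ker_eq hn hs b (rt_sq z) (rt_sq u))
  rw [norm_mul, norm_mul, norm_mul, norm_mul, Complex.norm_real, Complex.norm_ofNat, ← hκ,
    Real.norm_of_nonneg (by positivity)] at h3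
  have h4 := norm_sub_le (fracExp n b (s * (bdot z u + rt z * rt u)))
    (fracExp n b (s * (bdot z u - rt z * rt u)))
  rw [weight_eq, weight_eq]
  set G₁ := Real.exp (-(s * nsq z / 2))
  set G₂ := Real.exp (-(s * nsq u / 2))
  calc ‖ker n s b z u‖ * (‖rt z‖ * G₁) * (‖rt u‖ * G₂)
      = (2 * (‖rt z‖ * ‖rt u‖) * ‖ker n s b z u‖) / 2 * (G₁ * G₂) := by ring
    _ ≤ (κ * (‖fracExp n b (s * (bdot z u + rt z * rt u))‖ +
        ‖fracExp n b (s * (bdot z u - rt z * rt u))‖)) / 2 * (G₁ * G₂) := by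
        rw [h3]; gcongr
    _ = κ / 2 * (‖fracExp n b (s * (bdot z u + rt z * rt u))‖ * G₁ * G₂ +
        ‖fracExp n b (s * (bdot z u - rt z * rt u))‖ * G₁ * G₂) := by ring
    _ ≤ κ / 2 * (C * _ + C * _) := by gcongr
    _ = _ := by ring

/-- For p ≤ 1 the p-th power is subadditive, so the sheets separate. The choice b = 1/p - 1 makes bp
= 1 - p, as `growth_le` needs. Half of the Gaussian absorbs 1 + d, and the other half is integrated
uniformly by `chart_bound`. -/
theorem exists_lintegral_ker_le (hn : 1 ≤ n) {s p : ℝ} (hs : 0 < s) (hp : 0 < p) (hp1 : p ≤ 1) :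
    ∃ K : ℝ≥0∞, K ≠ ⊤ ∧ ∀ u : Fin n → ℂ,
      ∫⁻ z, ENNReal.ofReal ((‖ker n s (1 / p - 1) z u‖ * weight s z * weight s u) ^ p) *
        (ENNReal.ofReal ‖bdot z z‖)⁻¹ ≤ K := by
  have hb : 0 ≤ 1 / p - 1 := by rw [sub_nonneg, le_div_iff₀ hp]; linarith
  obtain ⟨C, hC, h⟩ := exists_norm_ker_le hn hs hb
  obtain ⟨K, hK, hch⟩ := chart_bound hn hp (by linarith) (by positivity : 0 < s / 16 * p / 2)
  obtain ⟨C₁, hC₁, hexp⟩ := exists_one_add_pow_mul_exp_le 1 (by positivity : 0 < s / 16 * p / 2)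
  refine ⟨ENNReal.ofReal (C ^ p * 12 * C₁) * (K + K), by finiteness, fun u => ?_⟩
  have hηsq : star (rt u) ^ 2 = bdot (star u) (star u) := by rw [← star_pow, rt_sq, bdot_star]
  have key : ∀ z (η : ℂ), η ^ 2 = bdot (star u) (star u) →
      ((Nstar z * Nstar u) * (1 + Nstar z * Nstar u) ^ (1 / p - 1)) ^ p *
        Real.exp (-(s / 16) * dsq z (rt z) (star u) η) ^ p ≤
      12 * C₁ * ((nsq z ^ (p / 2) + nsq z) *
        Real.exp (-(s / 16 * p / 2) * dsq z (rt z) (star u) η)) := by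
    intro z η hη
    have hz := Nstar_nonneg z
    have hu := Nstar_nonneg u
    have hnz := nsq_nonneg z
    set d := dsq z (rt z) (star u) η with hd
    have hd0 : 0 ≤ d := dsq_nonneg _ _ _ _
    have h1 : Nstar u ^ 2 ≤ 2 * (Nstar z ^ 2 + d) := by
      rw [Nstar_sq, Nstar_sq, ← nsq_star u]
      exact nsq_le_two_mul (rt_sq z) hη
    have h2 := growth_le hp hp1 hz hu hd0 h1
    rw [Nstar_sq] at h2
    rw [Real.mul_rpow (by positivity) (by positivity), ← Real.rpow_mul (by positivity),
      show (1 / p - 1) * p = 1 - p by field_simp, ← Real.exp_mul]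
    have h3 := hexp d hd0
    rw [pow_one] at h3
    have h4 : Real.exp (-(s / 16) * d * p) = Real.exp (-(s / 16 * p / 2 * d)) *
        Real.exp (-(s / 16 * p / 2) * d) := by
      rw [← Real.exp_add]; congr 1; ring
    rw [h4]
    calc _ ≤ 12 * (nsq z ^ (p / 2) + nsq z) * (1 + d) * (Real.exp (-(s / 16 * p / 2 * d)) *
          Real.exp (-(s / 16 * p / 2) * d)) := by gcongr
      _ = 12 * ((1 + d) * Real.exp (-(s / 16 * p / 2 * d))) * ((nsq z ^ (p / 2) + nsq z) *
          Real.exp (-(s / 16 * p / 2) * d)) := by ring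
      _ ≤ _ := by gcongr
  have hpt : ∀ z, (‖ker n s (1 / p - 1) z u‖ * weight s z * weight s u) ^ p ≤
      C ^ p * 12 * C₁ * ((nsq z ^ (p / 2) + nsq z) *
        Real.exp (-(s / 16 * p / 2) * dsq z (rt z) (star u) (star (rt u))) +
        (nsq z ^ (p / 2) + nsq z) *
        Real.exp (-(s / 16 * p / 2) * dsq z (rt z) (star u) (-star (rt u)))) := by
    intro z
    have hz := Nstar_nonneg z
    have hu := Nstar_nonneg u
    have hw := weight_nonneg s z
    have hw' := weight_nonneg s u
    refine (Real.rpow_le_rpow (by positivity) (h z u) hp.le).trans ?_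
    rw [Real.mul_rpow hC (by positivity), Real.mul_rpow (by positivity) (by positivity)]
    have h1 := Real.rpow_add_le_add_rpow
      (Real.exp_pos (-(s / 16) * dsq z (rt z) (star u) (star (rt u)))).le
      (Real.exp_pos (-(s / 16) * dsq z (rt z) (star u) (-star (rt u)))).le hp.le hp1
    have k1 := key z (star (rt u)) hηsq
    have k2 := key z (-star (rt u)) (by rw [neg_sq, hηsq])
    calc _ ≤ C ^ p * (((Nstar z * Nstar u) * (1 + Nstar z * Nstar u) ^ (1 / p - 1)) ^ p *
          (Real.exp (-(s / 16) * dsq z (rt z) (star u) (star (rt u))) ^ p +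
          Real.exp (-(s / 16) * dsq z (rt z) (star u) (-star (rt u))) ^ p)) := by gcongr
      _ ≤ C ^ p * (12 * C₁ * ((nsq z ^ (p / 2) + nsq z) *
        Real.exp (-(s / 16 * p / 2) * dsq z (rt z) (star u) (star (rt u)))) +
        12 * C₁ * ((nsq z ^ (p / 2) + nsq z) *
        Real.exp (-(s / 16 * p / 2) * dsq z (rt z) (star u) (-star (rt u))))) := by
          rw [mul_add]; gcongr
      _ = _ := by ring
  have hmeas : ∀ η : ℂ, Measurable fun z : Fin n → ℂ => ENNReal.ofReal
      ((nsq z ^ (p / 2) + nsq z) * Real.exp (-(s / 16 * p / 2) * dsq z (rt z) (star u) η)) *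
        (ENNReal.ofReal ‖bdot z z‖)⁻¹ := by
    intro η
    have h1 := continuous_nsq (n := n) |>.measurable
    have h2 := measurable_rt (n := n)
    have h3 := continuous_bdot_self (n := n) |>.measurable
    have h4 : Measurable fun z : Fin n → ℂ => euclSq (z - star u) :=
      (continuous_euclSq.comp (by fun_prop)).measurable
    unfold dsq
    fun_prop
  calc _ ≤ ∫⁻ z, ENNReal.ofReal (C ^ p * 12 * C₁) * (ENNReal.ofReal
        ((nsq z ^ (p / 2) + nsq z) *
          Real.exp (-(s / 16 * p / 2) * dsq z (rt z) (star u) (star (rt u)))) *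
          (ENNReal.ofReal ‖bdot z z‖)⁻¹ + ENNReal.ofReal ((nsq z ^ (p / 2) + nsq z) *
          Real.exp (-(s / 16 * p / 2) * dsq z (rt z) (star u) (-star (rt u)))) *
          (ENNReal.ofReal ‖bdot z z‖)⁻¹) := by
        refine lintegral_mono fun z => ?_
        have hnz := nsq_nonneg z
        rw [← add_mul, ← mul_assoc, ← ENNReal.ofReal_add (by positivity) (by positivity),
          ← ENNReal.ofReal_mul (by positivity)]
        gcongr
        exact hpt z
    _ = ENNReal.ofReal (C ^ p * 12 * C₁) * _ := by
        rw [lintegral_const_mul' _ _ ENNReal.ofReal_ne_top, lintegral_add_left (hmeas _)]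
    _ ≤ _ := by gcongr <;> exact hch _ _

end KernelBound

/-! ### Sub-mean-value property of |f|^p and crude pointwise bounds -/

section MeanValue
variable {n : ℕ}

theorem mean_value_ball {f : (Fin n → ℂ) → ℂ} (hf : Differentiable ℂ f) (w : Fin n → ℂ) (t : ℝ) :
    ∫ v in Metric.ball (0 : Fin n → ℂ) t, f (w + v) =
      (volume.real (Metric.ball (0 : Fin n → ℂ) t) : ℂ) * f w := by
  have hg : Differentiable ℂ fun v => f (w + v) := hf.comp ((differentiable_id).const_add w)
  set Φ : (Fin n → ℂ) → ℂ := (Metric.ball (0 : Fin n → ℂ) t).indicator 1 with hΦ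
  have hmul : ∀ h : (Fin n → ℂ) → ℂ, (fun v => Φ v * h v) =
      (Metric.ball (0 : Fin n → ℂ) t).indicator h := by
    intro h; funext v
    by_cases hv : v ∈ Metric.ball (0 : Fin n → ℂ) t <;> simp [hΦ, hv]
  have hint : ∀ h : (Fin n → ℂ) → ℂ, Continuous h → Integrable fun v => Φ v * h v := by
    intro h hh
    rw [hmul, integrable_indicator_iff measurableSet_ball]
    exact (hh.continuousOn.integrableOn_compact (isCompact_closedBall 0 t)).mono_set
      Metric.ball_subset_closedBall
  have h1 := integral_mul_eq_integral_mul_hcomp 0 (Φ := Φ) (h := fun v => f (w + v))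
    (fun c hc v => by
      have : c • v ∈ Metric.ball (0 : Fin n → ℂ) t ↔ v ∈ Metric.ball (0 : Fin n → ℂ) t := by
        simp only [mem_ball_zero_iff, norm_smul, hc, one_mul]
      by_cases hv : v ∈ Metric.ball (0 : Fin n → ℂ) t
      · simp [hΦ, hv, this.mpr hv]
      · simp [hΦ, hv, mt this.mp hv])
    (by
      rw [hmul]
      exact hg.continuous.measurable.indicator measurableSet_ball)
    (hint _ hg.continuous)
  rw [hmul, hmul, integral_indicator measurableSet_ball, integral_indicator measurableSet_ball]
    at h1
  rw [h1]
  simp only [hcomp_zero hg, add_zero]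
  rw [setIntegral_const, Complex.real_smul]

/-- A self-improvement of the mean value property. At a maximum point w of |g(v)| (1 - |v|)^k, the
nearby values of g are bounded by that maximum, so |g| ≤ |g|^p times a power of it. Cancelling this
power gives the p-th power inequality. -/
theorem exists_rpow_norm_le_integral (n : ℕ) {p : ℝ} (hp : 0 < p) (hp1 : p ≤ 1) :
    ∃ C : ℝ, 0 < C ∧ ∀ g : (Fin n → ℂ) → ℂ, Differentiable ℂ g →
      ‖g 0‖ ^ p ≤ C * ∫ v in Metric.ball (0 : Fin n → ℂ) 1, ‖g v‖ ^ p := by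
  -- Then kp ≥ 2n, so t^{kp} is at most the volume factor t^{2n}; the extra 1 makes k positive even
  -- for n = 0.
  obtain ⟨k, hk⟩ := exists_nat_ge ((2 * n + 1) / p)
  rw [div_le_iff₀ hp] at hk
  have hk0 : 0 < k := by
    rcases Nat.eq_zero_or_pos k with rfl | h
    · simp at hk; linarith [(Nat.cast_nonneg n : (0 : ℝ) ≤ n)]
    · exact h
  set V := volume.real (Metric.ball (0 : Fin n → ℂ) 1) with hV
  have hV0 : 0 < V := ENNReal.toReal_pos (Metric.measure_ball_pos _ _ one_pos).ne'
    measure_ball_lt_top.ne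
  refine ⟨2 ^ k / V, by positivity, fun g hg => ?_⟩
  have hgc := hg.continuous
  set I := ∫ v in Metric.ball (0 : Fin n → ℂ) 1, ‖g v‖ ^ p with hI
  have hI0 : 0 ≤ I := integral_nonneg fun v => by positivity
  have hpc : Continuous fun v => ‖g v‖ ^ p := hgc.norm.rpow_const fun _ => Or.inr hp.le
  have hIi : IntegrableOn (fun v => ‖g v‖ ^ p) (Metric.ball 0 1) :=
    (hpc.continuousOn.integrableOn_compact (isCompact_closedBall 0 1)).mono_set
      Metric.ball_subset_closedBall
  obtain ⟨w, hw, hmax⟩ := (isCompact_closedBall (0 : Fin n → ℂ) 1).exists_isMaxOn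
    ⟨0, by simp⟩ (f := fun v => ‖g v‖ * (1 - ‖v‖) ^ k)
    (Continuous.continuousOn (by fun_prop))
  set M := ‖g w‖ * (1 - ‖w‖) ^ k with hM
  have hmax' : ∀ v : Fin n → ℂ, ‖v‖ ≤ 1 → ‖g v‖ * (1 - ‖v‖) ^ k ≤ M := fun v hv =>
    hmax (by simpa using hv)
  have h0 : ‖g 0‖ ≤ M := by simpa using hmax' 0 (by simp)
  rcases (norm_nonneg (g 0)).eq_or_lt with h00 | h00
  · rw [← h00, Real.zero_rpow hp.ne']; positivity
  have hM0 : 0 < M := h00.trans_le h0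
  have hw1 : ‖w‖ < 1 := by
    rcases (show ‖w‖ ≤ 1 by simpa using hw).eq_or_lt with h | h
    · rw [hM, h, sub_self, zero_pow hk0.ne', mul_zero] at hM0
      exact absurd hM0 (lt_irrefl _)
    · exact h
  -- The ball of radius t about w stays at distance at least t from the unit sphere.
  set t := (1 - ‖w‖) / 2 with ht
  have ht0 : 0 < t := by rw [ht]; linarith
  have ht1 : t ≤ 1 := by rw [ht]; linarith [norm_nonneg w]
  have hball : ∀ v ∈ Metric.ball (0 : Fin n → ℂ) t, ‖w + v‖ ≤ 1 - t := by
    intro v hv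
    rw [mem_ball_zero_iff] at hv
    linarith [norm_add_le w v]
  have hgle : ∀ v ∈ Metric.ball (0 : Fin n → ℂ) t, ‖g (w + v)‖ ≤ M / t ^ k := by
    intro v hv
    have h1 := hball v hv
    rw [le_div_iff₀ (by positivity)]
    refine le_trans ?_ (hmax' (w + v) (by linarith))
    gcongr
    linarith
  have hvol : volume.real (Metric.ball (0 : Fin n → ℂ) t) = t ^ (2 * n) * V := by
    rw [hV, Measure.real, Measure.real, Measure.addHaar_ball_of_pos _ _ ht0, ENNReal.toReal_mul,
      ENNReal.toReal_ofReal (by positivity), Module.finrank_pi_fintype]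
    simp [mul_comm]
  have h1 : ‖g w‖ * (t ^ (2 * n) * V) ≤ (M / t ^ k) ^ (1 - p) * I := by
    have h2 := mean_value_ball hg w t
    rw [hvol] at h2
    have h3 : ‖g w‖ * (t ^ (2 * n) * V) = ‖∫ v in Metric.ball (0 : Fin n → ℂ) t, g (w + v)‖ := by
      rw [h2, norm_mul, Complex.norm_real, Real.norm_of_nonneg (by positivity), mul_comm]
    rw [h3]
    have hpc' : IntegrableOn (fun v => ‖g (w + v)‖ ^ p) (Metric.ball (0 : Fin n → ℂ) t) :=
      ((hpc.comp (continuous_const.add continuous_id)).continuousOn.integrableOn_compact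
        (isCompact_closedBall 0 t)).mono_set Metric.ball_subset_closedBall
    refine (norm_integral_le_of_norm_le (hpc'.const_mul ((M / t ^ k) ^ (1 - p))) ?_).trans ?_
    · filter_upwards [ae_restrict_mem measurableSet_ball] with v hv
      rcases (norm_nonneg (g (w + v))).eq_or_lt with h | h
      · rw [← h]; positivity
      · calc ‖g (w + v)‖ = ‖g (w + v)‖ ^ (1 - p) * ‖g (w + v)‖ ^ p := by
              rw [← Real.rpow_add h]; simp
          _ ≤ _ := by
              gcongr
              exact hgle v hv
    · rw [integral_const_mul]
      gcongr
      have h4 : ∫ v in Metric.ball (0 : Fin n → ℂ) t, ‖g (w + v)‖ ^ p =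
          ∫ v in Metric.ball w t, ‖g v‖ ^ p := by
        rw [← integral_indicator measurableSet_ball,
          ← integral_indicator measurableSet_ball]
        symm
        rw [← integral_add_left_eq_self _ w]
        congr 1; funext v
        simp only [Set.indicator, Metric.mem_ball, dist_eq_norm, sub_zero, add_sub_cancel_left]
      rw [h4]
      refine setIntegral_mono_set hIi (Filter.Eventually.of_forall fun v => by positivity) ?_
      refine Filter.Eventually.of_forall (Metric.ball_subset_ball' ?_)
      rw [dist_zero_right]; linarith
  have h5 : M = ‖g w‖ * (2 * t) ^ k := by rw [hM, ht]; congr 2; ring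
  have h6 : M ^ p * t ^ (2 * n) * V ≤ 2 ^ k * (t ^ k) ^ p * I := by
    have h7 : ‖g w‖ = M / (2 ^ k * t ^ k) := by
      rw [h5, mul_pow]; field_simp
    rw [h7, Real.div_rpow hM0.le (by positivity), div_mul_eq_mul_div, div_mul_eq_mul_div,
      div_le_div_iff₀ (by positivity) (by positivity)] at h1
    have h8 : M = M ^ p * M ^ (1 - p) := by rw [← Real.rpow_add hM0]; simp
    have h9 : t ^ k = (t ^ k) ^ p * (t ^ k) ^ (1 - p) := by
      rw [← Real.rpow_add (by positivity)]; simp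
    have h10 : 0 < M ^ (1 - p) := by positivity
    have h11 : 0 < (t ^ k) ^ (1 - p) := by positivity
    have h12 : M * (t ^ (2 * n) * V) * (t ^ k) ^ (1 - p) =
        (M ^ p * t ^ (2 * n) * V) * (M ^ (1 - p) * (t ^ k) ^ (1 - p)) := by
      nth_rewrite 1 [h8]; ring
    have h13 : M ^ (1 - p) * I * (2 ^ k * t ^ k) =
        (2 ^ k * (t ^ k) ^ p * I) * (M ^ (1 - p) * (t ^ k) ^ (1 - p)) := by
      nth_rewrite 1 [h9]; ring
    rw [h12, h13] at h1
    exact le_of_mul_le_mul_right h1 (by positivity)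
  have h14 : (t ^ k) ^ p ≤ t ^ (2 * n) := by
    rw [← Real.rpow_natCast, ← Real.rpow_natCast, ← Real.rpow_mul ht0.le]
    refine Real.rpow_le_rpow_of_exponent_ge ht0 ht1 ?_
    push_cast; linarith
  have h15 : M ^ p * V ≤ 2 ^ k * I := by
    refine le_of_mul_le_mul_right (a := t ^ (2 * n)) ?_ (by positivity)
    calc M ^ p * V * t ^ (2 * n) = M ^ p * t ^ (2 * n) * V := by ring
      _ ≤ 2 ^ k * (t ^ k) ^ p * I := h6
      _ ≤ 2 ^ k * t ^ (2 * n) * I := by gcongr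
      _ = _ := by ring
  calc ‖g 0‖ ^ p ≤ M ^ p := by gcongr
    _ ≤ 2 ^ k / V * I := by rw [div_mul_eq_mul_div, le_div_iff₀ hV0]; exact h15

theorem nsq_add_le (z v : Fin n → ℂ) : nsq (z + v) ≤ nsq z + 4 * n * (‖z‖ * ‖v‖) + 2 * n * ‖v‖ ^ 2 := by
  have hb : ∀ a b : Fin n → ℂ, ‖bdot a b‖ ≤ n * (‖a‖ * ‖b‖) := by
    intro a b
    refine (norm_sum_le _ _).trans ?_
    calc ∑ j, ‖a j * b j‖ ≤ ∑ _j : Fin n, ‖a‖ * ‖b‖ := by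
          refine Finset.sum_le_sum fun j _ => ?_
          rw [norm_mul]
          gcongr <;> exact norm_le_pi_norm _ _
      _ = _ := by simp
  have h1 : euclSq (z + v) = euclSq z + 2 * (bdot v (star z)).re + euclSq v := by
    have := euclSq_add_smul z v 1
    simpa using this
  have h2 : bdot (z + v) (z + v) = bdot z z + 2 * bdot z v + bdot v v := by
    rw [bdot_add_left, bdot_add_right, bdot_add_right, bdot_comm v z]; ring
  have h3 : (bdot v (star z)).re ≤ n * (‖z‖ * ‖v‖) := by
    refine (Complex.re_le_norm _).trans ((hb v (star z)).trans_eq ?_)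
    rw [norm_star, mul_comm ‖v‖]
  have h4 : ‖bdot (z + v) (z + v)‖ ≤ ‖bdot z z‖ + 2 * (n * (‖z‖ * ‖v‖)) + n * (‖v‖ * ‖v‖) := by
    rw [h2]
    refine (norm_add₃_le).trans ?_
    rw [norm_mul, Complex.norm_ofNat]
    gcongr
    · exact hb z v
    · exact hb v v
  have h5 := euclSq_le_mul_sq_norm v
  rw [nsq, nsq, h1]
  nlinarith

/-- The integral `∫ (|f| e^{-φ})^p |z • z|⁻¹` with respect to unnormalised Lebesgue measure. -/
noncomputable def fockInt (s p : ℝ) (f : (Fin n → ℂ) → ℂ) : ℝ≥0∞ :=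
  ∫⁻ z, ENNReal.ofReal ((‖f z‖ * weight s z) ^ p) * (ENNReal.ofReal ‖bdot z z‖)⁻¹

/-- Only the singular factor needs care: (1 + nsq) |ζ|^p / |ζ|² ≥ 1, because p ≤ 2 when |ζ| ≤ 1 and
|ζ|² ≤ nsq in general. -/
theorem rpow_norm_le_density {s p : ℝ} (hp : 0 < p) (hp1 : p ≤ 1)
    (f : (Fin n → ℂ) → ℂ) {w : Fin n → ℂ} (hw : bdot w w ≠ 0) :
    ENNReal.ofReal (‖f w‖ ^ p) ≤ ENNReal.ofReal ((1 + nsq w) * Real.exp (p * (s * nsq w / 2))) *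
      (ENNReal.ofReal ((‖f w‖ * weight s w) ^ p) * (ENNReal.ofReal ‖bdot w w‖)⁻¹) := by
  have hq : 0 < ‖bdot w w‖ := norm_pos_iff.mpr hw
  have hnq := norm_bdot_self_le_nsq w
  have hn0 := nsq_nonneg w
  have hr : ‖rt w‖ ^ p * ‖rt w‖ ^ p = ‖bdot w w‖ ^ p := by
    rw [← Real.mul_rpow (norm_nonneg _) (norm_nonneg _), ← sq, norm_rt_sq]
  have hr0 : 0 < ‖rt w‖ := by
    have := norm_rt_sq w
    by_contra h
    have h0 : ‖rt w‖ = 0 := le_antisymm (not_lt.mp h) (norm_nonneg _)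
    rw [h0] at this
    simp only [ne_eq, OfNat.ofNat_ne_zero, not_false_eq_true, zero_pow] at this
    exact hq.ne this
  rw [← ENNReal.ofReal_inv_of_pos hq, ← ENNReal.ofReal_mul (by have := weight_nonneg s w; positivity),
    ← ENNReal.ofReal_mul (by positivity), weight_eq]
  refine ENNReal.ofReal_le_ofReal ?_
  rw [Real.mul_rpow (norm_nonneg _) (by positivity), Real.mul_rpow (norm_nonneg _) (by positivity),
    ← Real.exp_mul]
  have e : Real.exp (p * (s * nsq w / 2)) * Real.exp (-(s * nsq w / 2) * p) = 1 := by
    rw [← Real.exp_add]; simp; ring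
  have h1 : 1 ≤ (1 + nsq w) * (‖rt w‖ ^ p * ‖bdot w w‖⁻¹) := by
    rw [← div_eq_mul_inv, ← mul_div_assoc, le_div_iff₀ hq, one_mul]
    rcases le_total ‖rt w‖ 1 with h | h
    · have h2 : ‖rt w‖ ^ (2 : ℝ) ≤ ‖rt w‖ ^ p :=
        Real.rpow_le_rpow_of_exponent_ge hr0 h (by linarith)
      rw [Real.rpow_two, norm_rt_sq] at h2
      have h3 : 0 ≤ ‖rt w‖ ^ p := by positivity
      nlinarith
    · have h2 : 1 ≤ ‖rt w‖ ^ p := Real.one_le_rpow h hp.le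
      nlinarith
  calc ‖f w‖ ^ p = ‖f w‖ ^ p * 1 := (mul_one _).symm
    _ ≤ ‖f w‖ ^ p * ((1 + nsq w) * (‖rt w‖ ^ p * ‖bdot w w‖⁻¹)) := by gcongr
    _ = ‖f w‖ ^ p * ((1 + nsq w) * (‖rt w‖ ^ p * ‖bdot w w‖⁻¹)) *
        (Real.exp (p * (s * nsq w / 2)) * Real.exp (-(s * nsq w / 2) * p)) := by rw [e, mul_one]
    _ = _ := by ring

theorem exists_rpow_norm_le_fockInt (hn : 1 ≤ n) {s p : ℝ} (hs : 0 < s) (hp : 0 < p)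
    (hp1 : p ≤ 1) : ∃ C : ℝ, 0 < C ∧ ∀ f : (Fin n → ℂ) → ℂ, Differentiable ℂ f →
      fockInt s p f ≠ ⊤ → ∀ z, ‖f z‖ ^ p ≤
        C * (1 + ‖z‖) ^ (2 * n + 2) * Real.exp (p * (s * nsq z / 2)) * (fockInt s p f).toReal := by
  obtain ⟨C, hC, h⟩ := exists_rpow_norm_le_integral n hp hp1
  refine ⟨C * ((1 + 2 * n) * Real.exp (p * (s * (6 * n) / 2))), by positivity,
    fun f hf hfin z => ?_⟩
  -- On a ball of this radius `nsq` changes by a bounded amount, so the exponential weight is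
  -- comparable to its value at z; the volume costs (1 + ‖z‖)^{2n}.
  set ρ := (1 + ‖z‖)⁻¹ with hρ
  have hz := norm_nonneg z
  have hρ0 : 0 < ρ := by positivity
  have hρ1 : ρ ≤ 1 := inv_le_one_of_one_le₀ (by linarith)
  have hρz : ρ * ‖z‖ ≤ 1 := by
    rw [hρ, inv_mul_le_iff₀ (by positivity)]; linarith
  have hg : Differentiable ℂ fun v : Fin n → ℂ => f (z + (ρ : ℂ) • v) := hf.comp (by fun_prop)
  have h1 := h _ hg
  simp only [smul_zero, add_zero] at h1
  have hpc : Continuous fun v => ‖f v‖ ^ p :=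
    hf.continuous.norm.rpow_const fun _ => Or.inr hp.le
  have hball : ∀ v ∈ Metric.ball z ρ, nsq v ≤ nsq z + 6 * n ∧
      1 + nsq v ≤ (1 + 2 * n) * (1 + ‖z‖) ^ 2 := by
    intro v hv
    obtain ⟨u, rfl⟩ : ∃ u, v = z + u := ⟨v - z, by abel⟩
    rw [Metric.mem_ball, dist_eq_norm, add_sub_cancel_left] at hv
    have hu := norm_nonneg u
    have hn' : (0 : ℝ) ≤ n := by positivity
    constructor
    · refine (nsq_add_le z u).trans ?_
      have h2 : ‖z‖ * ‖u‖ ≤ 1 := by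
        calc ‖z‖ * ‖u‖ ≤ ‖z‖ * ρ := by gcongr
          _ ≤ 1 := by linarith
      have h3 : ‖u‖ ^ 2 ≤ 1 := pow_le_one₀ hu (by linarith)
      nlinarith
    · have h2 := nsq_le_two_mul_euclSq (z + u)
      have h3 := euclSq_le_mul_sq_norm (z + u)
      have h4 : ‖z + u‖ ^ 2 ≤ (1 + ‖z‖) ^ 2 := by
        gcongr
        linarith [norm_add_le z u]
      have h5 : (1 : ℝ) ≤ (1 + ‖z‖) ^ 2 := one_le_pow₀ (by linarith)
      nlinarith
  have h2 : ∫ v in Metric.ball (0 : Fin n → ℂ) 1, ‖f (z + (ρ : ℂ) • v)‖ ^ p =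
      (1 + ‖z‖) ^ (2 * n) * ∫ v in Metric.ball z ρ, ‖f v‖ ^ p := by
    have h3 := Measure.integral_comp_smul (volume : Measure (Fin n → ℂ))
      ((Metric.ball (0 : Fin n → ℂ) ρ).indicator fun v => ‖f (z + v)‖ ^ p) ρ
    have hfin : Module.finrank ℝ (Fin n → ℂ) = 2 * n := by
      rw [Module.finrank_pi_fintype]; simp [mul_comm]
    rw [hfin, abs_of_pos (by positivity), hρ, inv_pow, inv_inv, ← hρ, smul_eq_mul] at h3
    have h4 : ∫ v in Metric.ball z ρ, ‖f v‖ ^ p =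
        ∫ v, (Metric.ball (0 : Fin n → ℂ) ρ).indicator (fun v => ‖f (z + v)‖ ^ p) v := by
      rw [← integral_indicator measurableSet_ball, ← integral_add_left_eq_self _ z]
      congr 1; funext v
      simp only [Set.indicator, Metric.mem_ball, dist_eq_norm, sub_zero, add_sub_cancel_left]
    rw [h4, ← h3, ← integral_indicator measurableSet_ball]
    congr 1; funext v
    simp only [Set.indicator, mem_ball_zero_iff, norm_smul, Real.norm_of_nonneg hρ0.le]
    have e : (ρ * ‖v‖ < ρ) ↔ ‖v‖ < 1 := by
      constructor
      · intro hh; nlinarith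
      · intro hh; nlinarith
    have e2 : ρ • v = (ρ : ℂ) • v := by ext j; simp
    simp only [e, e2]
  set B := (1 + 2 * n) * (1 + ‖z‖) ^ 2 * Real.exp (p * (s * (nsq z + 6 * n) / 2)) with hB
  have hB0 : 0 ≤ B := by positivity
  have h3 : ENNReal.ofReal (∫ v in Metric.ball z ρ, ‖f v‖ ^ p) ≤
      ENNReal.ofReal B * fockInt s p f := by
    rw [ofReal_integral_eq_lintegral_ofReal
      ((hpc.continuousOn.integrableOn_compact (isCompact_closedBall z ρ)).mono_set
        Metric.ball_subset_closedBall) (Filter.Eventually.of_forall fun v => by positivity)]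
    rw [fockInt, ← lintegral_const_mul' _ _ ENNReal.ofReal_ne_top]
    refine le_trans ?_ (setLIntegral_le_lintegral (Metric.ball z ρ) _)
    refine lintegral_mono_ae ?_
    filter_upwards [ae_restrict_mem measurableSet_ball,
      ae_restrict_of_ae (ae_bdot_self_ne_zero hn)] with v hv hqv
    refine (rpow_norm_le_density (s := s) hp hp1 f hqv).trans ?_
    gcongr
    obtain ⟨hv1, hv2⟩ := hball v hv
    have := nsq_nonneg v
    simp only [hB]
    gcongr
  have h4 : ∫ v in Metric.ball z ρ, ‖f v‖ ^ p ≤ B * (fockInt s p f).toReal := by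
    have h5 : ENNReal.ofReal B * fockInt s p f =
        ENNReal.ofReal (B * (fockInt s p f).toReal) := by
      rw [ENNReal.ofReal_mul hB0, ENNReal.ofReal_toReal hfin]
    rw [h5] at h3
    exact (ENNReal.ofReal_le_ofReal_iff (by positivity)).mp h3
  rw [h2] at h1
  refine h1.trans ?_
  calc C * ((1 + ‖z‖) ^ (2 * n) * ∫ v in Metric.ball z ρ, ‖f v‖ ^ p)
      ≤ C * ((1 + ‖z‖) ^ (2 * n) * (B * (fockInt s p f).toReal)) := by gcongr
    _ = _ := by
      have e : Real.exp (p * (s * (nsq z + 6 * n) / 2)) =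
          Real.exp (p * (s * nsq z / 2)) * Real.exp (p * (s * (6 * n) / 2)) := by
        rw [← Real.exp_add]; congr 1; ring
      rw [hB, e, pow_add]; ring

end MeanValue

/-! ### The norms, and integrability from growth bounds -/

section Norms
variable {n : ℕ}

/-- The normalising factor of `dA`. -/
noncomputable def ballInv (n : ℕ) : ℝ≥0∞ := (volume {z : Fin n → ℂ | euclSq z < 1})⁻¹

theorem ballInv_ne_zero : ballInv n ≠ 0 := by
  rw [ballInv, ENNReal.inv_ne_zero]
  refine ((measure_mono fun z hz => ?_).trans_lt (measure_closedBall_lt_top (x := 0) (r := 1))).ne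
  have h1 := sq_norm_le_euclSq z
  have h2 : euclSq z < 1 := hz
  rw [mem_closedBall_zero_iff]
  nlinarith [norm_nonneg z]

theorem ballInv_ne_top : ballInv n ≠ ⊤ := by
  rw [ballInv, ENNReal.inv_ne_top]
  refine (IsOpen.measure_pos volume (continuous_euclSq.isOpen_preimage _ isOpen_Iio) ⟨0, ?_⟩).ne'
  simp [euclSq]

theorem lintegral_fockMeasure {g : (Fin n → ℂ) → ℝ≥0∞} (hg : Measurable g) :
    ∫⁻ z, g z ∂(fockMeasure n) = ballInv n * ∫⁻ z, g z * (ENNReal.ofReal ‖bdot z z‖)⁻¹ := by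
  have hq : Measurable fun z : Fin n → ℂ => (ENNReal.ofReal ‖bdot z z‖)⁻¹ := by
    have := (continuous_bdot_self (n := n)).measurable
    fun_prop
  rw [fockMeasure, lintegral_withDensity_eq_lintegral_mul _ hq hg, dA, lintegral_smul_measure]
  rw [smul_eq_mul, ballInv]
  congr 1
  exact lintegral_congr fun z => mul_comm _ _

theorem eLpNorm_fockMeasure (s : ℝ) {p : ℝ} (hp : 0 < p) {f : (Fin n → ℂ) → ℂ}
    (hf : Continuous f) : eLpNorm (fun z => f z * (weight s z : ℂ)) (ENNReal.ofReal p)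
      (fockMeasure n) = (ballInv n * fockInt s p f) ^ (1 / p) := by
  rw [eLpNorm_eq_lintegral_rpow_enorm_toReal (by simpa using hp) ENNReal.ofReal_ne_top,
    ENNReal.toReal_ofReal hp.le]
  have hm : Measurable fun z => ‖f z * (weight s z : ℂ)‖ₑ ^ p := by
    have h1 := hf.measurable
    have h2 := (continuous_weight (n := n) s).measurable
    fun_prop
  rw [lintegral_fockMeasure hm, fockInt]
  congr 3
  funext z
  congr 1
  have hw := weight_nonneg s z
  rw [← ENNReal.ofReal_rpow_of_nonneg (by positivity) hp.le, ← ofReal_norm, norm_mul,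
    Complex.norm_real, Real.norm_of_nonneg hw]

theorem mem_fockP {s p : ℝ} (hp : 0 < p) {f : (Fin n → ℂ) → ℂ} :
    f ∈ FockP n s p ↔ Differentiable ℂ f ∧ fockInt s p f ≠ ⊤ := by
  have key : ∀ hf : Differentiable ℂ f, MemLp (fun z => f z * (weight s z : ℂ))
      (ENNReal.ofReal p) (fockMeasure n) ↔ fockInt s p f ≠ ⊤ := by
    intro hf
    rw [MemLp, eLpNorm_fockMeasure s hp hf.continuous]
    have h1 : AEStronglyMeasurable (fun z => f z * (weight s z : ℂ)) (fockMeasure n) := by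
      refine Continuous.aestronglyMeasurable (hf.continuous.mul ?_)
      exact Complex.continuous_ofReal.comp (continuous_weight s)
    have h2 : (ballInv n * fockInt s p f) ^ (1 / p) < ⊤ ↔ fockInt s p f ≠ ⊤ := by
      rw [lt_top_iff_ne_top, Ne, Ne, ENNReal.rpow_eq_top_iff_of_pos (by positivity),
        ENNReal.mul_eq_top]
      have h3 := ballInv_ne_zero (n := n)
      have h4 := ballInv_ne_top (n := n)
      tauto
    rw [h2]
    exact ⟨fun h => h.2, fun h => ⟨h1, h⟩⟩
  constructor
  · rintro ⟨h1, h2⟩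
    exact ⟨h1, (key h1).mp h2⟩
  · rintro ⟨h1, h2⟩
    exact ⟨h1, (key h1).mpr h2⟩

theorem pNorm_nonneg {s p : ℝ} (f : FockP n s p) : 0 ≤ pNorm f := ENNReal.toReal_nonneg

theorem pNorm_rpow {s p : ℝ} (hp : 0 < p) (f : FockP n s p) :
    pNorm f ^ p = (ballInv n).toReal * (fockInt s p (f : (Fin n → ℂ) → ℂ)).toReal := by
  rw [pNorm, eLpNorm_fockMeasure s hp f.2.1.continuous, ENNReal.toReal_rpow, ← ENNReal.rpow_mul,
    one_div_mul_cancel hp.ne', ENNReal.rpow_one, ENNReal.toReal_mul]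

theorem pNorm_smul {s p : ℝ} (c : ℂ) (f : FockP n s p) : pNorm (c • f) = ‖c‖ * pNorm f := by
  have h := eLpNorm_const_smul c (fun z => (f : (Fin n → ℂ) → ℂ) z * (weight s z : ℂ))
    (ENNReal.ofReal p) (fockMeasure n)
  have e : (fun z => ((c • f : FockP n s p) : (Fin n → ℂ) → ℂ) z * (weight s z : ℂ)) =
      c • fun z => (f : (Fin n → ℂ) → ℂ) z * (weight s z : ℂ) := by
    funext z; simp [mul_assoc]
  rw [pNorm, e, h, ENNReal.toReal_mul, toReal_enorm, pNorm]

theorem norm_mul_weight_le {s : ℝ} (g : FockInf n s) (z : Fin n → ℂ) :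
    ‖(g : (Fin n → ℂ) → ℂ) z‖ * weight s z ≤ infNorm g := by
  have h := le_ciSup g.2.2 z
  simp only [norm_mul, Complex.norm_real, Real.norm_of_nonneg (weight_nonneg s z)] at h
  rw [infNorm]
  simpa only [norm_mul, Complex.norm_real, Real.norm_of_nonneg (weight_nonneg s z)] using h

theorem infNorm_nonneg {s : ℝ} (g : FockInf n s) : 0 ≤ infNorm g :=
  Real.iSup_nonneg fun _ => norm_nonneg _

theorem infNorm_le {s K : ℝ} (g : FockInf n s)
    (h : ∀ z, ‖(g : (Fin n → ℂ) → ℂ) z‖ * weight s z ≤ K) : infNorm g ≤ K := by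
  refine ciSup_le fun z => ?_
  rw [norm_mul, Complex.norm_real, Real.norm_of_nonneg (weight_nonneg s z)]
  exact h z

theorem mem_fockInf {s K : ℝ} {g : (Fin n → ℂ) → ℂ} (hg : Differentiable ℂ g)
    (h : ∀ z, ‖g z‖ * weight s z ≤ K) : g ∈ FockInf n s := by
  refine ⟨hg, K, ?_⟩
  rintro _ ⟨z, rfl⟩
  show ‖g z * (weight s z : ℂ)‖ ≤ K
  rw [norm_mul, Complex.norm_real, Real.norm_of_nonneg (weight_nonneg s z)]
  exact h z

theorem exists_norm_le_pNorm (hn : 1 ≤ n) {s p : ℝ} (hs : 0 < s) (hp : 0 < p)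
    (hp1 : p ≤ 1) : ∃ (C : ℝ) (d : ℕ), 0 < C ∧ ∀ (f : FockP n s p) z,
      ‖(f : (Fin n → ℂ) → ℂ) z‖ ≤ C * (1 + Nstar z) ^ d * Real.exp (s * nsq z / 2) * pNorm f := by
  obtain ⟨C, hC, h⟩ := exists_rpow_norm_le_fockInt hn hs hp hp1
  have hb : 0 < (ballInv n).toReal := ENNReal.toReal_pos ballInv_ne_zero ballInv_ne_top
  refine ⟨(C / (ballInv n).toReal) ^ (1 / p), ⌈((2 * n + 2 : ℕ) : ℝ) / p⌉₊, by positivity,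
    fun f z => ?_⟩
  obtain ⟨h1, h2⟩ := (mem_fockP hp).mp f.2
  have h3 := h f h1 h2 z
  have hN := Nstar_nonneg z
  have hzN := norm_le_Nstar z
  have hpn := pNorm_nonneg f
  have h4 : (fockInt s p (f : (Fin n → ℂ) → ℂ)).toReal = pNorm f ^ p / (ballInv n).toReal := by
    rw [pNorm_rpow hp, mul_div_cancel_left₀ _ hb.ne']
  rw [h4] at h3
  have h5 : ‖(f : (Fin n → ℂ) → ℂ) z‖ =
      (‖(f : (Fin n → ℂ) → ℂ) z‖ ^ p) ^ (1 / p) := by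
    rw [← Real.rpow_mul (norm_nonneg _), mul_one_div_cancel hp.ne', Real.rpow_one]
  rw [h5]
  calc _ ≤ (C / (ballInv n).toReal * ((1 + Nstar z) ^ (2 * n + 2) *
        (Real.exp (p * (s * nsq z / 2)) * pNorm f ^ p))) ^ (1 / p) := by
        gcongr
        refine h3.trans ?_
        calc _ ≤ C * (1 + Nstar z) ^ (2 * n + 2) * Real.exp (p * (s * nsq z / 2)) *
              (pNorm f ^ p / (ballInv n).toReal) := by gcongr
          _ = _ := by ring
    _ = (C / (ballInv n).toReal) ^ (1 / p) * (((1 + Nstar z) ^ (2 * n + 2)) ^ (1 / p) *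
        (Real.exp (s * nsq z / 2) * pNorm f)) := by
        rw [Real.mul_rpow (by positivity) (by positivity),
          Real.mul_rpow (by positivity) (by positivity),
          Real.mul_rpow (by positivity) (by positivity), ← Real.exp_mul, ← Real.rpow_mul hpn,
          mul_one_div_cancel hp.ne', Real.rpow_one]
        congr 4
        field_simp
    _ ≤ (C / (ballInv n).toReal) ^ (1 / p) * ((1 + Nstar z) ^ ⌈((2 * n + 2 : ℕ) : ℝ) / p⌉₊ *
        (Real.exp (s * nsq z / 2) * pNorm f)) := by
        gcongr
        rw [← Real.rpow_natCast, ← Real.rpow_mul (by positivity), ← Real.rpow_natCast,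
          mul_one_div]
        exact Real.rpow_le_rpow_of_exponent_le (by linarith) (Nat.le_ceil _)
    _ = _ := by ring

theorem exists_poly_exp_le (k : ℕ) (A : ℝ) {c : ℝ} (hc : 0 < c) :
    ∃ C, 0 < C ∧ ∀ N : ℝ, 0 ≤ N →
      (1 + N) ^ k * Real.exp (A * N - c * N ^ 2) ≤ C * Real.exp (-(c / 2) * N ^ 2) := by
  obtain ⟨K, hK, h⟩ := exists_one_add_pow_mul_exp_le k one_pos
  refine ⟨K * Real.exp ((A + 1) ^ 2 / (2 * c)), by positivity, fun N hN => ?_⟩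
  have h1 := h N hN
  rw [one_mul, Real.exp_neg, ← div_eq_mul_inv, div_le_iff₀ (Real.exp_pos _)] at h1
  have h2 : N + (A * N - c * N ^ 2) ≤ (A + 1) ^ 2 / (2 * c) + -(c / 2) * N ^ 2 := by
    have h3 : 0 ≤ (c / 2) * (N - (A + 1) / c) ^ 2 := by positivity
    have h4 : (c / 2) * (N - (A + 1) / c) ^ 2 =
        c / 2 * N ^ 2 - (A + 1) * N + (A + 1) ^ 2 / (2 * c) := by field_simp; ring
    nlinarith
  calc (1 + N) ^ k * Real.exp (A * N - c * N ^ 2)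
      ≤ (K * Real.exp N) * Real.exp (A * N - c * N ^ 2) := by gcongr
    _ = K * Real.exp (N + (A * N - c * N ^ 2)) := by rw [Real.exp_add]; ring
    _ ≤ K * Real.exp ((A + 1) ^ 2 / (2 * c) + -(c / 2) * N ^ 2) := by gcongr
    _ = _ := by rw [Real.exp_add]; ring

theorem dsq_zero (z : Fin n → ℂ) : dsq z (rt z) 0 0 = nsq z := by
  rw [dsq, sub_zero, sub_zero, nsq, norm_rt_sq]

/-- `chart_bound` with p = 1, centred at the vertex of the cone. -/
theorem integrable_exp_nsq_div (hn : 1 ≤ n) {c : ℝ} (hc : 0 < c) :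
    Integrable fun z : Fin n → ℂ =>
      (nsq z ^ ((1 : ℝ) / 2) + nsq z) * Real.exp (-c * nsq z) * ‖bdot z z‖⁻¹ := by
  obtain ⟨K, hK, h⟩ := chart_bound hn one_pos one_le_two hc
  have h1 := h 0 0
  simp only [dsq_zero] at h1
  have hm1 := continuous_nsq (n := n) |>.measurable
  have hm2 := continuous_bdot_self (n := n) |>.measurable
  refine ⟨Measurable.aestronglyMeasurable (by fun_prop), ?_⟩
  rw [hasFiniteIntegral_iff_ofReal (Filter.Eventually.of_forall fun z => by
    have := nsq_nonneg z
    positivity)]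
  refine lt_of_eq_of_lt ?_ (h1.trans_lt hK.lt_top)
  refine lintegral_congr_ae ?_
  filter_upwards [ae_bdot_self_ne_zero hn] with z hz
  have := nsq_nonneg z
  rw [ENNReal.ofReal_mul (by positivity), ENNReal.ofReal_inv_of_pos (norm_pos_iff.mpr hz)]

theorem norm_rt_pos {z : Fin n → ℂ} (hz : bdot z z ≠ 0) : 0 < ‖rt z‖ := by
  rw [norm_pos_iff]
  intro h
  have := rt_sq z
  rw [h] at this
  exact hz (by rw [← this]; simp)

/-- The weight controls h only up to |ζ|⁻¹. This singularity is integrable, being at most N_* / |z •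
z|, and the spare half of the Gaussian absorbs e^{A N_*} and the polynomial. -/
theorem gaussInt_of_weight_bound (hn : 1 ≤ n) {s : ℝ} (hs : 0 < s) {h : (Fin n → ℂ) → ℂ}
    (hc : Continuous h) {K : ℝ} {k : ℕ} (hK : ∀ z, ‖h z‖ * weight s z ≤ K * (1 + Nstar z) ^ k) :
    GaussInt s h := by
  intro A
  obtain ⟨C, hC, hexp⟩ := exists_poly_exp_le k A (half_pos hs)
  have hK0 : 0 ≤ K := by
    have h1 := hK 0
    have h2 : 0 ≤ ‖h 0‖ * weight s (0 : Fin n → ℂ) :=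
      mul_nonneg (norm_nonneg _) (weight_nonneg _ _)
    have h3 : Nstar (0 : Fin n → ℂ) = 0 := by simp [Nstar, euclSq, bdot]
    rw [h3] at h1
    simpa using h2.trans h1
  have hNc := continuous_Nstar (n := n)
  have hnc : Continuous fun z : Fin n → ℂ => nsq z := continuous_nsq
  refine ((integrable_exp_nsq_div hn (by positivity : 0 < s / 2 / 2)).const_mul (K * C)).mono'
    (Continuous.aestronglyMeasurable (by fun_prop)) ?_
  filter_upwards [ae_bdot_self_ne_zero hn] with z hz
  have hr := norm_rt_pos hz
  have hN := Nstar_nonneg z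
  have hn0 := nsq_nonneg z
  rw [Real.norm_of_nonneg (by positivity)]
  have h1 := hK z
  rw [weight_eq] at h1
  have h2 : ‖rt z‖⁻¹ ≤ (nsq z ^ ((1 : ℝ) / 2) + nsq z) * ‖bdot z z‖⁻¹ := by
    have h3 : ‖bdot z z‖ = ‖rt z‖ ^ 2 := (norm_rt_sq z).symm
    rw [h3, ← div_eq_mul_inv, le_div_iff₀ (by positivity), sq, inv_mul_cancel_left₀ hr.ne']
    have h4 : ‖rt z‖ ≤ nsq z ^ ((1 : ℝ) / 2) := by
      rw [← Real.sqrt_eq_rpow]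
      exact Real.le_sqrt_of_sq_le (by rw [norm_rt_sq]; exact norm_bdot_self_le_nsq z)
    linarith
  have h5 := hexp (Nstar z) hN
  rw [Nstar_sq] at h5
  have e1 : Real.exp (A * Nstar z - s * nsq z) = Real.exp (-(s * nsq z / 2)) *
      Real.exp (A * Nstar z - s / 2 * nsq z) := by rw [← Real.exp_add]; congr 1; ring
  have e2 : -(s / 2 / 2) * nsq z = -(s / 2 / 2) * nsq z := rfl
  calc ‖h z‖ * Real.exp (A * Nstar z - s * nsq z)
      = (‖h z‖ * (‖rt z‖ * Real.exp (-(s * nsq z / 2)))) * ‖rt z‖⁻¹ *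
        Real.exp (A * Nstar z - s / 2 * nsq z) := by rw [e1]; field_simp
    _ ≤ (K * (1 + Nstar z) ^ k) * ((nsq z ^ ((1 : ℝ) / 2) + nsq z) * ‖bdot z z‖⁻¹) *
        Real.exp (A * Nstar z - s / 2 * nsq z) := by gcongr
    _ = K * ((1 + Nstar z) ^ k * Real.exp (A * Nstar z - s / 2 * nsq z)) *
        ((nsq z ^ ((1 : ℝ) / 2) + nsq z) * ‖bdot z z‖⁻¹) := by ring
    _ ≤ K * (C * Real.exp (-(s / 2 / 2) * nsq z)) *
        ((nsq z ^ ((1 : ℝ) / 2) + nsq z) * ‖bdot z z‖⁻¹) := by gcongr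
    _ = _ := by ring

end Norms

/-! ### Sharp pointwise growth in F_s^p -/

section Growth
variable {n : ℕ}

theorem integrable_fockInt (hn : 1 ≤ n) {s p : ℝ} {f : (Fin n → ℂ) → ℂ}
    (hf : Continuous f) (hfin : fockInt s p f ≠ ⊤) :
    Integrable (fun z => (‖f z‖ * weight s z) ^ p * ‖bdot z z‖⁻¹) ∧
      ∫ z, (‖f z‖ * weight s z) ^ p * ‖bdot z z‖⁻¹ = (fockInt s p f).toReal := by
  have hw : ∀ z : Fin n → ℂ, 0 ≤ weight s z := weight_nonneg s
  have hm : AEStronglyMeasurable (fun z => (‖f z‖ * weight s z) ^ p * ‖bdot z z‖⁻¹) volume := by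
    have h1 := hf.measurable
    have h2 := (continuous_weight (n := n) s).measurable
    have h3 := (continuous_bdot_self (n := n)).measurable
    exact Measurable.aestronglyMeasurable (by fun_prop)
  have h0 : ∀ z, 0 ≤ (‖f z‖ * weight s z) ^ p * ‖bdot z z‖⁻¹ := fun z => by
    have := hw z; positivity
  have h1 : ∫⁻ z, ENNReal.ofReal ((‖f z‖ * weight s z) ^ p * ‖bdot z z‖⁻¹) = fockInt s p f := by
    refine lintegral_congr_ae ?_
    filter_upwards [ae_bdot_self_ne_zero hn] with z hz
    have := hw z
    rw [ENNReal.ofReal_mul (by positivity), ENNReal.ofReal_inv_of_pos (norm_pos_iff.mpr hz)]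
  refine ⟨⟨hm, ?_⟩, ?_⟩
  · rw [hasFiniteIntegral_iff_ofReal (Filter.Eventually.of_forall h0), h1]
    exact hfin.lt_top
  · rw [integral_eq_lintegral_of_nonneg_ae (Filter.Eventually.of_forall h0) hm, h1]

theorem weight_star (s : ℝ) (w : Fin n → ℂ) : weight s (star w) = weight s w := by
  rw [weight, weight, Nstar_star, bdot_star, norm_star]

theorem weight_sq (s : ℝ) (w : Fin n → ℂ) :
    weight s w ^ 2 = ‖bdot w w‖ * Real.exp (-s * nsq w) := by
  rw [weight_eq, mul_pow, norm_rt_sq, ← Real.exp_nat_mul]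
  congr 2; push_cast; ring

theorem one_add_mul_nsq_le {w u : Fin n → ℂ} {δ d : ℝ} (hδ : 0 ≤ δ) (hδ1 : δ ≤ 1) (hd : 0 ≤ d)
    (h : nsq w ≤ 2 * (nsq u + d)) : 1 + δ * nsq w ≤ 2 * (1 + d) * (1 + δ * nsq u) := by
  have hu := nsq_nonneg u
  have h1 : δ * nsq w ≤ δ * (2 * (nsq u + d)) := by gcongr
  have h2 : 0 ≤ δ * nsq u * d := by positivity
  nlinarith [mul_nonneg hδ hu]

/-- Since nsq w ≤ 2(nsq u + d), weights move from w to u at the cost of powers of 1 + d, which the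
Gaussian decay absorbs. The prefactor N_*(u) N_*(w) costs one power of 1 + nsq u. The constant must
not depend on δ. -/
theorem exists_ker_growth_le (hn : 1 ≤ n) {s : ℝ} (hs : 0 < s) (E : ℝ) (_hE : 0 ≤ E) :
    ∃ C : ℝ, 0 < C ∧ ∀ (u w : Fin n → ℂ) (δ γ D : ℝ), 0 ≤ δ → δ ≤ 1 → 0 ≤ γ → 0 ≤ D → γ + D ≤ E →
      ‖ker n s 0 u (star w)‖ * weight s u * weight s w * ((1 + nsq w) ^ γ * (1 + δ * nsq w) ^ D) ≤
        C * ((1 + nsq u) ^ (1 + γ) * (1 + δ * nsq u) ^ D) := by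
  obtain ⟨C₀, hC₀, hker⟩ := exists_norm_ker_le hn hs le_rfl
  obtain ⟨C₁, hC₁, hexp⟩ := exists_rpow_le_exp_mul (1 + E) (by positivity : 0 < s / 16)
  refine ⟨(C₀ + 1) * (2 * (2 ^ (1 + E) * C₁)), by positivity,
    fun u w δ γ D hδ hδ1 hγ hD hE' => ?_⟩
  have hnu := nsq_nonneg u
  have hnw := nsq_nonneg w
  have hNu := Nstar_nonneg u
  have hNw := Nstar_nonneg w
  have key : ∀ η : ℂ, η ^ 2 = bdot w w → Nstar u * Nstar w *
      Real.exp (-(s / 16) * dsq u (rt u) w η) * ((1 + nsq w) ^ γ * (1 + δ * nsq w) ^ D) ≤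
      2 ^ (1 + E) * C₁ * ((1 + nsq u) ^ (1 + γ) * (1 + δ * nsq u) ^ D) := by
    intro η hη
    set d := dsq u (rt u) w η with hd
    have hd0 : 0 ≤ d := dsq_nonneg _ _ _ _
    have h1 := nsq_le_two_mul (rt_sq u) hη
    have h2 := one_add_mul_nsq_le hδ hδ1 hd0 h1
    have h3 := one_add_mul_nsq_le zero_le_one le_rfl hd0 h1
    rw [one_mul, one_mul] at h3
    have h4 : Nstar u * Nstar w ≤ 2 * (1 + d) * (1 + nsq u) := by
      have : 2 * (Nstar u * Nstar w) ≤ nsq u + nsq w := by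
        rw [← Nstar_sq, ← Nstar_sq]; nlinarith [sq_nonneg (Nstar u - Nstar w)]
      nlinarith [mul_nonneg hd0 hnu]
    have h5 := hexp d hd0
    have hb : 1 ≤ 2 * (1 + d) := by linarith
    calc Nstar u * Nstar w * Real.exp (-(s / 16) * d) * ((1 + nsq w) ^ γ * (1 + δ * nsq w) ^ D)
        ≤ 2 * (1 + d) * (1 + nsq u) * Real.exp (-(s / 16) * d) *
          ((2 * (1 + d) * (1 + nsq u)) ^ γ * (2 * (1 + d) * (1 + δ * nsq u)) ^ D) := by gcongr
      _ = (2 * (1 + d)) ^ (1 + γ + D) * Real.exp (-(s / 16) * d) *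
          ((1 + nsq u) ^ (1 + γ) * (1 + δ * nsq u) ^ D) := by
          rw [Real.mul_rpow (x := 2 * (1 + d)) (y := 1 + nsq u) (by positivity) (by positivity),
            Real.mul_rpow (x := 2 * (1 + d)) (y := 1 + δ * nsq u) (by positivity) (by positivity),
            Real.rpow_add (by positivity : 0 < 2 * (1 + d)),
            Real.rpow_add (by positivity : 0 < 2 * (1 + d)), Real.rpow_one,
            Real.rpow_add (by positivity : 0 < 1 + nsq u), Real.rpow_one]
          ring
      _ ≤ (2 * (1 + d)) ^ (1 + E) * Real.exp (-(s / 16) * d) *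
          ((1 + nsq u) ^ (1 + γ) * (1 + δ * nsq u) ^ D) := by
          gcongr ?_ * Real.exp (-(s / 16) * d) * ((1 + nsq u) ^ (1 + γ) * (1 + δ * nsq u) ^ D)
          exact Real.rpow_le_rpow_of_exponent_le hb (by linarith)
      _ ≤ 2 ^ (1 + E) * C₁ * ((1 + nsq u) ^ (1 + γ) * (1 + δ * nsq u) ^ D) := by
          refine mul_le_mul_of_nonneg_right ?_ (by positivity)
          rw [Real.mul_rpow two_pos.le (by positivity), mul_assoc]
          refine mul_le_mul_of_nonneg_left ?_ (by positivity)
          rw [neg_mul, Real.exp_neg, ← div_eq_mul_inv, div_le_iff₀ (Real.exp_pos _)]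
          exact h5
  have h1 := hker u (star w)
  rw [weight_star, Nstar_star, star_star, Real.rpow_zero, mul_one] at h1
  have hη : star (rt (star w)) ^ 2 = bdot w w := by
    rw [← star_pow, rt_sq, bdot_star, star_star]
  have k1 := key _ hη
  have k2 := key (-star (rt (star w))) (by rw [neg_sq, hη])
  set Λ := (1 + nsq w) ^ γ * (1 + δ * nsq w) ^ D
  set Λ' := (1 + nsq u) ^ (1 + γ) * (1 + δ * nsq u) ^ D
  have hΛ : 0 ≤ Λ := by positivity
  have hΛ' : 0 ≤ Λ' := by positivity
  calc _ ≤ C₀ * (Nstar u * Nstar w * (Real.exp (-(s / 16) * dsq u (rt u) w (star (rt (star w)))) +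
          Real.exp (-(s / 16) * dsq u (rt u) w (-star (rt (star w)))))) * Λ := by gcongr
    _ = C₀ * (Nstar u * Nstar w * Real.exp (-(s / 16) * dsq u (rt u) w (star (rt (star w)))) * Λ +
        Nstar u * Nstar w * Real.exp (-(s / 16) * dsq u (rt u) w (-star (rt (star w)))) * Λ) := by
        ring
    _ ≤ C₀ * (2 ^ (1 + E) * C₁ * Λ' + 2 ^ (1 + E) * C₁ * Λ') := by gcongr
    _ ≤ (C₀ + 1) * (2 ^ (1 + E) * C₁ * Λ' + 2 ^ (1 + E) * C₁ * Λ') := by gcongr; linarith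
    _ = _ := by ring

theorem reproduce (hn : 1 ≤ n) {s : ℝ} (hs : 0 < s) {f : (Fin n → ℂ) → ℂ}
    (hf : Differentiable ℂ f) (hi : GaussInt s f) (u : Fin n → ℂ) :
    f u = ∫ w, ker n s 0 u (star w) * (Real.exp (-s * nsq w) : ℝ) * f w := by
  have h1 := hi.hasSum_integral hn hs 0 hf u 1 0
  simp only [Real.rpow_zero, zero_mul, add_zero, mul_one, one_mul, Complex.ofReal_one] at h1
  exact (hasSum_hcomp hf u).unique h1

theorem norm_mul_weight_le_pow {s C : ℝ} {d : ℕ} {f : (Fin n → ℂ) → ℂ} {z : Fin n → ℂ}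
    (hC : 0 ≤ C) (h : ‖f z‖ ≤ C * (1 + Nstar z) ^ d * Real.exp (s * nsq z / 2)) :
    ‖f z‖ * weight s z ≤ C * (1 + Nstar z) ^ (d + 1) := by
  have hN := Nstar_nonneg z
  have hr : ‖rt z‖ ≤ 1 + Nstar z := by
    have : ‖rt z‖ ≤ Nstar z := by
      refine le_of_sq_le_sq ?_ hN
      rw [norm_rt_sq, Nstar_sq]; exact norm_bdot_self_le_nsq z
    linarith
  rw [weight_eq]
  calc ‖f z‖ * (‖rt z‖ * Real.exp (-(s * nsq z / 2)))
      ≤ (C * (1 + Nstar z) ^ d * Real.exp (s * nsq z / 2)) *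
        ((1 + Nstar z) * Real.exp (-(s * nsq z / 2))) := by gcongr
    _ = C * (1 + Nstar z) ^ (d + 1) *
        (Real.exp (s * nsq z / 2) * Real.exp (-(s * nsq z / 2))) := by ring
    _ = _ := by rw [← Real.exp_add]; simp

theorem gaussInt_of_mem_fockP (hn : 1 ≤ n) {s p : ℝ} (hs : 0 < s) (hp : 0 < p) (hp1 : p ≤ 1)
    (f : FockP n s p) : GaussInt s (f : (Fin n → ℂ) → ℂ) := by
  obtain ⟨C, d, hC, h⟩ := exists_norm_le_pNorm hn hs hp hp1
  refine gaussInt_of_weight_bound hn hs f.2.1.continuous (K := C * pNorm f) (k := d + 1)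
    fun z => ?_
  have := pNorm_nonneg f
  exact norm_mul_weight_le_pow (by positivity) ((h f z).trans_eq (by ring))

/-- Let F = |f| e^{-φ}, and let S be its supremum relative to a growth weight Λ. In the reproducing
formula write F = F^{1-p} F^p and bound F^{1-p} by (SΛ)^{1-p}; the kernel estimate gives S ≤ C
S^{1-p} I, with I the integral of F^p. Hence S^p ≤ C I, once S is known to be finite. -/
theorem exists_sharp_growth (hn : 1 ≤ n) {s p : ℝ} (hs : 0 < s) (hp : 0 < p) (hp1 : p ≤ 1) :
    ∃ C : ℝ, 0 < C ∧ ∀ (f : FockP n s p) z,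
      ‖(f : (Fin n → ℂ) → ℂ) z‖ * weight s z ≤ C * (1 + nsq z) ^ (1 / p) * pNorm f := by
  obtain ⟨C₀, d, hC₀, hcrude⟩ := exists_norm_le_pNorm hn hs hp hp1
  obtain ⟨C, hC, hker⟩ := exists_ker_growth_le hn hs (1 / p + (d + 1)) (by positivity)
  have hb : 0 < (ballInv n).toReal := ENNReal.toReal_pos ballInv_ne_zero ballInv_ne_top
  refine ⟨(C / (ballInv n).toReal) ^ (1 / p), by positivity, fun f u => ?_⟩
  have hpn := pNorm_nonneg f
  obtain ⟨hfd, hfin⟩ := (mem_fockP hp).mp f.2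
  set g : (Fin n → ℂ) → ℂ := (f : (Fin n → ℂ) → ℂ) with hg
  set F : (Fin n → ℂ) → ℝ := fun z => ‖g z‖ * weight s z with hF
  have hF0 : ∀ z, 0 ≤ F z := fun z => mul_nonneg (norm_nonneg _) (weight_nonneg _ _)
  obtain ⟨hint, hintv⟩ := integrable_fockInt hn hfd.continuous hfin
  set I := (fockInt s p g).toReal with hI
  have hI0 : 0 ≤ I := ENNReal.toReal_nonneg
  have hIp : I = pNorm f ^ p / (ballInv n).toReal := by
    rw [pNorm_rpow hp, mul_div_cancel_left₀ _ hb.ne']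
  -- The factor (1 + δ nsq)^{d+1} beats the crude polynomial bound, so S is finite; the estimate
  -- obtained is uniform in δ, which then tends to 0.
  have main : ∀ δ : ℝ, 0 < δ → δ ≤ 1 → ∀ z, F z ≤
      (C * I) ^ (1 / p) * ((1 + nsq z) ^ (1 / p) * (1 + δ * nsq z) ^ ((d : ℝ) + 1)) := by
    intro δ hδ hδ1
    set Λ : (Fin n → ℂ) → ℝ := fun z => (1 + nsq z) ^ (1 / p) * (1 + δ * nsq z) ^ ((d : ℝ) + 1)
      with hΛ
    have hΛ0 : ∀ z, 0 < Λ z := fun z => by have := nsq_nonneg z; positivity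
    have hbdd : BddAbove (Set.range fun z => F z / Λ z) := by
      refine ⟨C₀ * pNorm f * (2 / δ) ^ (d + 1), ?_⟩
      rintro _ ⟨z, rfl⟩
      have hN := Nstar_nonneg z
      have hn0 := nsq_nonneg z
      show F z / Λ z ≤ _
      rw [div_le_iff₀ (hΛ0 z)]
      have h1 : F z ≤ C₀ * pNorm f * (1 + Nstar z) ^ (d + 1) :=
        norm_mul_weight_le_pow (by positivity) ((hcrude f z).trans_eq (by ring))
      have h2 : 1 + Nstar z ≤ 2 / δ * (1 + δ * nsq z) := by
        rw [div_mul_eq_mul_div, le_div_iff₀ hδ, ← Nstar_sq]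
        nlinarith [sq_nonneg (Nstar z - 1), mul_nonneg hδ.le hN, mul_nonneg hδ.le (sq_nonneg (Nstar z - 1))]
      have h3 : 1 ≤ (1 + nsq z) ^ (1 / p) := Real.one_le_rpow (by linarith) (by positivity)
      calc F z ≤ C₀ * pNorm f * (2 / δ * (1 + δ * nsq z)) ^ (d + 1) := h1.trans (by gcongr)
        _ = C₀ * pNorm f * (2 / δ) ^ (d + 1) * (1 * (1 + δ * nsq z) ^ ((d : ℝ) + 1)) := by
            rw [mul_pow, ← Nat.cast_succ, Real.rpow_natCast, Nat.succ_eq_add_one]; ring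
        _ ≤ _ := by simp only [hΛ]; gcongr
    set S := ⨆ z, F z / Λ z with hS
    have hFS : ∀ z, F z ≤ S * Λ z := fun z => by
      rw [← div_le_iff₀ (hΛ0 z)]; exact le_ciSup hbdd z
    have hS0 : 0 ≤ S := Real.iSup_nonneg fun z => div_nonneg (hF0 z) (hΛ0 z).le
    have hstep : ∀ z, F z ≤ C * S ^ (1 - p) * I * Λ z := by
      intro z
      have hwz := weight_nonneg s z
      have e1 : F z = ‖∫ w, (weight s z : ℂ) * (ker n s 0 z (star w) *
          (Real.exp (-s * nsq w) : ℝ) * g w)‖ := by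
        rw [integral_const_mul, ← reproduce hn hs hfd (gaussInt_of_mem_fockP hn hs hp hp1 f) z,
          norm_mul, Complex.norm_real, Real.norm_of_nonneg hwz, mul_comm]
      rw [e1, ← hintv, ← integral_const_mul, ← integral_mul_const]
      refine norm_integral_le_of_norm_le ((hint.const_mul _).mul_const _) ?_
      filter_upwards [ae_bdot_self_ne_zero hn] with w hw
      have hq : 0 < ‖bdot w w‖ := norm_pos_iff.mpr hw
      have hww := weight_nonneg s w
      have hnw := nsq_nonneg w
      have hnz := nsq_nonneg z
      have h1 := hker z w δ (1 / p * (1 - p)) ((d + 1) * (1 - p)) hδ.le hδ1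
        (mul_nonneg (by positivity) (by linarith)) (mul_nonneg (by positivity) (by linarith))
        (by
          rw [← add_mul]
          exact mul_le_of_le_one_right (by positivity) (by linarith))
      -- The exponent 1/p is the fixed point: the kernel's extra power of 1 + nsq restores what the
      -- power 1 - p removes.
      have e2 : 1 + 1 / p * (1 - p) = 1 / p := by field_simp; ring
      rw [e2] at h1
      have h2 : F w = F w ^ (1 - p) * F w ^ p := by
        rcases (hF0 w).eq_or_lt with h | h
        · rw [← h, Real.zero_rpow hp.ne', mul_zero]
        · rw [← Real.rpow_add h]; simp
      have h3 : F w ^ (1 - p) ≤ S ^ (1 - p) * ((1 + nsq w) ^ (1 / p * (1 - p)) *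
          (1 + δ * nsq w) ^ (((d : ℝ) + 1) * (1 - p))) := by
        calc F w ^ (1 - p) ≤ (S * Λ w) ^ (1 - p) :=
              Real.rpow_le_rpow (hF0 w) (hFS w) (by linarith)
          _ = _ := by
              rw [Real.mul_rpow hS0 (hΛ0 w).le, Real.mul_rpow (by positivity) (by positivity),
                ← Real.rpow_mul (by positivity), ← Real.rpow_mul (by positivity)]
      have h4 : (1 + δ * nsq z) ^ (((d : ℝ) + 1) * (1 - p)) ≤ (1 + δ * nsq z) ^ ((d : ℝ) + 1) := by
        refine Real.rpow_le_rpow_of_exponent_le ?_ ?_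
        · have : 0 ≤ δ * nsq z := by positivity
          linarith
        · exact mul_le_of_le_one_right (by positivity) (by linarith)
      have e3 : Real.exp (-s * nsq w) = weight s w * weight s w * ‖bdot w w‖⁻¹ := by
        rw [← sq, weight_sq]; field_simp
      rw [norm_mul, norm_mul, norm_mul, Complex.norm_real, Complex.norm_real,
        Real.norm_of_nonneg hwz, Real.norm_of_nonneg (Real.exp_pos _).le, e3]
      calc weight s z * (‖ker n s 0 z (star w)‖ * (weight s w * weight s w * ‖bdot w w‖⁻¹) * ‖g w‖)
          = ‖ker n s 0 z (star w)‖ * weight s z * weight s w * F w * ‖bdot w w‖⁻¹ := by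
            simp only [hF]; ring
        _ = ‖ker n s 0 z (star w)‖ * weight s z * weight s w * (F w ^ (1 - p) * F w ^ p) *
            ‖bdot w w‖⁻¹ := by rw [← h2]
        _ ≤ ‖ker n s 0 z (star w)‖ * weight s z * weight s w * ((S ^ (1 - p) *
            ((1 + nsq w) ^ (1 / p * (1 - p)) * (1 + δ * nsq w) ^ (((d : ℝ) + 1) * (1 - p)))) *
            F w ^ p) * ‖bdot w w‖⁻¹ := by
            have := Real.rpow_nonneg (hF0 w) p
            gcongr
        _ = (‖ker n s 0 z (star w)‖ * weight s z * weight s w * ((1 + nsq w) ^ (1 / p * (1 - p)) *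
            (1 + δ * nsq w) ^ (((d : ℝ) + 1) * (1 - p)))) * (S ^ (1 - p) *
            (F w ^ p * ‖bdot w w‖⁻¹)) := by ring
        _ ≤ (C * Λ z) * (S ^ (1 - p) * (F w ^ p * ‖bdot w w‖⁻¹)) := by
            have := Real.rpow_nonneg (hF0 w) p
            refine mul_le_mul_of_nonneg_right (h1.trans ?_) (by positivity)
            simp only [hΛ]
            gcongr
        _ = _ := by ring
    have hSle : S ≤ C * S ^ (1 - p) * I := ciSup_le fun z => by
      rw [div_le_iff₀ (hΛ0 z)]; exact hstep z
    have hSp : S ≤ (C * I) ^ (1 / p) := by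
      rcases hS0.eq_or_lt with h | h
      · rw [← h]; positivity
      · have h1 : S ^ p ≤ C * I := by
          have h2 : S = S ^ p * S ^ (1 - p) := by rw [← Real.rpow_add h]; simp
          have h3 : S ^ p * S ^ (1 - p) ≤ (C * I) * S ^ (1 - p) := by
            rw [← h2]; exact hSle.trans_eq (by ring)
          exact le_of_mul_le_mul_right h3 (by positivity)
        calc S = (S ^ p) ^ (1 / p) := by
              rw [← Real.rpow_mul hS0, mul_one_div_cancel hp.ne', Real.rpow_one]
          _ ≤ _ := by gcongr
    intro z
    exact (hFS z).trans (mul_le_mul_of_nonneg_right hSp (hΛ0 z).le)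
  have hlim : Filter.Tendsto (fun δ : ℝ => (C * I) ^ (1 / p) *
      ((1 + nsq u) ^ (1 / p) * (1 + δ * nsq u) ^ ((d : ℝ) + 1))) (nhdsWithin 0 (Set.Ioi 0))
      (nhds ((C * I) ^ (1 / p) * ((1 + nsq u) ^ (1 / p) * (1 + 0 * nsq u) ^ ((d : ℝ) + 1)))) := by
    refine Filter.Tendsto.mono_left ?_ nhdsWithin_le_nhds
    have : ContinuousAt (fun δ : ℝ => (C * I) ^ (1 / p) *
      ((1 + nsq u) ^ (1 / p) * (1 + δ * nsq u) ^ ((d : ℝ) + 1))) 0 := by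
      refine ContinuousAt.mul continuousAt_const (ContinuousAt.mul continuousAt_const ?_)
      refine ContinuousAt.rpow_const (by fun_prop) (Or.inr (by positivity))
    exact this
  have h1 : F u ≤ (C * I) ^ (1 / p) * ((1 + nsq u) ^ (1 / p) * (1 + 0 * nsq u) ^ ((d : ℝ) + 1)) := by
    refine ge_of_tendsto hlim ?_
    filter_upwards [Ioc_mem_nhdsGT (one_pos : (0 : ℝ) < 1)] with δ hδ
    exact main δ hδ.1 hδ.2 u
  rw [zero_mul, add_zero, Real.one_rpow, mul_one] at h1
  refine h1.trans_eq ?_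
  rw [hIp, ← mul_div_assoc, mul_div_right_comm, Real.mul_rpow (by positivity) (by positivity),
    ← Real.rpow_mul hpn, mul_one_div_cancel hp.ne', Real.rpow_one]
  ring

end Growth

/-! ### The fractional integral T -/

section FractionalIntegral
variable {n : ℕ}

theorem exists_bound_on_ball {g : (Fin n → ℂ) → ℂ} (hg : Continuous g) (R : ℝ) :
    ∃ M, 0 ≤ M ∧ ∀ z, ‖z‖ ≤ R → ‖g z‖ ≤ M := by
  obtain ⟨M, hM⟩ := (isCompact_closedBall (0 : Fin n → ℂ) R).exists_bound_of_continuousOn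
    hg.continuousOn
  exact ⟨max M 0, le_max_right _ _, fun z hz => (hM z (by simpa using hz)).trans (le_max_left _ _)⟩

/-- The operator acting on homogeneous functions of degree `m` as multiplication by
`(m + c) ^ (-a)`. -/
noncomputable def fracInt (a c : ℝ) (g : (Fin n → ℂ) → ℂ) (w : Fin n → ℂ) : ℂ :=
  (Real.Gamma a : ℂ)⁻¹ * ∫ y in Set.Ioi (0 : ℝ),
    (y ^ (a - 1) * Real.exp (-(c * y)) : ℝ) * g ((Real.exp (-y) : ℂ) • w)

theorem norm_exp_neg_smul_le {y : ℝ} (hy : 0 < y) (w : Fin n → ℂ) :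
    ‖(Real.exp (-y) : ℂ) • w‖ ≤ ‖w‖ := by
  rw [norm_smul, Complex.norm_real, Real.norm_of_nonneg (Real.exp_pos _).le]
  exact mul_le_of_le_one_left (norm_nonneg _) (Real.exp_le_one_iff.mpr (by linarith))

theorem fracInt_kernel_nonneg (a c : ℝ) {y : ℝ} (hy : 0 < y) :
    0 ≤ y ^ (a - 1) * Real.exp (-(c * y)) := by positivity

theorem measurable_fracInt_integrand (a c : ℝ) {g : (Fin n → ℂ) → ℂ} (hg : Continuous g)
    (w : Fin n → ℂ) : Measurable fun y : ℝ =>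
      ((y ^ (a - 1) * Real.exp (-(c * y)) : ℝ) : ℂ) * g ((Real.exp (-y) : ℂ) • w) := by
  have h : Continuous fun y : ℝ => g ((Real.exp (-y) : ℂ) • w) := by fun_prop
  have := h.measurable
  fun_prop

theorem norm_fracInt_integrand_le (a c : ℝ) {g : (Fin n → ℂ) → ℂ} {R M : ℝ}
    (hM : ∀ z, ‖z‖ ≤ R → ‖g z‖ ≤ M) {w : Fin n → ℂ} (hw : ‖w‖ ≤ R) {y : ℝ} (hy : 0 < y) :
    ‖((y ^ (a - 1) * Real.exp (-(c * y)) : ℝ) : ℂ) * g ((Real.exp (-y) : ℂ) • w)‖ ≤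
      y ^ (a - 1) * Real.exp (-(c * y)) * M := by
  rw [norm_mul, Complex.norm_real, Real.norm_of_nonneg (fracInt_kernel_nonneg a c hy)]
  have := fracInt_kernel_nonneg a c hy
  gcongr
  exact hM _ ((norm_exp_neg_smul_le hy w).trans hw)

theorem integrableOn_fracInt {a c : ℝ} (ha : 0 < a) (hc : 0 < c) {g : (Fin n → ℂ) → ℂ}
    (hg : Continuous g) (w : Fin n → ℂ) : IntegrableOn (fun y : ℝ =>
      ((y ^ (a - 1) * Real.exp (-(c * y)) : ℝ) : ℂ) * g ((Real.exp (-y) : ℂ) • w))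
      (Set.Ioi 0) := by
  obtain ⟨M, -, hM⟩ := exists_bound_on_ball hg ‖w‖
  refine Integrable.mono' ((integrableOn_rpow_mul_exp ha hc).mul_const M)
    (measurable_fracInt_integrand a c hg w).aestronglyMeasurable ?_
  filter_upwards [ae_restrict_mem measurableSet_Ioi] with y hy
  exact norm_fracInt_integrand_le a c hM le_rfl hy

theorem differentiable_fracInt {a c : ℝ} (ha : 0 < a) (hc : 0 < c) {g : (Fin n → ℂ) → ℂ}
    (hg : Differentiable ℂ g) : Differentiable ℂ (fracInt a c g) := by
  unfold fracInt
  refine Differentiable.const_mul ?_ _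
  have e : ∀ w : Fin n → ℂ, ∫ y in Set.Ioi (0 : ℝ),
      ((y ^ (a - 1) * Real.exp (-(c * y)) : ℝ) : ℂ) * g ((Real.exp (-y) : ℂ) • w) =
      ∫ y : ℝ, (Set.Ioi (0 : ℝ)).indicator (fun y : ℝ =>
        ((y ^ (a - 1) * Real.exp (-(c * y)) : ℝ) : ℂ) * g ((Real.exp (-y) : ℂ) • w)) y :=
    fun w => (integral_indicator measurableSet_Ioi).symm
  simp only [e]
  refine differentiable_integral (fun w => ?_) (fun y => ?_) fun R => ?_
  · exact ((measurable_fracInt_integrand a c hg.continuous w).indicator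
      measurableSet_Ioi).aestronglyMeasurable
  · by_cases hy : y ∈ Set.Ioi (0 : ℝ)
    · simp only [Set.indicator_of_mem hy]
      exact (hg.comp (g := g) (f := fun z : Fin n → ℂ => (Real.exp (-y) : ℂ) • z)
        (by fun_prop)).const_mul _
    · simp only [Set.indicator_of_notMem hy]
      exact differentiable_const _
  · obtain ⟨M, -, hM⟩ := exists_bound_on_ball hg.continuous R
    refine ⟨(Set.Ioi (0 : ℝ)).indicator fun y => y ^ (a - 1) * Real.exp (-(c * y)) * M,
      (integrable_indicator_iff measurableSet_Ioi).mpr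
        ((integrableOn_rpow_mul_exp ha hc).mul_const M),
      fun z hz y => ?_⟩
    by_cases hy : y ∈ Set.Ioi (0 : ℝ)
    · simp only [Set.indicator_of_mem hy]
      exact norm_fracInt_integrand_le a c hM hz hy
    · simp only [Set.indicator_of_notMem hy, norm_zero, le_refl]

/-- On the component of degree m the dilation by e^{-y} acts as e^{-my}, so Fubini leaves the Gamma
integral of (m + c)^{-a}. -/
theorem hcomp_fracInt {a c : ℝ} (ha : 0 < a) (hc : 0 < c) {g : (Fin n → ℂ) → ℂ}
    (hg : Differentiable ℂ g) (m : ℕ) (z : Fin n → ℂ) :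
    hcomp m (fracInt a c g) z = ((m + c : ℝ) ^ (-a) : ℝ) * hcomp m g z := by
  obtain ⟨M, hM0, hM⟩ := exists_bound_on_ball hg.continuous ‖z‖
  have hnz : ∀ θ : ℝ, ‖Complex.exp (θ * Complex.I) • z‖ ≤ ‖z‖ := fun θ => by
    rw [norm_smul, norm_exp_I, one_mul]
  have hnm : ∀ θ : ℝ, ‖Complex.exp (θ * Complex.I) ^ (-(m : ℤ))‖ = 1 := fun θ => by
    rw [norm_zpow, norm_exp_I, one_zpow]
  set k : ℝ → ℝ := fun y => y ^ (a - 1) * Real.exp (-(c * y)) with hk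
  have hkm : Measurable k := by fun_prop
  have swap : (∫ θ : ℝ in Set.Ioc 0 (2 * Real.pi), ∫ y in Set.Ioi (0 : ℝ),
      Complex.exp (θ * Complex.I) ^ (-(m : ℤ)) *
        ((k y : ℝ) * g ((Real.exp (-y) : ℂ) • Complex.exp (θ * Complex.I) • z))) =
      ∫ y in Set.Ioi (0 : ℝ), ∫ θ : ℝ in Set.Ioc 0 (2 * Real.pi),
      Complex.exp (θ * Complex.I) ^ (-(m : ℤ)) *
        ((k y : ℝ) * g ((Real.exp (-y) : ℂ) • Complex.exp (θ * Complex.I) • z)) := by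
    refine integral_integral_swap ?_
    have hb : Integrable (fun x : ℝ × ℝ => (1 : ℝ) * (k x.2 * M))
        ((volume.restrict (Set.Ioc 0 (2 * Real.pi))).prod (volume.restrict (Set.Ioi 0))) :=
      Integrable.mul_prod (f := fun _ : ℝ => (1 : ℝ)) (g := fun y => k y * M)
        (integrable_const _) ((integrableOn_rpow_mul_exp ha hc).mul_const M)
    refine hb.mono' ?_ ?_
    · have h1 : Continuous fun x : ℝ × ℝ =>
          g ((Real.exp (-x.2) : ℂ) • Complex.exp (x.1 * Complex.I) • z) := by
        have := hg.continuous; fun_prop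
      have h2 : Continuous fun x : ℝ × ℝ => Complex.exp (x.1 * Complex.I) ^ (-(m : ℤ)) :=
        Continuous.zpow₀ (by fun_prop) _ fun x => Or.inl (Complex.exp_ne_zero _)
      have h3 := h1.measurable
      have h4 := h2.measurable
      exact (h4.mul ((Complex.measurable_ofReal.comp (hkm.comp measurable_snd)).mul
        h3)).aestronglyMeasurable
    · rw [Measure.prod_restrict]
      filter_upwards [ae_restrict_mem (measurableSet_Ioc.prod measurableSet_Ioi)] with x hx
      simp only [Function.uncurry]
      rw [norm_mul, hnm]
      gcongr
      exact norm_fracInt_integrand_le a c hM (hnz x.1) hx.2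
  have inner : ∀ y : ℝ, ∫ θ : ℝ in Set.Ioc 0 (2 * Real.pi),
      Complex.exp (θ * Complex.I) ^ (-(m : ℤ)) *
        ((k y : ℝ) * g ((Real.exp (-y) : ℂ) • Complex.exp (θ * Complex.I) • z)) =
      (k y * Real.exp (-y) ^ m : ℝ) * ((2 * Real.pi : ℂ) * hcomp m g z) := by
    intro y
    have h1 := hcomp_smul m hg (Real.exp (-y) : ℂ) z
    have hpi : (2 * Real.pi : ℂ) ≠ 0 := by simp [Real.pi_ne_zero]
    rw [hcomp, inv_mul_eq_iff_eq_mul₀ hpi] at h1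
    calc _ = ∫ θ : ℝ in Set.Ioc 0 (2 * Real.pi), (k y : ℂ) *
          (Complex.exp (θ * Complex.I) ^ (-(m : ℤ)) *
            g (Complex.exp (θ * Complex.I) • (Real.exp (-y) : ℂ) • z)) := by
          refine integral_congr_ae (Filter.Eventually.of_forall fun θ => ?_)
          simp only
          rw [smul_comm (Real.exp (-y) : ℂ) (Complex.exp (θ * Complex.I)) z]; ring
      _ = _ := by
          rw [integral_const_mul, h1]; push_cast; ring
  have hval : ∫ y in Set.Ioi (0 : ℝ), k y * Real.exp (-y) ^ m =
      (m + c) ^ (-a) * Real.Gamma a := by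
    have hmc : 0 < m + c := by positivity
    rw [Real.rpow_neg hmc.le, ← Real.inv_rpow hmc.le, ← one_div,
      ← Real.integral_rpow_mul_exp_neg_mul_Ioi ha hmc]
    refine integral_congr_ae (Filter.Eventually.of_forall fun y => ?_)
    simp only [hk]
    rw [← Real.exp_nat_mul, mul_assoc, ← Real.exp_add]
    congr 2; ring
  have hG : (Real.Gamma a : ℂ) ≠ 0 := by exact_mod_cast (Real.Gamma_pos_of_pos ha).ne'
  have hpi : (2 * Real.pi : ℂ) ≠ 0 := by simp [Real.pi_ne_zero]
  calc hcomp m (fracInt a c g) z = (2 * Real.pi : ℂ)⁻¹ * ((Real.Gamma a : ℂ)⁻¹ *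
        ∫ θ : ℝ in Set.Ioc 0 (2 * Real.pi), ∫ y in Set.Ioi (0 : ℝ),
        Complex.exp (θ * Complex.I) ^ (-(m : ℤ)) *
          ((k y : ℝ) * g ((Real.exp (-y) : ℂ) • Complex.exp (θ * Complex.I) • z))) := by
        rw [hcomp, ← integral_const_mul (Real.Gamma a : ℂ)⁻¹]
        congr 1
        refine integral_congr_ae (Filter.Eventually.of_forall fun θ => ?_)
        simp only
        rw [fracInt, integral_const_mul]
        ring
    _ = _ := by
        rw [swap]
        simp only [inner]
        rw [integral_mul_const, integral_complex_ofReal, hval]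
        push_cast
        field_simp

theorem fracInt_add {a c : ℝ} (ha : 0 < a) (hc : 0 < c) {f g : (Fin n → ℂ) → ℂ}
    (hf : Continuous f) (hg : Continuous g) :
    fracInt a c (f + g) = fracInt a c f + fracInt a c g := by
  funext w
  simp only [fracInt, Pi.add_apply, mul_add]
  rw [integral_add (integrableOn_fracInt ha hc hf w) (integrableOn_fracInt ha hc hg w), mul_add]

theorem fracInt_smul (a c : ℝ) (t : ℂ) (g : (Fin n → ℂ) → ℂ) :
    fracInt a c (t • g) = t • fracInt a c g := by
  funext w
  simp only [fracInt, Pi.smul_apply, smul_eq_mul, ← integral_const_mul]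
  refine integral_congr_ae (Filter.Eventually.of_forall fun y => ?_)
  simp only; ring

theorem weight_exp_neg_smul (s y : ℝ) (w : Fin n → ℂ) :
    weight s ((Real.exp (-y) : ℂ) • w) =
      Real.exp (-y) * ‖rt w‖ * Real.exp (-(s * (Real.exp (-y) ^ 2 * nsq w) / 2)) := by
  rw [weight_eq, nsq_smul, Complex.norm_real, Real.norm_of_nonneg (Real.exp_pos _).le]
  congr 1
  refine (pow_left_inj₀ (norm_nonneg _) (by positivity) two_ne_zero).mp ?_
  rw [norm_rt_sq, bdot_smul_self, mul_pow, norm_rt_sq, norm_mul, norm_pow, Complex.norm_real,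
    Real.norm_of_nonneg (Real.exp_pos _).le]

/-- Contracting w by e^{-y} lowers the admissible growth from e^X to at most e^{X e^{-y}}, with X =
s nsq w / 2. The Laplace bound then gains (1 + X)^{-a}. The factor |ζ| of the weight scales by
e^{-y}, which leaves the rate n out of n + 1, positive because n ≥ 1. -/
theorem exists_norm_fracInt_le (hn : 1 ≤ n) {s a : ℝ} (hs : 0 < s) (ha : 0 < a) :
    ∃ C : ℝ, 0 < C ∧ ∀ (g : (Fin n → ℂ) → ℂ) (N : ℝ),
      (∀ z, ‖g z‖ * weight s z ≤ N) → ∀ w,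
      ‖fracInt a (n + 1) g w‖ * weight s w ≤ C * N * (1 + nsq w) ^ (-a) := by
  have hn0 : (0 : ℝ) < n := by exact_mod_cast hn
  obtain ⟨C, hC, hL⟩ := exists_laplace_le ha hn0
  set κ : ℝ := 1 + 2 / s with hκ
  have hκ0 : 0 < κ := by positivity
  have hG := Real.Gamma_pos_of_pos ha
  refine ⟨(Real.Gamma a)⁻¹ * C * κ ^ a, by positivity, fun g N hN w => ?_⟩
  have hN0 : 0 ≤ N := (mul_nonneg (norm_nonneg _) (weight_nonneg s 0)).trans (hN 0)
  have hw := nsq_nonneg w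
  by_cases hq : bdot w w = 0
  · rw [weight_eq, show ‖rt w‖ = 0 by rw [norm_eq_zero, rt, hq]; simp, zero_mul, mul_zero]
    positivity
  have hr := norm_rt_pos hq
  set X := s * nsq w / 2 with hX
  have hX0 : 0 ≤ X := by positivity
  have hpt : ∀ y : ℝ, 0 < y →
      ‖((y ^ (a - 1) * Real.exp (-((n + 1) * y)) : ℝ) : ℂ) * g ((Real.exp (-y) : ℂ) • w)‖ ≤
      y ^ (a - 1) * Real.exp (-(n * y)) * Real.exp (X * Real.exp (-y)) * (N * ‖rt w‖⁻¹) := by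
    intro y hy
    have he1 : Real.exp (-y) ≤ 1 := Real.exp_le_one_iff.mpr (by linarith)
    have he0 := Real.exp_pos (-y)
    have h1 := hN ((Real.exp (-y) : ℂ) • w)
    rw [weight_exp_neg_smul] at h1
    have h2 : ‖g ((Real.exp (-y) : ℂ) • w)‖ ≤
        N * ‖rt w‖⁻¹ * (Real.exp y * Real.exp (s * (Real.exp (-y) ^ 2 * nsq w) / 2)) := by
      have h3 : ‖g ((Real.exp (-y) : ℂ) • w)‖ = ‖g ((Real.exp (-y) : ℂ) • w)‖ *
          (Real.exp (-y) * ‖rt w‖ * Real.exp (-(s * (Real.exp (-y) ^ 2 * nsq w) / 2))) *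
          (‖rt w‖⁻¹ * (Real.exp y * Real.exp (s * (Real.exp (-y) ^ 2 * nsq w) / 2))) := by
        rw [Real.exp_neg (s * _ / 2), Real.exp_neg y]
        field_simp
      rw [h3, mul_assoc N]
      gcongr
    have h4 : Real.exp (s * (Real.exp (-y) ^ 2 * nsq w) / 2) ≤ Real.exp (X * Real.exp (-y)) := by
      refine Real.exp_le_exp.mpr ?_
      rw [hX]
      have : s * nsq w / 2 * Real.exp (-y) ^ 2 ≤ s * nsq w / 2 * Real.exp (-y) := by
        gcongr; rw [sq]; exact mul_le_of_le_one_left he0.le he1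
      linarith
    rw [norm_mul, Complex.norm_real, Real.norm_of_nonneg (fracInt_kernel_nonneg a _ hy)]
    calc y ^ (a - 1) * Real.exp (-((n + 1) * y)) * ‖g ((Real.exp (-y) : ℂ) • w)‖
        ≤ y ^ (a - 1) * Real.exp (-((n + 1) * y)) *
          (N * ‖rt w‖⁻¹ * (Real.exp y * Real.exp (X * Real.exp (-y)))) := by
          have := fracInt_kernel_nonneg a (n + 1) hy
          gcongr
          exact h2.trans (by gcongr)
      _ = _ := by
          rw [show -(((n : ℝ) + 1) * y) = -(n * y) + -y by ring, Real.exp_add, Real.exp_neg y]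
          field_simp
  have hint : ‖∫ y in Set.Ioi (0 : ℝ),
      ((y ^ (a - 1) * Real.exp (-((n + 1) * y)) : ℝ) : ℂ) * g ((Real.exp (-y) : ℂ) • w)‖ ≤
      C * ((1 + X) ^ (-a) * Real.exp X) * (N * ‖rt w‖⁻¹) := by
    have h5 := hL X hX0
    have h6 : 0 ≤ N * ‖rt w‖⁻¹ := by positivity
    refine le_trans ?_ (mul_le_mul_of_nonneg_right h5 h6)
    rw [← integral_mul_const]
    refine norm_integral_le_of_norm_le ((integrableOn_laplace ha hn0 hX0).mul_const _) ?_
    filter_upwards [ae_restrict_mem measurableSet_Ioi] with y hy using hpt y hy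
  have hcomp : (1 + X) ^ (-a) ≤ κ ^ a * (1 + nsq w) ^ (-a) := by
    rw [Real.rpow_neg (by positivity), Real.rpow_neg (by positivity), ← div_eq_mul_inv,
      le_div_iff₀ (by positivity), inv_mul_le_iff₀ (by positivity),
      ← Real.mul_rpow (by positivity) (by positivity)]
    refine Real.rpow_le_rpow (by positivity) ?_ ha.le
    have : 2 / s * X = nsq w := by rw [hX]; field_simp
    have h7 : 0 ≤ 2 / s := by positivity
    rw [hκ]; nlinarith
  rw [fracInt, norm_mul, norm_inv, Complex.norm_real, Real.norm_of_nonneg hG.le, weight_eq, ← hX]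
  calc _ ≤ (Real.Gamma a)⁻¹ * (C * ((1 + X) ^ (-a) * Real.exp X) * (N * ‖rt w‖⁻¹)) *
        (‖rt w‖ * Real.exp (-X)) := by gcongr
    _ = (Real.Gamma a)⁻¹ * C * N * (1 + X) ^ (-a) := by
        rw [Real.exp_neg]; field_simp
    _ ≤ (Real.Gamma a)⁻¹ * C * N * (κ ^ a * (1 + nsq w) ^ (-a)) := by gcongr
    _ = _ := by ring

end FractionalIntegral

/-! ### The duality pairing and its boundedness -/

section Pairing
variable {n : ℕ}

theorem gaussInt_fracInt (hn : 1 ≤ n) {s a : ℝ} (hs : 0 < s) (ha : 0 < a) (g : FockInf n s) :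
    GaussInt s (fracInt a (n + 1) (g : (Fin n → ℂ) → ℂ)) := by
  obtain ⟨C, hC, h⟩ := exists_norm_fracInt_le hn hs ha
  refine gaussInt_of_weight_bound hn hs
    (differentiable_fracInt ha (by positivity) g.2.1).continuous (K := C * infNorm g) (k := 0)
    fun z => (h _ _ (norm_mul_weight_le g) z).trans ?_
  have h0 := infNorm_nonneg g
  have h1 := nsq_nonneg z
  rw [pow_zero]
  gcongr
  exact Real.rpow_le_one_of_one_le_of_nonpos (by linarith) (by linarith)

/-- By `integral_homKer` with α = β = 1, the factor `1 + s * nsq w` multiplies degree m by m + n +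
1. It supplies the one power left over between the order 1/p of `fracInt` and the kernel exponent
1/p - 1. -/
noncomputable def pairingDensity (s p : ℝ) (f g : (Fin n → ℂ) → ℂ) (w : Fin n → ℂ) : ℂ :=
  f w * fracInt (1 / p) (n + 1) g (star w) *
    ((1 + s * nsq w) * Real.exp (-s * nsq w) : ℝ)

theorem continuous_pairingDensity {s p : ℝ} (hp : 0 < p) {f g : (Fin n → ℂ) → ℂ}
    (hf : Continuous f) (hg : Differentiable ℂ g) : Continuous (pairingDensity s p f g) := by
  have h1 : Continuous fun w : Fin n → ℂ => fracInt (1 / p) (n + 1) g (star w) :=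
    (differentiable_fracInt (by positivity) (by positivity) hg).continuous.comp continuous_star_pi
  have h2 := continuous_nsq (n := n)
  unfold pairingDensity
  fun_prop

/-- Split F = F^{1-p} F^p with F = |f| e^{-φ}. Sharp growth bounds F^{1-p} by (1 + nsq)^{1/p-1}, T
contributes (1 + nsq)^{-1/p}, and the density contributes 1 + nsq. The exponents sum to 0, leaving
the integrand of the norm. -/
theorem exists_norm_pairingDensity_le (hn : 1 ≤ n) {s p : ℝ} (hs : 0 < s) (hp : 0 < p)
    (hp1 : p ≤ 1) : ∃ C : ℝ, 0 < C ∧ ∀ (f : FockP n s p) (g : FockInf n s) (w : Fin n → ℂ),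
      bdot w w ≠ 0 → ‖pairingDensity s p f g w‖ ≤ C * pNorm f ^ (1 - p) * infNorm g *
        ((‖(f : (Fin n → ℂ) → ℂ) w‖ * weight s w) ^ p * ‖bdot w w‖⁻¹) := by
  obtain ⟨C₁, hC₁, h₁⟩ := exists_sharp_growth hn hs hp hp1
  obtain ⟨C₂, hC₂, h₂⟩ := exists_norm_fracInt_le hn hs (by positivity : 0 < 1 / p)
  refine ⟨C₁ ^ (1 - p) * C₂ * (1 + s), by positivity, fun f g w hw => ?_⟩
  have hP := pNorm_nonneg f
  have hN := infNorm_nonneg g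
  have hnw := nsq_nonneg w
  have hww := weight_nonneg s w
  have hq : 0 < ‖bdot w w‖ := norm_pos_iff.mpr hw
  set F := ‖(f : (Fin n → ℂ) → ℂ) w‖ * weight s w with hF
  have hF0 : 0 ≤ F := by positivity
  set T := ‖fracInt (1 / p) (n + 1) (g : (Fin n → ℂ) → ℂ) (star w)‖ * weight s w with hT
  have hTle : T ≤ C₂ * infNorm g * (1 + nsq w) ^ (-(1 / p)) := by
    have := h₂ _ _ (norm_mul_weight_le g) (star w)
    rwa [weight_star, nsq_star] at this
  have hFle : F ^ (1 - p) ≤ C₁ ^ (1 - p) * (1 + nsq w) ^ (1 / p - 1) * pNorm f ^ (1 - p) := by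
    calc F ^ (1 - p) ≤ (C₁ * (1 + nsq w) ^ (1 / p) * pNorm f) ^ (1 - p) :=
          Real.rpow_le_rpow hF0 (h₁ f w) (by linarith)
      _ = _ := by
          rw [Real.mul_rpow (by positivity) hP, Real.mul_rpow hC₁.le (by positivity),
            ← Real.rpow_mul (by positivity), show 1 / p * (1 - p) = 1 / p - 1 by field_simp]
  have hFF : F = F ^ (1 - p) * F ^ p := by
    rcases hF0.eq_or_lt with h | h
    · rw [← h, Real.zero_rpow hp.ne', mul_zero]
    · rw [← Real.rpow_add h]; simp
  have hexp : Real.exp (-s * nsq w) = weight s w * weight s w * ‖bdot w w‖⁻¹ := by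
    rw [← sq, weight_sq]; field_simp
  have hcancel : (1 + nsq w) ^ (1 / p - 1) * (1 + nsq w) ^ (-(1 / p)) * (1 + nsq w) = 1 := by
    rw [← Real.rpow_add (by positivity), ← Real.rpow_add_one (by positivity)]
    ring_nf
    exact Real.rpow_zero _
  rw [pairingDensity, norm_mul, norm_mul, Complex.norm_real,
    Real.norm_of_nonneg (by positivity : 0 ≤ (1 + s * nsq w) * Real.exp (-s * nsq w)), hexp]
  calc _ = F * T * (1 + s * nsq w) * ‖bdot w w‖⁻¹ := by rw [hF, hT]; ring
    _ = F ^ (1 - p) * F ^ p * T * (1 + s * nsq w) * ‖bdot w w‖⁻¹ := by rw [← hFF]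
    _ ≤ (C₁ ^ (1 - p) * (1 + nsq w) ^ (1 / p - 1) * pNorm f ^ (1 - p)) * F ^ p *
        (C₂ * infNorm g * (1 + nsq w) ^ (-(1 / p))) * ((1 + s) * (1 + nsq w)) *
        ‖bdot w w‖⁻¹ := by
        gcongr
        nlinarith
    _ = C₁ ^ (1 - p) * C₂ * (1 + s) * pNorm f ^ (1 - p) * infNorm g * (F ^ p * ‖bdot w w‖⁻¹) *
        ((1 + nsq w) ^ (1 / p - 1) * (1 + nsq w) ^ (-(1 / p)) * (1 + nsq w)) := by ring
    _ = _ := by rw [hcancel, mul_one]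

theorem integrable_pairingDensity (hn : 1 ≤ n) {s p : ℝ} (hs : 0 < s) (hp : 0 < p) (hp1 : p ≤ 1)
    (f : FockP n s p) (g : FockInf n s) : Integrable (pairingDensity s p
      (f : (Fin n → ℂ) → ℂ) (g : (Fin n → ℂ) → ℂ)) := by
  obtain ⟨C, hC, h⟩ := exists_norm_pairingDensity_le hn hs hp hp1
  obtain ⟨hfd, hfin⟩ := (mem_fockP hp).mp f.2
  refine ((integrable_fockInt hn hfd.continuous hfin).1.const_mul
    (C * pNorm f ^ (1 - p) * infNorm g)).mono'
    (continuous_pairingDensity hp hfd.continuous g.2.1).aestronglyMeasurable ?_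
  filter_upwards [ae_bdot_self_ne_zero hn] with w hw using h f g w hw

/-- The duality pairing `⟨f, g⟩ = ∫ f(w) (T g)(w̄) (1 + s N_*(w)²) exp (-s N_*(w)²) dw`, where `T` is
the fractional integral of order `1 / p`. -/
noncomputable def pairing (hn : 1 ≤ n) {s p : ℝ} (hs : 0 < s) (hp : 0 < p) (hp1 : p ≤ 1) :
    FockP n s p →ₗ[ℂ] FockInf n s →ₗ[ℂ] ℂ :=
  LinearMap.mk₂ ℂ (fun f g => ∫ w, pairingDensity s p (f : (Fin n → ℂ) → ℂ) g w)
    (fun f₁ f₂ g => by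
      rw [← integral_add (integrable_pairingDensity hn hs hp hp1 f₁ g)
        (integrable_pairingDensity hn hs hp hp1 f₂ g)]
      congr 1; funext w
      simp only [pairingDensity, Submodule.coe_add, Pi.add_apply]; ring)
    (fun c f g => by
      rw [smul_eq_mul, ← integral_const_mul]
      congr 1; funext w
      simp only [pairingDensity, Submodule.coe_smul, Pi.smul_apply, smul_eq_mul]; ring)
    (fun f g₁ g₂ => by
      rw [← integral_add (integrable_pairingDensity hn hs hp hp1 f g₁)
        (integrable_pairingDensity hn hs hp hp1 f g₂)]
      congr 1; funext w
      simp only [pairingDensity, Submodule.coe_add]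
      rw [fracInt_add (by positivity) (by positivity) g₁.2.1.continuous g₂.2.1.continuous,
        Pi.add_apply]
      ring)
    (fun c f g => by
      rw [smul_eq_mul, ← integral_const_mul]
      congr 1; funext w
      simp only [pairingDensity, Submodule.coe_smul]
      rw [fracInt_smul, Pi.smul_apply, smul_eq_mul]; ring)

theorem pairing_apply (hn : 1 ≤ n) {s p : ℝ} (hs : 0 < s) (hp : 0 < p) (hp1 : p ≤ 1)
    (f : FockP n s p) (g : FockInf n s) : pairing hn hs hp hp1 f g =
      ∫ w, pairingDensity s p (f : (Fin n → ℂ) → ℂ) (g : (Fin n → ℂ) → ℂ) w := rfl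

theorem exists_norm_pairing_le (hn : 1 ≤ n) {s p : ℝ} (hs : 0 < s) (hp : 0 < p) (hp1 : p ≤ 1) :
    ∃ C : ℝ, 0 < C ∧ ∀ (f : FockP n s p) (g : FockInf n s),
      ‖pairing hn hs hp hp1 f g‖ ≤ C * pNorm f * infNorm g := by
  obtain ⟨C, hC, h⟩ := exists_norm_pairingDensity_le hn hs hp hp1
  have hb : 0 < (ballInv n).toReal := ENNReal.toReal_pos ballInv_ne_zero ballInv_ne_top
  refine ⟨C / (ballInv n).toReal, by positivity, fun f g => ?_⟩
  have hP := pNorm_nonneg f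
  obtain ⟨hfd, hfin⟩ := (mem_fockP hp).mp f.2
  obtain ⟨hint, hval⟩ := integrable_fockInt hn hfd.continuous hfin
  have h1 : ‖pairing hn hs hp hp1 f g‖ ≤ ∫ w, C * pNorm f ^ (1 - p) * infNorm g *
      ((‖(f : (Fin n → ℂ) → ℂ) w‖ * weight s w) ^ p * ‖bdot w w‖⁻¹) := by
    rw [pairing_apply]
    refine norm_integral_le_of_norm_le (hint.const_mul _) ?_
    filter_upwards [ae_bdot_self_ne_zero hn] with w hw using h f g w hw
  have h2 : pNorm f ^ (1 - p) * pNorm f ^ p = pNorm f := by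
    rcases hP.eq_or_lt with h | h
    · rw [← h, Real.zero_rpow hp.ne', mul_zero]
    · rw [← Real.rpow_add h]; simp
  rw [integral_const_mul, hval] at h1
  refine h1.trans_eq ?_
  have h3 := pNorm_rpow hp f
  calc _ = C / (ballInv n).toReal * (pNorm f ^ (1 - p) *
        ((ballInv n).toReal * (fockInt s p (f : (Fin n → ℂ) → ℂ)).toReal)) * infNorm g := by
        field_simp
    _ = _ := by rw [← h3, h2]

end Pairing

/-! ### The kernel functions as elements of F_s^p -/

section KernelSections
variable {n : ℕ}

/-- A Gaussian rate κ below s leaves decay e^{-p(s-κ) nsq/2}, integrable by `chart_bound` at the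
vertex. Such weighted sup bounds are how series are made to converge in F_s^p. -/
theorem exists_pNorm_le_of_gauss_bound (hn : 1 ≤ n) {s p κ : ℝ} (hp : 0 < p) (hp1 : p ≤ 1)
    (hκ : κ < s) : ∃ C : ℝ, 0 < C ∧ ∀ (K : ℝ) (f : (Fin n → ℂ) → ℂ), 0 ≤ K → Differentiable ℂ f →
      (∀ z, ‖f z‖ ≤ K * Real.exp (κ * nsq z / 2)) →
      ∃ hf : f ∈ FockP n s p, pNorm (⟨f, hf⟩ : FockP n s p) ≤ C * K := by
  obtain ⟨K₀, hK₀, hchart⟩ := chart_bound hn hp (by linarith : p ≤ 2)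
    (by have : 0 < s - κ := by linarith
        positivity : 0 < p * (s - κ) / 2)
  have h0 := hchart 0 0
  simp only [dsq_zero] at h0
  have hb : 0 < (ballInv n).toReal := ENNReal.toReal_pos ballInv_ne_zero ballInv_ne_top
  refine ⟨((ballInv n).toReal * K₀.toReal) ^ (1 / p) + 1, by positivity, fun K f hK hf hbd => ?_⟩
  have hint : fockInt s p f ≤ ENNReal.ofReal (K ^ p) * K₀ := by
    refine le_trans ?_ (mul_le_mul_right h0 _)
    rw [← lintegral_const_mul' _ _ ENNReal.ofReal_ne_top]
    refine lintegral_mono fun z => ?_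
    simp only
    rw [← mul_assoc]
    gcongr
    have hz := nsq_nonneg z
    rw [← ENNReal.ofReal_mul (by positivity)]
    refine ENNReal.ofReal_le_ofReal ?_
    have hw := weight_nonneg s z
    have hr : ‖rt z‖ ^ p ≤ nsq z ^ (p / 2) := by
      have h1 : ‖rt z‖ ^ p = (‖rt z‖ ^ 2) ^ (p / 2) := by
        rw [← Real.rpow_natCast, ← Real.rpow_mul (norm_nonneg _)]; congr 1; push_cast; ring
      rw [h1, norm_rt_sq]
      exact Real.rpow_le_rpow (norm_nonneg _) (norm_bdot_self_le_nsq z) (by positivity)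
    calc (‖f z‖ * weight s z) ^ p
        ≤ (K * Real.exp (κ * nsq z / 2) * (‖rt z‖ * Real.exp (-(s * nsq z / 2)))) ^ p := by
          rw [weight_eq]
          gcongr
          exact hbd z
      _ = K ^ p * (‖rt z‖ ^ p * Real.exp (-(p * (s - κ) / 2) * nsq z)) := by
          rw [show K * Real.exp (κ * nsq z / 2) * (‖rt z‖ * Real.exp (-(s * nsq z / 2))) =
            K * (‖rt z‖ * (Real.exp (κ * nsq z / 2) * Real.exp (-(s * nsq z / 2)))) by ring,
            ← Real.exp_add, Real.mul_rpow hK (by positivity),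
            Real.mul_rpow (by positivity) (by positivity), ← Real.exp_mul]
          congr 3
          ring
      _ ≤ K ^ p * ((nsq z ^ (p / 2) + nsq z) * Real.exp (-(p * (s - κ) / 2) * nsq z)) := by
          gcongr
          linarith
  have hfin : fockInt s p f ≠ ⊤ := ne_top_of_le_ne_top
    (ENNReal.mul_ne_top ENNReal.ofReal_ne_top hK₀) hint
  have hmem := (mem_fockP hp).mpr ⟨hf, hfin⟩
  refine ⟨hmem, ?_⟩
  have hP := pNorm_nonneg (⟨f, hmem⟩ : FockP n s p)
  have h1 : pNorm (⟨f, hmem⟩ : FockP n s p) ^ p ≤ (ballInv n).toReal * K₀.toReal * K ^ p := by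
    rw [pNorm_rpow hp, mul_assoc]
    gcongr
    have := ENNReal.toReal_mono (ENNReal.mul_ne_top ENNReal.ofReal_ne_top hK₀) hint
    rw [ENNReal.toReal_mul, ENNReal.toReal_ofReal (by positivity)] at this
    linarith
  calc pNorm (⟨f, hmem⟩ : FockP n s p) = (pNorm (⟨f, hmem⟩ : FockP n s p) ^ p) ^ (1 / p) := by
        rw [← Real.rpow_mul hP, mul_one_div_cancel hp.ne', Real.rpow_one]
    _ ≤ ((ballInv n).toReal * K₀.toReal * K ^ p) ^ (1 / p) := by gcongr
    _ = ((ballInv n).toReal * K₀.toReal) ^ (1 / p) * K := by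
        rw [Real.mul_rpow (by positivity) (by positivity), ← Real.rpow_mul hK,
          mul_one_div_cancel hp.ne', Real.rpow_one]
    _ ≤ _ := by gcongr; linarith

theorem exp_mul_nsq_le {κ R : ℝ} (hκ : 0 ≤ κ) {z : Fin n → ℂ} (hz : ‖z‖ ≤ R) :
    Real.exp (κ * nsq z / 2) ≤ Real.exp (κ * (n * R ^ 2)) := by
  have h1 := nsq_le_two_mul_euclSq z
  have h2 := euclSq_le_mul_sq_norm z
  have h3 : (n : ℝ) * ‖z‖ ^ 2 ≤ n * R ^ 2 := by gcongr
  refine Real.exp_le_exp.mpr ?_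
  have : κ * nsq z ≤ κ * (2 * (n * R ^ 2)) := by gcongr; linarith
  linarith

theorem differentiable_tsum_of_gauss_bound {κ : ℝ} (hκ0 : 0 ≤ κ) {F : ℕ → (Fin n → ℂ) → ℂ}
    {K : ℕ → ℝ} (hd : ∀ m, Differentiable ℂ (F m)) (hK0 : ∀ m, 0 ≤ K m) (hK : Summable K)
    (hb : ∀ m z, ‖F m z‖ ≤ K m * Real.exp (κ * nsq z / 2)) :
    Differentiable ℂ fun z => ∑' m, F m z := by
  refine differentiable_tsum_of_bound hd fun R => ⟨fun m => K m * Real.exp (κ * (n * R ^ 2)),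
    hK.mul_right _, fun z hz m => (hb m z).trans ?_⟩
  exact mul_le_mul_of_nonneg_left (exp_mul_nsq_le hκ0 hz) (hK0 m)

/-- Bounded functionals commute with series that converge in a Gaussian norm. -/
theorem hasSum_functional (hn : 1 ≤ n) {s p κ : ℝ} (hp : 0 < p) (hp1 : p ≤ 1)
    (hκ : κ < s) {F : ℕ → (Fin n → ℂ) → ℂ} {K : ℕ → ℝ} (hd : ∀ m, Differentiable ℂ (F m))
    (hK0 : ∀ m, 0 ≤ K m) (hK : Summable K)
    (hb : ∀ m z, ‖F m z‖ ≤ K m * Real.exp (κ * nsq z / 2)) (hF : ∀ m, F m ∈ FockP n s p)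
    {S : (Fin n → ℂ) → ℂ} (hSF : ∀ z, HasSum (fun m => F m z) (S z)) (hS : S ∈ FockP n s p)
    {G : FockP n s p →ₗ[ℂ] ℂ} (hG : IsBoundedFunctional G) :
    HasSum (fun m => G ⟨F m, hF m⟩) (G ⟨S, hS⟩) := by
  obtain ⟨C, hC, h⟩ := exists_pNorm_le_of_gauss_bound hn hp hp1 hκ
  obtain ⟨M, hM⟩ := hG
  have hM' : ∀ f, ‖G f‖ ≤ |M| * pNorm f := fun f =>
    (hM f).trans (mul_le_mul_of_nonneg_right (le_abs_self M) (pNorm_nonneg f))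
  have hsum : Summable fun m => G ⟨F m, hF m⟩ := by
    refine Summable.of_norm_bounded ((hK.mul_left C).mul_left |M|) fun m => (hM' _).trans ?_
    gcongr
    obtain ⟨_, h1⟩ := h (K m) (F m) (hK0 m) (hd m) (hb m)
    exact h1
  have ht : Filter.Tendsto (fun N => ∑ m ∈ Finset.range N, G ⟨F m, hF m⟩) Filter.atTop
      (nhds (G ⟨S, hS⟩)) := by
    rw [tendsto_iff_norm_sub_tendsto_zero]
    have h0 : Filter.Tendsto (fun N => |M| * (C * ∑' m, K (m + N))) Filter.atTop (nhds 0) := by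
      have := ((tendsto_sum_nat_add K).const_mul C).const_mul |M|
      simpa using this
    refine squeeze_zero (fun _ => norm_nonneg _) (fun N => ?_) h0
    -- The tail obeys the same Gaussian bound with the tail of ∑ K, so no triangle inequality for
    -- the quasi-norm is needed.
    set R : FockP n s p := ⟨S, hS⟩ - ∑ m ∈ Finset.range N, ⟨F m, hF m⟩ with hR
    have hRv : ∀ z, (R : (Fin n → ℂ) → ℂ) z = ∑' m, F (m + N) z := by
      intro z
      have := (hSF z).summable.sum_add_tsum_nat_add N
      rw [(hSF z).tsum_eq] at this
      simp only [hR, Submodule.coe_sub, Submodule.coe_sum, Pi.sub_apply, Finset.sum_apply]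
      rw [← this]; ring
    have hRb : ∀ z, ‖(R : (Fin n → ℂ) → ℂ) z‖ ≤ (∑' m, K (m + N)) * Real.exp (κ * nsq z / 2) := by
      intro z
      rw [hRv, ← tsum_mul_right]
      exact tsum_of_norm_bounded
        (((summable_nat_add_iff N).mpr hK).mul_right _).hasSum fun m => hb (m + N) z
    have h2 : pNorm R ≤ C * ∑' m, K (m + N) := by
      obtain ⟨_, h1⟩ := h _ (R : (Fin n → ℂ) → ℂ) (tsum_nonneg fun m => hK0 _) R.2.1 hRb
      exact h1
    have e : (∑ m ∈ Finset.range N, G ⟨F m, hF m⟩) - G ⟨S, hS⟩ = -G R := by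
      rw [hR, map_sub, map_sum]; ring
    rw [e, norm_neg]
    exact (hM' R).trans (by gcongr)
  rw [← tendsto_nhds_unique hsum.hasSum.tendsto_sum_nat ht]
  exact hsum.hasSum

/-- Use x^m / m! ≤ 2^{-m} e^{2x} with x = A N_*(z) N_*(u), then complete the square so that the
growth in z has rate s/2 < s. -/
theorem exists_norm_kerCoef_mul_le_gauss (n : ℕ) {s : ℝ} (hs : 0 < s) (b : ℝ) :
    ∃ C A : ℝ, 0 < C ∧ 0 < A ∧ ∀ (m : ℕ) (z u : Fin n → ℂ), ‖kerCoef n s b m * homKer m z u‖ ≤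
      C * Real.exp (A * nsq u) * (1 / 2) ^ m * Real.exp (s / 2 * nsq z / 2) := by
  obtain ⟨C, A, hC, hA, h⟩ := exists_norm_kerCoef_mul_le n hs b
  refine ⟨C, 4 * A ^ 2 / s, hC, by positivity, fun m z u => (h m z u).trans ?_⟩
  have hz := Nstar_nonneg z
  have hu := Nstar_nonneg u
  have h1 : (A * Nstar z * Nstar u) ^ m / m.factorial ≤
      (1 / 2) ^ m * Real.exp (2 * (A * Nstar z * Nstar u)) := by
    have h2 := Real.pow_div_factorial_le_exp (2 * (A * Nstar z * Nstar u)) (by positivity) m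
    calc (A * Nstar z * Nstar u) ^ m / m.factorial
        = (1 / 2) ^ m * ((2 * (A * Nstar z * Nstar u)) ^ m / m.factorial) := by
          rw [mul_pow 2, ← mul_div_assoc, ← mul_assoc, ← mul_pow]; norm_num
      _ ≤ _ := by gcongr
  have h3 : Real.exp (2 * (A * Nstar z * Nstar u)) ≤
      Real.exp (4 * A ^ 2 / s * nsq u) * Real.exp (s / 2 * nsq z / 2) := by
    rw [← Real.exp_add]
    refine Real.exp_le_exp.mpr ?_
    rw [← Nstar_sq, ← Nstar_sq]
    have h4 : 4 * A ^ 2 / s * Nstar u ^ 2 + s / 2 * Nstar z ^ 2 / 2 -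
        2 * (A * Nstar z * Nstar u) = (2 * A * Nstar u - s / 2 * Nstar z) ^ 2 / s := by
      field_simp; ring
    have h5 : 0 ≤ (2 * A * Nstar u - s / 2 * Nstar z) ^ 2 / s := by positivity
    linarith
  calc _ ≤ C * ((1 / 2) ^ m * (Real.exp (4 * A ^ 2 / s * nsq u) *
        Real.exp (s / 2 * nsq z / 2))) := by
        gcongr
        exact h1.trans (by gcongr)
    _ = _ := by ring

theorem differentiable_kerCoef_mul (s b : ℝ) (m : ℕ) (u : Fin n → ℂ) :
    Differentiable ℂ fun z => (kerCoef n s b m : ℂ) * homKer m z u :=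
  (homogEntire_homKer m u).differentiable.const_mul _

theorem differentiable_ker {s : ℝ} (hs : 0 < s) (b : ℝ) (u : Fin n → ℂ) :
    Differentiable ℂ fun z => ker n s b z u := by
  obtain ⟨C, A, hC, -, h⟩ := exists_norm_kerCoef_mul_le_gauss n hs b
  exact differentiable_tsum_of_gauss_bound (by positivity : 0 ≤ s / 2)
    (differentiable_kerCoef_mul s b · u) (fun m => by positivity)
    (summable_geometric_two.mul_left (C * Real.exp (A * nsq u))) (fun m z => h m z u)

theorem ker_mem_fockP (hn : 1 ≤ n) {s p : ℝ} (hs : 0 < s) (hp : 0 < p) (hp1 : p ≤ 1) (b : ℝ)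
    (u : Fin n → ℂ) : (fun z => ker n s b z u) ∈ FockP n s p := by
  obtain ⟨C, A, hC, -, h⟩ := exists_norm_kerCoef_mul_le_gauss n hs b
  obtain ⟨D, -, hD⟩ := exists_pNorm_le_of_gauss_bound hn hp hp1 (half_lt_self hs)
  obtain ⟨hf, -⟩ := hD (C * Real.exp (A * nsq u) * 2) _ (by positivity) (differentiable_ker hs b u)
    fun z => by
      refine tsum_of_norm_bounded ?_ (fun m => h m z u)
      have := (hasSum_geometric_two.mul_left (C * Real.exp (A * nsq u))).mul_right
        (Real.exp (s / 2 * nsq z / 2))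
      exact this
  exact hf

theorem homogEntire_mem_fockP (hn : 1 ≤ n) {s p : ℝ} (hs : 0 < s) (hp : 0 < p) (hp1 : p ≤ 1)
    {m : ℕ} {f : (Fin n → ℂ) → ℂ} (hf : HomogEntire m f) : f ∈ FockP n s p := by
  obtain ⟨C, hC, h⟩ := hf.exists_bound
  obtain ⟨D, hD, hD'⟩ := exists_one_add_pow_mul_exp_le m (by positivity : 0 < s / 4)
  obtain ⟨E, -, hE⟩ := exists_pNorm_le_of_gauss_bound hn hp hp1 (half_lt_self hs)
  obtain ⟨hf, -⟩ := hE (C * (D * Real.exp (s / 4))) f (by positivity) hf.differentiable fun z => by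
    have hz := norm_nonneg z
    have h1 := hD' ‖z‖ hz
    rw [Real.exp_neg, ← div_eq_mul_inv, div_le_iff₀ (Real.exp_pos _)] at h1
    have h2 : Real.exp (s / 4 * ‖z‖) ≤ Real.exp (s / 4) * Real.exp (s / 2 * nsq z / 2) := by
      rw [← Real.exp_add]
      refine Real.exp_le_exp.mpr ?_
      have h3 : ‖z‖ ^ 2 ≤ nsq z := (sq_norm_le_euclSq z).trans (euclSq_le_nsq z)
      have h4 : ‖z‖ ≤ 1 + nsq z := by nlinarith [sq_nonneg (‖z‖ - 1)]
      have h5 : s / 4 * ‖z‖ ≤ s / 4 * (1 + nsq z) := by gcongr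
      linarith
    calc ‖f z‖ ≤ C * ‖z‖ ^ m := h z
      _ ≤ C * (1 + ‖z‖) ^ m := by gcongr; linarith
      _ ≤ C * (D * (Real.exp (s / 4) * Real.exp (s / 2 * nsq z / 2))) := by
          gcongr
          exact h1.trans (by gcongr)
      _ = _ := by ring
  exact hf

/-- The kernel function `ker · u` as an element of `F_s^p`. -/
noncomputable def kerFun (hn : 1 ≤ n) {s p : ℝ} (hs : 0 < s) (hp : 0 < p) (hp1 : p ≤ 1)
    (u : Fin n → ℂ) : FockP n s p :=
  ⟨fun z => ker n s (1 / p - 1) z u, ker_mem_fockP hn hs hp hp1 _ u⟩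

theorem exists_pNorm_kerFun_le (hn : 1 ≤ n) {s p : ℝ} (hs : 0 < s) (hp : 0 < p) (hp1 : p ≤ 1) :
    ∃ C : ℝ, 0 < C ∧ ∀ u : Fin n → ℂ, pNorm (kerFun hn hs hp hp1 u) * weight s u ≤ C := by
  obtain ⟨K, hK, h⟩ := exists_lintegral_ker_le hn hs hp hp1
  have hb : 0 < (ballInv n).toReal := ENNReal.toReal_pos ballInv_ne_zero ballInv_ne_top
  refine ⟨((ballInv n).toReal * K.toReal) ^ (1 / p) + 1, by positivity, fun u => ?_⟩
  have hP := pNorm_nonneg (kerFun hn hs hp hp1 u)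
  have hw := weight_nonneg s u
  have h1 : ENNReal.ofReal (weight s u ^ p) * fockInt s p (fun z => ker n s (1 / p - 1) z u) ≤
      K := by
    refine le_trans (le_of_eq ?_) (h u)
    rw [fockInt, ← lintegral_const_mul' _ _ ENNReal.ofReal_ne_top]
    refine lintegral_congr fun z => ?_
    have hz := weight_nonneg s z
    rw [← mul_assoc, ← ENNReal.ofReal_mul (by positivity), ← Real.mul_rpow hw (by positivity)]
    rw [mul_comm (weight s u)]
  have h2 := ENNReal.toReal_mono hK h1
  rw [ENNReal.toReal_mul, ENNReal.toReal_ofReal (by positivity)] at h2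
  have h3 : (pNorm (kerFun hn hs hp hp1 u) * weight s u) ^ p ≤ (ballInv n).toReal * K.toReal := by
    rw [Real.mul_rpow hP hw, pNorm_rpow hp, mul_assoc]
    gcongr
    rw [mul_comm]
    exact h2
  calc pNorm (kerFun hn hs hp hp1 u) * weight s u
      = ((pNorm (kerFun hn hs hp hp1 u) * weight s u) ^ p) ^ (1 / p) := by
        rw [← Real.rpow_mul (by positivity), mul_one_div_cancel hp.ne', Real.rpow_one]
    _ ≤ ((ballInv n).toReal * K.toReal) ^ (1 / p) := by gcongr
    _ ≤ _ := by linarith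

theorem ker_comm (s b : ℝ) (z u : Fin n → ℂ) : ker n s b z u = ker n s b u z := by
  simp only [ker, homKer_comm _ z u]

/-- In degree m the factors are (m+n+1)^{1/p-1} from the kernel, m+n+1 from the density and
(m+n+1)^{-1/p} from T. Their product is 1, so the homogeneous expansion of g is returned. -/
theorem pairing_kerFun (hn : 1 ≤ n) {s p : ℝ} (hs : 0 < s) (hp : 0 < p) (hp1 : p ≤ 1)
    (u : Fin n → ℂ) (g : FockInf n s) :
    pairing hn hs hp hp1 (kerFun hn hs hp hp1 u) g = (g : (Fin n → ℂ) → ℂ) u := by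
  have ha : 0 < 1 / p := by positivity
  have hc : (0 : ℝ) < n + 1 := by positivity
  have h1 := (gaussInt_fracInt hn hs ha g).hasSum_integral hn hs (1 / p - 1)
    (differentiable_fracInt ha hc g.2.1) u 1 1
  have h2 : ∀ m : ℕ, (((m + n + 1 : ℝ) ^ (1 / p - 1) * (1 + 1 * (m + n)) : ℝ) : ℂ) *
      hcomp m (fracInt (1 / p) (n + 1) (g : (Fin n → ℂ) → ℂ)) u =
      hcomp m (g : (Fin n → ℂ) → ℂ) u := by
    intro m
    rw [hcomp_fracInt ha hc g.2.1, ← mul_assoc, ← Complex.ofReal_mul]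
    have : (m + n + 1 : ℝ) ^ (1 / p - 1) * (1 + 1 * (m + n)) * (m + (n + 1)) ^ (-(1 / p)) = 1 := by
      have h3 : (0 : ℝ) < m + n + 1 := by positivity
      rw [show (1 + 1 * (m + n) : ℝ) = m + n + 1 by ring, ← add_assoc (m : ℝ),
        ← Real.rpow_add_one h3.ne', sub_add_cancel, ← Real.rpow_add h3, add_neg_cancel,
        Real.rpow_zero]
    rw [this, Complex.ofReal_one, one_mul]
  simp only [h2] at h1
  rw [(hasSum_hcomp g.2.1 u).unique h1, pairing_apply]
  -- The pairing evaluates T g at w̄, whereas the kernel expansion conjugates the kernel variable; w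
  -- ↦ w̄ exchanges the two.
  rw [← measurePreserving_star.integral_comp
    (Homeomorph.mk (Equiv.mk star star star_star star_star) continuous_star
      continuous_star).measurableEmbedding]
  refine integral_congr_ae (Filter.Eventually.of_forall fun w => ?_)
  simp only [pairingDensity, kerFun, star_star, nsq_star, one_mul]
  rw [ker_comm]
  ring

end KernelSections

/-! ### Functionals vanishing on the kernel functions -/

section Totality
variable {n : ℕ}

theorem eq_zero_of_hasSum_pow_mul {c : ℕ → ℂ} (h : ∀ t : ℂ, HasSum (fun m => t ^ m * c m) 0)
    (m : ℕ) : c m = 0 := by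
  have h1 : HasFPowerSeriesAt (0 : ℂ → ℂ) (FormalMultilinearSeries.ofScalars ℂ c) 0 := by
    rw [hasFPowerSeriesAt_iff]
    refine Filter.Eventually.of_forall fun t => ?_
    simpa [FormalMultilinearSeries.coeff_ofScalars] using h t
  have h2 := congrArg (fun q => FormalMultilinearSeries.coeff q m) h1.eq_zero
  simp only [FormalMultilinearSeries.coeff_ofScalars] at h2
  exact h2

/-- `homKer m · u` as an element of `F_s^p`. -/
noncomputable def homKerFun (hn : 1 ≤ n) {s p : ℝ} (hs : 0 < s) (hp : 0 < p) (hp1 : p ≤ 1) (m : ℕ)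
    (u : Fin n → ℂ) : FockP n s p :=
  ⟨fun z => homKer m z u, homogEntire_mem_fockP hn hs hp hp1 (homogEntire_homKer m u)⟩

theorem hasSum_functional_kerFun (hn : 1 ≤ n) {s p : ℝ} (hs : 0 < s) (hp : 0 < p) (hp1 : p ≤ 1)
    {G : FockP n s p →ₗ[ℂ] ℂ} (hG : IsBoundedFunctional G) (u : Fin n → ℂ) :
    HasSum (fun m => kerCoef n s (1 / p - 1) m * G (homKerFun hn hs hp hp1 m u))
      (G (kerFun hn hs hp hp1 u)) := by
  obtain ⟨C, A, hC, -, h⟩ := exists_norm_kerCoef_mul_le_gauss n hs (1 / p - 1)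
  have hmem : ∀ m, (fun z => (kerCoef n s (1 / p - 1) m : ℂ) * homKer m z u) ∈ FockP n s p :=
    fun m => homogEntire_mem_fockP hn hs hp hp1 ((homogEntire_homKer m u).const_mul _)
  have h1 := hasSum_functional hn hp hp1 (half_lt_self hs)
    (differentiable_kerCoef_mul s (1 / p - 1) · u) (fun m => by positivity)
    (summable_geometric_two.mul_left (C * Real.exp (A * nsq u))) (fun m z => h m z u) hmem
    (fun z => hasSum_ker hs (1 / p - 1) z u) (ker_mem_fockP hn hs hp hp1 _ u) hG
  have e : ∀ m, (kerCoef n s (1 / p - 1) m : ℂ) * G (homKerFun hn hs hp hp1 m u) =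
      G ⟨_, hmem m⟩ := fun m => by rw [← smul_eq_mul, ← map_smul]; rfl
  simp only [e]
  exact h1

theorem functional_homKerFun_eq (hn : 1 ≤ n) {s p : ℝ} (hs : 0 < s) (hp : 0 < p) (hp1 : p ≤ 1)
    (G : FockP n s p →ₗ[ℂ] ℂ) {m : ℕ} {ι : Type} [Fintype ι] {a c : ι → (Fin n → ℂ) → ℂ}
    (ha : ∀ i, HomogEntire m (a i)) (hac : ∀ z u, homKer m z u = ∑ i, a i z * c i u)
    (u : Fin n → ℂ) : G (homKerFun hn hs hp hp1 m u) =
      ∑ i, c i u * G ⟨a i, homogEntire_mem_fockP hn hs hp hp1 (ha i)⟩ := by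
  simp only [← smul_eq_mul (c _ u), ← map_smul, ← map_sum]
  congr 1
  ext z
  simp only [homKerFun, hac, Submodule.coe_sum, Submodule.coe_smul, Finset.sum_apply,
    Pi.smul_apply, smul_eq_mul]
  exact Finset.sum_congr rfl fun i _ => mul_comm _ _

theorem homogEntire_functional_homKerFun (hn : 1 ≤ n) {s p : ℝ} (hs : 0 < s) (hp : 0 < p)
    (hp1 : p ≤ 1) (G : FockP n s p →ₗ[ℂ] ℂ) (m : ℕ) :
    HomogEntire m fun u => G (homKerFun hn hs hp hp1 m u) := by
  obtain ⟨ι, _, a, c, ha, hc, hac⟩ := finRank_homKer (n := n) m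
  simp only [functional_homKerFun_eq hn hs hp hp1 G ha hac]
  refine ⟨?_, fun t u => ?_⟩
  · exact Differentiable.fun_sum fun i _ => (hc i).differentiable.mul_const _
  · rw [Finset.mul_sum]
    refine Finset.sum_congr rfl fun i _ => ?_
    rw [(hc i).smul]; ring

/-- The degree m terms are entire by finite rank, and boundedness of G transfers the Gaussian bound
on the kernel terms to a locally uniform summable bound in u. -/
theorem differentiable_functional_kerFun (hn : 1 ≤ n) {s p : ℝ} (hs : 0 < s) (hp : 0 < p)
    (hp1 : p ≤ 1) {G : FockP n s p →ₗ[ℂ] ℂ} (hG : IsBoundedFunctional G) :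
    Differentiable ℂ fun u => G (kerFun hn hs hp hp1 u) := by
  have e : (fun u => G (kerFun hn hs hp hp1 u)) = fun u => ∑' m,
      kerCoef n s (1 / p - 1) m * G (homKerFun hn hs hp hp1 m u) := by
    funext u; exact (hasSum_functional_kerFun hn hs hp hp1 hG u).tsum_eq.symm
  obtain ⟨C, A, hC, hA, h⟩ := exists_norm_kerCoef_mul_le_gauss n hs (1 / p - 1)
  obtain ⟨D, hD, hD'⟩ := exists_pNorm_le_of_gauss_bound hn hp hp1 (half_lt_self hs)
  obtain ⟨M, hM⟩ := hG
  rw [e]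
  refine differentiable_tsum_of_gauss_bound (κ := 2 * A) (K := fun m => |M| * (D * C) * (1 / 2) ^ m)
    (by positivity)
    (fun m => (homogEntire_functional_homKerFun hn hs hp hp1 G m).differentiable.const_mul _)
    (fun m => by positivity) (summable_geometric_two.mul_left _) fun m u => ?_
  obtain ⟨hmem, hle⟩ := hD' (C * Real.exp (A * nsq u) * (1 / 2) ^ m) _ (by positivity)
    (differentiable_kerCoef_mul s (1 / p - 1) m u) (fun z => h m z u)
  have e2 : (kerCoef n s (1 / p - 1) m : ℂ) * G (homKerFun hn hs hp hp1 m u) =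
      G ⟨fun z => (kerCoef n s (1 / p - 1) m : ℂ) * homKer m z u, hmem⟩ := by
    rw [← smul_eq_mul, ← map_smul]; rfl
  rw [e2]
  calc _ ≤ |M| * pNorm (⟨_, hmem⟩ : FockP n s p) :=
        (hM _).trans (mul_le_mul_of_nonneg_right (le_abs_self M) (pNorm_nonneg _))
    _ ≤ |M| * (D * (C * Real.exp (A * nsq u) * (1 / 2) ^ m)) := by gcongr
    _ = _ := by
        rw [show 2 * A * nsq u / 2 = A * nsq u by ring]; ring

/-- Along the line t ↦ tu the series of G on kernel functions is a power series vanishing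
identically, so every coefficient is zero; the coefficients of the kernel are not. -/
theorem functional_homKerFun_eq_zero (hn : 1 ≤ n) {s p : ℝ} (hs : 0 < s) (hp : 0 < p)
    (hp1 : p ≤ 1) {G : FockP n s p →ₗ[ℂ] ℂ} (hG : IsBoundedFunctional G)
    (h0 : ∀ u, G (kerFun hn hs hp hp1 u) = 0) (m : ℕ) (u : Fin n → ℂ) :
    G (homKerFun hn hs hp hp1 m u) = 0 := by
  have h1 := eq_zero_of_hasSum_pow_mul
    (c := fun m => kerCoef n s (1 / p - 1) m * G (homKerFun hn hs hp hp1 m u)) (fun t => by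
      have h2 := hasSum_functional_kerFun hn hs hp hp1 hG (t • u)
      rw [h0] at h2
      convert h2 using 2 with k
      rw [(homogEntire_functional_homKerFun hn hs hp hp1 G k).smul]; ring) m
  have h2 : (kerCoef n s (1 / p - 1) m : ℂ) ≠ 0 := by exact_mod_cast (kerCoef_pos hs _ m).ne'
  exact (mul_eq_zero.mp h1).resolve_left h2

/-- The reproducing formula writes f as an integral of the functions P_m(·, w̄). By finite rank it
is a finite linear combination of fixed functions, so G may be applied under the integral. -/
theorem functional_homogEntire_eq_zero (hn : 1 ≤ n) {s p : ℝ} (hs : 0 < s) (hp : 0 < p)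
    (hp1 : p ≤ 1) {G : FockP n s p →ₗ[ℂ] ℂ} (hG : IsBoundedFunctional G)
    (h0 : ∀ u, G (kerFun hn hs hp hp1 u) = 0) {m : ℕ} {f : (Fin n → ℂ) → ℂ}
    (hf : HomogEntire m f) (hmem : f ∈ FockP n s p) : G ⟨f, hmem⟩ = 0 := by
  obtain ⟨ι, _, a, c, ha, hc, hac⟩ := finRank_homKer (n := n) m
  set A : ι → FockP n s p := fun i => ⟨a i, homogEntire_mem_fockP hn hs hp hp1 (ha i)⟩ with hA
  set J : ι → ℂ := fun i => ∫ w, c i (star w) * f w * (Real.exp (-s * nsq w) : ℂ) with hJ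
  have hint : ∀ i, Integrable fun w => c i (star w) * f w * (Real.exp (-s * nsq w) : ℂ) := by
    intro i
    obtain ⟨C, hC, h⟩ := (hc i).exists_bound
    have h1 : ExpBdd fun w : Fin n → ℂ => c i (star w) :=
      ExpBdd.of_norm_pow hC fun w => by simpa using h (star w)
    have h2 : Continuous fun w : Fin n → ℂ => c i (star w) :=
      (hc i).differentiable.continuous.comp continuous_star_pi
    exact (h1.mul hf.expBdd).integrable_mul_exp_nsq
      (h2.mul hf.differentiable.continuous).aestronglyMeasurable hs
  have hX : (normConst n s m : ℂ) ≠ 0 := by exact_mod_cast (normConst_pos hs m).ne'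
  have hrep : (normConst n s m : ℂ) • (⟨f, hmem⟩ : FockP n s p) = ∑ i, J i • A i := by
    ext z
    have h1 := integral_homKer hn hs hf z 1 0
    simp only [zero_mul, add_zero, one_mul] at h1
    have h2 : ∫ w, homKer m z (star w) * (Real.exp (-s * nsq w) : ℝ) * f w =
        ∑ i, a i z * J i := by
      simp only [hJ, ← integral_const_mul]
      rw [← integral_finsetSum _ fun i _ => (hint i).const_mul _]
      congr 1; funext w
      rw [hac, Finset.sum_mul, Finset.sum_mul]
      refine Finset.sum_congr rfl fun i _ => ?_
      push_cast; ring
    simp only [Submodule.coe_smul, Submodule.coe_sum, Pi.smul_apply, Finset.sum_apply, smul_eq_mul]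
    rw [h2] at h1
    push_cast at h1
    rw [zero_mul, add_zero, mul_one] at h1
    rw [← h1]
    exact Finset.sum_congr rfl fun i _ => mul_comm _ _
  have hG0 : G ((normConst n s m : ℂ) • (⟨f, hmem⟩ : FockP n s p)) = 0 := by
    rw [hrep, map_sum]
    simp only [map_smul, smul_eq_mul, hJ, ← integral_mul_const]
    rw [← integral_finsetSum _ fun i _ => (hint i).mul_const _]
    have h3 : ∀ w : Fin n → ℂ, ∑ i, c i (star w) * f w * (Real.exp (-s * nsq w) : ℂ) * G (A i) =
        0 := by
      intro w
      have h4 := functional_homKerFun_eq hn hs hp hp1 G ha hac (star w)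
      rw [functional_homKerFun_eq_zero hn hs hp hp1 hG h0] at h4
      calc _ = f w * (Real.exp (-s * nsq w) : ℂ) * ∑ i, c i (star w) * G (A i) := by
            rw [Finset.mul_sum]
            exact Finset.sum_congr rfl fun i _ => by ring
        _ = 0 := by rw [← h4, mul_zero]
    simp only [h3, integral_zero]
  rw [map_smul, smul_eq_mul] at hG0
  exact (mul_eq_zero.mp hG0).resolve_left hX

theorem exists_poly_exp_mul_le (d : ℕ) {s t : ℝ} (hs : 0 < s) (ht0 : 0 ≤ t) (ht : t < 1) :
    ∃ C, 0 < C ∧ ∀ N : ℝ, 0 ≤ N → (1 + N) ^ d * Real.exp (s * (t ^ 2 * N ^ 2) / 2) ≤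
      C * Real.exp (s * (1 + t ^ 2) / 2 * N ^ 2 / 2) := by
  have ht2 : t ^ 2 < 1 := by nlinarith
  have hc : 0 < s * (1 - t ^ 2) / 2 := by
    have : 0 < 1 - t ^ 2 := by linarith
    positivity
  obtain ⟨C, hC, h⟩ := exists_poly_exp_le d 0 hc
  refine ⟨C, hC, fun N hN => ?_⟩
  have h1 := mul_le_mul_of_nonneg_right (h N hN) (Real.exp_pos (s * N ^ 2 / 2)).le
  rw [mul_assoc, ← Real.exp_add, mul_assoc, ← Real.exp_add] at h1
  have e1 : 0 * N - s * (1 - t ^ 2) / 2 * N ^ 2 + s * N ^ 2 / 2 = s * (t ^ 2 * N ^ 2) / 2 := by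
    ring
  have e2 : -(s * (1 - t ^ 2) / 2 / 2) * N ^ 2 + s * N ^ 2 / 2 =
      s * (1 + t ^ 2) / 2 * N ^ 2 / 2 := by ring
  rwa [e1, e2] at h1


/-- For r < 1 the homogeneous expansion of f(rz) converges in a Gaussian norm of rate below s, so G
may be applied term by term, and each term gives 0. -/
theorem functional_dilation_eq_zero (hn : 1 ≤ n) {s p : ℝ} (hs : 0 < s) (hp : 0 < p)
    (hp1 : p ≤ 1) {G : FockP n s p →ₗ[ℂ] ℂ} (hG : IsBoundedFunctional G)
    (h0 : ∀ u, G (kerFun hn hs hp hp1 u) = 0) (f : FockP n s p) {r : ℝ} (hr : 0 < r) (hr1 : r < 1)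
    (hmem : (fun z => (f : (Fin n → ℂ) → ℂ) ((r : ℂ) • z)) ∈ FockP n s p) :
    G ⟨_, hmem⟩ = 0 := by
  have hfd := f.2.1
  obtain ⟨C, d, hC, hcr⟩ := exists_norm_le_pNorm hn hs hp hp1
  have hP := pNorm_nonneg f
  -- An intermediate radius r < t < 1: Cauchy's estimate at tz with homogeneity gives the ratio r/t,
  -- and t < 1 leaves room below the rate s.
  set t := (1 + r) / 2 with ht
  have ht0 : 0 < t := by positivity
  have ht1 : t < 1 := by rw [ht]; linarith
  have hrt : r < t := by rw [ht]; linarith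
  obtain ⟨C', hC', hpe⟩ := exists_poly_exp_mul_le d hs ht0.le ht1
  set κ := s * (1 + t ^ 2) / 2 with hκ
  have hκs : κ < s := by
    have h1 : t ^ 2 < 1 := by nlinarith
    have h2 := mul_lt_mul_of_pos_left h1 hs
    rw [hκ]; linarith
  have hF : ∀ m, HomogEntire m fun z => (r : ℂ) ^ m * hcomp m (f : (Fin n → ℂ) → ℂ) z :=
    fun m => (homogEntire_hcomp m hfd).const_mul _
  have hbd : ∀ (m : ℕ) z, ‖(r : ℂ) ^ m * hcomp m (f : (Fin n → ℂ) → ℂ) z‖ ≤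
      C * pNorm f * C' * (r / t) ^ m * Real.exp (κ * nsq z / 2) := by
    intro m z
    have hN := Nstar_nonneg z
    have h1 : ‖hcomp m (f : (Fin n → ℂ) → ℂ) ((t : ℂ) • z)‖ ≤
        C * pNorm f * (C' * Real.exp (κ * nsq z / 2)) := by
      refine norm_hcomp_le m fun c hc => (hcr f _).trans ?_
      rw [Nstar_smul, Nstar_smul, nsq_smul, nsq_smul, hc, Complex.norm_real,
        Real.norm_of_nonneg ht0.le, one_mul, one_pow, one_mul]
      calc C * (1 + t * Nstar z) ^ d * Real.exp (s * (t ^ 2 * nsq z) / 2) * pNorm f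
          ≤ C * (1 + Nstar z) ^ d * Real.exp (s * (t ^ 2 * nsq z) / 2) * pNorm f := by
            gcongr
            exact mul_le_of_le_one_left hN ht1.le
        _ = C * pNorm f * ((1 + Nstar z) ^ d * Real.exp (s * (t ^ 2 * nsq z) / 2)) := by ring
        _ ≤ _ := by
            refine mul_le_mul_of_nonneg_left ?_ (by positivity)
            rw [← Nstar_sq]
            exact hpe _ hN
    rw [hcomp_smul m hfd, norm_mul, norm_pow, Complex.norm_real, Real.norm_of_nonneg ht0.le] at h1
    rw [norm_mul, norm_pow, Complex.norm_real, Real.norm_of_nonneg hr.le]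
    have h2 : r ^ m = (r / t) ^ m * t ^ m := by rw [← mul_pow, div_mul_cancel₀ _ ht0.ne']
    rw [h2, mul_assoc]
    calc (r / t) ^ m * (t ^ m * ‖hcomp m (f : (Fin n → ℂ) → ℂ) z‖)
        ≤ (r / t) ^ m * (C * pNorm f * (C' * Real.exp (κ * nsq z / 2))) := by gcongr
      _ = _ := by ring
  have hsum : Summable fun m : ℕ => C * pNorm f * C' * (r / t) ^ m :=
    (summable_geometric_of_lt_one (by positivity) ((div_lt_one ht0).mpr hrt)).mul_left _
  have h1 := hasSum_functional hn hp hp1 hκs (fun m => (hF m).differentiable)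
    (fun m => by positivity) hsum hbd (fun m => homogEntire_mem_fockP hn hs hp hp1 (hF m))
    (fun z => by
      have := hasSum_hcomp hfd ((r : ℂ) • z)
      simp only [hcomp_smul _ hfd] at this
      exact this) hmem hG
  simp only [functional_homogEntire_eq_zero hn hs hp hp1 hG h0 (hF _)] at h1
  exact h1.unique hasSum_zero

end Totality

/-! ### Dilations approximate f in F_s^p -/

section Density
variable {n : ℕ}

/-- Convergence in measure-theoretic mean from pointwise convergence and convergence of norms. -/
theorem exists_lintegral_lt_of_tendsto {α : Type*} [MeasurableSpace α] {μ : Measure α}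
    {a : α → ℝ≥0∞} {A B : ℕ → α → ℝ≥0∞} {c : ℕ → ℝ≥0∞} (ha : Measurable a)
    (hA : ∀ k, Measurable (A k)) (hB : ∀ k, Measurable (B k))
    (hle : ∀ k, B k ≤ᵐ[μ] fun x => A k x + a x)
    (hAt : ∀ᵐ x ∂μ, Filter.Tendsto (A · x) Filter.atTop (nhds (a x)))
    (hBt : ∀ᵐ x ∂μ, Filter.Tendsto (B · x) Filter.atTop (nhds 0))
    (hfin : ∫⁻ x, a x ∂μ ≠ ⊤) (hc : Filter.Tendsto c Filter.atTop (nhds 1))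
    (hAc : ∀ k, ∫⁻ x, A k x ∂μ ≤ c k * ∫⁻ x, a x ∂μ) {ε : ℝ≥0∞} (hε : ε ≠ 0) :
    ∃ k, ∫⁻ x, B k x ∂μ < ε := by
  by_contra! hcon
  set I := ∫⁻ x, a x ∂μ with hI
  have hlim : Filter.Tendsto (fun k => c k * I + I) Filter.atTop (nhds (I + I)) := by
    have := (ENNReal.Tendsto.mul_const hc (Or.inr hfin)).add_const I
    rwa [one_mul] at this
  have hadd : ∀ k, ∫⁻ x, A k x + a x ∂μ ≤ c k * I + I := fun k => by
    rw [lintegral_add_left (hA k)]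
    gcongr
    exact hAc k
  have hBle : ∀ k, ∫⁻ x, B k x ∂μ ≤ c k * I + I := fun k => (lintegral_mono_ae (hle k)).trans (hadd k)
  have hεI : ε ≤ I + I := ge_of_tendsto hlim (Filter.Eventually.of_forall fun k =>
    (hcon k).trans (hBle k))
  have hII : I + I ≠ ⊤ := ENNReal.add_ne_top.mpr ⟨hfin, hfin⟩
  have hεt : ε ≠ ⊤ := ne_top_of_le_ne_top hII hεI
  have hdiff : ∀ k, ∫⁻ x, (A k x + a x - B k x) ∂μ ≤ c k * I + I - ε := by
    intro k
    refine ENNReal.le_sub_of_add_le_right hεt ?_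
    calc _ ≤ ∫⁻ x, (A k x + a x - B k x) ∂μ + ∫⁻ x, B k x ∂μ := by gcongr; exact hcon k
      _ = ∫⁻ x, (A k x + a x - B k x) + B k x ∂μ := (lintegral_add_right _ (hB k)).symm
      _ = ∫⁻ x, A k x + a x ∂μ :=
          lintegral_congr_ae ((hle k).mono fun x hx => tsub_add_cancel_of_le hx)
      _ ≤ _ := hadd k
  -- Fatou's lemma for the nonnegative functions A_k + a - B_k, whose limit is 2a. If the integrals
  -- of B_k all stayed above ε, the lower limit would be at most 2I - ε.
  have hfatou : I + I ≤ Filter.liminf (fun k => ∫⁻ x, (A k x + a x - B k x) ∂μ) Filter.atTop := by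
    have h1 := lintegral_liminf_le (μ := μ) (u := Filter.atTop)
      (f := fun k x => A k x + a x - B k x) fun k => ((hA k).add ha).sub (hB k)
    refine le_trans (le_of_eq ?_) h1
    rw [hI, ← lintegral_add_left ha]
    refine lintegral_congr_ae ?_
    filter_upwards [hAt, hBt] with x h2 h3
    have := ENNReal.Tendsto.sub (h2.add_const (a x)) h3 (Or.inr ENNReal.zero_ne_top)
    rw [tsub_zero] at this
    exact this.liminf_eq.symm
  have hle2 : I + I ≤ I + I - ε := by
    have h4 := ENNReal.Tendsto.sub hlim (tendsto_const_nhds (x := ε)) (Or.inl hII)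
    refine hfatou.trans ((Filter.liminf_le_liminf (Filter.Eventually.of_forall hdiff)).trans ?_)
    exact h4.liminf_eq.le
  exact absurd hle2 (not_le.mpr (ENNReal.sub_lt_self hII
    (fun h => hε (le_antisymm (hεI.trans h.le) zero_le)) hε))

theorem norm_rt_smul (c : ℂ) (z : Fin n → ℂ) : ‖rt (c • z)‖ = ‖c‖ * ‖rt z‖ := by
  refine (pow_left_inj₀ (norm_nonneg _) (by positivity) two_ne_zero).mp ?_
  rw [norm_rt_sq, bdot_smul_self, mul_pow, norm_rt_sq, norm_mul, norm_pow]

/-- The constant tends to 1 as r → 1: the weight grows by at most 1/r under z ↦ rz, the density |z •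
z|⁻¹ scales by r², and the volume by the real dimension. -/
theorem fockInt_dilation_le (hn : 1 ≤ n) {s p : ℝ} (hs : 0 < s) (hp : 0 < p)
    {f : (Fin n → ℂ) → ℂ} (hf : Continuous f) {r : ℝ} (hr : 0 < r) (hr1 : r ≤ 1) :
    fockInt s p (fun z => f ((r : ℂ) • z)) ≤
      ENNReal.ofReal (r ^ (2 - p) * (r ^ Module.finrank ℝ (Fin n → ℂ))⁻¹) * fockInt s p f := by
  set H : (Fin n → ℂ) → ℝ≥0∞ := fun z =>
    ENNReal.ofReal ((‖f z‖ * weight s z) ^ p) * (ENNReal.ofReal ‖bdot z z‖)⁻¹ with hH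
  have hHm : Measurable H := by
    have h1 := hf.measurable
    have h2 := (continuous_weight (n := n) s).measurable
    have h3 := (continuous_bdot_self (n := n)).measurable
    fun_prop
  have hscale : ∫⁻ z, H ((r : ℂ) • z) =
      ENNReal.ofReal ((r ^ Module.finrank ℝ (Fin n → ℂ))⁻¹) * fockInt s p f := by
    have h1 := Measure.map_addHaar_smul (volume : Measure (Fin n → ℂ)) hr.ne'
    have h2 : ∫⁻ z, H z ∂(Measure.map (r • ·) (volume : Measure (Fin n → ℂ))) =
        ∫⁻ z, H (r • z) := lintegral_map hHm (by fun_prop)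
    rw [h1, lintegral_smul_measure, abs_of_pos (by positivity)] at h2
    simp only [Complex.coe_smul]
    rw [← h2, smul_eq_mul]
    rfl
  rw [ENNReal.ofReal_mul (by positivity), mul_assoc, ← hscale,
    ← lintegral_const_mul' _ _ ENNReal.ofReal_ne_top]
  refine lintegral_mono_ae ?_
  filter_upwards [ae_bdot_self_ne_zero hn] with z hz
  have hq : 0 < ‖bdot z z‖ := norm_pos_iff.mpr hz
  have hnz := nsq_nonneg z
  have hnr : ‖(r : ℂ)‖ = r := by rw [Complex.norm_real, Real.norm_of_nonneg hr.le]
  have hqr : ‖bdot ((r : ℂ) • z) ((r : ℂ) • z)‖ = r ^ 2 * ‖bdot z z‖ := by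
    rw [bdot_smul_self, norm_mul, norm_pow, hnr]
  have hw : weight s z ≤ r⁻¹ * weight s ((r : ℂ) • z) := by
    rw [weight_eq, weight_eq, norm_rt_smul, nsq_smul, hnr]
    have h1 : Real.exp (-(s * nsq z / 2)) ≤ Real.exp (-(s * (r ^ 2 * nsq z) / 2)) := by
      refine Real.exp_le_exp.mpr ?_
      have h2 : s * (r ^ 2 * nsq z) ≤ s * (1 * nsq z) := by
        gcongr
        exact pow_le_one₀ hr.le hr1
      linarith
    calc _ ≤ ‖rt z‖ * Real.exp (-(s * (r ^ 2 * nsq z) / 2)) := by gcongr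
      _ = _ := by field_simp
  have hwr := weight_nonneg s ((r : ℂ) • z)
  have hwz := weight_nonneg s z
  simp only [hH]
  rw [hqr, ← ENNReal.ofReal_inv_of_pos hq, ← ENNReal.ofReal_inv_of_pos (by positivity),
    ← ENNReal.ofReal_mul (by positivity), ← ENNReal.ofReal_mul (by positivity),
    ← ENNReal.ofReal_mul (by positivity)]
  refine ENNReal.ofReal_le_ofReal ?_
  calc (‖f ((r : ℂ) • z)‖ * weight s z) ^ p * ‖bdot z z‖⁻¹
      ≤ (r⁻¹ * (‖f ((r : ℂ) • z)‖ * weight s ((r : ℂ) • z))) ^ p * ‖bdot z z‖⁻¹ := by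
        refine mul_le_mul_of_nonneg_right (Real.rpow_le_rpow (by positivity) ?_ hp.le)
          (by positivity)
        exact (mul_le_mul_of_nonneg_left hw (norm_nonneg _)).trans_eq (by ring)
    _ = _ := by
        rw [Real.mul_rpow (by positivity) (by positivity), Real.rpow_sub hr, Real.inv_rpow hr.le,
          Real.rpow_two]
        field_simp

/-- Totality of the kernel functions. The functional G kills all dilations f(rz) with r < 1. These
converge pointwise to f, and the upper limit of their norm integrals is at most that of f, so along
a sequence r_k → 1 the distance integrals become arbitrarily small and continuity gives G f = 0. -/
theorem functional_eq_zero (hn : 1 ≤ n) {s p : ℝ} (hs : 0 < s) (hp : 0 < p)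
    (hp1 : p ≤ 1) {G : FockP n s p →ₗ[ℂ] ℂ} (hG : IsBoundedFunctional G)
    (h0 : ∀ u, G (kerFun hn hs hp hp1 u) = 0) : G = 0 := by
  ext f
  rw [LinearMap.zero_apply]
  by_contra hne
  obtain ⟨hfd, hfin⟩ := (mem_fockP hp).mp f.2
  set g : (Fin n → ℂ) → ℂ := (f : (Fin n → ℂ) → ℂ) with hg
  have hgc := hfd.continuous
  set r : ℕ → ℝ := fun k => 1 - 1 / ((k : ℝ) + 2) with hr
  have hr0 : ∀ k, 0 < r k := fun k => by
    have : 1 / ((k : ℝ) + 2) < 1 := by rw [div_lt_one (by positivity)]; linarith [k.cast_nonneg (α := ℝ)]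
    simp only [hr]; linarith
  have hr1 : ∀ k, r k < 1 := fun k => by
    have : 0 < 1 / ((k : ℝ) + 2) := by positivity
    simp only [hr]; linarith
  have hrt : Filter.Tendsto r Filter.atTop (nhds 1) := by
    have h1 : Filter.Tendsto (fun k : ℕ => 1 / ((k : ℝ) + 2)) Filter.atTop (nhds 0) := by
      have := (tendsto_one_div_add_atTop_nhds_zero_nat (𝕜 := ℝ)).comp (Filter.tendsto_add_atTop_nat 1)
      refine this.congr fun k => ?_
      simp only [Function.comp]; push_cast; ring
    simpa [hr] using h1.const_sub 1
  set gk : ℕ → (Fin n → ℂ) → ℂ := fun k z => g ((r k : ℂ) • z) with hgk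
  have hgkd : ∀ k, Differentiable ℂ (gk k) := fun k =>
    hfd.comp (f := fun z : Fin n → ℂ => (r k : ℂ) • z) (by fun_prop)
  have hdil := fun k => fockInt_dilation_le hn hs hp hgc (hr0 k) (hr1 k).le
  have hmem : ∀ k, gk k ∈ FockP n s p := fun k => (mem_fockP hp).mpr ⟨hgkd k,
    ne_top_of_le_ne_top (ENNReal.mul_ne_top ENNReal.ofReal_ne_top hfin) (hdil k)⟩
  have hGk : ∀ k, G ⟨gk k, hmem k⟩ = 0 := fun k =>
    functional_dilation_eq_zero hn hs hp hp1 hG h0 f (hr0 k) (hr1 k) (hmem k)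
  obtain ⟨M, hM⟩ := hG
  have hb : 0 < (ballInv n).toReal := ENNReal.toReal_pos ballInv_ne_zero ballInv_ne_top
  set e := ‖G f‖ ^ p with he
  have he0 : 0 < e := Real.rpow_pos_of_pos (norm_pos_iff.mpr hne) p
  set c := |M| ^ p * (ballInv n).toReal with hc
  have hc0 : 0 ≤ c := by positivity
  have hlower : ∀ k, e ≤ c * (fockInt s p (fun z => gk k z - g z)).toReal := by
    intro k
    set R : FockP n s p := ⟨gk k, hmem k⟩ - f with hR
    have h1 : ‖G f‖ = ‖G R‖ := by rw [hR, map_sub, hGk, zero_sub, norm_neg]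
    have h2 : ‖G R‖ ≤ |M| * pNorm R :=
      (hM R).trans (mul_le_mul_of_nonneg_right (le_abs_self M) (pNorm_nonneg R))
    calc e ≤ (|M| * pNorm R) ^ p := by rw [he, h1]; gcongr
      _ = |M| ^ p * ((ballInv n).toReal * (fockInt s p (R : (Fin n → ℂ) → ℂ)).toReal) := by
          rw [Real.mul_rpow (abs_nonneg M) (pNorm_nonneg R), pNorm_rpow hp]
      _ = _ := by rw [hc, mul_assoc]; rfl
  have hmeas : ∀ h : (Fin n → ℂ) → ℂ, Continuous h → Measurable fun z =>
      ENNReal.ofReal ((‖h z‖ * weight s z) ^ p) * (ENNReal.ofReal ‖bdot z z‖)⁻¹ := by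
    intro h hh
    have h1 := hh.measurable
    have h2 := (continuous_weight (n := n) s).measurable
    have h3 := (continuous_bdot_self (n := n)).measurable
    fun_prop
  have hgkt : ∀ z, Filter.Tendsto (fun k => gk k z) Filter.atTop (nhds (g z)) := by
    intro z
    have h1 : Filter.Tendsto (fun k => ((r k : ℝ) : ℂ) • z) Filter.atTop (nhds (((1 : ℝ) : ℂ) • z)) :=
      ((Complex.continuous_ofReal.tendsto 1).comp hrt).smul_const z
    rw [Complex.ofReal_one, one_smul] at h1
    exact (hgc.tendsto z).comp h1
  have hpt : ∀ (h : ℕ → (Fin n → ℂ) → ℂ) (l : ℂ) z, bdot z z ≠ 0 →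
      Filter.Tendsto (fun k => h k z) Filter.atTop (nhds l) →
      Filter.Tendsto (fun k => ENNReal.ofReal ((‖h k z‖ * weight s z) ^ p) *
        (ENNReal.ofReal ‖bdot z z‖)⁻¹) Filter.atTop
        (nhds (ENNReal.ofReal ((‖l‖ * weight s z) ^ p) * (ENNReal.ofReal ‖bdot z z‖)⁻¹)) := by
    intro h l z hz hl
    refine ENNReal.Tendsto.mul_const (ENNReal.tendsto_ofReal ?_) (Or.inr ?_)
    · exact (hl.norm.mul_const _).rpow_const (Or.inr hp.le)
    · rw [ENNReal.inv_ne_top]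
      exact (ENNReal.ofReal_pos.mpr (norm_pos_iff.mpr hz)).ne'
  have hlim : Filter.Tendsto (fun k => ENNReal.ofReal (r k ^ (2 - p) *
      (r k ^ Module.finrank ℝ (Fin n → ℂ))⁻¹)) Filter.atTop (nhds 1) := by
    have h1 : Filter.Tendsto (fun k => r k ^ (2 - p) * (r k ^ Module.finrank ℝ (Fin n → ℂ))⁻¹)
        Filter.atTop (nhds (1 ^ (2 - p) * (1 ^ Module.finrank ℝ (Fin n → ℂ))⁻¹)) :=
      (hrt.rpow_const (Or.inl one_ne_zero)).mul ((hrt.pow _).inv₀ (by simp))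
    simpa using ENNReal.tendsto_ofReal h1
  obtain ⟨k, hk⟩ := exists_lintegral_lt_of_tendsto (μ := (volume : Measure (Fin n → ℂ)))
    (a := fun z => ENNReal.ofReal ((‖g z‖ * weight s z) ^ p) * (ENNReal.ofReal ‖bdot z z‖)⁻¹)
    (A := fun k z => ENNReal.ofReal ((‖gk k z‖ * weight s z) ^ p) * (ENNReal.ofReal ‖bdot z z‖)⁻¹)
    (B := fun k z => ENNReal.ofReal ((‖gk k z - g z‖ * weight s z) ^ p) *
      (ENNReal.ofReal ‖bdot z z‖)⁻¹) (hmeas g hgc) (fun k => hmeas _ (hgkd k).continuous)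
    (fun k => hmeas _ ((hgkd k).continuous.sub hgc))
    (fun k => Filter.Eventually.of_forall fun z => by
      have hw := weight_nonneg s z
      simp only
      rw [← add_mul, ← ENNReal.ofReal_add (by positivity) (by positivity)]
      gcongr
      calc (‖gk k z - g z‖ * weight s z) ^ p
          ≤ (‖gk k z‖ * weight s z + ‖g z‖ * weight s z) ^ p := by
            gcongr
            rw [← add_mul]
            gcongr
            exact norm_sub_le _ _
        _ ≤ _ := Real.rpow_add_le_add_rpow (by positivity) (by positivity) hp.le hp1)
    (by filter_upwards [ae_bdot_self_ne_zero hn] with z hz using hpt gk _ z hz (hgkt z))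
    (by
      filter_upwards [ae_bdot_self_ne_zero hn] with z hz
      have h1 := hpt (fun k z => gk k z - g z) 0 z hz (by simpa using (hgkt z).sub_const (g z))
      simpa [Real.zero_rpow hp.ne'] using h1)
    hfin hlim hdil (ε := ENNReal.ofReal (e / (c + 1)))
    (ENNReal.ofReal_pos.mpr (by positivity)).ne'
  have h1 := ENNReal.toReal_lt_of_lt_ofReal hk
  have h2 : e ≤ c * (e / (c + 1)) := (hlower k).trans (mul_le_mul_of_nonneg_left h1.le hc0)
  rw [← mul_div_assoc, le_div_iff₀ (by positivity)] at h2
  linarith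

end Density

/-! ### Functional norms -/

section Duality
variable {n : ℕ}

theorem bddAbove_functional {s p : ℝ} {G : FockP n s p →ₗ[ℂ] ℂ} {M : ℝ} (hM0 : 0 ≤ M)
    (hM : ∀ f, ‖G f‖ ≤ M * pNorm f) :
    ∀ r ∈ {r : ℝ | ∃ f : FockP n s p, pNorm f ≤ 1 ∧ ‖G f‖ = r}, r ≤ M := by
  rintro _ ⟨f, hf, rfl⟩
  exact (hM f).trans (mul_le_of_le_one_right hM0 hf)

theorem norm_functional_le {s p : ℝ} {G : FockP n s p →ₗ[ℂ] ℂ} {M : ℝ} (hM0 : 0 ≤ M)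
    (hM : ∀ f, ‖G f‖ ≤ M * pNorm f) (f : FockP n s p) :
    ‖G f‖ ≤ functionalNorm G * pNorm f := by
  rcases (pNorm_nonneg f).eq_or_lt with h | h
  · have := hM f
    rw [← h, mul_zero] at this ⊢
    exact this
  · rw [← div_le_iff₀ h]
    refine le_csSup ⟨M, bddAbove_functional hM0 hM⟩ ⟨((pNorm f)⁻¹ : ℂ) • f, ?_, ?_⟩
    · rw [pNorm_smul, norm_inv, Complex.norm_real, Real.norm_of_nonneg h.le, inv_mul_cancel₀ h.ne']
    · rw [map_smul, norm_smul, norm_inv, Complex.norm_real, Real.norm_of_nonneg h.le,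
        inv_mul_eq_div]

end Duality
end HPFock

/-! ### Assembly of the duality -/

theorem theoremA (n : ℕ) (hn : 1 ≤ n) (s p : ℝ) (hs : 0 < s) (hp : 0 < p) (hp1 : p ≤ 1) :
    ∃ L : HPFock.FockP n s p →ₗ[ℂ] HPFock.FockInf n s →ₗ[ℂ] ℂ,
      (∃ M : ℝ, ∀ f g, ‖L f g‖ ≤ M * HPFock.pNorm f * HPFock.infNorm g) ∧
      (∀ G : HPFock.FockP n s p →ₗ[ℂ] ℂ, HPFock.IsBoundedFunctional G →
        ∃! g : HPFock.FockInf n s, ∀ f, G f = L f g) ∧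
      ∃ C : ℝ, 0 < C ∧ ∀ g : HPFock.FockInf n s,
        C⁻¹ * HPFock.infNorm g ≤ HPFock.functionalNorm (L.flip g) ∧
          HPFock.functionalNorm (L.flip g) ≤ C * HPFock.infNorm g := by
  obtain ⟨C₁, hC₁, hL⟩ := HPFock.exists_norm_pairing_le hn hs hp hp1
  obtain ⟨C₂, hC₂, hker⟩ := HPFock.exists_pNorm_kerFun_le hn hs hp hp1
  have hflip : ∀ (g : HPFock.FockInf n s) f,
      ‖(HPFock.pairing hn hs hp hp1).flip g f‖ ≤ C₁ * HPFock.infNorm g * HPFock.pNorm f :=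
    fun g f => (hL f g).trans_eq (by ring)
  refine ⟨HPFock.pairing hn hs hp hp1, ⟨C₁, hL⟩, fun G hG => ?_, C₁ + C₂, by positivity,
    fun g => ?_⟩
  · obtain ⟨M, hM⟩ := hG
    -- Evaluating on kernel functions forces this choice; the kernel norm bound puts it in F_s^∞.
    set g : HPFock.FockInf n s := ⟨fun u => G (HPFock.kerFun hn hs hp hp1 u),
      HPFock.mem_fockInf (K := |M| * C₂)
        (HPFock.differentiable_functional_kerFun hn hs hp hp1 ⟨M, hM⟩) fun u => by
          have h1 := hker u
          have h2 := HPFock.weight_nonneg s u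
          have h3 := HPFock.pNorm_nonneg (HPFock.kerFun hn hs hp hp1 u)
          calc _ ≤ |M| * HPFock.pNorm (HPFock.kerFun hn hs hp hp1 u) * HPFock.weight s u := by
                gcongr
                exact (hM _).trans (mul_le_mul_of_nonneg_right (le_abs_self M) h3)
            _ ≤ |M| * C₂ := by rw [mul_assoc]; gcongr⟩ with hg
    refine ⟨g, fun f => ?_, fun g' hg' => ?_⟩
    · have hD : G - (HPFock.pairing hn hs hp hp1).flip g = 0 := by
        refine HPFock.functional_eq_zero hn hs hp hp1 ⟨M + C₁ * HPFock.infNorm g, fun f => ?_⟩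
          fun u => ?_
        · rw [LinearMap.sub_apply, add_mul]
          exact (norm_sub_le _ _).trans (add_le_add (hM f) (hflip g f))
        · rw [LinearMap.sub_apply, LinearMap.flip_apply, HPFock.pairing_kerFun, hg, sub_self]
      have := LinearMap.congr_fun hD f
      rw [LinearMap.sub_apply, LinearMap.flip_apply, LinearMap.zero_apply, sub_eq_zero] at this
      exact this
    · ext u
      rw [← HPFock.pairing_kerFun hn hs hp hp1 u g', ← hg']
  · have hg0 := HPFock.infNorm_nonneg g
    have hM0 : 0 ≤ C₁ * HPFock.infNorm g := by positivity
    have hF0 : 0 ≤ HPFock.functionalNorm ((HPFock.pairing hn hs hp hp1).flip g) :=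
      Real.sSup_nonneg (by rintro _ ⟨f, -, rfl⟩; exact norm_nonneg _)
    constructor
    · rw [inv_mul_le_iff₀ (by positivity)]
      refine HPFock.infNorm_le g fun u => ?_
      -- Testing the functional on the kernel function at u recovers g(u), which gives the lower
      -- bound with constant `C₂`.
      have h1 := HPFock.norm_functional_le hM0 (hflip g) (HPFock.kerFun hn hs hp hp1 u)
      rw [LinearMap.flip_apply, HPFock.pairing_kerFun] at h1
      have h2 := HPFock.weight_nonneg s u
      calc _ ≤ HPFock.functionalNorm ((HPFock.pairing hn hs hp hp1).flip g) *
            HPFock.pNorm (HPFock.kerFun hn hs hp hp1 u) * HPFock.weight s u := by gcongr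
        _ ≤ HPFock.functionalNorm ((HPFock.pairing hn hs hp hp1).flip g) * C₂ := by
            rw [mul_assoc]
            gcongr
            exact hker u
        _ ≤ _ := by rw [mul_comm]; gcongr; linarith
    · refine (Real.sSup_le (HPFock.bddAbove_functional hM0 (hflip g)) hM0).trans ?_
      gcongr
      linarith
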